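/- **Setting.** Let $m\ge 1$, let $\beta_{j,i},\gamma_{j,i}\in\mathbb R$ ($0\le j\le 2m-1$, $1\le i\le m$), $j_0,\dots,j_{2m-1}\in\mathbb N_0$, let $\psi$ be a real polynomial, and put $\mathcal Q(v)=v^{j_0}(\partial_xv)^{j_1}\cdots(\partial_x^{2m-1}v)^{j_{2m-1}}$. Consider on $(-1,1)$ the equation $$\partial_t v=(-1)^{m+1}\partial_x^{2m}v+\mathcal Q(v)+\psi,\qquad \sum_{j=0}^{2m-1}\beta_{j,i}\partial_x^jv(-1)=0,\quad \sum_{j=0}^{2m-1}\gamma_{j,i}\partial_x^jv(1)=0\quad(1\le i\le m). \tag{1}$$ For $v\in C^{2m}([-1,1])$ let $b_0(v),\dots,b_{2m-1}(v)$ be the left-hand sides of the $2m$ boundary conditions (first those at $-1$, then those at $1$). *Sequence spaces.* $\ell^1_1$ is the space of (real or complex) sequences with $\|U\|_1=|U_0|+2\sum_{n\ge1}|U_n|<\infty$; $\|\cdot\|_1$ also denotes the operator norm on it. Put $\mathcal G_0U=U_0+2\sum_{n\ge1}U_nT_n$ ($T_n$ the Chebyshev polynomials), $(\mathcal G_0^{-1}u)_n=\frac1\pi\int_{-1}^1u\,T_n(1-x^2)^{-1/2}dx$,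 $(U*W)_n=\sum_{k\in\mathbb Z}U_{|k|}W_{|n-k|}$. Let $\pi^{\le N}$ and $\pi^{>N}$ be the coordinate projections onto the indices $\le N$ and $>N$ ($\pi^{>-1}$ is the identity); finite square matrices are identified with operators on $\ell^1_1$ acting on the first coordinates. Let $\mathcal S=\mathcal G_0^{-1}\int_{-1}^x\mathcal G_0$ and $\mathcal S^{(i)}=\pi^{>i-1}\mathcal S^i$. Let $(\mathcal BV)_n=b_n(\mathcal G_0V)$ for $n<2m$ and $0$ otherwise. Assume that the matrix $\pi^{\le 2m-1}\mathcal B\pi^{\le 2m-1}$ is invertible, with inverse $\mathcal B^\dagger_{2m}$, and put $$\mathcal L^{-1}=(-1)^{m+1}(\mathcal I-\mathcal B^\dagger_{2m}\mathcal B)\mathcal S^{(2m)},\qquad \mathcal K_i=\mathcal G_0^{-1}\partial_x^i\mathcal G_0\mathcal L^{-1}\quad(0\le i\le 2m-1).$$ Let $\mathcal K(U)=\mathcal G_0^{-1}\mathcal Q(\mathcal G_0\mathcal L^{-1}U)$ and $\mathcal F(U)=U+\mathcal K(U)+\mathcal G_0^{-1}\psi$ on the real space $\ell^1_1$, so that $D\mathcal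 F(U)=\mathcal I+D\mathcal K(U)$ with $D\mathcal K(U)H=\sum_{i=0}^{2m-1}\mathcal V_i(U)*\mathcal K_iH$, $\mathcal V_i(U)=\mathcal G_0^{-1}\big(j_i(\partial_x^iv)^{j_i-1}\prod_{l\ne i}(\partial_x^lv)^{j_l}\big)$, $v=\mathcal G_0\mathcal L^{-1}U$ (the $i$-th term being $0$ if $j_i=0$). These linear operators also act on complex sequences. *Constants $\gamma$, $\eta$.* Let $\gamma_{2p,k}=\prod_{j=1}^p\frac1{k^2-(2j-1)^2}$ and $\gamma_{2p+1,k}=k\prod_{j=0}^p\frac1{k^2-(2j)^2}$ (two indices $\in\mathbb N_0$; not to be confused with the boundary coefficients). For each $i\in\{0,\dots,2m-1\}$ fix an ordering of the $2m$ boundary conditions for which the block $\mathcal B_{11}$ (first $i$ rows, first $i$ columns) of the reordered matrix of $\pi^{\le 2m-1}\mathcal B\pi^{\le 2m-1}$ is invertible; let $\mathcal B_{21}$ be the block of the last $2m-i$ rows and first $i$ columns, and $\mathcal B_{12},\mathcal B_{22}$ the first $i$ rows and the last $2m-i$ rows of the reordered $\mathcal B$, restricted to the indices $\ge i$. Write $$\big((\mathcal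 B_{22}-\mathcal B_{21}\mathcal B_{11}^{-1}\mathcal B_{12})\mathcal S^{(i)}W\big)_n=\sum_{j=0}^{2m-1}\Big(\theta^{(-1)}_{j,n}\partial_x^j(\mathcal G_0\mathcal S^{(i)}W)(-1)+\theta^{(1)}_{j,n}\partial_x^j(\mathcal G_0\mathcal S^{(i)}W)(1)\Big),\quad 0\le n\le 2m-i-1,$$ where $\theta^{(\pm1)}$ are the coefficients obtained by applying the same row operation $(\mathcal I,-\mathcal B_{21}\mathcal B_{11}^{-1})$ to the coefficients of the boundary conditions. Call this operator $\mathcal B_{\mathcal K_i}$, let $\mathcal B^\dagger_{\mathcal K_i}$ be the inverse of the matrix $\pi^{\le 2m-i-1}\mathcal B_{\mathcal K_i}\pi^{\le 2m-i-1}$, and put $$\eta_{i,k}=\gamma_{2m-i,k}+\|\mathcal B^\dagger_{\mathcal K_i}\|_1\sum_{n=0}^{2m-i-1}\sum_{j=0}^{2m-1}\big(|\theta^{(-1)}_{j,n}|+|\theta^{(1)}_{j,n}|\big)\gamma_{2m-j,k}.$$ *Newton–Kantorovich hypotheses.* Let $N\ge 4m$, let $\mathcal A_0$ be a real $(N+1)\times(N+1)$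 matrix, $\mathcal A=\mathcal A_0+\pi^{>N}$, let $\bar U\in\ell^1_1$ be real, $Y,Z_1\ge0$, $Z_2:(0,\infty)\to[0,\infty)$ with $\|\mathcal A\mathcal F(\bar U)\|_1\le Y$, $\|\mathcal I-\mathcal AD\mathcal F(\bar U)\|_1\le Z_1$ and $\|\mathcal A(D\mathcal F(\bar U+h)-D\mathcal F(\bar U))\|_1\le Z_2(\rho)\rho$ for all $\rho>0$ and all real $h$ with $\|h\|_1\le\rho$. Let $r>0$ satisfy $\frac12Z_2(r)r^2-(1-Z_1)r+Y<0$ and $Z_1+Z_2(r)r<1$. Let $\tilde U$ be the (unique) real zero of $\mathcal F$ with $\|\tilde U-\bar U\|_1\le r$, and $\tilde v=\mathcal G_0(\mathcal L^{-1}\tilde U)$, a steady state of (1). *Eigenvalues.* Eigenvalues are those of $v\mapsto(-1)^{m+1}\partial_x^{2m}v+D\mathcal Q(\tilde v)v$ on the functions $v\in C^{2m}([-1,1];\mathbb C)$ satisfying the boundary conditions of (1); an eigenvalue $\lambda$ is unstable if $\Re\lambda>0$. *Second-homotopy disks.* Let $\lambda_{\max}>0$, let $\mathcal P_0$ be an invertible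 complex $(N+1)\times(N+1)$ matrix, $\mathcal M_0=\mathcal P_0^{-1}\mathcal A_0\pi^{\le N}\mathcal L^{-1}\pi^{\le N}\mathcal P_0$ with diagonal entries $\mu_0,\dots,\mu_N$, let $R_0$ be the off-diagonal part of $\mathcal M_0$, and $\lambda_j=1/\mu_j$ ($\lambda_j=\infty$ if $\mu_j=0$). Let $Z_{1,\mathcal P_0},Z_{2,\mathcal P_0},Z_{2,\le N},Z_{2,>N}\ge0$ and $\beta_{k,l}\ge 0$ satisfy, with $\Delta=D\mathcal K(\bar U)-D\mathcal K(\tilde U)$ and $z:=Z_{2,>N}r$, $$Z_{1,\mathcal P_0}\ge\|\mathcal P_0^{-1}(\pi^{\le N}-\mathcal A_0\pi^{\le N}D\mathcal F(\bar U)\pi^{\le N})\mathcal P_0\|_1,\quad Z_{2,\mathcal P_0}r\ge\|\mathcal P_0^{-1}\mathcal A_0\pi^{\le N}\Delta\pi^{\le N}\mathcal P_0\|_1,$$ $$Z_{2,\le N}r\ge\|\mathcal A_0\pi^{\le N}\Delta\|_1,\qquad Z_{2,>N}r\ge\|\pi^{>N}\Delta\|_1,$$ $$\beta_{0,1}\ge\|\pi^{>N}D\mathcal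 K(\bar U)\pi^{\le N}\mathcal P_0\|_1+\|\mathcal P_0\|_1z,$$ $$\beta_{0,2}\ge\|\mathcal P_0^{-1}\mathcal A_0\pi^{\le N}D\mathcal K(\bar U)\pi^{>N}D\mathcal K(\bar U)\pi^{\le N}\mathcal P_0\|_1+\|\mathcal P_0^{-1}\mathcal A_0\pi^{\le N}D\mathcal K(\bar U)\pi^{>N}\|_1\|\mathcal P_0\|_1z,$$ $$\beta_{1,1}\ge\eta_{0,N+1}\|\mathcal P_0^{-1}\mathcal A_0\|_1\big(\|\pi^{>N}D\mathcal K(\bar U)\pi^{\le N}\mathcal P_0\|_1+\|\mathcal P_0\|_1z\big),\quad \beta_{1,2}\ge\|\pi^{>N}\mathcal L^{-1}\pi^{\le N}\mathcal P_0\|_1,$$ $$\beta_{1,3}\ge\|\mathcal P_0^{-1}\mathcal A_0\pi^{\le N}D\mathcal K(\bar U)\pi^{>N}\mathcal L^{-1}\pi^{\le N}\mathcal P_0\|_1,\quad \beta_{1,4}\ge\|\mathcal P_0^{-1}\mathcal A_0\pi^{\le N}D\mathcal K(\bar U)\pi^{>N}\|_1+\|\mathcal P_0^{-1}\|_1Z_{2,\le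 N}r,$$ $$\beta_{2,1}\ge\|\mathcal P_0^{-1}\mathcal A_0\pi^{\le N}\mathcal L^{-1}\pi^{>N}\mathcal L^{-1}\pi^{\le N}\mathcal P_0\|_1,\quad \beta_{2,2}\ge\eta_{0,N+1}\|\mathcal P_0^{-1}\mathcal A_0\|_1.$$ Put, with $\bar{\mathcal V}_i=\mathcal V_i(\bar U)$, $$\epsilon=\sum_{i=0}^{2m-1}\Big(2\eta_{i,N+1}\sum_{k>N-2m+i}|(\bar{\mathcal V}_i)_k|+\|\bar{\mathcal V}_i\|_1\gamma_{2m-i,N+1}\Big)+\lambda_{\max}\gamma_{2m,N+1}+Z_{2,>N}r,$$ and, if $\epsilon<1$, $$\beta_2=\beta_{2,1}+\tfrac{\epsilon}{1-\epsilon}\beta_{1,2}\beta_{2,2},\quad \beta_1=\beta_{1,1}+\beta_{1,3}+\|\mathcal P_0^{-1}\|_1Z_{2,\le N}r\,\beta_{1,2}+\tfrac{\epsilon}{1-\epsilon}(\beta_{1,2}\beta_{1,4}+\beta_{0,1}\beta_{2,2}),$$ $$\beta_0=\beta_{0,2}+\|\mathcal P_0^{-1}\|_1Z_{2,\le N}r\,\beta_{0,1}+\tfrac{\epsilon}{1-\epsilon}\beta_{0,1}\beta_{1,4},\quad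 \delta=\lambda_{\max}\|R_0\|_1+\beta_2\lambda_{\max}^2+\beta_1\lambda_{\max}+\beta_0+Z_{1,\mathcal P_0}+Z_{2,\mathcal P_0}r.$$ Let $\mathfrak B_j=\{z\in\mathbb C:|z-\lambda_j|\le\delta|\lambda_j|\}$ for $0\le j\le N$ if $\mu_j\ne0$; if $\mu_j=0$, then $\mathfrak B_j=\{z\in\mathbb C:|1-\mu_jz|\le\delta\}$, i.e. $\emptyset$ if $\delta<1$ and $\mathbb C$ if $\delta\ge1$. **Theorem.** Assume that every eigenvalue $\lambda$ with $\Re\lambda\ge0$ satisfies $|\lambda|\le\lambda_{\max}$, and that $\epsilon<1$. Assume that exactly $n_u\in\mathbb N_0$ of the disks $\mathfrak B_j$ (with $\mu_j\neq0$) are included in $\{z:\Re z>0\}\cap\{z:|z|\le\lambda_{\max}\}$, and that all the other disks $\mathfrak B_j$ are included in $\{z:\Re z<0\}$. Then the linearization of (1) at $\tilde v$ has exactly $n_u$ unstable eigenvalues, counted with algebraic multiplicity (the set of unstable eigenvalues is finite and their algebraic multiplicities are finite and add up to $n_u$). -/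

import Mathlib

open scoped ENNReal NNReal

noncomputable section

namespace GegenbauerStability

/-- The interval `[-1,1]`. -/
abbrev seg : Set ℝ := Set.Icc (-1) 1

/-- The `j`-th derivative on `[-1,1]` (one-sided at the endpoints). -/
def dx {E : Type*} [NormedAddCommGroup E] [NormedSpace ℝ E] (j : ℕ) (v : ℝ → E) (x : ℝ) : E :=
  iteratedDerivWithin j v seg x

section Sequences

variable {𝕜 : Type*} [RCLike 𝕜]

/-- `‖U‖₁ = |U₀| + 2 ∑_{n ≥ 1} |Uₙ|`, with value `∞` when `U` is not in `ℓ¹`. -/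
def ell1Norm (U : ℕ → 𝕜) : ℝ≥0∞ := ‖U 0‖ₑ + 2 * ∑' n : ℕ, ‖U (n + 1)‖ₑ

/-- The operator norm of a linear operator on `ℓ¹` (as an extended nonnegative real). -/
def opNorm (M : (ℕ → 𝕜) → (ℕ → 𝕜)) : ℝ≥0∞ :=
  ⨆ (U : ℕ → 𝕜) (_ : ell1Norm U ≤ 1), ell1Norm (M U)

/-- The projection `π^{≤ N}`. -/
def piLe (N : ℕ) (U : ℕ → 𝕜) : ℕ → 𝕜 := fun n => if n ≤ N then U n else 0

/-- The projection `π^{> N}`. -/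
def piGt (N : ℕ) (U : ℕ → 𝕜) : ℕ → 𝕜 := fun n => if n ≤ N then 0 else U n

/-- A finite matrix, as an operator on sequences (acting on the first coordinates and with values
in the sequences supported there). -/
def emb {n : ℕ} (M : Matrix (Fin n) (Fin n) 𝕜) (U : ℕ → 𝕜) : ℕ → 𝕜 :=
  fun a => if h : a < n then ∑ b : Fin n, M ⟨a, h⟩ b * U b else 0

/-- The operator norm on `ℓ¹` of a finite matrix. -/
def matNorm {n : ℕ} (M : Matrix (Fin n) (Fin n) 𝕜) : ℝ≥0 := (opNorm (emb M)).toNNReal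

/-- The Chebyshev series `𝒢₀ U = U₀ + 2 ∑_{n ≥ 1} Uₙ Tₙ`. -/
def cheb (U : ℕ → 𝕜) (x : ℝ) : 𝕜 :=
  U 0 + ∑' n : ℕ, (2 * (Polynomial.Chebyshev.T ℝ ((n : ℤ) + 1)).eval x) • U (n + 1)

/-- The Chebyshev coefficients `𝒢₀⁻¹ u`. -/
def chebInv (u : ℝ → 𝕜) (n : ℕ) : 𝕜 :=
  Real.pi⁻¹ • ∫ x in (-1 : ℝ)..1,
    ((Polynomial.Chebyshev.T ℝ (n : ℤ)).eval x / √(1 - x ^ 2)) • u x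

/-- The convolution `(a ∗ U)ₙ = ∑_{k ∈ ℤ} a_{|k|} U_{|n-k|}` of a real sequence with a sequence. -/
def conv (a : ℕ → ℝ) (U : ℕ → 𝕜) (n : ℕ) : 𝕜 :=
  ∑' k : ℤ, a k.natAbs • U ((n : ℤ) - k).natAbs

/-- The antiderivative vanishing at `-1`, on Chebyshev coefficients. -/
def antider (U : ℕ → 𝕜) : ℕ → 𝕜
  | 0 => U 0 - (1 / 2 : ℝ) • U 1
      + ∑' n : ℕ, (2 * (-1) ^ (n + 3) / (((n : ℝ) + 2) ^ 2 - 1)) • U (n + 2)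
  | n + 1 => (1 / (2 * ((n : ℝ) + 1))) • (U n - U (n + 2))

/-- `𝒮^{(i)} = π^{> i-1} 𝒮^i`. -/
def antiderProj (i : ℕ) (U : ℕ → 𝕜) : ℕ → 𝕜 :=
  fun n => if n < i then 0 else (antider^[i] U) n

end Sequences

/-- The data of the parabolic problem
`∂ₜ v = (-1)^{m+1} ∂ₓ^{2m} v + v^{j₀} (∂ₓ v)^{j₁} ⋯ (∂ₓ^{2m-1} v)^{j_{2m-1}} + ψ` on `(-1,1)`,
with `∑_j β_{j,i} ∂ₓ^j v(-1) = 0` and `∑_j γ_{j,i} ∂ₓ^j v(1) = 0` for each of the `m` indices `i`. -/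
structure Problem where
  m : ℕ
  one_le_m : 1 ≤ m
  β : Fin (2 * m) → Fin m → ℝ
  γ : Fin (2 * m) → Fin m → ℝ
  expo : Fin (2 * m) → ℕ
  ψ : Polynomial ℝ

namespace Problem

variable (P : Problem)

/-- The coefficient of `∂ₓ^j v(-1)` in the boundary condition number `r`: the conditions at `-1`
are numbered `0, …, m-1`, those at `1` are numbered `m, …, 2m-1`. -/
def rowL (r j : Fin (2 * P.m)) : ℝ := if h : (r : ℕ) < P.m then P.β j ⟨r, h⟩ else 0

/-- The coefficient of `∂ₓ^j v(1)` in the boundary condition number `r`. -/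
def rowR (r j : Fin (2 * P.m)) : ℝ :=
  if _ : (r : ℕ) < P.m then 0 else P.γ j ⟨r - P.m, by have := r.isLt; omega⟩

/-- The left-hand side of the boundary condition number `r`. -/
def bc {E : Type*} [NormedAddCommGroup E] [NormedSpace ℝ E] (r : Fin (2 * P.m)) (v : ℝ → E) : E :=
  ∑ j : Fin (2 * P.m), (P.rowL r j • dx j v (-1) + P.rowR r j • dx j v 1)

/-- The matrix of `π^{≤ 2m-1} ℬ π^{≤ 2m-1}`. -/
def bcMat : Matrix (Fin (2 * P.m)) (Fin (2 * P.m)) ℝ :=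
  Matrix.of fun r k => P.bc r (cheb (Pi.single (k : ℕ) (1 : ℝ)))

section Operators

variable {𝕜 : Type*} [RCLike 𝕜]

/-- The solution operator `ℒ⁻¹ = (-1)^{m+1} (I - ℬ†_{2m} ℬ) 𝒮^{(2m)}` of
`(-1)^{m+1} ∂ₓ^{2m} v = w` with the boundary conditions, on Chebyshev coefficients. -/
def Linv (U : ℕ → 𝕜) : ℕ → 𝕜 := fun n =>
  ((-1 : ℝ) ^ (P.m + 1)) • (antiderProj (2 * P.m) U n -
    (if h : n < 2 * P.m then
      ∑ k : Fin (2 * P.m), (P.bcMat⁻¹ ⟨n, h⟩ k) • P.bc k (cheb (antiderProj (2 * P.m) U))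
     else 0))

/-- `𝒦ᵢ = 𝒢₀⁻¹ ∂ₓ^i 𝒢₀ ℒ⁻¹`. -/
def Ki (i : ℕ) (U : ℕ → 𝕜) : ℕ → 𝕜 := chebInv (dx i (cheb (P.Linv U)))

end Operators

/-- The function `𝒢₀ (ℒ⁻¹ U)`. -/
def sol (U : ℕ → ℝ) : ℝ → ℝ := cheb (P.Linv U)

/-- `𝒬(v) = v^{j₀} (∂ₓ v)^{j₁} ⋯ (∂ₓ^{2m-1} v)^{j_{2m-1}}`. -/
def Q (v : ℝ → ℝ) (x : ℝ) : ℝ := ∏ i : Fin (2 * P.m), (dx i v x) ^ (P.expo i)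

/-- The coefficient of `∂ₓ^i` in the linear differential operator `D𝒬(v)`. -/
def DQcoef (v : ℝ → ℝ) (i : Fin (2 * P.m)) (x : ℝ) : ℝ :=
  (P.expo i : ℝ) * (dx i v x) ^ (P.expo i - 1) *
    ∏ l ∈ Finset.univ.erase i, (dx l v x) ^ (P.expo l)

/-- `ℱ(U) = U + 𝒢₀⁻¹ 𝒬(𝒢₀ ℒ⁻¹ U) + 𝒢₀⁻¹ ψ`. -/
def F (U : ℕ → ℝ) : ℕ → ℝ := fun n =>
  U n + chebInv (P.Q (P.sol U)) n + chebInv (fun x => P.ψ.eval x) n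

/-- The sequence `𝒱ᵢ` at `U`: the Chebyshev coefficients of the coefficient of `∂ₓ^i` in
`D𝒬(𝒢₀ ℒ⁻¹ U)`. -/
def V (U : ℕ → ℝ) (i : Fin (2 * P.m)) : ℕ → ℝ := chebInv (P.DQcoef (P.sol U) i)

section Derivatives

variable {𝕜 : Type*} [RCLike 𝕜]

/-- `D𝒦(U) H = ∑ᵢ 𝒱ᵢ ∗ 𝒦ᵢ H`, acting on real or complex sequences `H`. -/
def DK (U : ℕ → ℝ) (H : ℕ → 𝕜) : ℕ → 𝕜 := ∑ i : Fin (2 * P.m), conv (P.V U i) (P.Ki i H)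

/-- `Dℱ(U) = I + D𝒦(U)`. -/
def DF (U : ℕ → ℝ) (H : ℕ → 𝕜) : ℕ → 𝕜 := H + P.DK U H

end Derivatives

end Problem

/-- The constants `γ^{(1)}_{i,k}`. -/
def gam (i k : ℕ) : ℝ :=
  if Even i then ∏ j ∈ Finset.Icc 1 (i / 2), 1 / ((k : ℝ) ^ 2 - (2 * (j : ℝ) - 1) ^ 2)
  else (k : ℝ) * ∏ j ∈ Finset.range (i / 2 + 1), 1 / ((k : ℝ) ^ 2 - (2 * (j : ℝ)) ^ 2)

namespace Problem

variable (P : Problem)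

/-! The boundary conditions satisfied by `w = ∂ₓ^i v` when `v` satisfies the `2m` boundary
conditions, the latter being ordered by a permutation `s`. -/

section Reduced

variable (s : Equiv.Perm (Fin (2 * P.m))) (i : Fin (2 * P.m))

/-- The index `p < i` as an index `< 2m`. -/
def lowIdx (p : Fin (i : ℕ)) : Fin (2 * P.m) := ⟨p, p.isLt.trans i.isLt⟩

/-- The index `i + n`, for `n < 2m - i`. -/
def highIdx (n : Fin (2 * P.m - i)) : Fin (2 * P.m) :=
  ⟨i + n, by have := n.isLt; omega⟩

/-- `ℬ₁₁`: the first `i` reordered rows, and the first `i` columns. -/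
def B11 : Matrix (Fin (i : ℕ)) (Fin (i : ℕ)) ℝ :=
  Matrix.of fun p q => P.bcMat (s (P.lowIdx i p)) (P.lowIdx i q)

/-- `ℬ₂₁`: the last `2m - i` reordered rows, and the first `i` columns. -/
def B21 : Matrix (Fin (2 * P.m - i)) (Fin (i : ℕ)) ℝ :=
  Matrix.of fun n q => P.bcMat (s (P.highIdx i n)) (P.lowIdx i q)

/-- The coefficient of `∂ₓ^j (·)(-1)` in row `n` of `(ℬ₂₂ - ℬ₂₁ ℬ₁₁⁻¹ ℬ₁₂) 𝒮^{(i)}`. -/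
def thetaL (j : Fin (2 * P.m)) (n : Fin (2 * P.m - i)) : ℝ :=
  P.rowL (s (P.highIdx i n)) j
    - ∑ p : Fin (i : ℕ), (P.B21 s i * (P.B11 s i)⁻¹) n p * P.rowL (s (P.lowIdx i p)) j

/-- The coefficient of `∂ₓ^j (·)(1)` in row `n` of `(ℬ₂₂ - ℬ₂₁ ℬ₁₁⁻¹ ℬ₁₂) 𝒮^{(i)}`. -/
def thetaR (j : Fin (2 * P.m)) (n : Fin (2 * P.m - i)) : ℝ :=
  P.rowR (s (P.highIdx i n)) j
    - ∑ p : Fin (i : ℕ), (P.B21 s i * (P.B11 s i)⁻¹) n p * P.rowR (s (P.lowIdx i p)) j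

/-- Row `n` of `ℬ_{𝒦ᵢ} = (ℬ₂₂ - ℬ₂₁ ℬ₁₁⁻¹ ℬ₁₂) 𝒮^{(i)}`. -/
def BK (n : Fin (2 * P.m - i)) (W : ℕ → ℝ) : ℝ :=
  ∑ j : Fin (2 * P.m), (P.thetaL s i j n * dx j (cheb (antiderProj i W)) (-1)
    + P.thetaR s i j n * dx j (cheb (antiderProj i W)) 1)

/-- The matrix of `π^{≤ 2m-i-1} ℬ_{𝒦ᵢ} π^{≤ 2m-i-1}`; its inverse is `ℬ†_{𝒦ᵢ,2m-i}`. -/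
def BKmat : Matrix (Fin (2 * P.m - i)) (Fin (2 * P.m - i)) ℝ :=
  Matrix.of fun n k => P.BK s i n (Pi.single (k : ℕ) 1)

/-- The constants `η^{(1)}_{i,k}`. -/
def eta (k : ℕ) : ℝ :=
  gam (2 * P.m - i) k + (matNorm (P.BKmat s i)⁻¹ : ℝ) *
    ∑ n : Fin (2 * P.m - i), ∑ j : Fin (2 * P.m),
      (|P.thetaL s i j n| + |P.thetaR s i j n|) * gam (2 * P.m - j) k

end Reduced

/-- The constant `ε`. -/
def eps (s : Fin (2 * P.m) → Equiv.Perm (Fin (2 * P.m))) (N : ℕ) (Ubar : ℕ → ℝ)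
    (lamMax : ℝ) (Z2gt r : ℝ≥0) : ℝ :=
  ∑ i : Fin (2 * P.m),
    (2 * P.eta (s i) i (N + 1) * (∑' k : ℕ, if N + i < k + 2 * P.m then |P.V Ubar i k| else 0)
      + (ell1Norm (P.V Ubar i)).toReal * gam (2 * P.m - i) (N + 1))
  + lamMax * gam (2 * P.m) (N + 1) + Z2gt * r

/-- The operator `𝒜 = 𝒜₀ + π^{> N}`. -/
def A {N : ℕ} (A0 : Matrix (Fin (N + 1)) (Fin (N + 1)) ℝ) (U : ℕ → ℝ) : ℕ → ℝ :=
  emb A0 U + piGt N U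

/-- The hypotheses of the Newton–Kantorovich theorem on `ℓ¹₁`, for a given radius `r`. -/
structure NewtonKantorovich {N : ℕ} (A0 : Matrix (Fin (N + 1)) (Fin (N + 1)) ℝ) (Ubar : ℕ → ℝ)
    (Y Z1 : ℝ≥0) (Z2 : ℝ≥0 → ℝ≥0) (r : ℝ≥0) : Prop where
  mem : ell1Norm Ubar < ∞
  bound_Y : ell1Norm (A A0 (P.F Ubar)) ≤ Y
  bound_Z1 : opNorm (fun H : ℕ → ℝ => H - A A0 (P.DF Ubar H)) ≤ Z1
  bound_Z2 : ∀ ρ : ℝ≥0, 0 < ρ → ∀ h : ℕ → ℝ, ell1Norm h ≤ ρ →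
    opNorm (fun H : ℕ → ℝ => A A0 (P.DF (Ubar + h) H - P.DF Ubar H)) ≤ (Z2 ρ * ρ : ℝ≥0)
  r_pos : 0 < r
  cond1 : (1 / 2 : ℝ) * Z2 r * r ^ 2 - (1 - Z1) * r + Y < 0
  cond2 : Z1 + Z2 r * r < 1

/-- `𝒜₀` as a complex matrix. -/
def cplx {N : ℕ} (A0 : Matrix (Fin (N + 1)) (Fin (N + 1)) ℝ) :
    Matrix (Fin (N + 1)) (Fin (N + 1)) ℂ := A0.map fun x => (x : ℂ)

/-- The matrix of `π^{≤ N} ℒ⁻¹ π^{≤ N}`. -/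
def LinvMat (N : ℕ) : Matrix (Fin (N + 1)) (Fin (N + 1)) ℂ :=
  Matrix.of fun a b => P.Linv (Pi.single (b : ℕ) (1 : ℂ)) a

/-- `ℳ₀ = 𝒫₀⁻¹ 𝒜₀ π^{≤ N} ℒ⁻¹ π^{≤ N} 𝒫₀`. -/
def M0 {N : ℕ} (A0 : Matrix (Fin (N + 1)) (Fin (N + 1)) ℝ)
    (P0 : Matrix (Fin (N + 1)) (Fin (N + 1)) ℂ) : Matrix (Fin (N + 1)) (Fin (N + 1)) ℂ :=
  P0⁻¹ * cplx A0 * P.LinvMat N * P0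

/-- `R₀`: the off-diagonal part of `ℳ₀`. -/
def R0 {N : ℕ} (A0 : Matrix (Fin (N + 1)) (Fin (N + 1)) ℝ)
    (P0 : Matrix (Fin (N + 1)) (Fin (N + 1)) ℂ) : Matrix (Fin (N + 1)) (Fin (N + 1)) ℂ :=
  P.M0 A0 P0 - Matrix.diagonal fun j => P.M0 A0 P0 j j

end Problem

/-- The constants `Z_{1,𝒫₀}`, `Z_{2,𝒫₀}(r)`, `Z_{2,≤N}(r)`, `Z_{2,>N}(r)` and `β_{k,l}`. -/
structure Consts where
  Z1P : ℝ≥0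
  Z2P : ℝ≥0
  Z2le : ℝ≥0
  Z2gt : ℝ≥0
  b01 : ℝ≥0
  b02 : ℝ≥0
  b11 : ℝ≥0
  b12 : ℝ≥0
  b13 : ℝ≥0
  b14 : ℝ≥0
  b21 : ℝ≥0
  b22 : ℝ≥0

/-- The inequalities required of the constants; operators act on complex `ℓ¹₁` sequences. -/
structure Consts.Valid (c : Consts) (P : Problem)
    (s : Fin (2 * P.m) → Equiv.Perm (Fin (2 * P.m))) {N : ℕ}
    (A0 : Matrix (Fin (N + 1)) (Fin (N + 1)) ℝ) (P0 : Matrix (Fin (N + 1)) (Fin (N + 1)) ℂ)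
    (Ubar Util : ℕ → ℝ) (r : ℝ≥0) : Prop where
  Z1P : opNorm (fun H : ℕ → ℂ =>
      emb P0⁻¹ (emb P0 H - emb (Problem.cplx A0) (P.DF Ubar (emb P0 H)))) ≤ c.Z1P
  Z2P : opNorm (fun H : ℕ → ℂ =>
      emb (P0⁻¹ * Problem.cplx A0) (P.DF Ubar (emb P0 H) - P.DF Util (emb P0 H)))
    ≤ (c.Z2P * r : ℝ≥0)
  Z2le : opNorm (fun H : ℕ → ℂ => emb (Problem.cplx A0) (P.DF Ubar H - P.DF Util H))
    ≤ (c.Z2le * r : ℝ≥0)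
  Z2gt : opNorm (fun H : ℕ → ℂ => piGt N (P.DK Ubar H - P.DK Util H)) ≤ (c.Z2gt * r : ℝ≥0)
  b01 : opNorm (fun H : ℕ → ℂ => piGt N (P.DK Ubar (emb P0 H)))
      + (matNorm P0 * (c.Z2gt * r) : ℝ≥0) ≤ c.b01
  b02 : opNorm (fun H : ℕ → ℂ =>
        emb (P0⁻¹ * Problem.cplx A0) (P.DK Ubar (piGt N (P.DK Ubar (emb P0 H)))))
      + opNorm (fun H : ℕ → ℂ => emb (P0⁻¹ * Problem.cplx A0) (P.DK Ubar (piGt N H)))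
        * (matNorm P0 * (c.Z2gt * r) : ℝ≥0) ≤ c.b02
  b11 : ENNReal.ofReal (P.eta (s ⟨0, by have := P.one_le_m; omega⟩) ⟨0, by have := P.one_le_m; omega⟩
          (N + 1))
      * matNorm (P0⁻¹ * Problem.cplx A0)
      * (opNorm (fun H : ℕ → ℂ => piGt N (P.DK Ubar (emb P0 H)))
        + (matNorm P0 * (c.Z2gt * r) : ℝ≥0)) ≤ c.b11
  b12 : opNorm (fun H : ℕ → ℂ => piGt N (P.Linv (emb P0 H))) ≤ c.b12
  b13 : opNorm (fun H : ℕ → ℂ =>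
      emb (P0⁻¹ * Problem.cplx A0) (P.DK Ubar (piGt N (P.Linv (emb P0 H))))) ≤ c.b13
  b14 : opNorm (fun H : ℕ → ℂ => emb (P0⁻¹ * Problem.cplx A0) (P.DK Ubar (piGt N H)))
      + (matNorm P0⁻¹ * (c.Z2le * r) : ℝ≥0) ≤ c.b14
  b21 : opNorm (fun H : ℕ → ℂ =>
      emb (P0⁻¹ * Problem.cplx A0) (P.Linv (piGt N (P.Linv (emb P0 H))))) ≤ c.b21
  b22 : ENNReal.ofReal (P.eta (s ⟨0, by have := P.one_le_m; omega⟩) ⟨0, by have := P.one_le_m; omega⟩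
          (N + 1))
      * matNorm (P0⁻¹ * Problem.cplx A0) ≤ c.b22

namespace Consts

variable (c : Consts) {n : ℕ} (P0 : Matrix (Fin n) (Fin n) ℂ) (e : ℝ) (r : ℝ≥0)

/-- `β₂`, as a function of `ε = e`. -/
def b2 : ℝ := c.b21 + e / (1 - e) * c.b12 * c.b22

/-- `β₁`. -/
def b1 : ℝ := c.b11 + c.b13 + matNorm P0⁻¹ * (c.Z2le * r) * c.b12
  + e / (1 - e) * (c.b12 * c.b14 + c.b01 * c.b22)

/-- `β₀`. -/
def b0 : ℝ := c.b02 + matNorm P0⁻¹ * (c.Z2le * r) * c.b01 + e / (1 - e) * c.b01 * c.b14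

/-- The constant `δ`. -/
def delta (R0 : Matrix (Fin n) (Fin n) ℂ) (lamMax : ℝ) : ℝ :=
  lamMax * matNorm R0 + c.b2 e * lamMax ^ 2 + c.b1 P0 e r * lamMax + c.b0 P0 e r
    + c.Z1P + c.Z2P * r

end Consts

/-- The disk `𝔅` attached to `μ`: the closed ball of center `λ = μ⁻¹` and radius `δ |λ|`. When
`μ = 0`, that is `λ = ∞`, it is the set of those `z` with `|1 - μ z| ≤ δ`: empty if `δ < 1` and
the whole plane otherwise. -/
def disk (μ : ℂ) (δ : ℝ) : Set ℂ :=
  if μ = 0 then {_z | 1 ≤ δ} else Metric.closedBall μ⁻¹ (δ * ‖μ⁻¹‖)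

namespace Problem

variable (P : Problem)

/-- The functions `v : [-1,1] → ℂ` of class `C^{2m}` satisfying the boundary conditions
(extended by `0` outside of `[-1,1]`). -/
def Dom : Set (ℝ → ℂ) :=
  {v | (∀ x ∉ seg, v x = 0) ∧ ContDiffOn ℝ (2 * P.m : ℕ) v seg ∧ ∀ r, P.bc r v = 0}

/-- The linearization `v ↦ (-1)^{m+1} ∂ₓ^{2m} v + D𝒬(w) v` at `w`. -/
def lin (w : ℝ → ℝ) (v : ℝ → ℂ) : ℝ → ℂ :=
  Set.indicator seg fun x =>
    (-1) ^ (P.m + 1) * dx (2 * P.m) v x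
      + ∑ i : Fin (2 * P.m), (P.DQcoef w i x : ℂ) * dx i v x

/-- `lam` is an eigenvalue of the linearization at `w`. -/
def IsEigenvalue (w : ℝ → ℝ) (lam : ℂ) : Prop :=
  ∃ v ∈ P.Dom, v ≠ 0 ∧ P.lin w v = lam • v

/-- `ker (lin w - lam)^k`. -/
def rootKer (w : ℝ → ℝ) (lam : ℂ) : ℕ → Set (ℝ → ℂ)
  | 0 => {0}
  | k + 1 => {v | v ∈ P.Dom ∧ P.lin w v - lam • v ∈ rootKer w lam k}

/-- The generalized eigenspace `⋃ₖ ker (lin w - lam)^k`. -/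
def rootSpace (w : ℝ → ℝ) (lam : ℂ) : Submodule ℂ (ℝ → ℂ) :=
  Submodule.span ℂ (⋃ k, P.rootKer w lam k)

/-- The unstable eigenvalues of the linearization at `w`. -/
def unstable (w : ℝ → ℝ) : Set ℂ := {lam | P.IsEigenvalue w lam ∧ 0 < lam.re}

end Problem

end GegenbauerStability

end

/-! Writing `v = 𝒢₀ ℒ⁻¹ U` turns the eigenvalue problem of the differential operator into the kernel
of a bounded analytic family on `ℓ¹₁`, namely `T(λ) = 1 + D𝒦(Ũ) - λ ℒ⁻¹`
(`lin_sub_smul_domFun_eq_iff`, `exists_domFun`). Generalized eigenvectors become chains `T(λ) xₙ =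
ℒ⁻¹ xₙ₊₁`: finitely supported sequences killed by the Taylor series of `T` at `λ`, the variable
acting as the left shift (`rank_rootSpace`).

For `|λ| ≤ λ_max` the block of `T(λ)` above `N` is the identity plus an operator of norm at most `ε
< 1` (`norm_tail_le`). Eliminating it leaves a Schur complement `E(λ)`, an analytic matrix of size
`N + 1`. The elimination preserves the dimension of the space of chains (`rank_ker_opAct`), and for
a matrix of scalar power series this dimension is the order of its determinant (`rank_ker_matAct`).
So the algebraic multiplicity of `λ` is the order of vanishing of `det E` at `λ`
(`rank_rootSpace_eq`).

Next, `𝒫₀⁻¹ 𝒜₀ E(λ) 𝒫₀` is the diagonal matrix with entries `1 - λ μ_j` plus an error of norm at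
most `δ` (`norm_errMat_le`, `dev_le_delta`). Scale the error by `t ∈ [0,1]`: every zero of the
determinant remains in some disk `𝔅_j` (`exists_norm_le_of_det_eq_zero`, `mem_disk`). Each disk lies
strictly on one side of the imaginary axis, so no zero crosses it. The number of zeros in the right
half-disk is thus independent of `t` (`zeroCount_eq_of_homotopy`, based on Jensen's formula), and at
`t = 0` it is the number of points `μ_j⁻¹` there.

Two points are delicate. First, the disks may touch the circle `|z| = λ_max`, so the count is made
in a slightly larger disk, which needs an error bound strictly below `δ`. The slack is the term
`γ/24` in `norm_LinvL_mul_qL_le`, exploited in `dev_lt_delta`. Second, `γ_{p,k}` is a row sum of the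
iterated antiderivative, whereas the norm of an operator on `ℓ¹` is governed by column sums; these
are `k γ_{p+1,k}` and may be larger. The excess is absorbed by the smallness of the endpoint values
(`endVal_le`) together with `gam_le_two_mul_eta_sub`, and, for the convolution terms, by a
symmetrization (`tsum_shift_bulk_le`). -/

open scoped ENNReal NNReal

noncomputable section

namespace GegenbauerStability

/-! ### The Banach space `ℓ¹₁` and operator norms on it. -/

section EllOne

variable {𝕜 : Type*} [RCLike 𝕜]

/-- The weights of the norm of `ℓ¹₁`. -/
def wt (n : ℕ) : ℝ := if n = 0 then 1 else 2

lemma wt_pos (n : ℕ) : 0 < wt n := by unfold wt; split_ifs <;> norm_num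

lemma one_le_wt (n : ℕ) : 1 ≤ wt n := by unfold wt; split_ifs <;> norm_num

lemma wt_le_two (n : ℕ) : wt n ≤ 2 := by unfold wt; split_ifs <;> norm_num

@[simp] lemma wt_zero : wt 0 = 1 := by simp [wt]

@[simp] lemma wt_succ (n : ℕ) : wt (n + 1) = 2 := by simp [wt]

lemma wt_of_ne {n : ℕ} (h : n ≠ 0) : wt n = 2 := by simp [wt, h]

lemma summable_wt_mul_iff {f : ℕ → ℝ} (hf : ∀ n, 0 ≤ f n) :
    Summable (fun n => wt n * f n) ↔ Summable f := by
  constructor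
  · intro h
    exact h.of_nonneg_of_le hf fun n => le_mul_of_one_le_left (hf n) (one_le_wt n)
  · intro h
    exact (h.mul_left 2).of_nonneg_of_le (fun n => mul_nonneg (wt_pos n).le (hf n))
      fun n => mul_le_mul_of_nonneg_right (wt_le_two n) (hf n)

variable (𝕜) in
/-- The absolutely summable sequences. -/
def ellOneSubmodule : Submodule 𝕜 (ℕ → 𝕜) where
  carrier := {U | Summable fun n => ‖U n‖}
  zero_mem' := by simp [summable_zero]
  add_mem' {a b} ha hb := (ha.add hb).of_nonneg_of_le (fun _ => norm_nonneg _)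
    fun n => norm_add_le (a n) (b n)
  smul_mem' c a ha := by
    simp only [Set.mem_ofPred_eq, Pi.smul_apply, norm_smul] at ha ⊢
    exact ha.mul_left _

variable (𝕜) in
/-- The Banach space `ℓ¹₁`. -/
def L1 : Type _ := ellOneSubmodule 𝕜

instance : AddCommGroup (L1 𝕜) := inferInstanceAs (AddCommGroup (ellOneSubmodule 𝕜))
instance : Module 𝕜 (L1 𝕜) := inferInstanceAs (Module 𝕜 (ellOneSubmodule 𝕜))
/-- The terms of an element of `ℓ¹₁`. -/
def L1.seq (U : L1 𝕜) : ℕ → 𝕜 := U.1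

instance : CoeFun (L1 𝕜) fun _ => ℕ → 𝕜 := ⟨L1.seq⟩

namespace L1

@[ext] lemma ext {U W : L1 𝕜} (h : ∀ n, U n = W n) : U = W := Subtype.ext (funext h)

@[simp] lemma add_apply (U W : L1 𝕜) (n : ℕ) : (U + W) n = U n + W n := rfl
@[simp] lemma sub_apply (U W : L1 𝕜) (n : ℕ) : (U - W) n = U n - W n := rfl
@[simp] lemma neg_apply (U : L1 𝕜) (n : ℕ) : (-U) n = -U n := rfl
@[simp] lemma smul_apply (c : 𝕜) (U : L1 𝕜) (n : ℕ) : (c • U) n = c * U n := rfl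

lemma coe_add (U W : L1 𝕜) : ((U + W : L1 𝕜) : ℕ → 𝕜) = (U : ℕ → 𝕜) + W := rfl
lemma coe_sub (U W : L1 𝕜) : ((U - W : L1 𝕜) : ℕ → 𝕜) = (U : ℕ → 𝕜) - W := rfl

lemma summable (U : L1 𝕜) : Summable fun n => ‖U n‖ := U.2

/-- An absolutely summable sequence, as an element of `ℓ¹₁`. -/
def mk (U : ℕ → 𝕜) (h : Summable fun n => ‖U n‖) : L1 𝕜 := ⟨U, h⟩

@[simp] lemma coe_mk (U : ℕ → 𝕜) (h : Summable fun n => ‖U n‖) : (mk U h : ℕ → 𝕜) = U := rfl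

lemma memlp (U : L1 𝕜) : Memℓp (fun n => wt n • U n) 1 := by
  rw [memℓp_gen_iff (by norm_num)]
  simp only [norm_smul, ENNReal.toReal_one, Real.rpow_one, Real.norm_of_nonneg (wt_pos _).le]
  exact (summable_wt_mul_iff fun _ => norm_nonneg _).2 U.summable

/-- The weighted isometry of `ℓ¹₁` with the unweighted `ℓ¹`. -/
def toLp : L1 𝕜 →ₗ[𝕜] lp (fun _ : ℕ => 𝕜) 1 where
  toFun U := ⟨fun n => wt n • U n, U.memlp⟩
  map_add' U W := by
    ext n
    change wt n • (U n + W n) = wt n • U n + wt n • W n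
    rw [smul_add]
  map_smul' c U := by
    ext n
    change wt n • (c * U n) = c * (wt n • U n)
    rw [mul_smul_comm]

lemma toLp_injective : Function.Injective (toLp (𝕜 := 𝕜)) := by
  intro U W h
  ext n
  have : wt n • U n = wt n • W n := congrFun (congrArg Subtype.val h) n
  exact smul_right_injective 𝕜 (wt_pos n).ne' this

instance : NormedAddCommGroup (L1 𝕜) :=
  NormedAddCommGroup.induced (L1 𝕜) (lp (fun _ : ℕ => 𝕜) 1) toLp toLp_injective

instance : NormedSpace 𝕜 (L1 𝕜) :=
  NormedSpace.induced 𝕜 (L1 𝕜) (lp (fun _ : ℕ => 𝕜) 1) toLp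

lemma summable_norm (U : L1 𝕜) : Summable fun n => wt n * ‖U n‖ :=
  (summable_wt_mul_iff fun _ => norm_nonneg _).2 U.summable

lemma norm_eq (U : L1 𝕜) : ‖U‖ = ∑' n, wt n * ‖U n‖ := by
  change ‖toLp U‖ = _
  rw [lp.norm_eq_tsum_rpow (by norm_num)]
  simp only [toLp, LinearMap.coe_mk, AddHom.coe_mk, norm_smul, ENNReal.toReal_one, Real.rpow_one,
    Real.norm_of_nonneg (wt_pos _).le, div_one]

lemma hasSum_norm (U : L1 𝕜) : HasSum (fun n => wt n * ‖U n‖) ‖U‖ := by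
  rw [norm_eq]; exact U.summable_norm.hasSum

lemma wt_mul_norm_le (U : L1 𝕜) (n : ℕ) : wt n * ‖U n‖ ≤ ‖U‖ :=
  le_hasSum U.hasSum_norm n fun _ _ => mul_nonneg (wt_pos _).le (norm_nonneg _)

lemma norm_apply_le (U : L1 𝕜) (n : ℕ) : ‖U n‖ ≤ ‖U‖ :=
  (le_mul_of_one_le_left (norm_nonneg _) (one_le_wt n)).trans (U.wt_mul_norm_le n)

lemma toLp_surjective : Function.Surjective (toLp (𝕜 := 𝕜)) := by
  intro f
  have hf := (memℓp_gen_iff (p := 1) (by norm_num)).1 f.2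
  simp only [ENNReal.toReal_one, Real.rpow_one] at hf
  refine ⟨mk (fun n => (wt n)⁻¹ • f n) ?_, ?_⟩
  · refine hf.of_nonneg_of_le (fun _ => norm_nonneg _) fun n => ?_
    rw [norm_smul, norm_inv, Real.norm_of_nonneg (wt_pos n).le]
    exact mul_le_of_le_one_left (norm_nonneg _) (inv_le_one_of_one_le₀ (one_le_wt n))
  · ext n
    change wt n • ((wt n)⁻¹ • f n) = f n
    rw [smul_inv_smul₀ (wt_pos n).ne']

instance : CompleteSpace (L1 𝕜) := by
  let e : L1 𝕜 ≃ₗᵢ[𝕜] lp (fun _ : ℕ => 𝕜) 1 :=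
    { LinearEquiv.ofBijective toLp ⟨toLp_injective, toLp_surjective⟩ with norm_map' := fun _ => rfl }
  exact (completeSpace_congr (e := e.toEquiv) e.isometry.isUniformEmbedding).2 inferInstance

/-- The unit sequences. -/
def e (k : ℕ) : L1 𝕜 :=
  mk (Pi.single k 1) (summable_of_ne_finset_zero (s := {k}) fun n hn => by
    rw [Pi.single_eq_of_ne (by simpa using hn), norm_zero])

lemma coe_e (k : ℕ) : (e k : ℕ → 𝕜) = Pi.single k 1 := rfl

lemma e_apply (k n : ℕ) : (e k : L1 𝕜) n = if n = k then 1 else 0 := by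
  simp [e, Pi.single_apply]

@[simp] lemma e_self (k : ℕ) : (e k : L1 𝕜) k = 1 := by simp [e_apply]

lemma e_of_ne {k n : ℕ} (h : n ≠ k) : (e k : L1 𝕜) n = 0 := by simp [e_apply, h]

@[simp] lemma norm_e (k : ℕ) : ‖(e k : L1 𝕜)‖ = wt k := by
  rw [norm_eq, tsum_eq_single k]
  · simp
  · intro n hn; simp [e_of_ne hn]

/-- The coordinate functionals. -/
def coord (n : ℕ) : L1 𝕜 →L[𝕜] 𝕜 := LinearMap.mkContinuous
    { toFun := fun U => U n, map_add' := fun _ _ => rfl, map_smul' := fun _ _ => rfl } 1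
    fun U => (U.norm_apply_le n).trans_eq (one_mul _).symm

@[simp] lemma coord_apply (n : ℕ) (U : L1 𝕜) : coord n U = U n := rfl

lemma hasSum_e (U : L1 𝕜) : HasSum (fun n => U n • (e n : L1 𝕜)) U := by
  have hs : Summable fun n => U n • (e n : L1 𝕜) := by
    refine Summable.of_norm ?_
    simp only [norm_smul, norm_e]
    simpa [mul_comm] using U.summable_norm
  convert hs.hasSum using 1
  ext n
  have h : (∑' k, U k • (e k : L1 𝕜)) n = ∑' k, coord n (U k • (e k : L1 𝕜)) :=
    (coord n).map_tsum hs
  rw [h, tsum_eq_single n]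
  · simp
  · intro k hk
    simp [e_of_ne hk.symm]

lemma finset_sum_apply {ι : Type*} (s : Finset ι) (f : ι → L1 𝕜) (n : ℕ) :
    (∑ i ∈ s, f i) n = ∑ i ∈ s, f i n := map_sum (coord n) f s

lemma coe_finset_sum {ι : Type*} (s : Finset ι) (f : ι → L1 𝕜) :
    ((∑ i ∈ s, f i : L1 𝕜) : ℕ → 𝕜) = ∑ i ∈ s, (f i : ℕ → 𝕜) := by
  funext n; rw [finset_sum_apply, Finset.sum_apply]

section maps

variable {F : Type*} [NormedAddCommGroup F] [NormedSpace 𝕜 F]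

lemma hasSum_map (M : L1 𝕜 →L[𝕜] F) (U : L1 𝕜) : HasSum (fun n => U n • M (e n)) (M U) := by
  simpa using U.hasSum_e.mapL M

/-- The expansion in unit sequences converges in norm, so identities between bounded operators may
be checked column by column. Most operator identities on Chebyshev series below are proved in this
way. -/
lemma clm_ext {M M' : L1 𝕜 →L[𝕜] F} (h : ∀ n, M (e n) = M' (e n)) : M = M' := by
  ext U
  exact (hasSum_map M U).unique (by simpa [h] using hasSum_map M' U)

lemma norm_map_le (M : L1 𝕜 →L[𝕜] F) {C : ℝ} (U : L1 𝕜)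
    (h : ∀ n, U n ≠ 0 → ‖M (e n)‖ ≤ C * wt n) : ‖M U‖ ≤ C * ‖U‖ := by
  have h2 := U.hasSum_norm.mul_left C
  rw [← (hasSum_map M U).tsum_eq]
  refine tsum_of_norm_bounded h2 fun n => ?_
  rw [norm_smul]
  by_cases hn : U n = 0
  · simp [hn]
  · calc ‖U n‖ * ‖M (e n)‖ ≤ ‖U n‖ * (C * wt n) := by gcongr; exact h n hn
      _ = C * (wt n * ‖U n‖) := by ring

lemma opNorm_le_of_e (M : L1 𝕜 →L[𝕜] F) {C : ℝ} (hC : 0 ≤ C)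
    (h : ∀ n, ‖M (e n)‖ ≤ C * wt n) : ‖M‖ ≤ C :=
  M.opNorm_le_bound hC fun U => norm_map_le M U fun n _ => h n

/-- A linear operator on sequences which is bounded on `ℓ¹₁`. -/
def lift (f : (ℕ → 𝕜) → (ℕ → 𝕜)) (C : ℝ)
    (hadd : ∀ U W : L1 𝕜, f ((U : ℕ → 𝕜) + W) = f U + f W)
    (hsmul : ∀ (c : 𝕜) (U : L1 𝕜), f (c • (U : ℕ → 𝕜)) = c • f U)
    (hs : ∀ U : L1 𝕜, Summable fun n => ‖f U n‖)
    (hC : ∀ U : L1 𝕜, ∑' n, wt n * ‖f U n‖ ≤ C * ‖U‖) : L1 𝕜 →L[𝕜] L1 𝕜 :=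
  LinearMap.mkContinuous
    { toFun := fun U => mk (f U) (hs U)
      map_add' := fun U W => L1.ext fun n => congrFun (hadd U W) n
      map_smul' := fun c U => L1.ext fun n => congrFun (hsmul c U) n } C
    fun U => by rw [norm_eq]; exact hC U

end maps

lemma ell1Norm_coe (U : L1 𝕜) : ell1Norm (U : ℕ → 𝕜) = ENNReal.ofReal ‖U‖ := by
  have h0 : Summable fun n => wt (n + 1) * ‖U (n + 1)‖ :=
    (summable_nat_add_iff 1).2 U.summable_norm
  have h1 : ∀ n, 0 ≤ wt (n + 1) * ‖U (n + 1)‖ :=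
    fun _ => mul_nonneg (wt_pos _).le (norm_nonneg _)
  rw [norm_eq, U.summable_norm.tsum_eq_zero_add, wt_zero, one_mul,
    ENNReal.ofReal_add (norm_nonneg _) (tsum_nonneg h1), ENNReal.ofReal_tsum_of_nonneg h1 h0,
    ell1Norm, ofReal_norm, ← ENNReal.tsum_mul_left]
  congr 2
  funext n
  rw [wt_succ, ENNReal.ofReal_mul (by norm_num), ofReal_norm]
  norm_num

lemma summable_of_ell1Norm {U : ℕ → 𝕜} (h : ell1Norm U < ∞) : Summable fun n => ‖U n‖ := by
  have h2 : 2 * ∑' n : ℕ, ‖U (n + 1)‖ₑ ≠ ∞ := (lt_of_le_of_lt le_add_self h).ne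
  have h3 : ∑' n : ℕ, ‖U (n + 1)‖ₑ ≠ ∞ := by
    intro h4
    rw [h4] at h2
    exact h2 (ENNReal.mul_top (by norm_num))
  refine (summable_nat_add_iff 1).1 ?_
  have h5 := ENNReal.summable_toReal h3
  simpa using h5

section opNorm

variable {f : (ℕ → 𝕜) → (ℕ → 𝕜)} {M : L1 𝕜 →L[𝕜] L1 𝕜}

/-- The bridge between the hypotheses, phrased with extended-real suprema over raw sequences, and
genuine operator norms. A sequence of finite norm is summable, hence an element of `L1`; conversely
the supremum controls unit vectors and one rescales. -/
lemma opNorm_eq (h : ∀ U : L1 𝕜, f U = M U) : opNorm f = ENNReal.ofReal ‖M‖ := by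
  apply le_antisymm
  · refine iSup₂_le fun U hU => ?_
    have hs := summable_of_ell1Norm (lt_of_le_of_lt hU ENNReal.one_lt_top)
    have hU' : ell1Norm ((mk U hs : L1 𝕜) : ℕ → 𝕜) ≤ 1 := hU
    have := h (mk U hs)
    rw [coe_mk] at this
    rw [this, ell1Norm_coe]
    rw [ell1Norm_coe, ← ENNReal.ofReal_one, ENNReal.ofReal_le_ofReal_iff (by norm_num)] at hU'
    apply ENNReal.ofReal_le_ofReal
    simpa using M.le_of_opNorm_le_of_le le_rfl hU'
  · by_cases htop : opNorm f = ∞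
    · rw [htop]; exact le_top
    rw [← ENNReal.ofReal_toReal htop]
    apply ENNReal.ofReal_le_ofReal
    have key : ∀ U : L1 𝕜, ‖U‖ = 1 → ‖M U‖ ≤ (opNorm f).toReal := fun U hU => by
      have h1 : ell1Norm (f U) ≤ opNorm f := le_iSup₂_of_le (f := fun (U : ℕ → 𝕜)
        (_ : ell1Norm U ≤ 1) => ell1Norm (f U)) (U : ℕ → 𝕜) (by rw [ell1Norm_coe, hU]; simp) le_rfl
      rw [h, ell1Norm_coe] at h1
      exact (ENNReal.ofReal_le_iff_le_toReal htop).1 h1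
    refine M.opNorm_le_bound ENNReal.toReal_nonneg fun U => ?_
    by_cases hU : U = 0
    · simp [hU]
    have hU' : 0 < ‖U‖ := norm_pos_iff.2 hU
    have h2 := key (((‖U‖⁻¹ : ℝ) : 𝕜) • U) (by
      rw [norm_smul, RCLike.norm_ofReal, abs_of_pos (inv_pos.2 hU'), inv_mul_cancel₀ hU'.ne'])
    rwa [map_smul, norm_smul, RCLike.norm_ofReal, abs_of_pos (inv_pos.2 hU'),
      inv_mul_le_iff₀ hU', mul_comm] at h2

lemma norm_le_of_opNorm_le {C : ℝ≥0} (h : ∀ U : L1 𝕜, f U = M U) (hf : opNorm f ≤ C) :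
    ‖M‖ ≤ C := by
  rw [opNorm_eq h, ← ENNReal.ofReal_coe_nnreal] at hf
  exact (ENNReal.ofReal_le_ofReal_iff C.2).1 hf

end opNorm

end L1

end EllOne

end GegenbauerStability

end

open scoped ENNReal NNReal

noncomputable section

namespace GegenbauerStability

open Polynomial.Chebyshev

/-! ### Evaluation of Chebyshev series on `[-1,1]`. -/

section ChebyshevSeries

variable {𝕜 : Type*} [RCLike 𝕜]

/-- The value of the Chebyshev polynomial `Tₙ`. -/
abbrev chT (n : ℤ) (x : ℝ) : ℝ := (T ℝ n).eval x

lemma abs_chT_le (n : ℤ) {x : ℝ} (hx : x ∈ seg) : |chT n x| ≤ 1 :=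
  abs_eval_T_real_le_one n (abs_le.2 hx)

lemma continuous_chT (n : ℤ) : Continuous (chT n) := Polynomial.continuous _

lemma norm_cheb_term_le (U : L1 𝕜) (n : ℕ) {x : ℝ} (hx : x ∈ seg) :
    ‖(wt n * chT n x) • U n‖ ≤ wt n * ‖U n‖ := by
  rw [norm_smul, norm_mul, Real.norm_of_nonneg (wt_pos n).le, Real.norm_eq_abs]
  have := abs_chT_le n hx
  have h2 := mul_nonneg (wt_pos n).le (norm_nonneg (U n))
  nlinarith

lemma hasSum_cheb (U : L1 𝕜) {x : ℝ} (hx : x ∈ seg) :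
    HasSum (fun n : ℕ => (wt n * chT n x) • U n) (cheb U x) := by
  have hs : Summable (fun n : ℕ => (wt n * chT n x) • U n) :=
    Summable.of_norm_bounded U.summable_norm fun n => norm_cheb_term_le U n hx
  have := hs.hasSum
  rw [hs.tsum_eq_zero_add] at this
  convert this using 1
  have h0 : chT 0 x = 1 := by simp [chT]
  simp [cheb, h0]

lemma norm_cheb_le (U : L1 𝕜) {x : ℝ} (hx : x ∈ seg) : ‖cheb U x‖ ≤ ‖U‖ := by
  rw [← (hasSum_cheb U hx).tsum_eq]
  exact tsum_of_norm_bounded U.hasSum_norm fun n => norm_cheb_term_le U n hx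

lemma cheb_add (U W : L1 𝕜) {x : ℝ} (hx : x ∈ seg) :
    cheb (U + W : L1 𝕜) x = cheb U x + cheb W x := by
  refine (hasSum_cheb _ hx).unique ?_
  simpa [smul_add] using (hasSum_cheb U hx).add (hasSum_cheb W hx)

lemma cheb_smul (c : 𝕜) (U : L1 𝕜) {x : ℝ} (hx : x ∈ seg) :
    cheb (c • U : L1 𝕜) x = c * cheb U x := by
  refine (hasSum_cheb _ hx).unique ?_
  simpa using (hasSum_cheb U hx).mul_left c

/-- The evaluation at a point of `[-1,1]` of the sum of a Chebyshev series. -/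
def chebAt (x : seg) : L1 𝕜 →L[𝕜] 𝕜 := LinearMap.mkContinuous
  { toFun := fun U => cheb U x
    map_add' := fun U W => cheb_add U W x.2
    map_smul' := fun c U => cheb_smul c U x.2 } 1
  fun U => (norm_cheb_le U x.2).trans_eq (one_mul _).symm

@[simp] lemma chebAt_apply (x : seg) (U : L1 𝕜) : chebAt x U = cheb U x := rfl

lemma cheb_sub (U W : L1 𝕜) {x : ℝ} (hx : x ∈ seg) :
    cheb (U - W : L1 𝕜) x = cheb U x - cheb W x := map_sub (chebAt ⟨x, hx⟩) U W

lemma cheb_zero {x : ℝ} (hx : x ∈ seg) : cheb (0 : L1 𝕜) x = 0 := map_zero (chebAt ⟨x, hx⟩)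

lemma cheb_sum {ι : Type*} (s : Finset ι) (f : ι → L1 𝕜) {x : ℝ} (hx : x ∈ seg) :
    cheb (∑ i ∈ s, f i : L1 𝕜) x = ∑ i ∈ s, cheb (f i) x := map_sum (chebAt ⟨x, hx⟩) f s

lemma cheb_e (k : ℕ) (x : ℝ) : cheb (L1.e k : L1 𝕜) x = ((wt k * chT k x : ℝ) : 𝕜) := by
  rcases k with _ | k
  · simp [cheb, L1.e_apply]
  · rw [cheb, tsum_eq_single k]
    · simp [L1.e_apply, RCLike.real_smul_eq_coe_mul]
    · intro b hb
      simp [L1.e_apply, hb]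

lemma continuousOn_cheb (U : L1 𝕜) : ContinuousOn (cheb (U : ℕ → 𝕜)) seg := by
  have : ContinuousOn (fun x => ∑' n : ℕ, (wt n * chT n x) • U n) seg :=
    continuousOn_tsum (fun n => by
      have := continuous_chT n
      fun_prop) U.summable_norm fun n x hx => norm_cheb_term_le U n hx
  exact this.congr fun x hx => (hasSum_cheb U hx).tsum_eq.symm

end ChebyshevSeries

/-! ### The antiderivative on Chebyshev coefficients. -/

section Antiderivative

variable {𝕜 : Type*} [RCLike 𝕜]

/-- The coefficients of the series in `antider`. -/
def antiderCoef (n : ℕ) : ℝ := 2 * (-1) ^ (n + 3) / (((n : ℝ) + 2) ^ 2 - 1)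

lemma abs_antiderCoef_le (n : ℕ) : |antiderCoef n| ≤ 1 := by
  have h : (0 : ℝ) ≤ n := n.cast_nonneg
  have h2 : (3 : ℝ) ≤ ((n : ℝ) + 2) ^ 2 - 1 := by nlinarith
  rw [antiderCoef, abs_div, abs_mul, abs_pow, abs_neg, abs_one, one_pow, mul_one, abs_two,
    abs_of_pos (by linarith), div_le_one (by linarith)]
  linarith

lemma summable_antiderCoef (U : L1 𝕜) : Summable fun n => antiderCoef n • U (n + 2) := by
  refine Summable.of_norm_bounded ((summable_nat_add_iff 2).2 U.summable) fun n => ?_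
  rw [norm_smul, Real.norm_eq_abs]
  exact mul_le_of_le_one_left (norm_nonneg _) (abs_antiderCoef_le n)

lemma antider_zero (U : ℕ → 𝕜) :
    antider U 0 = U 0 - (1 / 2 : ℝ) • U 1 + ∑' n : ℕ, antiderCoef n • U (n + 2) := rfl

lemma antider_succ (U : ℕ → 𝕜) (n : ℕ) :
    antider U (n + 1) = (1 / (2 * ((n : ℝ) + 1))) • (U n - U (n + 2)) := rfl

lemma tsum_norm_shift_le (U : L1 𝕜) (k : ℕ) : ∑' n, ‖U (n + k)‖ ≤ ‖U‖ := by
  rw [L1.norm_eq]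
  have h1 : ∑' n, ‖U (n + k)‖ ≤ ∑' n, ‖U n‖ := by
    rw [← U.summable.sum_add_tsum_nat_add k]
    have : 0 ≤ ∑ i ∈ Finset.range k, ‖U i‖ := Finset.sum_nonneg fun _ _ => norm_nonneg _
    linarith
  refine h1.trans (U.summable.tsum_le_tsum (fun n => ?_) U.summable_norm)
  exact le_mul_of_one_le_left (norm_nonneg _) (one_le_wt n)

lemma norm_antider_zero_le (U : L1 𝕜) : ‖antider (U : ℕ → 𝕜) 0‖ ≤ 3 * ‖U‖ := by
  have h1 := U.norm_apply_le 0
  have h2 : ‖(1 / 2 : ℝ) • U 1‖ ≤ ‖U‖ := by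
    rw [norm_smul]
    have := U.norm_apply_le 1
    have h0 := norm_nonneg (U 1)
    norm_num
    linarith
  have h3 : ‖∑' n : ℕ, antiderCoef n • U (n + 2)‖ ≤ ‖U‖ := by
    refine le_trans (tsum_of_norm_bounded ((summable_nat_add_iff 2).2 U.summable).hasSum
      fun n => ?_) (tsum_norm_shift_le U 2)
    rw [norm_smul, Real.norm_eq_abs]
    exact mul_le_of_le_one_left (norm_nonneg _) (abs_antiderCoef_le n)
  rw [antider_zero]
  calc _ ≤ ‖U 0‖ + ‖(1 / 2 : ℝ) • U 1‖ + ‖∑' n : ℕ, antiderCoef n • U (n + 2)‖ :=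
        (norm_add_le _ _).trans (by gcongr; exact norm_sub_le _ _)
    _ ≤ _ := by linarith

lemma norm_antider_succ_le (U : L1 𝕜) (n : ℕ) :
    2 * ‖antider (U : ℕ → 𝕜) (n + 1)‖ ≤ ‖U n‖ + ‖U (n + 2)‖ := by
  have h : (0 : ℝ) ≤ n := n.cast_nonneg
  rw [antider_succ, norm_smul, Real.norm_of_nonneg (by positivity)]
  have h1 := norm_sub_le (U n) (U (n + 2))
  have h2 : 1 / (2 * ((n : ℝ) + 1)) ≤ 1 / 2 := by
    apply one_div_le_one_div_of_le <;> linarith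
  have h3 := mul_le_mul h2 h1 (norm_nonneg _) (by norm_num)
  linarith

lemma summable_antider_succ (U : L1 𝕜) :
    Summable fun n => 2 * ‖antider (U : ℕ → 𝕜) (n + 1)‖ :=
  (U.summable.add ((summable_nat_add_iff 2).2 U.summable)).of_nonneg_of_le
    (fun _ => by positivity) (norm_antider_succ_le U)

lemma summable_antider (U : L1 𝕜) : Summable fun n => ‖antider (U : ℕ → 𝕜) n‖ := by
  refine (summable_nat_add_iff 1).1 ?_
  simpa using (summable_antider_succ U).div_const 2

/-- The antiderivative vanishing at `-1`, on `ℓ¹₁`. -/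
def antiderL : L1 𝕜 →L[𝕜] L1 𝕜 := L1.lift antider 5
  (fun U W => by
    funext n
    rcases n with _ | n
    · simp only [antider_zero, Pi.add_apply, smul_add,
        (summable_antiderCoef U).tsum_add (summable_antiderCoef W)]
      ring
    · simp only [antider_succ, Pi.add_apply, ← smul_add]
      ring_nf)
  (fun c U => by
    funext n
    rcases n with _ | n
    · have h (n : ℕ) : ((antiderCoef n : ℝ) : 𝕜) * (c * U (n + 2))
          = c * (((antiderCoef n : ℝ) : 𝕜) * U (n + 2)) := by ring
      simp only [antider_zero, Pi.smul_apply, smul_eq_mul, RCLike.real_smul_eq_coe_mul, h,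
        tsum_mul_left]
      ring
    · simp only [antider_succ, Pi.smul_apply, smul_eq_mul, RCLike.real_smul_eq_coe_mul]
      ring)
  summable_antider
  -- The entry of index `0` contributes at most `3‖U‖`. In the others the weight `2` is cancelled by
  -- `1 / (2 (n + 1))`, and the two shifted copies of `U` contribute at most `2‖U‖`; hence the
  -- constant `5`.
  (fun U => by
    have hs : Summable fun n => wt n * ‖antider (U : ℕ → 𝕜) n‖ :=
      (summable_wt_mul_iff fun _ => norm_nonneg _).2 (summable_antider U)
    rw [hs.tsum_eq_zero_add]
    simp only [wt_zero, one_mul, wt_succ]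
    have h1 := norm_antider_zero_le U
    have hs2 := (summable_nat_add_iff 2).2 U.summable
    have h2 := (summable_antider_succ U).tsum_le_tsum (norm_antider_succ_le U)
      (U.summable.add hs2)
    rw [U.summable.tsum_add hs2] at h2
    have h3 := tsum_norm_shift_le U 2
    have h4 := tsum_norm_shift_le U 0
    simp only [add_zero] at h4
    linarith)

@[simp] lemma coe_antiderL (U : L1 𝕜) : (antiderL U : ℕ → 𝕜) = antider U := rfl

lemma antider_e_zero : (antiderL (L1.e 0) : L1 𝕜) = L1.e 0 + (1 / 2 : 𝕜) • L1.e 1 := by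
  ext n
  rcases n with _ | _ | n
  · simp [antider_zero, L1.e_apply]
  · simp [antider_succ, L1.e_apply, RCLike.real_smul_eq_coe_mul, map_ofNat]
  · simp [antider_succ, L1.e_apply]

lemma antider_e_one :
    (antiderL (L1.e 1) : L1 𝕜) = (1 / 4 : 𝕜) • L1.e 2 - (1 / 2 : 𝕜) • L1.e 0 := by
  ext n
  rcases n with _ | _ | _ | n
  · simp [antider_zero, L1.e_apply, RCLike.real_smul_eq_coe_mul, map_ofNat]
  · simp [antider_succ, L1.e_apply]
  · simp [antider_succ, L1.e_apply, RCLike.real_smul_eq_coe_mul, map_ofNat]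
    norm_num
  · simp [antider_succ, L1.e_apply]

lemma antider_e_add_two (k : ℕ) :
    (antiderL (L1.e (k + 2)) : L1 𝕜) = ((antiderCoef k : ℝ) : 𝕜) • L1.e 0
      + ((1 / (2 * ((k : ℝ) + 3)) : ℝ) : 𝕜) • L1.e (k + 3)
      - ((1 / (2 * ((k : ℝ) + 1)) : ℝ) : 𝕜) • L1.e (k + 1) := by
  ext n
  rcases n with _ | n
  · rw [coe_antiderL, antider_zero, tsum_eq_single k]
    · simp [L1.e_apply, RCLike.real_smul_eq_coe_mul]
    · intro b hb
      simp [L1.e_apply, hb]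
  · rw [coe_antiderL, antider_succ]
    simp only [L1.e_apply, L1.sub_apply, L1.add_apply, L1.smul_apply,
      RCLike.real_smul_eq_coe_mul]
    by_cases h1 : n = k + 2
    · subst h1
      simp
      norm_num [add_assoc, map_ofNat]
    · by_cases h2 : n = k
      · subst h2
        simp
      · simp [h1, h2]

end Antiderivative

end GegenbauerStability

end

open scoped ENNReal NNReal

noncomputable section

namespace GegenbauerStability

open Polynomial.Chebyshev

lemma uniqueDiffOn_seg : UniqueDiffOn ℝ seg := uniqueDiffOn_Icc (by norm_num)

/-! ### Iterated one-sided derivatives on `[-1,1]`. -/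

section Chains

variable {E : Type*} [NormedAddCommGroup E] [NormedSpace ℝ E]

lemma dx_congr {u v : ℝ → E} (h : Set.EqOn u v seg) (j : ℕ) {x : ℝ} (hx : x ∈ seg) :
    dx j u x = dx j v x := iteratedDerivWithin_congr h hx

/-- A finite chain of derivatives. -/
lemma dx_of_chain (p : ℕ) : ∀ (v : ℕ → ℝ → E)
    (_ : ∀ j < p, ∀ x ∈ seg, HasDerivWithinAt (v j) (v (j + 1) x) seg x)
    (_ : ContinuousOn (v p) seg),
    ContDiffOn ℝ p (v 0) seg ∧ ∀ j ≤ p, ∀ x ∈ seg, dx j (v 0) x = v j x := by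
  induction p with
  | zero =>
    intro v _ hc
    refine ⟨contDiffOn_zero.2 hc, fun j hj x hx => ?_⟩
    obtain rfl : j = 0 := by omega
    simp [dx]
  | succ p ih =>
    intro v hv hc
    obtain ⟨h1, h2⟩ := ih (fun j => v (j + 1)) (fun j hj => hv (j + 1) (by omega)) hc
    have h0 : ∀ x ∈ seg, derivWithin (v 0) seg x = v 1 x := fun x hx =>
      (hv 0 (by omega) x hx).derivWithin (uniqueDiffOn_seg x hx)
    constructor
    · rw [Nat.cast_add, Nat.cast_one, contDiffOn_succ_iff_derivWithin uniqueDiffOn_seg]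
      refine ⟨fun x hx => (hv 0 (by omega) x hx).differentiableWithinAt, by simp, ?_⟩
      exact h1.congr h0
    · intro j hj x hx
      rcases j with _ | j
      · simp [dx]
      · rw [dx, iteratedDerivWithin_succ']
        rw [← h2 j (by omega) x hx]
        exact dx_congr h0 j hx

lemma hasDerivWithinAt_dx {v : ℝ → E} {p : ℕ} (hv : ContDiffOn ℝ p v seg) {j : ℕ} (hj : j < p)
    {x : ℝ} (hx : x ∈ seg) : HasDerivWithinAt (dx j v) (dx (j + 1) v x) seg x := by
  have h1 : DifferentiableWithinAt ℝ (iteratedDerivWithin j v seg) seg x :=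
    hv.differentiableOn_iteratedDerivWithin (by exact_mod_cast hj) uniqueDiffOn_seg x hx
  have h2 := h1.hasDerivWithinAt
  rwa [← iteratedDerivWithin_succ] at h2

lemma continuousOn_dx {v : ℝ → E} {p : ℕ} (hv : ContDiffOn ℝ p v seg) {j : ℕ} (hj : j ≤ p) :
    ContinuousOn (dx j v) seg :=
  hv.continuousOn_iteratedDerivWithin (by exact_mod_cast hj) uniqueDiffOn_seg

/-- Two functions with the same derivative on `[-1,1]` differ by a constant. -/
lemma eq_of_hasDerivWithinAt {u v w : ℝ → E} (hu : ∀ x ∈ seg, HasDerivWithinAt u (w x) seg x)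
    (hv : ∀ x ∈ seg, HasDerivWithinAt v (w x) seg x) (h0 : u (-1) = v (-1)) :
    Set.EqOn u v seg := by
  have hd : ∀ x ∈ seg, HasDerivWithinAt (u - v) 0 seg x := fun x hx => by
    simpa using (hu x hx).sub (hv x hx)
  intro x hx
  have h := constant_of_has_deriv_right_zero (f := u - v) (a := -1) (b := 1)
    (fun y hy => (hd y hy).continuousWithinAt)
    (fun y hy => ((hd y (Set.Ico_subset_Icc_self hy)).mono_of_mem_nhdsWithin
      (Icc_mem_nhdsGE_of_mem hy))) x hx
  simp only [Pi.sub_apply, h0, sub_self] at h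
  exact sub_eq_zero.1 h

end Chains

/-! ### Integration and differentiation of Chebyshev series. -/

section SeriesDerivatives

variable {𝕜 : Type*} [RCLike 𝕜]

lemma hasDerivAt_chT (n : ℤ) (x : ℝ) : HasDerivAt (chT n) (n * (U ℝ (n - 1)).eval x) x := by
  have := (T ℝ n).hasDerivAt x
  rwa [T_derivative_eq_U, Polynomial.eval_mul, Polynomial.eval_intCast] at this

lemma hasDerivAt_chT_antideriv (k : ℕ) (x : ℝ) :
    HasDerivAt (fun x => chT (k + 3) x / (k + 3) - chT (k + 1) x / (k + 1)) (2 * chT (k + 2) x)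
      x := by
  have h1 := (hasDerivAt_chT (k + 3) x).div_const ((k : ℝ) + 3)
  have h2 := (hasDerivAt_chT (k + 1) x).div_const ((k : ℝ) + 1)
  have h3 : ((k : ℝ) + 3) ≠ 0 := by positivity
  have h4 : ((k : ℝ) + 1) ≠ 0 := by positivity
  have h5 := congrArg (Polynomial.eval x) (two_mul_T_eq_U_sub_U ℝ (k : ℤ))
  simp only [Polynomial.eval_mul, Polynomial.eval_sub, Polynomial.eval_ofNat] at h5
  refine (h1.sub h2).congr_deriv ?_
  rw [h5]
  push_cast
  rw [mul_div_cancel_left₀ _ h3, mul_div_cancel_left₀ _ h4,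
    show (k : ℤ) + 3 - 1 = k + 2 by ring, show (k : ℤ) + 1 - 1 = k by ring]

lemma chT_neg_one (n : ℕ) : chT n (-1) = (-1) ^ n := by
  rw [chT, T_eval_neg_one]
  simp [Int.negOnePow_def]

lemma chT_one (n : ℤ) : chT n 1 = 1 := T_eval_one _ n

lemma neg_one_mem_seg : (-1 : ℝ) ∈ seg := by simp [seg]

lemma one_mem_seg : (1 : ℝ) ∈ seg := by simp [seg]

/-- The formula `∫ 2 T_k = T_{k+1}/(k+1) - T_{k-1}/(k-1)` degenerates for `k = 0, 1`, hence three
cases. The entry `antiderCoef k` in row `0` is the constant that makes the primitive of `2 T_{k+2}`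
vanish at `-1`. -/
lemma hasDerivAt_cheb_antider_e (k : ℕ) :
    ∃ G : ℝ → ℝ, (∀ x, HasDerivAt G (wt k * chT k x) x) ∧ G (-1) = 0 ∧
      ∀ x ∈ seg, cheb (antiderL (L1.e k) : L1 𝕜) x = ((G x : ℝ) : 𝕜) := by
  have hT0 (x : ℝ) : chT 0 x = 1 := by simp [chT]
  have hT1 (x : ℝ) : chT 1 x = x := by simp [chT]
  have hT2 (x : ℝ) : chT 2 x = 2 * x ^ 2 - 1 := by simp [chT, T_two]
  rcases k with _ | _ | k
  · refine ⟨fun x => x + 1, fun x => ?_, by norm_num, fun x hx => ?_⟩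
    · simpa [hT0] using (hasDerivAt_id x).add_const 1
    · rw [antider_e_zero, cheb_add _ _ hx, cheb_smul _ _ hx, cheb_e, cheb_e]
      simp [hT0, hT1, map_ofNat]
      ring
  · refine ⟨fun x => x ^ 2 - 1, fun x => ?_, by norm_num, fun x hx => ?_⟩
    · simpa [hT1] using ((hasDerivAt_id x).pow 2).sub_const 1
    · rw [antider_e_one, cheb_sub _ _ hx, cheb_smul _ _ hx, cheb_smul _ _ hx, cheb_e, cheb_e]
      simp [hT0, hT2, wt, map_ofNat]
      ring
  · refine ⟨fun x => (chT (k + 3) x / (k + 3) - chT (k + 1) x / (k + 1)) + antiderCoef k,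
      fun x => ?_, ?_, fun x hx => ?_⟩
    · rw [wt_succ]
      exact (hasDerivAt_chT_antideriv k x).add_const (antiderCoef k)
    · have h1 := chT_neg_one (k + 3)
      have h2 := chT_neg_one (k + 1)
      push_cast at h1 h2
      have hk : (0 : ℝ) ≤ k := k.cast_nonneg
      have h3 : ((k : ℝ) + 2) ^ 2 - 1 ≠ 0 := by nlinarith
      simp only [h1, h2, antiderCoef]
      field_simp
      ring
    · rw [antider_e_add_two, cheb_sub _ _ hx, cheb_add _ _ hx, cheb_smul _ _ hx, cheb_smul _ _ hx,
        cheb_smul _ _ hx, cheb_e, cheb_e, cheb_e]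
      have h3 : (k : ℝ) + 3 ≠ 0 := by positivity
      have h4 : (k : ℝ) + 1 ≠ 0 := by positivity
      have h5 : ((k + 3 : ℕ) : ℤ) = k + 3 := by push_cast; ring
      have h6 : ((k + 1 : ℕ) : ℤ) = k + 1 := by push_cast; ring
      rw [wt_succ, wt_succ, wt_zero, h5, h6, Nat.cast_zero, hT0]
      rw [← RCLike.ofReal_mul, ← RCLike.ofReal_mul, ← RCLike.ofReal_mul, ← RCLike.ofReal_add,
        ← RCLike.ofReal_sub]
      congr 1
      field_simp
      ring

lemma continuous_IccExtend_cheb (U : L1 𝕜) : Continuous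
    (Set.IccExtend (by norm_num : (-1 : ℝ) ≤ 1) (seg.domRestrict (cheb (U : ℕ → 𝕜)))) :=
  (continuousOn_iff_continuous_domRestrict.1 (continuousOn_cheb U)).Icc_extend'

lemma intervalIntegrable_cheb (U : L1 𝕜) {x : ℝ} (hx : x ∈ seg) :
    IntervalIntegrable (cheb (U : ℕ → 𝕜)) MeasureTheory.volume (-1) x := by
  refine ((continuousOn_cheb U).mono ?_).intervalIntegrable
  rw [Set.uIcc_of_le hx.1]
  exact Set.Icc_subset_Icc_right hx.2

/-- The integral of a Chebyshev series. -/
def integralL (x : seg) : L1 𝕜 →L[𝕜] 𝕜 := LinearMap.mkContinuous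
  { toFun := fun U => ∫ t in (-1 : ℝ)..x, cheb (U : ℕ → 𝕜) t
    map_add' := fun U W => by
      rw [← intervalIntegral.integral_add (intervalIntegrable_cheb U x.2)
        (intervalIntegrable_cheb W x.2)]
      refine intervalIntegral.integral_congr fun t ht => cheb_add U W ?_
      rw [Set.uIcc_of_le x.2.1] at ht
      exact Set.Icc_subset_Icc_right x.2.2 ht
    map_smul' := fun c U => by
      rw [RingHom.id_apply, ← intervalIntegral.integral_smul]
      refine intervalIntegral.integral_congr fun t ht => cheb_smul c U ?_
      rw [Set.uIcc_of_le x.2.1] at ht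
      exact Set.Icc_subset_Icc_right x.2.2 ht } 2
  fun U => by
    have := intervalIntegral.norm_integral_le_of_norm_le_const (f := cheb (U : ℕ → 𝕜))
      (a := -1) (b := x) (C := ‖U‖) fun t ht => by
        rw [Set.uIoc_of_le x.2.1] at ht
        exact norm_cheb_le U ⟨ht.1.le, ht.2.trans x.2.2⟩
    have h1 : |(x : ℝ) - -1| ≤ 2 := by
      have h2 := x.2.1
      have h3 := x.2.2
      rw [abs_le]; constructor <;> linarith
    have h4 := norm_nonneg U
    calc _ ≤ ‖U‖ * |(x : ℝ) - -1| := this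
      _ ≤ 2 * ‖U‖ := by nlinarith

/-- Both sides are bounded linear functionals of `U`, so it suffices to compare them on the unit
sequences, where an explicit primitive is available. -/
lemma cheb_antiderL (U : L1 𝕜) {x : ℝ} (hx : x ∈ seg) :
    cheb (antiderL U : L1 𝕜) x = ∫ t in (-1 : ℝ)..x, cheb (U : ℕ → 𝕜) t := by
  have : (chebAt ⟨x, hx⟩).comp antiderL = (integralL ⟨x, hx⟩ : L1 𝕜 →L[𝕜] 𝕜) := by
    refine L1.clm_ext fun k => ?_
    obtain ⟨G, h1, h2, h3⟩ := hasDerivAt_cheb_antider_e (𝕜 := 𝕜) k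
    change cheb (antiderL (L1.e k) : L1 𝕜) x = ∫ t in (-1 : ℝ)..x, cheb (L1.e k : L1 𝕜) t
    simp only [cheb_e]
    have hi : IntervalIntegrable (fun t => wt k * chT k t) MeasureTheory.volume (-1) x :=
      (continuous_const.mul (continuous_chT k)).intervalIntegrable _ _
    have h4 := (RCLike.ofRealCLM (K := 𝕜)).intervalIntegral_comp_comm hi
    rw [intervalIntegral.integral_eq_sub_of_hasDerivAt (fun t _ => h1 t) hi, h2, sub_zero] at h4
    rw [h3 x hx]
    exact h4.symm
  exact congrArg (fun M => M U) this

lemma hasDerivWithinAt_cheb_antiderL (U : L1 𝕜) {x : ℝ} (hx : x ∈ seg) :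
    HasDerivWithinAt (cheb (antiderL U : L1 𝕜)) (cheb (U : ℕ → 𝕜) x) seg x := by
  -- The series is controlled on `[-1,1]` only. Its extension by constants is continuous on the
  -- line, which makes the fundamental theorem of calculus applicable at the endpoints as well.
  set g := Set.IccExtend (by norm_num : (-1 : ℝ) ≤ 1) (seg.domRestrict (cheb (U : ℕ → 𝕜))) with hg
  have hgc : Continuous g := continuous_IccExtend_cheb U
  have hgx : ∀ t ∈ seg, g t = cheb (U : ℕ → 𝕜) t := fun t ht => by
    rw [hg, Set.IccExtend_of_mem _ _ ht]; rfl
  have h1 := (intervalIntegral.integral_hasDerivAt_right (hgc.intervalIntegrable (-1) x)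
    hgc.stronglyMeasurable.stronglyMeasurableAtFilter hgc.continuousAt).hasDerivWithinAt (s := seg)
  rw [hgx x hx] at h1
  have h2 : ∀ y ∈ seg, cheb (antiderL U : L1 𝕜) y = ∫ t in (-1 : ℝ)..y, g t := by
    intro y hy
    rw [cheb_antiderL U hy]
    refine intervalIntegral.integral_congr fun t ht => (hgx t ?_).symm
    rw [Set.uIcc_of_le hy.1] at ht
    exact Set.Icc_subset_Icc_right hy.2 ht
  exact h1.congr h2 (h2 x hx)

lemma cheb_antiderL_neg_one (U : L1 𝕜) : cheb (antiderL U : L1 𝕜) (-1) = 0 := by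
  rw [cheb_antiderL U neg_one_mem_seg, intervalIntegral.integral_same]

lemma coe_antiderL_pow (U : L1 𝕜) (p : ℕ) :
    (((antiderL ^ p) U : L1 𝕜) : ℕ → 𝕜) = antider^[p] (U : ℕ → 𝕜) := by
  induction p with
  | zero => rfl
  | succ p ih =>
    rw [pow_succ', Function.iterate_succ_apply', mul_apply_eq_comp, coe_antiderL, ih]

end SeriesDerivatives

/-! ### Polynomials as finitely supported sequences. -/

section PolynomialPart

variable {𝕜 : Type*} [RCLike 𝕜]

/-- The sequence is supported on the indices less than `d`. -/
def SuppLt (d : ℕ) (U : L1 𝕜) : Prop := ∀ n, d ≤ n → U n = 0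

lemma SuppLt.mono {d d' : ℕ} {U : L1 𝕜} (h : SuppLt d U) (hd : d ≤ d') : SuppLt d' U :=
  fun n hn => h n (hd.trans hn)

lemma SuppLt.add {d : ℕ} {U W : L1 𝕜} (h : SuppLt d U) (h' : SuppLt d W) : SuppLt d (U + W) :=
  fun n hn => by simp [h n hn, h' n hn]

lemma SuppLt.smul {d : ℕ} {U : L1 𝕜} (h : SuppLt d U) (c : 𝕜) : SuppLt d (c • U) :=
  fun n hn => by simp [h n hn]

lemma SuppLt.sum {d : ℕ} {ι : Type*} {s : Finset ι} {f : ι → L1 𝕜} (h : ∀ i ∈ s, SuppLt d (f i)) :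
    SuppLt d (∑ i ∈ s, f i) := fun n hn => by
  rw [L1.finset_sum_apply]
  exact Finset.sum_eq_zero fun i hi => h i hi n hn

lemma suppLt_e {k d : ℕ} (h : k < d) : SuppLt d (L1.e k : L1 𝕜) :=
  fun n hn => L1.e_of_ne (by omega)

lemma SuppLt.eq_sum {d : ℕ} {U : L1 𝕜} (h : SuppLt d U) :
    U = ∑ k ∈ Finset.range d, U k • L1.e k := by
  ext n
  rw [L1.finset_sum_apply]
  simp only [L1.smul_apply, L1.e_apply, mul_ite, mul_one, mul_zero, Finset.sum_ite_eq,
    Finset.mem_range]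
  split_ifs with hn
  · rfl
  · exact h n (by omega)

lemma SuppLt.antiderL {d : ℕ} {U : L1 𝕜} (h : SuppLt d U) :
    SuppLt (d + 1) (GegenbauerStability.antiderL U) := by
  intro n hn
  obtain ⟨n, rfl⟩ : ∃ k, n = k + 1 := ⟨n - 1, by omega⟩
  rw [coe_antiderL, antider_succ, h n (by omega), h (n + 2) (by omega)]
  simp

/-- The coefficients of the Chebyshev polynomials of the second kind `U_{k-1}`. -/
def secondKind : ℕ → L1 𝕜
  | 0 => 0
  | 1 => L1.e 0
  | k + 2 => L1.e (k + 1) + secondKind k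

lemma suppLt_secondKind : ∀ k, SuppLt k (secondKind k : L1 𝕜)
  | 0 => fun _ _ => rfl
  | 1 => suppLt_e (by omega)
  | k + 2 => (suppLt_e (by omega)).add ((suppLt_secondKind k).mono (by omega))

lemma cheb_secondKind {x : ℝ} (hx : x ∈ seg) :
    ∀ k : ℕ, cheb (secondKind k : L1 𝕜) x = (((U ℝ ((k : ℤ) - 1)).eval x : ℝ) : 𝕜)
  | 0 => by simp [secondKind, cheb_zero hx]
  | 1 => by simp [secondKind, cheb_e]
  | k + 2 => by
    rw [secondKind, cheb_add _ _ hx, cheb_secondKind hx k, cheb_e, wt_succ]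
    have h5 := congrArg (Polynomial.eval x) (U_eq_two_mul_T_add_U ℝ ((k : ℤ) - 1))
    simp only [Polynomial.eval_mul, Polynomial.eval_add, Polynomial.eval_ofNat] at h5
    rw [show (((k + 2 : ℕ) : ℤ) - 1) = (k : ℤ) - 1 + 2 by push_cast; ring, h5,
      show (((k + 1 : ℕ) : ℤ)) = (k : ℤ) - 1 + 2 by push_cast; ring]
    push_cast
    rfl

/-- The derivative of the partial sums of length `d` of Chebyshev series, on coefficients. -/
def derL (d : ℕ) : L1 𝕜 →L[𝕜] L1 𝕜 :=
  ∑ k ∈ Finset.range d, (L1.coord k).smulRight ((2 * k : 𝕜) • secondKind k)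

lemma derL_apply (d : ℕ) (U : L1 𝕜) :
    derL d U = ∑ k ∈ Finset.range d, U k • ((2 * k : 𝕜) • (secondKind k : L1 𝕜)) := by
  simp [derL]

lemma suppLt_derL {d d' : ℕ} {U : L1 𝕜} (h : SuppLt d' U) : SuppLt (d' - 1) (derL d U) := by
  rw [derL_apply]
  refine SuppLt.sum fun k _ => ?_
  by_cases hk : d' ≤ k
  · rw [h k hk, zero_smul]
    exact fun _ _ => rfl
  · exact (((suppLt_secondKind k).smul _).smul _).mono (by omega)

/-- Each differentiation lowers the degree by one, because `T_k' = k U_{k-1}`. The truncated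
subtraction is meaningful: for `j ≥ d` the support is empty, which is how low degree polynomials are
annihilated later. -/
lemma suppLt_derL_pow {d : ℕ} {Q : L1 𝕜} (h : SuppLt d Q) (j : ℕ) :
    SuppLt (d - j) ((derL d ^ j) Q) := by
  induction j with
  | zero => exact h
  | succ j ih =>
    rw [pow_succ', mul_apply_eq_comp]
    exact (suppLt_derL ih).mono (by omega)

lemma hasDerivWithinAt_cheb_derL {d : ℕ} {Q : L1 𝕜} (h : SuppLt d Q) {x : ℝ} (hx : x ∈ seg) :
    HasDerivWithinAt (cheb (Q : ℕ → 𝕜)) (cheb (derL d Q : L1 𝕜) x) seg x := by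
  have h1 : ∀ y ∈ seg, cheb (Q : ℕ → 𝕜) y
      = ∑ k ∈ Finset.range d, (wt k * chT k y) • Q k := by
    intro y hy
    conv_lhs => rw [h.eq_sum]
    rw [cheb_sum _ _ hy]
    simp only [cheb_smul _ _ hy, cheb_e, RCLike.real_smul_eq_coe_mul, mul_comm]
  have h2 : cheb (derL d Q : L1 𝕜) x = ∑ k ∈ Finset.range d,
      (wt k * (((k : ℤ) : ℝ) * (U ℝ ((k : ℤ) - 1)).eval x)) • Q k := by
    rw [derL_apply, cheb_sum _ _ hx]
    refine Finset.sum_congr rfl fun k _ => ?_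
    rw [cheb_smul _ _ hx, cheb_smul _ _ hx, cheb_secondKind hx, RCLike.real_smul_eq_coe_mul]
    rcases k with _ | k
    · simp
    · rw [wt_succ]
      simp only [RCLike.ofReal_mul, RCLike.ofReal_ofNat, Int.cast_natCast, RCLike.ofReal_natCast]
      ring
  rw [h2]
  refine HasDerivWithinAt.congr ?_ h1 (h1 x hx)
  refine HasDerivWithinAt.fun_sum fun k _ => ?_
  exact (((hasDerivAt_chT k x).const_mul (wt k)).hasDerivWithinAt (s := seg)).smul_const (Q k)

/-- The derivatives of `S^p U - Q`, for `Q` a polynomial of degree less than `d`. -/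
lemma dx_cheb_antiderL_pow_sub (U Q : L1 𝕜) (p : ℕ) {d : ℕ} (hQ : SuppLt d Q) :
    ContDiffOn ℝ p (cheb ((antiderL ^ p) U - Q : L1 𝕜)) seg ∧ ∀ j ≤ p, ∀ x ∈ seg,
      dx j (cheb ((antiderL ^ p) U - Q : L1 𝕜)) x
        = cheb ((antiderL ^ (p - j)) U - (derL d ^ j) Q : L1 𝕜) x := by
  refine dx_of_chain p (fun j => cheb ((antiderL ^ (p - j)) U - (derL d ^ j) Q : L1 𝕜)) ?_
    (continuousOn_cheb _)
  intro j hj x hx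
  have h1 := hasDerivWithinAt_cheb_antiderL ((antiderL ^ (p - (j + 1))) U) hx
  have h2 := hasDerivWithinAt_cheb_derL ((suppLt_derL_pow hQ j).mono (Nat.sub_le d j)) hx
  rw [← mul_apply_eq_comp, ← pow_succ', show p - (j + 1) + 1 = p - j by omega] at h1
  rw [← mul_apply_eq_comp, ← pow_succ'] at h2
  have h3 := h1.sub h2
  rw [← cheb_sub _ _ hx] at h3
  exact h3.congr (fun y hy => cheb_sub _ _ hy) (cheb_sub _ _ hx)

lemma dx_cheb_of_suppLt {Q : L1 𝕜} {d : ℕ} (hQ : SuppLt d Q) (j : ℕ) {x : ℝ} (hx : x ∈ seg) :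
    dx j (cheb (Q : ℕ → 𝕜)) x = cheb ((derL d ^ j) Q : L1 𝕜) x := by
  refine (dx_of_chain j (fun j => cheb ((derL d ^ j) Q : L1 𝕜)) ?_ (continuousOn_cheb _)).2
    j le_rfl x hx
  intro i _ y hy
  have h2 := hasDerivWithinAt_cheb_derL ((suppLt_derL_pow hQ i).mono (Nat.sub_le d i)) hy
  rwa [← mul_apply_eq_comp, ← pow_succ'] at h2

/-- A function whose `p`-th derivative is a Chebyshev series is itself one. -/
lemma exists_cheb_of_dx {p : ℕ} : ∀ {v : ℝ → 𝕜} (_ : ContDiffOn ℝ p v seg) {U : L1 𝕜}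
    (_ : ∀ x ∈ seg, dx p v x = cheb (U : ℕ → 𝕜) x),
    ∃ Q : L1 𝕜, SuppLt p Q ∧ ∀ x ∈ seg, v x = cheb ((antiderL ^ p) U - Q : L1 𝕜) x := by
  induction p with
  | zero =>
    intro v _ U hU
    exact ⟨0, fun _ _ => rfl, fun x hx => by simpa [dx] using hU x hx⟩
  | succ p ih =>
    intro v hv U hU
    have hv1 : ∀ x ∈ seg, HasDerivWithinAt v (dx 1 v x) seg x := fun x hx => by
      have := hasDerivWithinAt_dx hv (Nat.succ_pos p) hx
      have h0 : dx 0 v = v := by funext y; simp [dx]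
      rwa [h0] at this
    have hd : Set.EqOn (dx 1 v) (derivWithin v seg) seg := fun x _ => by
      rw [dx, iteratedDerivWithin_one]
    have hc : ContDiffOn ℝ p (dx 1 v) seg := by
      rw [Nat.cast_add, Nat.cast_one, contDiffOn_succ_iff_derivWithin uniqueDiffOn_seg] at hv
      exact hv.2.2.congr hd
    have hU' : ∀ x ∈ seg, dx p (dx 1 v) x = cheb (U : ℕ → 𝕜) x := fun x hx => by
      rw [← hU x hx, dx_congr hd p hx, dx, dx, iteratedDerivWithin_succ']
    obtain ⟨Q, hQ, h⟩ := ih hc hU'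
    -- Integrate the representation of `v'` from `-1`; the constant of integration is `v (-1)`, and
    -- `Q` enters with a minus sign.
    refine ⟨antiderL Q - v (-1) • L1.e 0, ?_, ?_⟩
    · rw [sub_eq_add_neg, ← neg_smul]
      exact hQ.antiderL.add ((suppLt_e (Nat.succ_pos p)).smul _)
    · have h3 : (antiderL ^ (p + 1)) U - (antiderL Q - v (-1) • L1.e 0)
          = antiderL ((antiderL ^ p) U - Q) + v (-1) • (L1.e 0 : L1 𝕜) := by
        rw [map_sub, pow_succ', mul_apply_eq_comp]
        abel
      have h4 : ∀ x ∈ seg, cheb ((antiderL ^ (p + 1)) U - (antiderL Q - v (-1) • L1.e 0) : L1 𝕜) x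
          = cheb (antiderL ((antiderL ^ p) U - Q) : L1 𝕜) x + v (-1) := by
        intro x hx
        rw [h3, cheb_add _ _ hx, cheb_smul _ _ hx, cheb_e]
        simp
      refine eq_of_hasDerivWithinAt hv1 (fun x hx => ?_) ?_
      · rw [h x hx]
        exact ((hasDerivWithinAt_cheb_antiderL _ hx).add_const (v (-1))).congr h4 (h4 x hx)
      · rw [h4 _ neg_one_mem_seg, cheb_antiderL_neg_one, zero_add]

end PolynomialPart

end GegenbauerStability

end

open scoped ENNReal NNReal

noncomputable section

namespace GegenbauerStability

open Polynomial.Chebyshev MeasureTheory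

/-! ### Chebyshev coefficients: uniqueness, Bessel's inequality and decay. -/

section Coefficients

variable {𝕜 : Type*} [RCLike 𝕜]

lemma cos_mem_seg (θ : ℝ) : Real.cos θ ∈ seg := ⟨Real.neg_one_le_cos θ, Real.cos_le_one θ⟩

lemma chT_cos (n : ℕ) (θ : ℝ) : chT n (Real.cos θ) = Real.cos (n * θ) := by
  rw [chT, T_real_cos, Int.cast_natCast]

lemma image_cos_Ioo : Real.cos '' Set.Ioo 0 Real.pi = Set.Ioo (-1) 1 := by
  apply Set.Subset.antisymm
  · rintro _ ⟨θ, hθ, rfl⟩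
    have h := Real.strictAntiOn_cos
    constructor
    · rw [← Real.cos_pi]
      exact h (Set.Ioo_subset_Icc_self hθ) ⟨Real.pi_pos.le, le_rfl⟩ hθ.2
    · rw [← Real.cos_zero]
      exact h ⟨le_rfl, Real.pi_pos.le⟩ (Set.Ioo_subset_Icc_self hθ) hθ.1
  · intro x hx
    exact ⟨Real.arccos x, ⟨Real.arccos_pos.2 hx.2, Real.arccos_lt_pi.2 hx.1⟩,
      Real.cos_arccos hx.1.le hx.2.le⟩

/-- The substitution `x = cos θ` absorbs the singular weight `(1 - x²)^{-1/2}` into the Jacobian.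
For continuous `u`, all integrands are then continuous on `[0, π]`. -/
lemma chebInv_eq_integral_cos (u : ℝ → 𝕜) (n : ℕ) :
    chebInv u n = Real.pi⁻¹ • ∫ θ in (0 : ℝ)..Real.pi, Real.cos (n * θ) • u (Real.cos θ) := by
  rw [chebInv]
  congr 1
  rw [intervalIntegral.integral_of_le (by norm_num), intervalIntegral.integral_of_le Real.pi_pos.le,
    integral_Ioc_eq_integral_Ioo, integral_Ioc_eq_integral_Ioo, ← image_cos_Ioo,
    integral_image_eq_integral_abs_deriv_smul measurableSet_Ioo
      (fun x _ => (Real.hasDerivAt_cos x).hasDerivWithinAt)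
      (Real.injOn_cos.mono Set.Ioo_subset_Icc_self)]
  refine setIntegral_congr_fun measurableSet_Ioo fun θ hθ => ?_
  have hs : 0 < Real.sin θ := Real.sin_pos_of_mem_Ioo hθ
  have h1 : √(1 - Real.cos θ ^ 2) = Real.sin θ := by
    rw [← Real.sin_sq, Real.sqrt_sq hs.le]
  simp only [h1, abs_neg, abs_of_pos hs, T_real_cos, smul_smul, Int.cast_natCast]
  congr 1
  field_simp

lemma continuous_comp_cos {u : ℝ → 𝕜} (hu : ContinuousOn u seg) :
    Continuous fun θ => u (Real.cos θ) :=
  hu.comp_continuous Real.continuous_cos cos_mem_seg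

lemma intervalIntegrable_cos_smul {u : ℝ → 𝕜} (hu : ContinuousOn u seg) (n : ℕ) :
    IntervalIntegrable (fun θ => Real.cos (n * θ) • u (Real.cos θ)) volume 0 Real.pi := by
  exact Continuous.intervalIntegrable
    ((by fun_prop : Continuous fun θ => Real.cos (n * θ)).smul (continuous_comp_cos hu)) _ _

lemma chebInv_congr {u v : ℝ → 𝕜} (h : Set.EqOn u v seg) : chebInv u = chebInv v := by
  funext n
  simp only [chebInv_eq_integral_cos, h (cos_mem_seg _)]

lemma chebInv_add {u v : ℝ → 𝕜} (hu : ContinuousOn u seg) (hv : ContinuousOn v seg) :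
    chebInv (fun x => u x + v x) = chebInv u + chebInv v := by
  funext n
  rw [Pi.add_apply]
  simp only [chebInv_eq_integral_cos, smul_add]
  rw [intervalIntegral.integral_add (intervalIntegrable_cos_smul hu n)
    (intervalIntegrable_cos_smul hv n), smul_add]

lemma chebInv_const_mul (c : 𝕜) (u : ℝ → 𝕜) :
    chebInv (fun x => c * u x) = c • chebInv u := by
  funext n
  rw [Pi.smul_apply]
  simp only [chebInv_eq_integral_cos]
  rw [smul_eq_mul, mul_smul_comm, ← intervalIntegral.integral_const_mul]
  simp only [mul_smul_comm]

lemma norm_chebInv_le {u : ℝ → 𝕜} {C : ℝ} (h : ∀ x ∈ seg, ‖u x‖ ≤ C) (n : ℕ) :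
    ‖chebInv u n‖ ≤ C := by
  rw [chebInv_eq_integral_cos, norm_smul]
  have h1 := intervalIntegral.norm_integral_le_of_norm_le_const
    (f := fun θ => Real.cos (n * θ) • u (Real.cos θ)) (a := 0) (b := Real.pi) (C := C) (by
      intro θ _
      rw [norm_smul]
      have h2 := Real.abs_cos_le_one (n * θ)
      have h3 := h _ (cos_mem_seg θ)
      have h4 := norm_nonneg (u (Real.cos θ))
      rw [Real.norm_eq_abs]
      nlinarith [abs_nonneg (Real.cos (n * θ))])
  rw [sub_zero, abs_of_pos Real.pi_pos] at h1
  rw [norm_inv, Real.norm_of_nonneg Real.pi_pos.le, inv_mul_le_iff₀ Real.pi_pos]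
  linarith

lemma integral_cos_mul_cos (n k : ℕ) :
    ∫ θ in (0 : ℝ)..Real.pi, Real.cos (n * θ) * (wt k * Real.cos (k * θ))
      = if n = k then Real.pi else 0 := by
  have h1 : ∫ θ in (0 : ℝ)..Real.pi, Real.cos (n * θ) * Real.cos (k * θ)
      = ∫ x, (T ℝ n).eval x * (T ℝ k).eval x ∂measureT := by
    rw [integral_measureT_eq_integral_cos]
    simp [T_real_cos]
  have h2 : ∫ θ in (0 : ℝ)..Real.pi, Real.cos (n * θ) * (wt k * Real.cos (k * θ))
      = wt k * ∫ θ in (0 : ℝ)..Real.pi, Real.cos (n * θ) * Real.cos (k * θ) := by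
    rw [← intervalIntegral.integral_const_mul]
    congr 1; funext θ; ring
  rw [h2, h1]
  split_ifs with h
  · subst h
    rcases n with _ | n
    · rw [wt_zero, one_mul]
      exact integral_eval_T_real_mul_self_measureT_zero
    · rw [integral_T_real_mul_self_measureT_of_ne_zero (Nat.succ_ne_zero n), wt_succ]
      ring
  · rw [integral_eval_T_real_mul_eval_T_real_measureT_of_ne h, mul_zero]

/-- The coefficients of a Chebyshev series. -/
lemma chebInv_cheb (U : L1 𝕜) : chebInv (cheb (U : ℕ → 𝕜)) = U := by
  funext n
  let M : L1 𝕜 →L[𝕜] 𝕜 := LinearMap.mkContinuous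
    { toFun := fun U => chebInv (cheb (U : ℕ → 𝕜)) n
      map_add' := fun U W => by
        rw [chebInv_congr (fun x hx => cheb_add U W hx),
          chebInv_add (continuousOn_cheb U) (continuousOn_cheb W), Pi.add_apply]
      map_smul' := fun c U => by
        rw [chebInv_congr (fun x hx => cheb_smul c U hx), chebInv_const_mul]; rfl } 1
    fun U => (norm_chebInv_le (fun x hx => norm_cheb_le U hx) n).trans_eq (one_mul _).symm
  have : M = L1.coord n := by
    refine L1.clm_ext fun k => ?_
    change chebInv (cheb (L1.e k : L1 𝕜)) n = (L1.e k : L1 𝕜) n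
    rw [chebInv_eq_integral_cos, L1.e_apply]
    have hi : IntervalIntegrable (fun θ => Real.cos (n * θ) * (wt k * Real.cos (k * θ)))
        volume 0 Real.pi := Continuous.intervalIntegrable (by fun_prop) _ _
    have h4 := (RCLike.ofRealCLM (K := 𝕜)).intervalIntegral_comp_comm hi
    rw [integral_cos_mul_cos] at h4
    have h5 : ∀ θ, Real.cos (n * θ) • cheb (L1.e k : L1 𝕜) (Real.cos θ)
        = RCLike.ofRealCLM (K := 𝕜) (Real.cos (n * θ) * (wt k * Real.cos (k * θ))) := by
      intro θ
      rw [cheb_e, chT_cos, RCLike.real_smul_eq_coe_mul]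
      simp
    simp only [h5]
    rw [h4]
    split_ifs with h
    · rw [RCLike.ofRealCLM_apply, RCLike.real_smul_eq_coe_mul, ← RCLike.ofReal_mul,
        inv_mul_cancel₀ Real.pi_ne_zero, RCLike.ofReal_one]
    · simp
  exact congrArg (fun M => M U) this

/-- Chebyshev series determine their coefficients. -/
lemma cheb_injective {U W : L1 𝕜} (h : Set.EqOn (cheb (U : ℕ → 𝕜)) (cheb (W : ℕ → 𝕜)) seg) :
    U = W := by
  have := chebInv_congr h
  rw [chebInv_cheb, chebInv_cheb] at this
  exact Subtype.ext this

lemma chebInv_re {u : ℝ → 𝕜} (hu : ContinuousOn u seg) (n : ℕ) :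
    chebInv (fun x => RCLike.re (u x)) n = RCLike.re (chebInv u n) := by
  rw [chebInv_eq_integral_cos, chebInv_eq_integral_cos]
  have := (RCLike.reCLM (K := 𝕜)).intervalIntegral_comp_comm (intervalIntegrable_cos_smul hu n)
  simp only [map_smul, RCLike.reCLM_apply] at this
  rw [this, RCLike.smul_re]
  rfl

lemma chebInv_im {u : ℝ → 𝕜} (hu : ContinuousOn u seg) (n : ℕ) :
    chebInv (fun x => RCLike.im (u x)) n = RCLike.im (chebInv u n) := by
  rw [chebInv_eq_integral_cos, chebInv_eq_integral_cos]
  have := (RCLike.imCLM (K := 𝕜)).intervalIntegral_comp_comm (intervalIntegrable_cos_smul hu n)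
  simp only [map_smul, RCLike.imCLM_apply] at this
  rw [this, RCLike.smul_im]
  rfl

/-- The truncated Chebyshev series. -/
lemma integral_mul_cheb_of_suppLt {u : ℝ → ℝ} (hu : ContinuousOn u seg) {Q : L1 ℝ} {d : ℕ}
    (hQ : SuppLt d Q) : ∫ θ in (0 : ℝ)..Real.pi, cheb (Q : ℕ → ℝ) (Real.cos θ) * u (Real.cos θ)
      = Real.pi * ∑ k ∈ Finset.range d, wt k * Q k * chebInv u k := by
  have h1 : ∀ θ, cheb (Q : ℕ → ℝ) (Real.cos θ) * u (Real.cos θ) = ∑ k ∈ Finset.range d,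
      (wt k * Q k) * (Real.cos (k * θ) • u (Real.cos θ)) := by
    intro θ
    conv_lhs => rw [hQ.eq_sum]
    rw [cheb_sum _ _ (cos_mem_seg θ), Finset.sum_mul]
    refine Finset.sum_congr rfl fun k _ => ?_
    rw [cheb_smul _ _ (cos_mem_seg θ), cheb_e, chT_cos, smul_eq_mul]
    simp
    ring
  simp only [h1]
  rw [intervalIntegral.integral_finsetSum fun k _ =>
    (intervalIntegrable_cos_smul hu k).const_mul _, Finset.mul_sum]
  refine Finset.sum_congr rfl fun k _ => ?_
  rw [intervalIntegral.integral_const_mul, chebInv_eq_integral_cos, smul_eq_mul]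
  have := Real.pi_ne_zero
  field_simp

/-- The derivative of order `natDegree + 1` vanishes, so `exists_cheb_of_dx` applies with `U = 0`
and only its polynomial part is left. -/
lemma exists_cheb_eq_polynomial (p : Polynomial ℝ) :
    ∃ d, ∃ Q : L1 ℝ, SuppLt d Q ∧ ∀ x ∈ seg, p.eval x = cheb (Q : ℕ → ℝ) x := by
  obtain ⟨h1, h2⟩ := dx_of_chain (p.natDegree + 1)
    (fun j x => (Polynomial.derivative^[j] p).eval x) (fun j _ x _ => by
      rw [Function.iterate_succ_apply']
      exact ((Polynomial.derivative^[j] p).hasDerivAt x).hasDerivWithinAt)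
    (Polynomial.continuous _).continuousOn
  obtain ⟨Q, hQ, h⟩ := exists_cheb_of_dx h1 (U := 0) (fun x hx => by
    rw [h2 _ le_rfl x hx, Polynomial.iterate_derivative_eq_zero (Nat.lt_succ_self _), cheb_zero hx]
    simp)
  refine ⟨p.natDegree + 1, -Q, fun n hn => by simp [hQ n hn], fun x hx => ?_⟩
  have := h x hx
  simpa using this

/-- Vanishing coefficients make `u` orthogonal to all polynomials for the Chebyshev weight; by
Weierstrass approximation it is then orthogonal to itself, and a continuous nonnegative function of
integral zero vanishes. -/
lemma eqOn_zero_of_chebInv_real {u : ℝ → ℝ} (hu : ContinuousOn u seg) (h : chebInv u = 0) :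
    ∀ x ∈ seg, u x = 0 := by
  have hc := continuous_comp_cos hu
  have hp (p : Polynomial ℝ) :
      ∫ θ in (0 : ℝ)..Real.pi, p.eval (Real.cos θ) * u (Real.cos θ) = 0 := by
    obtain ⟨d, Q, hQ, hQp⟩ := exists_cheb_eq_polynomial p
    simp only [hQp _ (cos_mem_seg _), integral_mul_cheb_of_suppLt hu hQ, h]
    simp
  obtain ⟨C, hC⟩ := (isCompact_Icc (a := (-1 : ℝ)) (b := 1)).exists_bound_of_continuousOn hu
  have hC0 : 0 ≤ C := (norm_nonneg _).trans (hC 1 one_mem_seg)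
  have hint : ∫ θ in (0 : ℝ)..Real.pi, u (Real.cos θ) ^ 2 = 0 := by
    apply le_antisymm
    · refine le_of_forall_pos_le_add fun ε hε => ?_
      obtain ⟨p, hp'⟩ := exists_polynomial_near_of_continuousOn (-1) 1 u hu
        (ε / (Real.pi * (C + 1))) (by positivity)
      have e1 : ∫ θ in (0 : ℝ)..Real.pi, u (Real.cos θ) ^ 2
          = ∫ θ in (0 : ℝ)..Real.pi, (u (Real.cos θ) - p.eval (Real.cos θ)) * u (Real.cos θ) := by
        have e2 : ∀ θ, (u (Real.cos θ) - p.eval (Real.cos θ)) * u (Real.cos θ)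
          = u (Real.cos θ) ^ 2 - p.eval (Real.cos θ) * u (Real.cos θ) := fun θ => by ring
        simp only [e2]
        rw [intervalIntegral.integral_sub, hp p, sub_zero]
        · exact (hc.pow 2).intervalIntegrable _ _
        · exact ((p.continuous.comp Real.continuous_cos).mul hc).intervalIntegrable _ _
      rw [e1, zero_add]
      refine (Real.le_norm_self _).trans ?_
      refine (intervalIntegral.norm_integral_le_of_norm_le_const
        (C := ε / (Real.pi * (C + 1)) * C) fun θ _ => ?_).trans ?_
      · rw [norm_mul]
        have h1 := hp' _ (cos_mem_seg θ)
        rw [abs_sub_comm] at h1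
        exact mul_le_mul h1.le (hC _ (cos_mem_seg θ)) (norm_nonneg _) (by positivity)
      · rw [sub_zero, abs_of_pos Real.pi_pos]
        have := Real.pi_pos
        rw [show ε / (Real.pi * (C + 1)) * C * Real.pi = ε * (C / (C + 1)) by field_simp]
        exact mul_le_of_le_one_right hε.le ((div_le_one (by linarith)).2 (by linarith))
    · exact intervalIntegral.integral_nonneg Real.pi_pos.le fun θ _ => sq_nonneg _
  intro x hx
  by_contra hne
  have hpos : 0 < ∫ θ in (0 : ℝ)..Real.pi, u (Real.cos θ) ^ 2 := by
    refine intervalIntegral.integral_pos Real.pi_pos (hc.pow 2).continuousOn (fun θ _ => sq_nonneg _)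
      ⟨Real.arccos x, ⟨Real.arccos_nonneg x, Real.arccos_le_pi x⟩, ?_⟩
    rw [Real.cos_arccos hx.1 hx.2]
    positivity
  exact hpos.ne' hint

/-- A continuous function is determined by its Chebyshev coefficients. -/
lemma eqOn_of_chebInv_eq {u v : ℝ → 𝕜} (hu : ContinuousOn u seg) (hv : ContinuousOn v seg)
    (h : chebInv u = chebInv v) : Set.EqOn u v seg := by
  have h1 := eqOn_zero_of_chebInv_real (u := fun x => RCLike.re (u x) - RCLike.re (v x))
    ((RCLike.continuous_re.comp_continuousOn hu).sub (RCLike.continuous_re.comp_continuousOn hv)) (by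
      have e := chebInv_add (u := fun x => RCLike.re (u x)) (v := fun x => -1 * RCLike.re (v x))
        (RCLike.continuous_re.comp_continuousOn hu)
        (continuousOn_const.mul (RCLike.continuous_re.comp_continuousOn hv))
      simp only [neg_one_mul, ← sub_eq_add_neg] at e
      rw [e]
      have e2 := chebInv_const_mul (-1 : ℝ) (fun x => RCLike.re (v x))
      simp only [neg_one_mul] at e2
      funext n
      rw [e2, Pi.add_apply, Pi.smul_apply, chebInv_re hu, chebInv_re hv, h]
      simp)
  have h2 := eqOn_zero_of_chebInv_real (u := fun x => RCLike.im (u x) - RCLike.im (v x))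
    ((RCLike.continuous_im.comp_continuousOn hu).sub (RCLike.continuous_im.comp_continuousOn hv)) (by
      have e := chebInv_add (u := fun x => RCLike.im (u x)) (v := fun x => -1 * RCLike.im (v x))
        (RCLike.continuous_im.comp_continuousOn hu)
        (continuousOn_const.mul (RCLike.continuous_im.comp_continuousOn hv))
      simp only [neg_one_mul, ← sub_eq_add_neg] at e
      rw [e]
      have e2 := chebInv_const_mul (-1 : ℝ) (fun x => RCLike.im (v x))
      simp only [neg_one_mul] at e2
      funext n
      rw [e2, Pi.add_apply, Pi.smul_apply, chebInv_im hu, chebInv_im hv, h]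
      simp)
  intro x hx
  exact RCLike.ext (sub_eq_zero.1 (h1 x hx)) (sub_eq_zero.1 (h2 x hx))

/-- Bessel's inequality for Chebyshev coefficients. -/
lemma summable_chebInv_sq {u : ℝ → ℝ} (hu : ContinuousOn u seg) :
    Summable fun n => chebInv u n ^ 2 := by
  have hc := continuous_comp_cos hu
  refine summable_of_sum_range_le (c := Real.pi⁻¹ * ∫ θ in (0 : ℝ)..Real.pi, u (Real.cos θ) ^ 2)
    (fun _ => sq_nonneg _) fun d => ?_
  set Q : L1 ℝ := ∑ k ∈ Finset.range d, chebInv u k • L1.e k with hQdef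
  have hQ : SuppLt d Q := SuppLt.sum fun k hk => (suppLt_e (Finset.mem_range.1 hk)).smul _
  have hQk : ∀ k ∈ Finset.range d, Q k = chebInv u k := by
    intro k hk
    rw [hQdef, L1.finset_sum_apply]
    simp only [L1.smul_apply, L1.e_apply, mul_ite, mul_one, mul_zero, Finset.sum_ite_eq, if_pos hk]
  have hcQ := continuous_comp_cos (continuousOn_cheb Q)
  have e1 := integral_mul_cheb_of_suppLt hu hQ
  have e2 := integral_mul_cheb_of_suppLt (continuousOn_cheb Q) hQ
  rw [chebInv_cheb] at e2
  have e3 : ∑ k ∈ Finset.range d, wt k * Q k * chebInv u k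
      = ∑ k ∈ Finset.range d, wt k * Q k * Q k :=
    Finset.sum_congr rfl fun k hk => by rw [hQk k hk]
  rw [e3, ← e2] at e1
  -- Bessel: expand the squared distance from `u` to its partial sum `Q`; the cross term and the
  -- square of `Q` coincide up to the factor `2`.
  have e4 : 0 ≤ ∫ θ in (0 : ℝ)..Real.pi, (u (Real.cos θ) - cheb (Q : ℕ → ℝ) (Real.cos θ)) ^ 2 :=
    intervalIntegral.integral_nonneg Real.pi_pos.le fun θ _ => sq_nonneg _
  have e5 : ∀ θ, (u (Real.cos θ) - cheb (Q : ℕ → ℝ) (Real.cos θ)) ^ 2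
      = u (Real.cos θ) ^ 2 - 2 * (cheb (Q : ℕ → ℝ) (Real.cos θ) * u (Real.cos θ))
        + cheb (Q : ℕ → ℝ) (Real.cos θ) * cheb (Q : ℕ → ℝ) (Real.cos θ) := fun θ => by ring
  simp only [e5] at e4
  have hc1 : Continuous fun θ =>
    2 * (cheb (Q : ℕ → ℝ) (Real.cos θ) * u (Real.cos θ)) := continuous_const.mul (hcQ.mul hc)
  have hc2 : Continuous fun θ => u (Real.cos θ) ^ 2 := hc.pow 2
  have hc3 : Continuous fun θ => cheb (Q : ℕ → ℝ) (Real.cos θ) * cheb (Q : ℕ → ℝ) (Real.cos θ) :=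
    hcQ.mul hcQ
  have hc4 : Continuous fun θ => u (Real.cos θ) ^ 2
    - 2 * (cheb (Q : ℕ → ℝ) (Real.cos θ) * u (Real.cos θ)) := hc2.sub hc1
  rw [intervalIntegral.integral_add (hc4.intervalIntegrable _ _) (hc3.intervalIntegrable _ _),
    intervalIntegral.integral_sub (hc2.intervalIntegrable _ _)
    (hc1.intervalIntegrable _ _), intervalIntegral.integral_const_mul, e1,
    e2] at e4
  have e6 : ∑ k ∈ Finset.range d, chebInv u k ^ 2 ≤ ∑ k ∈ Finset.range d, wt k * Q k * Q k := by
    refine Finset.sum_le_sum fun k hk => ?_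
    rw [hQk k hk]
    nlinarith [one_le_wt k, sq_nonneg (chebInv u k)]
  rw [inv_mul_eq_div, le_div_iff₀ Real.pi_pos]
  nlinarith [Real.pi_pos]

/-- Integrate by parts in `θ`: the boundary terms vanish with `sin ((n+1)θ)`, and the product of the
two sines is half the difference of `cos (nθ)` and `cos ((n+2)θ)`. -/
lemma chebInv_succ_of_contDiffOn {u : ℝ → 𝕜} (hu : ContDiffOn ℝ 1 u seg) (n : ℕ) :
    chebInv u (n + 1) = (1 / (2 * ((n : ℝ) + 1))) •
      (chebInv (dx 1 u) n - chebInv (dx 1 u) (n + 2)) := by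
  have hu1 : ContDiffOn ℝ (1 : ℕ) u seg := by exact_mod_cast hu
  have hd : ∀ θ, HasDerivAt (fun θ => u (Real.cos θ)) (-Real.sin θ • dx 1 u (Real.cos θ)) θ := by
    intro θ
    have h1 := hasDerivWithinAt_dx hu1 one_pos (cos_mem_seg θ)
    have h0 : dx 0 u = u := by funext y; simp [dx]
    rw [h0] at h1
    have h2 := h1.scomp θ (Real.hasDerivAt_cos θ).hasDerivWithinAt
      (fun t _ => cos_mem_seg t : Set.MapsTo Real.cos Set.univ seg)
    exact hasDerivWithinAt_univ.1 h2
  have hn : ((n : ℝ) + 1) ≠ 0 := by positivity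
  have hs : ∀ θ, HasDerivAt (fun θ => Real.sin (((n : ℝ) + 1) * θ) / ((n : ℝ) + 1))
      (Real.cos (((n : ℝ) + 1) * θ)) θ := by
    intro θ
    have h1 := ((Real.hasDerivAt_sin (((n : ℝ) + 1) * θ)).comp θ
      ((hasDerivAt_id θ).const_mul ((n : ℝ) + 1))).div_const ((n : ℝ) + 1)
    refine h1.congr_deriv ?_
    field_simp
  have hcd := continuous_comp_cos (continuousOn_dx hu1 le_rfl)
  have hc1 : Continuous fun θ => Real.cos (((n : ℝ) + 1) * θ) := by fun_prop
  have hc2 : Continuous fun θ => -Real.sin θ := by fun_prop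
  have hparts := intervalIntegral.integral_smul_deriv_eq_deriv_smul (a := 0) (b := Real.pi)
    (fun θ _ => hs θ) (fun θ _ => hd θ) (hc1.intervalIntegrable _ _)
    ((hc2.smul hcd).intervalIntegrable _ _)
  have hsin : Real.sin (((n : ℝ) + 1) * Real.pi) = 0 := by
    exact_mod_cast Real.sin_nat_mul_pi (n + 1)
  simp only [hsin, mul_zero, Real.sin_zero, zero_div, zero_smul, sub_self, zero_sub] at hparts
  have e1 := neg_eq_iff_eq_neg.2 hparts
  have e2 : ∀ θ, -((Real.sin (((n : ℝ) + 1) * θ) / ((n : ℝ) + 1)) •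
      (-Real.sin θ • dx 1 u (Real.cos θ))) = (1 / (2 * ((n : ℝ) + 1))) •
      (Real.cos (n * θ) • dx 1 u (Real.cos θ)
        - Real.cos ((n + 2 : ℕ) * θ) • dx 1 u (Real.cos θ)) := by
    intro θ
    rw [← sub_smul, smul_smul, smul_smul, ← neg_smul]
    congr 1
    have h1 : Real.cos (n * θ) = Real.cos (((n : ℝ) + 1) * θ - θ) := by congr 1; ring
    have h2 : Real.cos ((n + 2 : ℕ) * θ) = Real.cos (((n : ℝ) + 1) * θ + θ) := by
      congr 1; push_cast; ring
    rw [h1, h2, Real.cos_sub, Real.cos_add]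
    field_simp
    ring
  have hi := intervalIntegrable_cos_smul (continuousOn_dx hu1 le_rfl)
  rw [chebInv_eq_integral_cos, chebInv_eq_integral_cos, chebInv_eq_integral_cos, ← smul_sub,
    ← intervalIntegral.integral_sub (hi n) (hi (n + 2)), smul_comm _ Real.pi⁻¹]
  congr 1
  have e3 : ∫ θ in (0 : ℝ)..Real.pi, Real.cos ((n + 1 : ℕ) * θ) • u (Real.cos θ)
      = ∫ θ in (0 : ℝ)..Real.pi, -((Real.sin (((n : ℝ) + 1) * θ) / ((n : ℝ) + 1)) •
      (-Real.sin θ • dx 1 u (Real.cos θ))) := by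
    rw [intervalIntegral.integral_neg]
    push_cast
    exact e1.symm
  rw [e3, ← intervalIntegral.integral_smul]
  exact intervalIntegral.integral_congr fun θ _ => e2 θ

/-- The previous formula gains a factor `1/(n+1)` over the coefficients of the derivative. These are
square summable by Bessel, and products of square summable sequences are summable (here through
`t|a| ≤ (t² + a²)/2`). -/
lemma summable_chebInv_real {u : ℝ → ℝ} (hu : ContDiffOn ℝ 1 u seg) :
    Summable fun n => |chebInv u n| := by
  have hu1 : ContDiffOn ℝ (1 : ℕ) u seg := by exact_mod_cast hu
  have hs := summable_chebInv_sq (continuousOn_dx hu1 le_rfl)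
  have h2 : Summable fun n : ℕ => 1 / ((n : ℝ) + 1) ^ 2 := by
    simpa using (summable_nat_add_iff 1).2 (Real.summable_one_div_nat_pow.2 (one_lt_two))
  refine (summable_nat_add_iff 1).1 (Summable.of_nonneg_of_le (fun _ => abs_nonneg _) (fun n => ?_)
    ((hs.add ((summable_nat_add_iff 2).2 hs)).add h2))
  rw [chebInv_succ_of_contDiffOn hu, smul_eq_mul, abs_mul]
  set a := chebInv (dx 1 u) n
  set b := chebInv (dx 1 u) (n + 2)
  have hab := abs_sub a b
  have hn : (0 : ℝ) < (n : ℝ) + 1 := by positivity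
  set t := 1 / ((n : ℝ) + 1) with ht
  have htp : 0 < t := by positivity
  have h3 : |1 / (2 * ((n : ℝ) + 1))| = t / 2 := by
    rw [abs_of_pos (by positivity), ht]; field_simp
  have h4 : 1 / ((n : ℝ) + 1) ^ 2 = t ^ 2 := by rw [ht]; field_simp
  rw [h3, h4]
  nlinarith [sq_nonneg (t - |a|), sq_nonneg (t - |b|), sq_abs a, sq_abs b, abs_nonneg a,
    abs_nonneg b]

/-- Functions of class `C¹` are sums of absolutely convergent Chebyshev series. -/
lemma exists_cheb_of_contDiffOn {u : ℝ → 𝕜} (hu : ContDiffOn ℝ 1 u seg) :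
    ∃ U : L1 𝕜, ∀ x ∈ seg, u x = cheb (U : ℕ → 𝕜) x := by
  have h1 : Summable fun n => |chebInv (fun x => RCLike.re (u x)) n| :=
    summable_chebInv_real ((RCLike.reCLM (K := 𝕜)).contDiff.comp_contDiffOn hu)
  have h2 : Summable fun n => |chebInv (fun x => RCLike.im (u x)) n| :=
    summable_chebInv_real ((RCLike.imCLM (K := 𝕜)).contDiff.comp_contDiffOn hu)
  simp only [chebInv_re hu.continuousOn] at h1
  simp only [chebInv_im hu.continuousOn] at h2
  have hs : Summable fun n => ‖chebInv u n‖ :=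
    (h1.add h2).of_nonneg_of_le (fun _ => norm_nonneg _) fun n => by
      have norm_I_le : ‖(RCLike.I : 𝕜)‖ ≤ 1 := by
        rcases eq_or_ne (RCLike.I : 𝕜) 0 with h | h
        · rw [h, norm_zero]; exact zero_le_one
        · exact (RCLike.norm_I_of_ne_zero h).le
      have h3 := norm_add_le ((RCLike.re (chebInv u n) : ℝ) : 𝕜)
        ((RCLike.im (chebInv u n) : 𝕜) * RCLike.I)
      rw [RCLike.re_add_im, norm_mul, RCLike.norm_ofReal, RCLike.norm_ofReal] at h3
      exact h3.trans (by gcongr; exact mul_le_of_le_one_right (abs_nonneg _) norm_I_le)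
  refine ⟨L1.mk _ hs, fun x hx => ?_⟩
  exact eqOn_of_chebInv_eq hu.continuousOn (continuousOn_cheb _) (by rw [chebInv_cheb]; rfl) hx

end Coefficients

end GegenbauerStability

end

open scoped ENNReal NNReal

noncomputable section

namespace GegenbauerStability

open Polynomial.Chebyshev

/-! ### Convolution of coefficients and products of functions. -/

section Convolution

variable {𝕜 : Type*} [RCLike 𝕜]

/-- The weight `wt n` counts the integers of absolute value `n`. Thus `ℓ¹₁` is the space of even
summable sequences on `ℤ` with its plain `ℓ¹` norm, and the convolution estimates are the classical
ones on `ℤ`. -/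
lemma hasSum_int_natAbs {F : Type*} [NormedAddCommGroup F] [NormedSpace ℝ F] [CompleteSpace F]
    {g : ℕ → F} (hg : Summable fun n => ‖g n‖) :
    HasSum (fun k : ℤ => g k.natAbs) (∑' n, wt n • g n) := by
  have hs : Summable g := hg.of_norm
  have hs1 : Summable fun n => g (n + 1) := (summable_nat_add_iff 1).2 hs
  have hw : Summable fun n => wt n • g n := by
    refine Summable.of_norm ?_
    simp only [norm_smul, Real.norm_of_nonneg (wt_pos _).le]
    exact (summable_wt_mul_iff fun _ => norm_nonneg _).2 hg
  have h := HasSum.of_nat_of_neg_add_one (f := fun k : ℤ => g k.natAbs) (m := ∑' n, g n)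
    (m' := ∑' n, g (n + 1)) (by simpa using hs.hasSum) (by
      have h1 : ∀ n : ℕ, (-((n : ℤ) + 1)).natAbs = n + 1 := fun n => by omega
      simpa only [h1] using hs1.hasSum)
  convert h using 1
  rw [hw.tsum_eq_zero_add, hs.tsum_eq_zero_add]
  simp only [wt_zero, wt_succ, one_smul]
  rw [tsum_const_smul'', two_smul, add_assoc]

lemma tsum_int_natAbs {g : ℕ → ℝ} (hg : Summable g) (h0 : ∀ n, 0 ≤ g n) :
    ∑' k : ℤ, g k.natAbs = ∑' n, wt n * g n :=
  (hasSum_int_natAbs (by simpa only [Real.norm_of_nonneg (h0 _)] using hg)).tsum_eq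

lemma summable_int_natAbs {g : ℕ → ℝ} (hg : Summable g) (h0 : ∀ n, 0 ≤ g n) :
    Summable fun k : ℤ => g k.natAbs :=
  (hasSum_int_natAbs (by simpa only [Real.norm_of_nonneg (h0 _)] using hg)).summable

lemma summable_int_norm (U : L1 𝕜) : Summable fun k : ℤ => ‖U k.natAbs‖ :=
  summable_int_natAbs U.summable fun _ => norm_nonneg _

lemma tsum_int_norm (U : L1 𝕜) : ∑' k : ℤ, ‖U k.natAbs‖ = ‖U‖ := by
  rw [L1.norm_eq, ← tsum_int_natAbs U.summable fun _ => norm_nonneg _]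

lemma chT_natAbs (k : ℤ) (x : ℝ) : chT (k.natAbs : ℤ) x = chT k x := by
  rw [chT, T_natAbs]

lemma hasSum_int_cheb (U : L1 𝕜) {x : ℝ} (hx : x ∈ seg) :
    HasSum (fun k : ℤ => chT k x • U k.natAbs) (cheb U x) := by
  have h1 : Summable fun n : ℕ => ‖chT n x • U n‖ := by
    refine U.summable.of_nonneg_of_le (fun _ => norm_nonneg _) fun n => ?_
    rw [norm_smul]
    exact mul_le_of_le_one_left (norm_nonneg _) (abs_chT_le n hx)
  have h2 := hasSum_int_natAbs h1
  simp only [chT_natAbs, smul_smul] at h2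
  rwa [(hasSum_cheb U hx).tsum_eq] at h2

/-- The double sequence whose sums along the antidiagonals are the convolution. -/
lemma summable_conv_prod (a : L1 ℝ) (U : L1 𝕜) :
    Summable fun q : ℤ × ℤ => ‖a q.1.natAbs‖ * ‖U q.2.natAbs‖ :=
  (summable_int_norm a).mul_of_nonneg (summable_int_norm U) (fun _ => norm_nonneg _)
    fun _ => norm_nonneg _

/-- The change of indices `(n, i) ↦ (i, n - i)`. -/
def antidiagEquiv : ℤ × ℤ ≃ ℤ × ℤ where
  toFun q := (q.2, q.1 - q.2)
  invFun q := (q.1 + q.2, q.1)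
  left_inv q := by simp
  right_inv q := by simp

/-- The convolution is even in `n`, by the change of variable `k ↦ -k`; it may therefore be summed
over all integers. -/
lemma conv_natAbs (a : ℕ → ℝ) (U : ℕ → 𝕜) (n : ℤ) :
    conv a U n.natAbs = ∑' k : ℤ, a k.natAbs • U (n - k).natAbs := by
  rcases Int.natAbs_eq n with h | h
  · rw [conv, ← h]
  · rw [conv, ← (Equiv.neg ℤ).tsum_eq]
    refine tsum_congr fun k => ?_
    rw [Equiv.neg_apply, Int.natAbs_neg]
    congr 2
    omega

lemma summable_conv_antidiag (a : L1 ℝ) (U : L1 𝕜) :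
    Summable fun q : ℤ × ℤ => ‖a q.2.natAbs‖ * ‖U (q.1 - q.2).natAbs‖ :=
  (antidiagEquiv.summable_iff (f := fun q : ℤ × ℤ => ‖a q.1.natAbs‖ * ‖U q.2.natAbs‖)).2
    (summable_conv_prod a U)

lemma norm_conv_le_tsum (a : L1 ℝ) (U : L1 𝕜) (n : ℤ) :
    ‖conv a U n.natAbs‖ ≤ ∑' k : ℤ, ‖a k.natAbs‖ * ‖U (n - k).natAbs‖ := by
  rw [conv_natAbs]
  have h := (summable_conv_antidiag a U).prod_factor n
  exact tsum_of_norm_bounded h.hasSum fun k => (norm_smul _ _).le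

lemma summable_conv (a : L1 ℝ) (U : L1 𝕜) : Summable fun n => ‖conv (a : ℕ → ℝ) (U : ℕ → 𝕜) n‖ := by
  have h1 := (summable_conv_antidiag a U).prod
  have h2 : Summable fun n : ℤ => ‖conv (a : ℕ → ℝ) (U : ℕ → 𝕜) n.natAbs‖ :=
    h1.of_nonneg_of_le (fun _ => norm_nonneg _) (norm_conv_le_tsum a U)
  exact h2.comp_injective (i := fun n : ℕ => (n : ℤ)) Nat.cast_injective

/-- A bound of the part of the convolution selected by `χ`. -/
lemma tsum_wt_conv_le (a : L1 ℝ) (U : L1 𝕜) (χ : ℕ → ℝ) (h0 : ∀ n, 0 ≤ χ n) (h1 : ∀ n, χ n ≤ 1) :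
    ∑' n, wt n * (χ n * ‖conv (a : ℕ → ℝ) (U : ℕ → 𝕜) n‖)
      ≤ ∑' i : ℤ, ‖a i.natAbs‖ * ∑' j : ℤ, χ (i + j).natAbs * ‖U j.natAbs‖ := by
  have hs : Summable fun n => χ n * ‖conv (a : ℕ → ℝ) (U : ℕ → 𝕜) n‖ :=
    (summable_conv a U).of_nonneg_of_le (fun n => mul_nonneg (h0 n) (norm_nonneg _))
      fun n => mul_le_of_le_one_left (norm_nonneg _) (h1 n)
  rw [← tsum_int_natAbs hs fun n => mul_nonneg (h0 n) (norm_nonneg _)]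
  have hp : Summable fun q : ℤ × ℤ =>
      χ (q.1 + q.2).natAbs * (‖a q.1.natAbs‖ * ‖U q.2.natAbs‖) :=
    (summable_conv_prod a U).of_nonneg_of_le (fun q => mul_nonneg (h0 _) (by positivity))
      fun q => mul_le_of_le_one_left (by positivity) (h1 _)
  have hq := (antidiagEquiv.summable_iff).2 hp
  have e1 : ∑' i : ℤ, ‖a i.natAbs‖ * ∑' j : ℤ, χ (i + j).natAbs * ‖U j.natAbs‖
      = ∑' q : ℤ × ℤ, χ (q.1 + q.2).natAbs * (‖a q.1.natAbs‖ * ‖U q.2.natAbs‖) := by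
    rw [hp.tsum_prod]
    refine tsum_congr fun i => ?_
    rw [← tsum_mul_left]
    exact tsum_congr fun j => by ring
  have e3 := (antidiagEquiv.tsum_eq fun q : ℤ × ℤ =>
    χ (q.1 + q.2).natAbs * (‖a q.1.natAbs‖ * ‖U q.2.natAbs‖)).symm.trans (Summable.tsum_prod hq)
  rw [e1, e3]
  refine (summable_int_natAbs hs fun n => mul_nonneg (h0 n) (norm_nonneg _)).tsum_le_tsum
    (fun n => ?_) hq.prod
  have e2 : ∑' k : ℤ, χ ((antidiagEquiv (n, k)).1 + (antidiagEquiv (n, k)).2).natAbs *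
      (‖a (antidiagEquiv (n, k)).1.natAbs‖ * ‖U (antidiagEquiv (n, k)).2.natAbs‖)
      = χ n.natAbs * ∑' k : ℤ, ‖a k.natAbs‖ * ‖U (n - k).natAbs‖ := by
    rw [← tsum_mul_left]
    refine tsum_congr fun k => ?_
    simp [antidiagEquiv]
  rw [e2]
  exact mul_le_mul_of_nonneg_left (norm_conv_le_tsum a U n) (h0 _)

lemma tsum_wt_norm_conv_le (a : L1 ℝ) (U : L1 𝕜) :
    ∑' n, wt n * ‖conv (a : ℕ → ℝ) (U : ℕ → 𝕜) n‖ ≤ ‖a‖ * ‖U‖ := by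
  have := tsum_wt_conv_le a U (fun _ => 1) (fun _ => zero_le_one) (fun _ => le_rfl)
  simpa only [one_mul, tsum_int_norm, tsum_mul_right] using this

lemma summable_conv_apply (a : L1 ℝ) (U : L1 𝕜) (n : ℕ) :
    Summable fun k : ℤ => a k.natAbs • U ((n : ℤ) - k).natAbs :=
  Summable.of_norm (by
    simpa only [norm_smul] using (summable_conv_antidiag a U).prod_factor (n : ℤ))

/-- The convolution with a fixed sequence. -/
def convL (a : L1 ℝ) : L1 𝕜 →L[𝕜] L1 𝕜 := L1.lift (conv a) ‖a‖
  (fun U W => by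
    funext n
    simp only [conv, Pi.add_apply, smul_add]
    exact (summable_conv_apply a U n).tsum_add (summable_conv_apply a W n))
  (fun c U => by
    funext n
    simp only [conv, Pi.smul_apply, smul_comm _ c]
    exact tsum_const_smul'' c)
  (summable_conv a) (tsum_wt_norm_conv_le a)

@[simp] lemma coe_convL (a : L1 ℝ) (U : L1 𝕜) : (convL a U : ℕ → 𝕜) = conv a U := rfl

/-- The product of two Chebyshev series. -/
lemma cheb_convL (a : L1 ℝ) (U : L1 𝕜) {x : ℝ} (hx : x ∈ seg) :
    cheb (convL a U : L1 𝕜) x = cheb (a : ℕ → ℝ) x • cheb (U : ℕ → 𝕜) x := by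
  have ha := hasSum_int_cheb a hx
  have hU := hasSum_int_cheb U hx
  have hb (t : ℝ) (ht : |t| ≤ 1) (q : ℤ × ℤ) : ‖t • (a q.1.natAbs • U q.2.natAbs)‖
      ≤ ‖a q.1.natAbs‖ * ‖U q.2.natAbs‖ := by
    rw [norm_smul, norm_smul]
    exact mul_le_of_le_one_left (by positivity) ht
  have hG : Summable fun q : ℤ × ℤ => chT (q.1 + q.2) x • (a q.1.natAbs • U q.2.natAbs) :=
    Summable.of_norm_bounded (summable_conv_prod a U) fun q => hb _ (abs_chT_le _ hx) q
  have hF : Summable fun q : ℤ × ℤ => (chT q.1 x • a q.1.natAbs) • (chT q.2 x • U q.2.natAbs) := by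
    refine Summable.of_norm_bounded (summable_conv_prod a U) fun q => ?_
    rw [smul_eq_mul, norm_smul, norm_mul, norm_smul]
    have h1 := abs_chT_le q.1 hx
    have h2 := abs_chT_le q.2 hx
    exact mul_le_mul (mul_le_of_le_one_left (norm_nonneg _) h1)
      (mul_le_of_le_one_left (norm_nonneg _) h2) (by positivity) (norm_nonneg _)
  have hprod : cheb (a : ℕ → ℝ) x • cheb (U : ℕ → 𝕜) x
      = ∑' q : ℤ × ℤ, (chT q.1 x • a q.1.natAbs) • (chT q.2 x • U q.2.natAbs) := by
    rw [hF.tsum_prod]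
    simp only [tsum_const_smul'', hU.tsum_eq]
    rw [← ha.tsum_eq]
    exact (ha.summable.tsum_smul_const _).symm
  -- The linearization `2 T_a T_b = T_{a+b} + T_{a-b}` produces two double sums. Since the sequences
  -- are even, reflecting the second index shows that the sums are equal.
  have hG' : HasSum (fun q : ℤ × ℤ => chT (q.1 - q.2) x • (a q.1.natAbs • U q.2.natAbs))
      (∑' q : ℤ × ℤ, chT (q.1 + q.2) x • (a q.1.natAbs • U q.2.natAbs)) := by
    have h := (((Equiv.refl ℤ).prodCongr (Equiv.neg ℤ)).hasSum_iff).2 hG.hasSum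
    have h2 : (fun q : ℤ × ℤ => chT (q.1 - q.2) x • (a q.1.natAbs • U q.2.natAbs))
        = (fun q : ℤ × ℤ => chT (q.1 + q.2) x • (a q.1.natAbs • U q.2.natAbs))
          ∘ ((Equiv.refl ℤ).prodCongr (Equiv.neg ℤ)) := by
      funext q
      change _ = chT (q.1 + -q.2) x • (a q.1.natAbs • U (-q.2).natAbs)
      rw [Int.natAbs_neg, sub_eq_add_neg]
    rw [h2]
    exact h
  have e1 : ∀ q : ℤ × ℤ, (chT q.1 x • a q.1.natAbs) • (chT q.2 x • U q.2.natAbs)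
      = (1 / 2 : ℝ) • (chT (q.1 + q.2) x • (a q.1.natAbs • U q.2.natAbs)
        + chT (q.1 - q.2) x • (a q.1.natAbs • U q.2.natAbs)) := by
    intro q
    have h5 := congrArg (Polynomial.eval x) (T_mul_T ℝ q.1 q.2)
    simp only [Polynomial.eval_mul, Polynomial.eval_add, Polynomial.eval_ofNat] at h5
    rw [← add_smul, ← h5, smul_smul, smul_smul, smul_smul, smul_eq_mul]
    congr 1
    change chT q.1 x * a q.1.natAbs * chT q.2 x
      = 1 / 2 * (2 * chT q.1 x * chT q.2 x) * a q.1.natAbs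
    ring
  have e2 := (antidiagEquiv.tsum_eq
    fun q : ℤ × ℤ => chT (q.1 + q.2) x • (a q.1.natAbs • U q.2.natAbs)).symm.trans
    (Summable.tsum_prod ((antidiagEquiv.summable_iff).2 hG))
  have e3 : ∑' q : ℤ × ℤ, (chT q.1 x • a q.1.natAbs) • (chT q.2 x • U q.2.natAbs)
      = ∑' q : ℤ × ℤ, chT (q.1 + q.2) x • (a q.1.natAbs • U q.2.natAbs) := by
    simp only [e1]
    have h := (hG.hasSum.add hG').const_smul (1 / 2 : ℝ)
    rw [h.tsum_eq, ← two_smul ℝ, smul_smul, one_div_mul_cancel two_ne_zero, one_smul]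
  rw [hprod, e3, e2, ← (hasSum_int_cheb (convL a U) hx).tsum_eq]
  refine tsum_congr fun n => ?_
  rw [coe_convL, conv_natAbs, ← tsum_const_smul'']
  refine tsum_congr fun k => ?_
  simp [antidiagEquiv]

end Convolution

end GegenbauerStability

end

open scoped ENNReal NNReal

noncomputable section

namespace GegenbauerStability

/-! ### The solution operator of the boundary value problem, on coefficients. -/

section RealDerivatives

variable {𝕜 : Type*} [RCLike 𝕜]

lemma dx_ofReal {u : ℝ → ℝ} {p : ℕ} (hu : ContDiffOn ℝ p u seg) {j : ℕ} (hj : j ≤ p) {x : ℝ}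
    (hx : x ∈ seg) : dx j (fun x => ((u x : ℝ) : 𝕜)) x = ((dx j u x : ℝ) : 𝕜) := by
  have h := (dx_of_chain p (fun j x => ((dx j u x : ℝ) : 𝕜)) (fun j hj x hx => ?_) ?_).2 j hj x hx
  · simpa [dx] using h
  · exact (RCLike.ofRealCLM (K := 𝕜)).hasFDerivAt.comp_hasDerivWithinAt x (hasDerivWithinAt_dx hu hj hx)
  · exact RCLike.continuous_ofReal.comp_continuousOn (continuousOn_dx hu le_rfl)

end RealDerivatives

namespace Problem

variable (P : Problem) {𝕜 : Type*} [RCLike 𝕜]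

lemma two_m_pos : 0 < 2 * P.m := by have := P.one_le_m; omega

/-- The boundary conditions of the iterated antiderivative. -/
def bcS (k : Fin (2 * P.m)) : L1 𝕜 →L[𝕜] 𝕜 :=
  ∑ j : Fin (2 * P.m), (((P.rowL k j : ℝ) : 𝕜) • (chebAt ⟨-1, neg_one_mem_seg⟩).comp
      (antiderL ^ (2 * P.m - j))
    + ((P.rowR k j : ℝ) : 𝕜) • (chebAt ⟨1, one_mem_seg⟩).comp (antiderL ^ (2 * P.m - j)))

/-- The boundary conditions of polynomials. -/
def bcQ (k : Fin (2 * P.m)) : L1 𝕜 →L[𝕜] 𝕜 :=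
  ∑ j : Fin (2 * P.m), (((P.rowL k j : ℝ) : 𝕜) • (chebAt ⟨-1, neg_one_mem_seg⟩).comp
      (derL (2 * P.m) ^ (j : ℕ))
    + ((P.rowR k j : ℝ) : 𝕜) • (chebAt ⟨1, one_mem_seg⟩).comp (derL (2 * P.m) ^ (j : ℕ)))

lemma bc_congr {u v : ℝ → 𝕜} (h : Set.EqOn u v seg) (k : Fin (2 * P.m)) : P.bc k u = P.bc k v := by
  simp only [bc, dx_congr h _ neg_one_mem_seg, dx_congr h _ one_mem_seg]

lemma bc_cheb_sub (k : Fin (2 * P.m)) (U : L1 𝕜) {Q : L1 𝕜} (hQ : SuppLt (2 * P.m) Q) :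
    P.bc k (cheb ((antiderL ^ (2 * P.m)) U - Q : L1 𝕜)) = P.bcS k U - P.bcQ k Q := by
  have h := (dx_cheb_antiderL_pow_sub U Q (2 * P.m) hQ).2
  simp only [bc, bcS, bcQ, sum_apply, add_apply,
    smul_apply, ContinuousLinearMap.comp_apply, chebAt_apply,
    ← Finset.sum_sub_distrib]
  refine Finset.sum_congr rfl fun j _ => ?_
  rw [h j j.2.le _ neg_one_mem_seg, h j j.2.le _ one_mem_seg, cheb_sub _ _ neg_one_mem_seg,
    cheb_sub _ _ one_mem_seg]
  simp only [RCLike.real_smul_eq_coe_mul, smul_eq_mul]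
  ring

lemma bc_cheb_of_suppLt (k : Fin (2 * P.m)) {Q : L1 𝕜} (hQ : SuppLt (2 * P.m) Q) :
    P.bc k (cheb (Q : ℕ → 𝕜)) = P.bcQ k Q := by
  have := P.bc_cheb_sub k 0 (Q := -Q) (fun n hn => by simp [hQ n hn])
  simpa using this

lemma bcQ_e (k n : Fin (2 * P.m)) : P.bcQ k (L1.e n : L1 𝕜) = ((P.bcMat k n : ℝ) : 𝕜) := by
  have h1 : SuppLt (2 * P.m) (L1.e n : L1 ℝ) := suppLt_e n.2
  have hc : ContDiffOn ℝ (2 * P.m : ℕ) (cheb (L1.e n : L1 ℝ)) seg := by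
    have := (dx_cheb_antiderL_pow_sub (0 : L1 ℝ) (-L1.e n) (2 * P.m) (d := 2 * P.m)
      (fun l hl => by simp [h1 l hl])).1
    simpa using this
  have h2 : Set.EqOn (cheb (L1.e n : L1 𝕜)) (fun x => ((cheb (L1.e n : L1 ℝ) x : ℝ) : 𝕜)) seg :=
    fun x _ => by
      rw [cheb_e]
      beta_reduce
      rw [cheb_e]; rfl
  rw [← P.bc_cheb_of_suppLt k (suppLt_e n.2), P.bc_congr h2]
  simp only [bcMat, Matrix.of_apply, bc, ← L1.coe_e]
  rw [RCLike.ofReal_sum]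
  refine Finset.sum_congr rfl fun j _ => ?_
  rw [dx_ofReal hc j.2.le neg_one_mem_seg, dx_ofReal hc j.2.le one_mem_seg]
  simp [RCLike.real_smul_eq_coe_mul]

lemma sum_fin_smul_e {d : ℕ} {Q : L1 𝕜} (hQ : SuppLt d Q) :
    Q = ∑ n : Fin d, Q n • (L1.e n : L1 𝕜) := by
  conv_lhs => rw [hQ.eq_sum]
  exact Finset.sum_range fun n => Q n • (L1.e n : L1 𝕜)

lemma bcQ_eq (k : Fin (2 * P.m)) {Q : L1 𝕜} (hQ : SuppLt (2 * P.m) Q) :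
    P.bcQ k Q = ∑ n : Fin (2 * P.m), ((P.bcMat k n : ℝ) : 𝕜) * Q n := by
  conv_lhs => rw [sum_fin_smul_e hQ]
  rw [map_sum]
  simp only [map_smul, bcQ_e, smul_eq_mul, mul_comm]

/-- The polynomial that corrects the boundary values of the iterated antiderivative. -/
def polyL : L1 𝕜 →L[𝕜] L1 𝕜 :=
  ∑ n : Fin (2 * P.m), (∑ k : Fin (2 * P.m), ((P.bcMat⁻¹ n k : ℝ) : 𝕜) • P.bcS k).smulRight
    (L1.e (n : ℕ))

lemma polyL_eq (U : L1 𝕜) : P.polyL U = ∑ n : Fin (2 * P.m),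
    (∑ k : Fin (2 * P.m), ((P.bcMat⁻¹ n k : ℝ) : 𝕜) * P.bcS k U) • (L1.e n : L1 𝕜) := by
  simp [polyL, sum_apply]

lemma suppLt_polyL (U : L1 𝕜) : SuppLt (2 * P.m) (P.polyL U) := by
  rw [polyL_eq]
  exact SuppLt.sum fun n _ => (suppLt_e n.2).smul _

lemma polyL_apply (U : L1 𝕜) (n : Fin (2 * P.m)) :
    (P.polyL U) n = ∑ k : Fin (2 * P.m), ((P.bcMat⁻¹ n k : ℝ) : 𝕜) * P.bcS k U := by
  rw [polyL_eq, L1.finset_sum_apply, Finset.sum_eq_single n]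
  · simp
  · intro l _ hl
    rw [L1.smul_apply, L1.e_of_ne (fun h => hl (Fin.ext h.symm)), mul_zero]
  · simp

variable {P} in
lemma bcMat_mul_inv_apply (hwell : IsUnit P.bcMat) (k l : Fin (2 * P.m)) :
    ∑ n, ((P.bcMat k n : ℝ) : 𝕜) * ((P.bcMat⁻¹ n l : ℝ) : 𝕜) = if k = l then 1 else 0 := by
  have h := congrFun (congrFun (Matrix.mul_nonsing_inv _
    ((Matrix.isUnit_iff_isUnit_det _).1 hwell)) k) l
  rw [Matrix.mul_apply, Matrix.one_apply] at h
  simp only [← RCLike.ofReal_mul, ← RCLike.ofReal_sum, h]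
  split_ifs <;> simp

variable {P} in
lemma inv_mul_bcMat_apply (hwell : IsUnit P.bcMat) (k l : Fin (2 * P.m)) :
    ∑ n, ((P.bcMat⁻¹ k n : ℝ) : 𝕜) * ((P.bcMat n l : ℝ) : 𝕜) = if k = l then 1 else 0 := by
  have h := congrFun (congrFun (Matrix.nonsing_inv_mul _
    ((Matrix.isUnit_iff_isUnit_det _).1 hwell)) k) l
  rw [Matrix.mul_apply, Matrix.one_apply] at h
  simp only [← RCLike.ofReal_mul, ← RCLike.ofReal_sum, h]
  split_ifs <;> simp

variable {P} in
lemma bcQ_polyL (hwell : IsUnit P.bcMat) (k : Fin (2 * P.m)) (U : L1 𝕜) :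
    P.bcQ k (P.polyL U) = P.bcS k U := by
  rw [bcQ_eq _ _ (suppLt_polyL _ _)]
  simp only [polyL_apply, Finset.mul_sum, ← mul_assoc]
  rw [Finset.sum_comm]
  simp only [← Finset.sum_mul, bcMat_mul_inv_apply hwell]
  simp

variable {P} in
/-- A polynomial of degree less than `2m` is determined by its boundary values. -/
lemma eq_polyL_of_bcQ (hwell : IsUnit P.bcMat) {U Q : L1 𝕜} (hQ : SuppLt (2 * P.m) Q)
    (h : ∀ k, P.bcQ k Q = P.bcS k U) : Q = P.polyL U := by
  ext n
  by_cases hn : n < 2 * P.m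
  · have := P.polyL_apply U ⟨n, hn⟩
    rw [this]
    simp only [← h, bcQ_eq _ _ hQ, Finset.mul_sum, ← mul_assoc]
    rw [Finset.sum_comm]
    simp only [← Finset.sum_mul, inv_mul_bcMat_apply hwell]
    simp
  · rw [hQ n (by omega), P.suppLt_polyL U n (by omega)]

/-- The sign `(-1)^{m+1}`. -/
def sgn : 𝕜 := (-1) ^ (P.m + 1)

lemma sgn_mul_sgn : (P.sgn : 𝕜) * P.sgn = 1 := by
  rw [sgn, ← mul_pow]; simp

lemma norm_sgn : ‖(P.sgn : 𝕜)‖ = 1 := by simp [sgn]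

/-- `∂ₓ^i 𝒢₀ ℒ⁻¹` on Chebyshev coefficients. -/
def KiL (i : ℕ) : L1 𝕜 →L[𝕜] L1 𝕜 :=
  (P.sgn : 𝕜) • (antiderL ^ (2 * P.m - i) - (derL (2 * P.m) ^ i).comp P.polyL)

lemma KiL_apply (i : ℕ) (U : L1 𝕜) : P.KiL i U
    = (P.sgn : 𝕜) • ((antiderL ^ (2 * P.m - i)) U - (derL (2 * P.m) ^ i) (P.polyL U)) := rfl

/-- The solution operator on `ℓ¹₁`. -/
abbrev LinvL : L1 𝕜 →L[𝕜] L1 𝕜 := P.KiL 0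

lemma KiL_two_m (U : L1 𝕜) : P.KiL (2 * P.m) U = (P.sgn : 𝕜) • U := by
  have h : (derL (2 * P.m) ^ (2 * P.m)) (P.polyL U) = 0 := by
    ext n
    exact suppLt_derL_pow (P.suppLt_polyL U) (2 * P.m) n (by omega)
  rw [KiL_apply, h, Nat.sub_self]
  simp

lemma LinvL_eq (U : L1 𝕜) :
    P.LinvL U = (antiderL ^ (2 * P.m)) ((P.sgn : 𝕜) • U) - (P.sgn : 𝕜) • P.polyL U := by
  rw [LinvL, KiL_apply, smul_sub, map_smul]
  simp

lemma suppLt_sgn_polyL (U : L1 𝕜) : SuppLt (2 * P.m) ((P.sgn : 𝕜) • P.polyL U) :=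
  (P.suppLt_polyL U).smul _

lemma contDiffOn_cheb_LinvL (U : L1 𝕜) :
    ContDiffOn ℝ (2 * P.m : ℕ) (cheb (P.LinvL U : L1 𝕜)) seg := by
  rw [LinvL_eq]
  exact (dx_cheb_antiderL_pow_sub _ _ _ (P.suppLt_sgn_polyL U)).1

lemma dx_cheb_LinvL (U : L1 𝕜) {i : ℕ} (hi : i ≤ 2 * P.m) {x : ℝ} (hx : x ∈ seg) :
    dx i (cheb (P.LinvL U : L1 𝕜)) x = cheb (P.KiL i U : L1 𝕜) x := by
  rw [LinvL_eq, (dx_cheb_antiderL_pow_sub _ _ _ (P.suppLt_sgn_polyL U)).2 i hi x hx, KiL_apply,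
    smul_sub, map_smul, map_smul]

lemma dx_two_m_cheb_LinvL (U : L1 𝕜) {x : ℝ} (hx : x ∈ seg) :
    dx (2 * P.m) (cheb (P.LinvL U : L1 𝕜)) x = P.sgn * cheb (U : ℕ → 𝕜) x := by
  rw [P.dx_cheb_LinvL U le_rfl hx, KiL_two_m, cheb_smul _ _ hx]

variable {P}

lemma bc_cheb_LinvL (hwell : IsUnit P.bcMat) (U : L1 𝕜) (k : Fin (2 * P.m)) :
    P.bc k (cheb (P.LinvL U : L1 𝕜)) = 0 := by
  rw [LinvL_eq, bc_cheb_sub _ _ _ (P.suppLt_sgn_polyL U), map_smul, map_smul,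
    bcQ_polyL hwell, sub_self]

/-- The solution of the boundary value problem is unique. -/
lemma eqOn_cheb_LinvL (hwell : IsUnit P.bcMat) {v : ℝ → 𝕜} (hv : ContDiffOn ℝ (2 * P.m : ℕ) v seg)
    (hbc : ∀ k, P.bc k v = 0) {U : L1 𝕜}
    (hU : ∀ x ∈ seg, dx (2 * P.m) v x = P.sgn * cheb (U : ℕ → 𝕜) x) :
    Set.EqOn v (cheb (P.LinvL U : L1 𝕜)) seg := by
  obtain ⟨Q, hQ, h⟩ := exists_cheb_of_dx hv (U := (P.sgn : 𝕜) • U)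
    (fun x hx => by rw [hU x hx, cheb_smul _ _ hx])
  have h2 : Q = P.polyL ((P.sgn : 𝕜) • U) := by
    refine eq_polyL_of_bcQ hwell hQ fun k => ?_
    have h3 := hbc k
    rw [P.bc_congr h, bc_cheb_sub _ _ _ hQ] at h3
    exact (sub_eq_zero.1 h3).symm
  intro x hx
  rw [h x hx, h2, LinvL_eq, map_smul P.polyL]

/-- The low order part of a sequence. -/
lemma coe_antiderProj (p : ℕ) (U : L1 𝕜) : antiderProj p (U : ℕ → 𝕜) = ((antiderL ^ p) U
    - ∑ n : Fin p, ((antiderL ^ p) U) n • L1.e n : L1 𝕜) := by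
  funext n
  rw [antiderProj, L1.sub_apply, L1.finset_sum_apply, coe_antiderL_pow]
  simp only [L1.smul_apply, L1.e_apply, mul_ite, mul_one, mul_zero]
  split_ifs with h
  · rw [Finset.sum_eq_single ⟨n, h⟩]
    · simp
    · intro b _ hb
      rw [if_neg fun h => hb (Fin.ext h.symm)]
    · simp
  · rw [Finset.sum_eq_zero, sub_zero]
    intro b _
    rw [if_neg]
    have := b.2
    omega

/-- The definition truncates `𝒮^{2m}` below index `2m`. This alters it by a polynomial `Q` of degree
`< 2m`, and `I - ℬ†ℬ` kills such polynomials, so the untruncated power may be used instead. -/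
lemma coe_LinvL (hwell : IsUnit P.bcMat) (U : L1 𝕜) :
    P.Linv (U : ℕ → 𝕜) = (P.LinvL U : L1 𝕜) := by
  set Q : L1 𝕜 := ∑ n : Fin (2 * P.m), ((antiderL ^ (2 * P.m)) U) n • L1.e n with hQdef
  have hQ : SuppLt (2 * P.m) Q := SuppLt.sum fun n _ => (suppLt_e n.2).smul _
  have hproj := coe_antiderProj (2 * P.m) U
  rw [← hQdef] at hproj
  have hQn (l : Fin (2 * P.m)) : Q l = ((antiderL ^ (2 * P.m)) U) l := by
    have h1 : antiderProj (2 * P.m) (U : ℕ → 𝕜) l = 0 := if_pos l.2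
    rw [hproj, L1.sub_apply] at h1
    exact (sub_eq_zero.1 h1).symm
  funext n
  rw [Linv, hproj, LinvL, KiL_apply]
  simp only [bc_cheb_sub _ _ _ hQ, bcQ_eq _ _ hQ, RCLike.real_smul_eq_coe_mul]
  have hsgn : (((-1 : ℝ) ^ (P.m + 1) : ℝ) : 𝕜) = P.sgn := by simp [sgn]
  rw [hsgn, L1.smul_apply, pow_zero]
  congr 1
  rw [L1.sub_apply, L1.sub_apply]
  split_ifs with h
  · have h1 : ∑ k : Fin (2 * P.m), ((P.bcMat⁻¹ ⟨n, h⟩ k : ℝ) : 𝕜) *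
        (P.bcS k U - ∑ l : Fin (2 * P.m), ((P.bcMat k l : ℝ) : 𝕜) * Q l)
        = (P.polyL U) n - Q n := by
      have h2 := P.polyL_apply U ⟨n, h⟩
      simp only [mul_sub, Finset.sum_sub_distrib, ← h2, Finset.mul_sum, ← mul_assoc]
      rw [Finset.sum_comm]
      simp only [← Finset.sum_mul, inv_mul_bcMat_apply hwell]
      simp
    rw [h1]
    change _ = ((antiderL ^ (2 * P.m)) U) n - (P.polyL U) n
    ring
  · change _ = _ - (P.polyL U) n
    rw [hQ n (by omega), P.suppLt_polyL U n (by omega)]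
    simp

lemma coe_KiL (hwell : IsUnit P.bcMat) {i : ℕ} (hi : i ≤ 2 * P.m) (U : L1 𝕜) :
    P.Ki i (U : ℕ → 𝕜) = (P.KiL i U : L1 𝕜) := by
  rw [Ki, coe_LinvL hwell, chebInv_congr fun x hx => P.dx_cheb_LinvL U hi hx, chebInv_cheb]

end Problem

/-! ### The multipliers `𝒱ᵢ` and the operator `D𝒦`. -/

section Coefficients

/-- The functions which are sums of absolutely convergent Chebyshev series. -/
def IsCheb (f : ℝ → ℝ) : Prop := ∃ a : L1 ℝ, Set.EqOn f (cheb (a : ℕ → ℝ)) seg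

lemma IsCheb.mul {f g : ℝ → ℝ} (hf : IsCheb f) (hg : IsCheb g) : IsCheb fun x => f x * g x := by
  obtain ⟨a, ha⟩ := hf
  obtain ⟨b, hb⟩ := hg
  exact ⟨convL a b, fun x hx => by rw [cheb_convL _ _ hx, smul_eq_mul, ← ha hx, ← hb hx]⟩

lemma isCheb_const (c : ℝ) : IsCheb fun _ => c :=
  ⟨c • L1.e 0, fun x hx => by rw [cheb_smul _ _ hx, cheb_e]; simp [chT]⟩

lemma IsCheb.pow {f : ℝ → ℝ} (hf : IsCheb f) (n : ℕ) : IsCheb fun x => f x ^ n := by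
  induction n with
  | zero => simpa using isCheb_const 1
  | succ n ih => simpa only [pow_succ] using ih.mul hf

lemma IsCheb.prod {ι : Type*} (s : Finset ι) {f : ι → ℝ → ℝ} (hf : ∀ i ∈ s, IsCheb (f i)) :
    IsCheb fun x => ∏ i ∈ s, f i x := by
  classical
  induction s using Finset.induction_on with
  | empty => simpa using isCheb_const 1
  | insert i s his ih =>
    simp only [Finset.prod_insert his]
    exact (hf i (Finset.mem_insert_self i s)).mul
      (ih fun j hj => hf j (Finset.mem_insert_of_mem hj))

namespace Problem

variable {P : Problem}

/-- Derivatives of `𝒢₀ ℒ⁻¹ U` of order `< 2m` are absolutely convergent Chebyshev series, and such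
functions form an algebra under multiplication. -/
lemma isCheb_DQcoef (hwell : IsUnit P.bcMat) (U : L1 ℝ) (i : Fin (2 * P.m)) :
    IsCheb (P.DQcoef (P.sol (U : ℕ → ℝ)) i) := by
  have h (l : Fin (2 * P.m)) : IsCheb (dx l (P.sol (U : ℕ → ℝ))) :=
    ⟨P.KiL l U, fun x hx => by rw [sol, coe_LinvL hwell, P.dx_cheb_LinvL U l.2.le hx]⟩
  exact ((isCheb_const _).mul ((h i).pow _)).mul (IsCheb.prod _ fun l _ => (h l).pow _)

/-- The sequences `𝒱ᵢ` as elements of `ℓ¹₁`. -/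
def VL (hwell : IsUnit P.bcMat) (U : L1 ℝ) (i : Fin (2 * P.m)) : L1 ℝ :=
  (isCheb_DQcoef hwell U i).choose

lemma cheb_VL (hwell : IsUnit P.bcMat) (U : L1 ℝ) (i : Fin (2 * P.m)) {x : ℝ} (hx : x ∈ seg) :
    cheb (VL hwell U i : ℕ → ℝ) x = P.DQcoef (P.sol (U : ℕ → ℝ)) i x :=
  ((isCheb_DQcoef hwell U i).choose_spec hx).symm

lemma coe_VL (hwell : IsUnit P.bcMat) (U : L1 ℝ) (i : Fin (2 * P.m)) :
    P.V (U : ℕ → ℝ) i = (VL hwell U i : ℕ → ℝ) := by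
  rw [V, chebInv_congr fun x hx => (cheb_VL hwell U i hx).symm, chebInv_cheb]

variable {𝕜 : Type*} [RCLike 𝕜]

/-- The operator `D𝒦(U)` on `ℓ¹₁`. -/
def DKL (hwell : IsUnit P.bcMat) (U : L1 ℝ) : L1 𝕜 →L[𝕜] L1 𝕜 :=
  ∑ i : Fin (2 * P.m), (convL (VL hwell U i)).comp (P.KiL i)

lemma DKL_apply (hwell : IsUnit P.bcMat) (U : L1 ℝ) (H : L1 𝕜) :
    DKL hwell U H = ∑ i : Fin (2 * P.m), convL (VL hwell U i) (P.KiL i H) := by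
  simp [DKL, sum_apply]

lemma coe_DKL (hwell : IsUnit P.bcMat) (U : L1 ℝ) (H : L1 𝕜) :
    P.DK (U : ℕ → ℝ) (H : ℕ → 𝕜) = (DKL hwell U H : L1 𝕜) := by
  rw [DKL_apply, L1.coe_finset_sum, DK]
  refine Finset.sum_congr rfl fun i _ => ?_
  rw [coe_convL, coe_VL hwell, coe_KiL hwell i.2.le]

end Problem

end Coefficients

end GegenbauerStability

end

open scoped ENNReal NNReal

noncomputable section

namespace GegenbauerStability

/-! ### Recurrences and comparison inequalities for the constants `γ`. -/

section Gam

lemma gam_zero (k : ℕ) : gam 0 k = 1 := by simp [gam]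

lemma gam_one (k : ℕ) : gam 1 k = 1 / k := by
  rcases eq_or_ne k 0 with rfl | hk
  · simp [gam]
  · have : (k : ℝ) ≠ 0 := by exact_mod_cast hk
    simp [gam]
    field_simp

lemma gam_add_two (p k : ℕ) : gam (p + 2) k = gam p k / ((k : ℝ) ^ 2 - ((p : ℝ) + 1) ^ 2) := by
  rcases Nat.even_or_odd p with ⟨q, rfl⟩ | ⟨q, rfl⟩
  · have h1 : (q + q + 2) / 2 = q + 1 := by omega
    have h2 : (q + q) / 2 = q := by omega
    rw [gam, if_pos ⟨q + 1, by ring⟩, gam, if_pos ⟨q, rfl⟩, h1, h2,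
      Finset.prod_Icc_succ_top (by omega)]
    push_cast
    rw [div_eq_mul_one_div]
    congr 3
    ring
  · have h1 : (2 * q + 1 + 2) / 2 = q + 1 := by omega
    have h2 : (2 * q + 1) / 2 = q := by omega
    rw [gam, if_neg (by simp [Nat.even_add_one, parity_simps]), gam,
      if_neg (by simp [parity_simps]), h1, h2, Finset.prod_range_succ _ (q + 1)]
    push_cast
    rw [← mul_assoc, div_eq_mul_one_div _ ((k : ℝ) ^ 2 - _)]
    congr 3
    ring

lemma sq_sub_pos {p k : ℕ} (h : p < k) : 0 < (k : ℝ) ^ 2 - (p : ℝ) ^ 2 := by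
  have : (p : ℝ) < k := by exact_mod_cast h
  have : (0 : ℝ) ≤ p := p.cast_nonneg
  nlinarith

lemma gam_pos {p k : ℕ} (h : p < k) : 0 < gam p k := by
  induction p using Nat.twoStepInduction with
  | zero => simp [gam_zero]
  | one =>
    rw [gam_one]
    have : (0 : ℝ) < k := by exact_mod_cast (by omega : 0 < k)
    positivity
  | more p ih _ =>
    rw [gam_add_two]
    have := sq_sub_pos (p := p + 1) (k := k) (by omega)
    push_cast at this
    exact div_pos (ih (by omega)) this

lemma gam_anti {p k l : ℕ} (h : p < k) (hkl : k ≤ l) : gam p l ≤ gam p k := by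
  have hkl' : (k : ℝ) ≤ l := by exact_mod_cast hkl
  induction p using Nat.twoStepInduction with
  | zero => simp [gam_zero]
  | one =>
    rw [gam_one, gam_one]
    have : (0 : ℝ) < k := by exact_mod_cast (by omega : 0 < k)
    exact one_div_le_one_div_of_le this hkl'
  | more p ih _ =>
    rw [gam_add_two, gam_add_two]
    have := sq_sub_pos (p := p + 1) (k := k) (by omega)
    push_cast at this
    have h0 := (gam_pos (p := p) (k := k) (by omega)).le
    have h1 := ih (by omega)
    have : (k : ℝ) ^ 2 ≤ (l : ℝ) ^ 2 := by gcongr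
    gcongr

lemma gam_succ_right {p k : ℕ} (h : p + 1 < k) :
    gam p (k + 1) = ((k : ℝ) - p) * gam (p + 1) k := by
  induction p using Nat.twoStepInduction with
  | zero =>
    have : (0 : ℝ) < k := by exact_mod_cast (by omega : 0 < k)
    rw [gam_zero, gam_one]
    field_simp
    simp
  | one =>
    have h1 : (2 : ℝ) < k := by exact_mod_cast h
    rw [gam_one, gam_add_two, gam_zero]
    have h2 : (k : ℝ) ^ 2 - ((0 : ℕ) + 1) ^ 2 ≠ 0 := by push_cast; nlinarith
    push_cast at h2 ⊢
    field_simp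
    ring
  | more p ih _ =>
    have h1 : (p : ℝ) + 3 < k := by exact_mod_cast h
    have h0 : (0 : ℝ) ≤ p := p.cast_nonneg
    rw [gam_add_two, gam_add_two, ih (by omega)]
    push_cast
    have e1 : ((k : ℝ) + 1) ^ 2 - ((p : ℝ) + 1) ^ 2 = ((k : ℝ) - p) * (k + p + 2) := by ring
    have e2 : (k : ℝ) ^ 2 - ((p : ℝ) + 1 + 1) ^ 2 = ((k : ℝ) - (p + 2)) * (k + p + 2) := by ring
    have h2 : (k : ℝ) - p ≠ 0 := by linarith
    have h3 : (k : ℝ) - (p + 2) ≠ 0 := by linarith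
    have h4 : (k : ℝ) + p + 2 ≠ 0 := by linarith
    rw [e1, e2]
    field_simp

lemma gam_pred_right {p k : ℕ} (h : p + 1 < k) :
    gam p (k - 1) = ((k : ℝ) + p) * gam (p + 1) k := by
  obtain ⟨k, rfl⟩ : ∃ l, k = l + 1 := ⟨k - 1, by omega⟩
  rw [Nat.add_sub_cancel]
  induction p using Nat.twoStepInduction with
  | zero =>
    have : (0 : ℝ) < k := by exact_mod_cast (by omega : 0 < k)
    rw [gam_zero, gam_one]
    push_cast
    field_simp
    simp
  | one =>
    have h1 : (1 : ℝ) < k := by exact_mod_cast (by omega : 1 < k)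
    rw [gam_one, gam_add_two, gam_zero]
    push_cast
    have h2 : ((k : ℝ) + 1) ^ 2 - (0 + 1) ^ 2 ≠ 0 := by nlinarith
    field_simp
    ring
  | more p ih _ =>
    have h1 : (p : ℝ) + 2 < k := by exact_mod_cast (by omega : p + 2 < k)
    have h0 : (0 : ℝ) ≤ p := p.cast_nonneg
    rw [gam_add_two, gam_add_two, ih (by omega)]
    push_cast
    have e1 : (k : ℝ) ^ 2 - ((p : ℝ) + 1) ^ 2 = ((k : ℝ) - p - 1) * (k + p + 1) := by ring
    have e2 : ((k : ℝ) + 1) ^ 2 - ((p : ℝ) + 1 + 1) ^ 2 = ((k : ℝ) - p - 1) * (k + p + 3) := by ring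
    have h2 : (k : ℝ) - p - 1 ≠ 0 := by linarith
    have h3 : (k : ℝ) + p + 1 ≠ 0 := by linarith
    have h4 : (k : ℝ) + p + 3 ≠ 0 := by linarith
    have e3 : (k : ℝ) + 1 + p = k + p + 1 := by ring
    have e4 : (k : ℝ) + 1 + (p + 2) = k + p + 3 := by ring
    rw [e1, e2, e3, e4]
    field_simp

/-- This is the recurrence satisfied by the row sums of the iterated antiderivative, whose rows
combine the neighbours `k - 1` and `k + 1` with factor `1/(2k)`. -/
lemma gam_pred_add_succ {p k : ℕ} (h : p + 1 < k) :
    gam p (k - 1) + gam p (k + 1) = 2 * k * gam (p + 1) k := by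
  rw [gam_pred_right h, gam_succ_right h]
  ring

/-- Trades one order of integration for one index. As a consequence, columns of index at least `N +
2` are bounded by `γ_{p,N+1}` without any loss; only the column `N + 1` needs finer arguments. -/
lemma mul_gam_succ_le {p k : ℕ} (h : p + 1 < k) : (k : ℝ) * gam (p + 1) k ≤ gam p (k - 1) := by
  rw [gam_pred_right h]
  have := gam_pos (p := p + 1) h
  have : (0 : ℝ) ≤ p := p.cast_nonneg
  gcongr
  linarith

/-- Column sums `k γ_{2q+1,k}` exceed the row sums `γ_{2q,k}` by a factor whose square is at most
`(k² - 1)/(k² - (2q+1)²)`. With `A = k² - (2q+1)²` the induction step reduces to `A (A - (8q+8)) ≤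
(A - (4q+3))²`. -/
lemma sq_mul_gam_le {q k : ℕ} (h : 2 * q + 1 < k) :
    ((k : ℝ) * gam (2 * q + 1) k) ^ 2 * ((k : ℝ) ^ 2 - (2 * q + 1) ^ 2)
      ≤ ((k : ℝ) ^ 2 - 1) * gam (2 * q) k ^ 2 := by
  induction q with
  | zero =>
    have : (0 : ℝ) < k := by exact_mod_cast (by omega : 0 < k)
    rw [gam_one, mul_zero, gam_zero]
    field_simp
    simp
  | succ q ih =>
    have ih := ih (by omega)
    have h1 : (2 * q + 3 : ℝ) < k := by exact_mod_cast h
    have h0 : (0 : ℝ) ≤ q := q.cast_nonneg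
    rw [show 2 * (q + 1) + 1 = 2 * q + 1 + 2 by ring, show 2 * (q + 1) = 2 * q + 2 by ring,
      gam_add_two, gam_add_two]
    push_cast
    set A := (k : ℝ) ^ 2 - (2 * q + 1) ^ 2 with hA
    have eB : (k : ℝ) ^ 2 - (2 * q + 1 + 1) ^ 2 = A - (4 * q + 3) := by rw [hA]; ring
    have eC : (k : ℝ) ^ 2 - (2 * (q + 1) + 1) ^ 2 = A - (8 * q + 8) := by rw [hA]; ring
    rw [eB, eC]
    have hA0 : 8 * (q : ℝ) + 8 < A := by rw [hA]; nlinarith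
    set B := A - (4 * q + 3) with hB
    have hB0 : 0 < B := by linarith
    set x := (k : ℝ) * gam (2 * q + 1) k
    set y := gam (2 * q) k
    have hAC : A * (A - (8 * q + 8)) ≤ B ^ 2 := by rw [hB]; nlinarith
    have h2 : ((k : ℝ) * (gam (2 * q + 1) k / B)) ^ 2 = x ^ 2 / B ^ 2 := by
      simp only [x]; field_simp
    have hA1 : 0 < A := by linarith
    rw [h2, div_pow, ← mul_div_assoc, div_mul_eq_mul_div, div_le_div_iff₀ (by positivity) (by positivity)]
    have h3 : x ^ 2 * (A - (8 * q + 8)) * A ^ 2 ≤ x ^ 2 * A * B ^ 2 := by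
      nlinarith [mul_le_mul_of_nonneg_left hAC (mul_nonneg (sq_nonneg x) (by linarith : 0 ≤ A))]
    calc x ^ 2 * (A - (8 * q + 8)) * A ^ 2 ≤ x ^ 2 * A * B ^ 2 := h3
      _ ≤ _ := by gcongr

/-- Uniform comparison of column sums and row sums, in the range where it is needed. -/
lemma mul_gam_succ_le_of_le {q k : ℕ} (hq : 1 ≤ q) (h : 4 * q + 1 ≤ k) :
    (k : ℝ) * gam (2 * q + 1) k ≤ 5 / 4 * gam (2 * q) k := by
  have h0 := sq_mul_gam_le (q := q) (k := k) (by omega)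
  have h1 : (4 * q + 1 : ℝ) ≤ k := by exact_mod_cast h
  have h2 : (1 : ℝ) ≤ q := by exact_mod_cast hq
  have hy := gam_pos (p := 2 * q) (k := k) (by omega)
  set x := (k : ℝ) * gam (2 * q + 1) k
  set y := gam (2 * q) k
  -- The constant is `(5/4)²`. At `q = 1`, `k = 5` the two sides are `24` and `25`, so `5/4` is not
  -- far from optimal.
  have h3 : (k : ℝ) ^ 2 - 1 ≤ 25 / 16 * ((k : ℝ) ^ 2 - (2 * q + 1) ^ 2) := by nlinarith
  have hA : 0 < (k : ℝ) ^ 2 - (2 * q + 1) ^ 2 := by nlinarith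
  refine abs_le_of_sq_le_sq' ?_ (by positivity) |>.2
  refine le_of_mul_le_mul_right (h0.trans ?_) hA
  nlinarith [mul_le_mul_of_nonneg_right h3 (sq_nonneg y)]

end Gam

/-! ### Rows and columns of the iterated antiderivative, away from low indices. -/

section Bulk

/-- Weights of the rows of the iterated bulk of the antiderivative. -/
def rowW : ℕ → ℕ → ℕ → ℝ
  | 0, k => Pi.single k 1
  | p + 1, k => fun n => (rowW p (k - 1) n + rowW p (k + 1) n) / (2 * k)

lemma rowW_nonneg (p k n : ℕ) : 0 ≤ rowW p k n := by
  induction p generalizing k with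
  | zero => rw [rowW, Pi.single_apply]; split_ifs <;> norm_num
  | succ p ih =>
    have := ih (k - 1)
    have := ih (k + 1)
    rw [rowW]
    positivity

lemma rowW_eq_zero {p k n : ℕ} (h : n + p < k) : rowW p k n = 0 := by
  induction p generalizing k with
  | zero => rw [rowW, Pi.single_eq_of_ne (by omega)]
  | succ p ih => simp [rowW, ih (k := k - 1) (by omega), ih (k := k + 1) (by omega)]

lemma hasSum_rowW {p k : ℕ} (h : p < k) : HasSum (rowW p k) (gam p k) := by
  induction p generalizing k with
  | zero => rw [gam_zero]; exact hasSum_pi_single k 1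
  | succ p ih =>
    have h1 := ((ih (k := k - 1) (by omega)).add (ih (k := k + 1) (by omega))).div_const (2 * (k : ℝ))
    rw [gam_pred_add_succ h] at h1
    have : (0 : ℝ) < k := by exact_mod_cast (by omega : 0 < k)
    rwa [mul_div_cancel_left₀ _ (by positivity)] at h1

/-- Absolute values of the columns of the iterated bulk of the antiderivative. -/
def colW : ℕ → ℕ → ℕ → ℝ
  | 0, k => Pi.single k 1
  | p + 1, k => fun n => colW p (k + 1) n / (2 * ((k : ℝ) + 1)) + colW p (k - 1) n / (2 * ((k : ℝ) - 1))

/-- The two recursions are conjugate under the diagonal operator of multiplication by the index.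
Entries of a column therefore differ from those of the corresponding row by the factor `k / n`,
which explains both column sums and the comparisons below. -/
lemma mul_colW {p k : ℕ} (h : p < k) (n : ℕ) : (n : ℝ) * colW p k n = k * rowW p k n := by
  induction p generalizing k with
  | zero =>
    simp only [colW, rowW, Pi.single_apply]
    split_ifs with h
    · rw [h]
    · simp
  | succ p ih =>
    have h1 := ih (k := k - 1) (by omega)
    have h2 := ih (k := k + 1) (by omega)
    have hk : (1 : ℝ) < k := by exact_mod_cast (by omega : 1 < k)
    have hk' : (k : ℝ) - 1 ≠ 0 := by linarith
    rw [Nat.cast_sub (by omega)] at h1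
    push_cast at h1 h2
    rw [colW, rowW]
    have e1 : (n : ℝ) * (colW p (k + 1) n / (2 * ((k : ℝ) + 1)) + colW p (k - 1) n / (2 * ((k : ℝ) - 1)))
        = (n * colW p (k + 1) n) / (2 * ((k : ℝ) + 1)) + (n * colW p (k - 1) n) / (2 * ((k : ℝ) - 1)) := by
      ring
    rw [e1, h1, h2]
    field_simp
    ring

lemma colW_nonneg {p k : ℕ} (h : p < k) (n : ℕ) : 0 ≤ colW p k n := by
  induction p generalizing k with
  | zero => rw [colW, Pi.single_apply]; split_ifs <;> norm_num
  | succ p ih =>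
    have h1 := ih (k := k - 1) (by omega)
    have h2 := ih (k := k + 1) (by omega)
    have hk : (1 : ℝ) < k := by exact_mod_cast (by omega : 1 < k)
    have : (0 : ℝ) < k - 1 := by linarith
    rw [colW]
    positivity

lemma colW_eq_zero {p k n : ℕ} (h : n + p < k) : colW p k n = 0 := by
  induction p generalizing k with
  | zero => rw [colW, Pi.single_eq_of_ne (by omega)]
  | succ p ih => simp [colW, ih (k := k - 1) (by omega), ih (k := k + 1) (by omega)]

lemma hasSum_colW {p k : ℕ} (h : p + 1 < k) : HasSum (colW p k) (k * gam (p + 1) k) := by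
  induction p generalizing k with
  | zero =>
    have : (0 : ℝ) < k := by exact_mod_cast (by omega : 0 < k)
    rw [gam_one, mul_one_div_cancel this.ne']
    exact hasSum_pi_single k (1 : ℝ)
  | succ p ih =>
    have h1 := ((ih (k := k + 1) (by omega)).div_const (2 * ((k : ℝ) + 1))).add
      ((ih (k := k - 1) (by omega)).div_const (2 * ((k : ℝ) - 1)))
    have hk : (1 : ℝ) < k := by exact_mod_cast (by omega : 1 < k)
    have hk' : (k : ℝ) - 1 ≠ 0 := by linarith
    have h2 := gam_pred_add_succ (p := p + 1) (k := k) h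
    rw [Nat.cast_sub (by omega)] at h1
    push_cast at h1
    have e : ((k : ℝ) + 1) * gam (p + 1) (k + 1) / (2 * ((k : ℝ) + 1))
        + ((k : ℝ) - 1) * gam (p + 1) (k - 1) / (2 * ((k : ℝ) - 1)) = k * gam (p + 1 + 1) k := by
      have e : (k : ℝ) * gam (p + 1 + 1) k = (gam (p + 1) (k - 1) + gam (p + 1) (k + 1)) / 2 := by
        rw [h2]; ring
      rw [e]
      field_simp
      ring
    rwa [e] at h1

/-- A nonzero entry has `n ≥ k - p`, and `2p < k` then gives `k / n ≤ 2`. -/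
lemma colW_le_two_mul {p k n : ℕ} (h : 2 * p < k) : colW p k n ≤ 2 * rowW p k n := by
  rcases lt_or_ge (n + p) k with hn | hn
  · rw [colW_eq_zero hn, rowW_eq_zero hn, mul_zero]
  · have h1 := mul_colW (p := p) (k := k) (by omega) n
    have h2 := colW_nonneg (p := p) (k := k) (by omega) n
    have h3 := rowW_nonneg p k n
    have h4 : (k : ℝ) ≤ 2 * n := by exact_mod_cast (by omega : k ≤ 2 * n)
    have h5 : (0 : ℝ) < n := by exact_mod_cast (by omega : 0 < n)
    refine le_of_mul_le_mul_left ?_ h5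
    rw [h1]
    nlinarith

lemma colW_le {p k n : ℕ} (h : p < k) (hn : k ≤ n) : colW p k n ≤ rowW p k n := by
  have h1 := mul_colW h n
  have h3 := rowW_nonneg p k n
  have h4 : (k : ℝ) ≤ n := by exact_mod_cast hn
  have h5 : (0 : ℝ) < n := by exact_mod_cast (by omega : 0 < n)
  refine le_of_mul_le_mul_left ?_ h5
  rw [h1]
  nlinarith

variable {𝕜 : Type*} [RCLike 𝕜]

/-- The iterated antiderivative of `e_k`, up to a polynomial of low degree. -/
def bulk : ℕ → ℕ → L1 𝕜
  | 0, k => L1.e k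
  | p + 1, k => ((1 / (2 * ((k : ℝ) + 1)) : ℝ) : 𝕜) • bulk p (k + 1)
      - ((1 / (2 * ((k : ℝ) - 1)) : ℝ) : 𝕜) • bulk p (k - 1)

lemma norm_bulk_apply_le {p k : ℕ} (h : p < k) (n : ℕ) : ‖(bulk p k : L1 𝕜) n‖ ≤ colW p k n := by
  induction p generalizing k with
  | zero =>
    rw [bulk, colW, L1.e_apply, Pi.single_apply]
    split_ifs <;> simp
  | succ p ih =>
    have h1 := ih (k := k - 1) (by omega)
    have h2 := ih (k := k + 1) (by omega)
    have hk : (1 : ℝ) < k := by exact_mod_cast (by omega : 1 < k)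
    have hk' : (0 : ℝ) < k - 1 := by linarith
    rw [bulk, colW, L1.sub_apply, L1.smul_apply, L1.smul_apply]
    refine (norm_sub_le _ _).trans ?_
    rw [norm_mul, norm_mul, RCLike.norm_ofReal, RCLike.norm_ofReal, abs_of_pos (by positivity),
      abs_of_pos (by positivity), one_div_mul_eq_div, one_div_mul_eq_div]
    exact add_le_add (by gcongr) (by gcongr)

end Bulk

end GegenbauerStability

end

open scoped ENNReal NNReal

noncomputable section

namespace GegenbauerStability

/-! ### Endpoint values of the iterated antiderivatives. -/

section BoundaryValues

lemma inv_prod_succ (p : ℕ) (x : ℝ) : ∏ j ∈ Finset.range (p + 1), 1 / (x ^ 2 - ((j : ℝ) + 1) ^ 2)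
    = (∏ j ∈ Finset.range p, 1 / (x ^ 2 - ((j : ℝ) + 1) ^ 2)) / (x ^ 2 - ((p : ℝ) + 1) ^ 2) := by
  rw [Finset.prod_range_succ, mul_one_div]

lemma inv_prod_add_one {p : ℕ} {x : ℝ} (h : (p : ℝ) + 1 < x) :
    (∏ j ∈ Finset.range p, 1 / ((x + 1) ^ 2 - ((j : ℝ) + 1) ^ 2)) / (x + 1)
      = (∏ j ∈ Finset.range (p + 1), 1 / (x ^ 2 - ((j : ℝ) + 1) ^ 2)) * ((x - p) * (x - p - 1)) / x := by
  induction p with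
  | zero =>
    have h0 : 1 < x := by simpa using h
    have h1 : x ^ 2 - 1 ≠ 0 := by nlinarith
    simp
    field_simp
    ring
  | succ p ih =>
    push_cast at h
    have h0 : (0 : ℝ) ≤ p := p.cast_nonneg
    have ih := ih (by linarith)
    rw [inv_prod_succ p (x + 1), div_right_comm, ih, inv_prod_succ (p + 1) x]
    set G := ∏ j ∈ Finset.range (p + 1), 1 / (x ^ 2 - ((j : ℝ) + 1) ^ 2)
    push_cast
    have e1 : (x + 1) ^ 2 - ((p : ℝ) + 1) ^ 2 = (x - p) * (x + p + 2) := by ring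
    have e2 : x ^ 2 - ((p : ℝ) + 1 + 1) ^ 2 = (x - p - 2) * (x + p + 2) := by ring
    have h2 : x - p ≠ 0 := by linarith
    have h3 : x - p - 2 ≠ 0 := by linarith
    have h4 : x + p + 2 ≠ 0 := by linarith
    have h5 : x ≠ 0 := by linarith
    rw [e1, e2]
    field_simp
    ring

lemma inv_prod_sub_one {p : ℕ} {x : ℝ} (h : (p : ℝ) + 1 < x) :
    (∏ j ∈ Finset.range p, 1 / ((x - 1) ^ 2 - ((j : ℝ) + 1) ^ 2)) / (x - 1)
      = (∏ j ∈ Finset.range (p + 1), 1 / (x ^ 2 - ((j : ℝ) + 1) ^ 2)) * ((x + p) * (x + p + 1)) / x := by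
  induction p with
  | zero =>
    have h0 : 1 < x := by simpa using h
    have h1 : x ^ 2 - 1 ≠ 0 := by nlinarith
    have h2 : x - 1 ≠ 0 := by linarith
    simp
    field_simp
    ring
  | succ p ih =>
    push_cast at h
    have h0 : (0 : ℝ) ≤ p := p.cast_nonneg
    have ih := ih (by linarith)
    rw [inv_prod_succ p (x - 1), div_right_comm, ih, inv_prod_succ (p + 1) x]
    set G := ∏ j ∈ Finset.range (p + 1), 1 / (x ^ 2 - ((j : ℝ) + 1) ^ 2)
    push_cast
    have e1 : (x - 1) ^ 2 - ((p : ℝ) + 1) ^ 2 = (x - p - 2) * (x + p) := by ring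
    have e2 : x ^ 2 - ((p : ℝ) + 1 + 1) ^ 2 = (x - p - 2) * (x + p + 2) := by ring
    have h2 : x + p ≠ 0 := by linarith
    have h3 : x - p - 2 ≠ 0 := by linarith
    have h4 : x + p + 2 ≠ 0 := by linarith
    have h5 : x ≠ 0 := by linarith
    rw [e1, e2]
    field_simp
    ring

/-- The absolute value at the endpoints of the iterated bulk of the antiderivative of `e_k`. -/
def endVal (p k : ℕ) : ℝ := 2 * (∏ i ∈ Finset.range p, (2 * (i : ℝ) + 1))
  * ∏ j ∈ Finset.range p, 1 / ((k : ℝ) ^ 2 - ((j : ℝ) + 1) ^ 2)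

/-- After both shifted products are expressed through the product at `k`, the bracket is
`(k+p)(k+p+1) - (k-p)(k-p-1) = 2k(2p+1)`: each integration contributes one odd factor. -/
lemma endVal_succ {p k : ℕ} (h : p + 1 < k) : endVal (p + 1) k
    = endVal p (k - 1) / (2 * ((k : ℝ) - 1)) - endVal p (k + 1) / (2 * ((k : ℝ) + 1)) := by
  have hk : (p : ℝ) + 1 < k := by exact_mod_cast h
  have h0 : (0 : ℝ) ≤ p := p.cast_nonneg
  have h1 := inv_prod_add_one hk
  have h2 := inv_prod_sub_one hk
  rw [endVal, endVal, endVal, Finset.prod_range_succ (fun i : ℕ => (2 * (i : ℝ) + 1)) p,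
    Nat.cast_sub (by omega)]
  push_cast
  set W := ∏ i ∈ Finset.range p, (2 * (i : ℝ) + 1)
  have e : ∀ a b : ℝ, 2 * W * a / (2 * b) = W * (a / b) := fun a b => by
    rw [mul_assoc 2 W a, mul_div_mul_left _ _ two_ne_zero, mul_div_assoc]
  rw [e, e, h1, h2]
  have h5 : (k : ℝ) ≠ 0 := by linarith
  field_simp
  ring

variable {𝕜 : Type*} [RCLike 𝕜]

lemma cheb_bulk_one {p k : ℕ} (h : p < k) :
    cheb (bulk p k : L1 𝕜) 1 = (((-1) ^ p * endVal p k : ℝ) : 𝕜) := by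
  induction p generalizing k with
  | zero =>
    rw [bulk, cheb_e, chT_one, wt_of_ne (by omega)]
    simp [endVal]
  | succ p ih =>
    rw [bulk, cheb_sub _ _ one_mem_seg, cheb_smul _ _ one_mem_seg, cheb_smul _ _ one_mem_seg,
      ih (by omega), ih (by omega), endVal_succ h, ← RCLike.ofReal_mul,
      ← RCLike.ofReal_mul, ← RCLike.ofReal_sub]
    congr 1
    ring

lemma cheb_bulk_neg_one {p k : ℕ} (h : p < k) :
    cheb (bulk p k : L1 𝕜) (-1) = (((-1) ^ k * endVal p k : ℝ) : 𝕜) := by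
  induction p generalizing k with
  | zero =>
    rw [bulk, cheb_e, chT_neg_one, wt_of_ne (by omega)]
    simp [endVal]
    ring
  | succ p ih =>
    rw [bulk, cheb_sub _ _ neg_one_mem_seg, cheb_smul _ _ neg_one_mem_seg,
      cheb_smul _ _ neg_one_mem_seg,
      ih (by omega), ih (by omega), endVal_succ h, ← RCLike.ofReal_mul,
      ← RCLike.ofReal_mul, ← RCLike.ofReal_sub]
    congr 1
    have : (-1 : ℝ) ^ (k - 1) = -(-1) ^ k := by
      obtain ⟨l, rfl⟩ : ∃ l, k = l + 1 := ⟨k - 1, by omega⟩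
      rw [Nat.add_sub_cancel]; ring
    rw [this]
    ring

lemma endVal_pos {p k : ℕ} (h : p < k) : 0 < endVal p k := by
  have h1 : ∀ j ∈ Finset.range p, 0 < 1 / ((k : ℝ) ^ 2 - ((j : ℝ) + 1) ^ 2) := fun j hj => by
    have := sq_sub_pos (p := j + 1) (k := k) (by have := Finset.mem_range.1 hj; omega)
    push_cast at this
    positivity
  have := Finset.prod_pos h1
  have h2 : 0 < ∏ i ∈ Finset.range p, (2 * (i : ℝ) + 1) := Finset.prod_pos fun i _ => by positivity
  rw [endVal]
  positivity

lemma prod_odd_le {q : ℕ} (hq : 1 ≤ q) {x : ℝ} (hx : 5 ≤ x) :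
    2 * ∏ i ∈ Finset.range q, (2 * (i : ℝ) + 1)
      ≤ 5 / 12 * ∏ j ∈ Finset.range q, (x + 2 * (j : ℝ) + 2) := by
  induction q, hq using Nat.le_induction with
  | base => simp; linarith
  | succ q hq ih =>
    rw [Finset.prod_range_succ, Finset.prod_range_succ, ← mul_assoc, ← mul_assoc]
    have : 0 ≤ ∏ j ∈ Finset.range q, (x + 2 * (j : ℝ) + 2) :=
      Finset.prod_nonneg fun i _ => by positivity
    refine mul_le_mul ih (by linarith) (by positivity) (by positivity)

lemma prod_odd_mul_le {q : ℕ} (hq : 1 ≤ q) {x : ℝ} (hx : 5 ≤ x) :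
    2 * (∏ i ∈ Finset.range q, (2 * (i : ℝ) + 1)) * x
      ≤ 5 / 12 * ∏ j ∈ Finset.range (q + 1), (x + 2 * (j : ℝ) + 1) := by
  induction q, hq using Nat.le_induction with
  | base => simp [Finset.prod_range_succ]; nlinarith
  | succ q hq ih =>
    rw [Finset.prod_range_succ, Finset.prod_range_succ _ (q + 1), ← mul_assoc, ← mul_assoc,
      mul_right_comm]
    have : 0 ≤ ∏ j ∈ Finset.range (q + 1), (x + 2 * (j : ℝ) + 1) :=
      Finset.prod_nonneg fun i _ => by positivity
    push_cast
    refine mul_le_mul ih (by linarith) (by positivity) (by positivity)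

/-- Reversing the second half matches its largest odd factor with `j = 0`. In `endVal_le` each such
factor is then bounded by the corresponding decreasing factor `k - 2j - 2` or `k - 2j - 1`. -/
lemma prod_odd_add (a b : ℕ) : ∏ i ∈ Finset.range (a + b), (2 * (i : ℝ) + 1)
    = (∏ i ∈ Finset.range a, (2 * (i : ℝ) + 1))
      * ∏ j ∈ Finset.range b, (2 * ((a + (b - 1 - j) : ℕ) : ℝ) + 1) := by
  rw [Finset.prod_range_add]
  congr 1
  rw [← Finset.prod_range_reflect]

/-- The endpoint value has the factors `k² - i²` for all `1 ≤ i ≤ 2q` in its denominator, while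
`γ_{2q,k}` has those with `i` odd; the even ones remain and split as `(k - i)(k + i)`. -/
lemma endVal_even {q k : ℕ} (h : 4 * q + 1 ≤ k) :
    endVal (2 * q) k * ∏ j ∈ Finset.range q, (((k : ℝ) - 2 * j - 2) * (k + 2 * j + 2))
      = 2 * (∏ i ∈ Finset.range (2 * q), (2 * (i : ℝ) + 1)) * gam (2 * q) k := by
  rw [endVal, mul_assoc]
  congr 1
  induction q with
  | zero => simp [gam_zero]
  | succ q ih =>
    have hk : (4 * q + 5 : ℝ) ≤ k := by exact_mod_cast h
    have h0 : (0 : ℝ) ≤ q := q.cast_nonneg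
    rw [show 2 * (q + 1) = 2 * q + 1 + 1 by ring, inv_prod_succ, inv_prod_succ, Finset.prod_range_succ,
      gam_add_two, ← ih (by omega)]
    push_cast
    have e2 : (k : ℝ) ^ 2 - (2 * q + 1 + 1) ^ 2 = (k - 2 * q - 2) * (k + 2 * q + 2) := by ring
    have h1 : (k : ℝ) ^ 2 - (2 * q + 1) ^ 2 ≠ 0 := by nlinarith
    have h2 : (k : ℝ) - 2 * q - 2 ≠ 0 := by linarith
    have h3 : (k : ℝ) + 2 * q + 2 ≠ 0 := by linarith
    rw [e2]
    field_simp

lemma endVal_odd {q k : ℕ} (h : 4 * q + 3 ≤ k) :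
    endVal (2 * q + 1) k * ∏ j ∈ Finset.range (q + 1), (((k : ℝ) - 2 * j - 1) * (k + 2 * j + 1))
      = 2 * (∏ i ∈ Finset.range (2 * q + 1), (2 * (i : ℝ) + 1)) * (k * gam (2 * q + 1) k) := by
  rw [endVal, mul_assoc]
  congr 1
  induction q with
  | zero =>
    have hk : (3 : ℝ) ≤ k := by exact_mod_cast h
    have h1 : (k : ℝ) ^ 2 - 1 ≠ 0 := by nlinarith
    have h2 : (k : ℝ) ≠ 0 := by linarith
    simp [gam_one]
    field_simp
    ring
  | succ q ih =>
    have hk : (4 * q + 7 : ℝ) ≤ k := by exact_mod_cast h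
    have h0 : (0 : ℝ) ≤ q := q.cast_nonneg
    rw [show 2 * (q + 1) + 1 = 2 * q + 1 + 1 + 1 by ring, inv_prod_succ (2 * q + 1 + 1),
      inv_prod_succ (2 * q + 1), Finset.prod_range_succ _ (q + 1), gam_add_two, ← mul_div_assoc,
      ← ih (by omega)]
    push_cast
    have e2 : (k : ℝ) ^ 2 - (2 * q + 1 + 1 + 1) ^ 2
        = (k - 2 * (q + 1) - 1) * (k + 2 * (q + 1) + 1) := by ring
    have h1 : (k : ℝ) ^ 2 - (2 * q + 1 + 1) ^ 2 ≠ 0 := by nlinarith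
    have h2 : (k : ℝ) - 2 * (q + 1) - 1 ≠ 0 := by linarith
    have h3 : (k : ℝ) + 2 * (q + 1) + 1 ≠ 0 := by linarith
    rw [e2]
    field_simp

/-- After division by `γ_{p,k}` there remain the odd numbers up to `2p - 1` against factors `k ± i`.
The upper odd numbers are dominated by the `k - i`, because `2p + 1 ≤ k`, and the lower ones by the
`k + i`, with room to spare. -/
lemma endVal_le {p k : ℕ} (hp : 1 ≤ p) (h : 2 * p + 1 ≤ k) (hk : 5 ≤ k) :
    endVal p k ≤ 5 / 12 * gam p k := by
  have hk' : (5 : ℝ) ≤ k := by exact_mod_cast hk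
  have hg := gam_pos (p := p) (k := k) (by omega)
  rcases Nat.even_or_odd' p with ⟨q, rfl | rfl⟩
  · have hD : 0 < ∏ j ∈ Finset.range q, (((k : ℝ) - 2 * j - 2) * (k + 2 * j + 2)) :=
      Finset.prod_pos fun j hj => by
        have h1 : (2 * j + 2 : ℝ) < k := by
          exact_mod_cast (by have := Finset.mem_range.1 hj; omega : 2 * j + 2 < k)
        have : (0 : ℝ) < k - 2 * j - 2 := by linarith
        positivity
    refine le_of_mul_le_mul_right ?_ hD
    rw [endVal_even (by omega), mul_right_comm (5 / 12 : ℝ)]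
    refine mul_le_mul_of_nonneg_right ?_ hg.le
    rw [two_mul q, prod_odd_add, Finset.prod_mul_distrib, ← mul_assoc,
      mul_comm (∏ j ∈ Finset.range q, ((k : ℝ) - 2 * j - 2)), ← mul_assoc]
    refine mul_le_mul (prod_odd_le (by omega) hk') (Finset.prod_le_prod (fun _ _ => by positivity)
      fun j hj => ?_) (Finset.prod_nonneg fun _ _ => by positivity)
      (mul_nonneg (by norm_num) (Finset.prod_nonneg fun _ _ => by positivity))
    have := Finset.mem_range.1 hj
    have h2 : ((2 * (q + (q - 1 - j)) + 1 + 2 * j + 2 : ℕ) : ℝ) ≤ k := by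
      exact_mod_cast (by omega : 2 * (q + (q - 1 - j)) + 1 + 2 * j + 2 ≤ k)
    push_cast at h2 ⊢
    linarith
  · have hD : 0 < ∏ j ∈ Finset.range (q + 1), (((k : ℝ) - 2 * j - 1) * (k + 2 * j + 1)) :=
      Finset.prod_pos fun j hj => by
        have h1 : (2 * j + 1 : ℝ) < k := by
          exact_mod_cast (by have := Finset.mem_range.1 hj; omega : 2 * j + 1 < k)
        have : (0 : ℝ) < k - 2 * j - 1 := by linarith
        positivity
    refine le_of_mul_le_mul_right ?_ hD
    rw [endVal_odd (by omega), mul_right_comm (5 / 12 : ℝ), ← mul_assoc]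
    refine mul_le_mul_of_nonneg_right ?_ hg.le
    -- The case `p = 1` determines the constant: the inequality is `2/(k² - 1) ≤ (5/12)/k`, an
    -- equality at `k = 5`.
    rcases Nat.eq_zero_or_pos q with rfl | hq
    · simp
      nlinarith
    · rw [show 2 * q + 1 = q + (q + 1) by ring, prod_odd_add, Finset.prod_mul_distrib, ← mul_assoc,
        mul_comm (∏ j ∈ Finset.range (q + 1), ((k : ℝ) - 2 * j - 1)), ← mul_assoc, mul_right_comm]
      refine mul_le_mul (prod_odd_mul_le hq hk') (Finset.prod_le_prod (fun _ _ => by positivity)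
        fun j hj => ?_) (Finset.prod_nonneg fun _ _ => by positivity)
        (mul_nonneg (by norm_num) (Finset.prod_nonneg fun _ _ => by positivity))
      have := Finset.mem_range.1 hj
      have h2 : ((2 * (q + (q + 1 - 1 - j)) + 1 + 2 * j + 1 : ℕ) : ℝ) ≤ k := by
        exact_mod_cast (by omega : 2 * (q + (q + 1 - 1 - j)) + 1 + 2 * j + 1 ≤ k)
      push_cast at h2 ⊢
      linarith

lemma norm_cheb_bulk_endpoint_le {p k : ℕ} (hp : 1 ≤ p) (h : 2 * p + 1 ≤ k) (hk : 5 ≤ k) :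
    ‖cheb (bulk p k : L1 𝕜) (-1)‖ ≤ 5 / 12 * gam p k ∧ ‖cheb (bulk p k : L1 𝕜) 1‖ ≤ 5 / 12 * gam p k := by
  have h0 := endVal_pos (p := p) (k := k) (by omega)
  rw [cheb_bulk_one (by omega), cheb_bulk_neg_one (by omega), RCLike.norm_ofReal, RCLike.norm_ofReal,
    abs_mul, abs_mul, abs_of_pos h0]
  simpa using endVal_le hp h hk

/-- The polynomial part of the iterated antiderivatives. -/
lemma exists_antiderL_pow_bulk (j : ℕ) {p k : ℕ} (h : p + j < k) :
    ∃ Q : L1 𝕜, SuppLt j Q ∧ (antiderL ^ j) (bulk p k) = bulk (p + j) k + Q := by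
  have h1 : ∀ {p k : ℕ}, p + 1 < k →
      ∃ c : 𝕜, antiderL (bulk p k : L1 𝕜) = bulk (p + 1) k + c • L1.e 0 := by
    intro p
    induction p with
    | zero =>
      intro k hk
      obtain ⟨l, rfl⟩ : ∃ l, k = l + 2 := ⟨k - 2, by omega⟩
      refine ⟨((antiderCoef l : ℝ) : 𝕜), (antider_e_add_two l).trans ?_⟩
      rw [show bulk (0 + 1) (l + 2) = ((1 / (2 * (((l + 2 : ℕ) : ℝ) + 1)) : ℝ) : 𝕜) • L1.e (l + 2 + 1)
        - ((1 / (2 * (((l + 2 : ℕ) : ℝ) - 1)) : ℝ) : 𝕜) • L1.e (l + 2 - 1) from rfl]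
      have e1 : ((l + 2 : ℕ) : ℝ) + 1 = l + 3 := by push_cast; ring
      have e2 : ((l + 2 : ℕ) : ℝ) - 1 = l + 1 := by push_cast; ring
      rw [e1, e2, show l + 2 - 1 = l + 1 from rfl]
      abel
    | succ p ih =>
      intro k hk
      obtain ⟨c, hc⟩ := ih (k := k + 1) (by omega)
      obtain ⟨c', hc'⟩ := ih (k := k - 1) (by omega)
      refine ⟨((1 / (2 * ((k : ℝ) + 1)) : ℝ) : 𝕜) * c - ((1 / (2 * ((k : ℝ) - 1)) : ℝ) : 𝕜) * c', ?_⟩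
      conv_lhs => rw [bulk]
      conv_rhs => rw [bulk]
      rw [map_sub, map_smul, map_smul, hc, hc']
      module
  induction j with
  | zero => exact ⟨0, fun _ _ => rfl, by simp⟩
  | succ j ih =>
    obtain ⟨Q, hQ, h2⟩ := ih (by omega)
    obtain ⟨c, hc⟩ := h1 (p := p + j) (k := k) (by omega)
    refine ⟨c • L1.e 0 + antiderL Q, ((suppLt_e (by omega)).smul c).add hQ.antiderL, ?_⟩
    rw [pow_succ', mul_apply_eq_comp, h2, map_add, hc]
    rw [← add_assoc, add_assoc p j 1]

/-- Integrating `bulk p k` `j` times gives `bulk (p + j) k` up to a polynomial of degree `< j`,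
which `j` differentiations remove. -/
lemma dx_cheb_bulk {j p k : ℕ} (h : p + j < k) {x : ℝ} (hx : x ∈ seg) :
    dx j (cheb (bulk (p + j) k : L1 𝕜)) x = cheb (bulk p k : L1 𝕜) x := by
  obtain ⟨Q, hQ, h2⟩ := exists_antiderL_pow_bulk (𝕜 := 𝕜) j h
  have h3 := (dx_cheb_antiderL_pow_sub (bulk p k) Q j hQ).2 j le_rfl x hx
  rw [h2, add_sub_cancel_right, Nat.sub_self] at h3
  have h4 : (derL j ^ j) Q = 0 := by
    ext n
    exact suppLt_derL_pow hQ j n (by omega)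
  rw [h3, h4]
  simp

end BoundaryValues

end GegenbauerStability

end

open scoped ENNReal NNReal

noncomputable section

namespace GegenbauerStability

/-! ### Finite matrices as operators on `ℓ¹₁`. -/

section Matrices

variable {𝕜 : Type*} [RCLike 𝕜] {d : ℕ}

/-- A sequence supported on the first `d` indices. -/
def ofFin (y : Fin d → 𝕜) : L1 𝕜 := ∑ a, y a • L1.e (a : ℕ)

lemma ofFin_apply (y : Fin d → 𝕜) (n : ℕ) : (ofFin y) n = if h : n < d then y ⟨n, h⟩ else 0 := by
  rw [ofFin, L1.finset_sum_apply]
  simp only [L1.smul_apply, L1.e_apply, mul_ite, mul_one, mul_zero]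
  split_ifs with h
  · rw [Finset.sum_eq_single ⟨n, h⟩]
    · simp
    · intro b _ hb
      rw [if_neg fun h => hb (Fin.ext h.symm)]
    · simp
  · refine Finset.sum_eq_zero fun b _ => if_neg ?_
    have := b.2
    omega

@[simp] lemma ofFin_apply_fin (y : Fin d → 𝕜) (n : Fin d) : (ofFin y) n = y n := by
  rw [ofFin_apply, dif_pos n.2]

lemma suppLt_ofFin (y : Fin d → 𝕜) : SuppLt d (ofFin y) :=
  fun n hn => by rw [ofFin_apply, dif_neg (by omega)]

lemma SuppLt.eq_ofFin {U : L1 𝕜} (h : SuppLt d U) : U = ofFin fun a : Fin d => U a := by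
  ext n
  rw [ofFin_apply]
  split_ifs with hn
  · rfl
  · exact h n (by omega)

lemma norm_ofFin (y : Fin d → 𝕜) : ‖ofFin y‖ = ∑ a : Fin d, wt a * ‖y a‖ := by
  rw [L1.norm_eq, tsum_eq_sum (s := Finset.range d)]
  · rw [Finset.sum_range]
    simp
  · intro n hn
    rw [ofFin_apply, dif_neg (by simpa using hn)]
    simp

/-- A finite matrix as an operator on `ℓ¹₁`. -/
def embL (M : Matrix (Fin d) (Fin d) 𝕜) : L1 𝕜 →L[𝕜] L1 𝕜 :=
  ∑ a, ∑ b, (M a b • L1.coord (b : ℕ)).smulRight (L1.e (a : ℕ))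

lemma embL_apply (M : Matrix (Fin d) (Fin d) 𝕜) (U : L1 𝕜) :
    embL M U = ofFin (M.mulVec fun b => U b) := by
  simp only [embL, sum_apply, ContinuousLinearMap.smulRight_apply, ofFin, Matrix.mulVec, dotProduct]
  simp [Finset.sum_smul]

lemma coe_embL (M : Matrix (Fin d) (Fin d) 𝕜) (U : L1 𝕜) : emb M (U : ℕ → 𝕜) = (embL M U : L1 𝕜) := by
  funext n
  rw [embL_apply, ofFin_apply]
  rfl

lemma opNorm_emb (M : Matrix (Fin d) (Fin d) 𝕜) : opNorm (emb M) = ENNReal.ofReal ‖embL M‖ :=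
  L1.opNorm_eq (coe_embL M)

lemma coe_matNorm (M : Matrix (Fin d) (Fin d) 𝕜) : (matNorm M : ℝ) = ‖embL M‖ := by
  rw [matNorm, opNorm_emb]
  simp

lemma embL_mul (M M' : Matrix (Fin d) (Fin d) 𝕜) : embL (M * M') = embL M * embL M' := by
  ext U n
  rw [mul_apply_eq_comp, embL_apply, embL_apply, embL_apply]
  simp [Matrix.mulVec_mulVec]

lemma embL_e (M : Matrix (Fin d) (Fin d) 𝕜) (b : Fin d) :
    embL M (L1.e (b : ℕ)) = ofFin fun a => M a b := by
  rw [embL_apply]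
  congr 1
  funext a
  rw [Matrix.mulVec, dotProduct, Finset.sum_eq_single b]
  · simp
  · intro l _ hl
    rw [L1.e_of_ne (fun h => hl (Fin.ext h)), mul_zero]
  · simp

lemma sum_wt_mul_col_le (M : Matrix (Fin d) (Fin d) 𝕜) (b : Fin d) :
    ∑ a : Fin d, wt a * ‖M a b‖ ≤ matNorm M * wt b := by
  rw [← norm_ofFin (fun a => M a b), ← embL_e, coe_matNorm, ← L1.norm_e (𝕜 := 𝕜)]
  exact (embL M).le_opNorm _

end Matrices

section RealSequences

variable {𝕜 : Type*} [RCLike 𝕜]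

/-- A real sequence as a sequence in `𝕜`. -/
def L1.ofRealSeq (U : L1 ℝ) : L1 𝕜 := L1.mk (fun n => (U n : 𝕜)) (by simpa using U.summable)

@[simp] lemma L1.ofRealSeq_apply (U : L1 ℝ) (n : ℕ) : (L1.ofRealSeq U : L1 𝕜) n = (U n : 𝕜) := rfl

lemma L1.ofRealSeq_e (k : ℕ) : (L1.ofRealSeq (L1.e k) : L1 𝕜) = L1.e k := by
  ext n
  rw [ofRealSeq_apply, e_apply, e_apply]
  split_ifs <;> simp

lemma antiderL_ofRealSeq (U : L1 ℝ) :
    antiderL (L1.ofRealSeq U : L1 𝕜) = L1.ofRealSeq (antiderL U) := by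
  ext n
  rcases n with _ | n
  · simp [antider_zero, RCLike.ofReal_tsum, RCLike.real_smul_eq_coe_mul]
  · simp [antider_succ, RCLike.real_smul_eq_coe_mul]

lemma antiderL_pow_ofRealSeq (p : ℕ) (U : L1 ℝ) :
    (antiderL ^ p) (L1.ofRealSeq U : L1 𝕜) = L1.ofRealSeq ((antiderL ^ p) U) := by
  induction p with
  | zero => rfl
  | succ p ih => rw [pow_succ', mul_apply_eq_comp, ih, antiderL_ofRealSeq, pow_succ', mul_apply_eq_comp]

lemma SuppLt.antiderL_pow {d : ℕ} {U : L1 𝕜} (h : SuppLt d U) (p : ℕ) :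
    SuppLt (d + p) ((GegenbauerStability.antiderL ^ p) U) := by
  induction p with
  | zero => exact h
  | succ p ih =>
    rw [pow_succ', mul_apply_eq_comp, ← add_assoc]
    exact ih.antiderL

end RealSequences

/-! ### Reduced boundary conditions and the polynomial part of `𝒦ᵢ`. -/

namespace Problem

variable (P : Problem) {𝕜 : Type*} [RCLike 𝕜] (s : Equiv.Perm (Fin (2 * P.m))) (i : Fin (2 * P.m))

/-- The combination of the boundary conditions that does not see polynomials of degree `< i`. -/
def theta {E : Type*} [NormedAddCommGroup E] [NormedSpace ℝ E] (n : Fin (2 * P.m - i))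
    (v : ℝ → E) : E :=
  ∑ j : Fin (2 * P.m), (P.thetaL s i j n • dx j v (-1) + P.thetaR s i j n • dx j v 1)

lemma theta_eq {E : Type*} [NormedAddCommGroup E] [NormedSpace ℝ E] (n : Fin (2 * P.m - i))
    (v : ℝ → E) : P.theta s i n v = P.bc (s (P.highIdx i n)) v
      - ∑ p : Fin (i : ℕ), (P.B21 s i * (P.B11 s i)⁻¹) n p • P.bc (s (P.lowIdx i p)) v := by
  simp only [theta, bc, thetaL, thetaR, sub_smul, Finset.sum_smul, Finset.smul_sum,
    smul_add, mul_smul]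
  rw [Finset.sum_comm, ← Finset.sum_sub_distrib]
  refine Finset.sum_congr rfl fun j _ => ?_
  rw [Finset.sum_add_distrib]
  abel

/-- `theta` on polynomials. -/
def thetaQ (n : Fin (2 * P.m - i)) : L1 𝕜 →L[𝕜] 𝕜 := P.bcQ (s (P.highIdx i n))
  - ∑ p : Fin (i : ℕ), (((P.B21 s i * (P.B11 s i)⁻¹) n p : ℝ) : 𝕜) • P.bcQ (s (P.lowIdx i p))

lemma theta_cheb_of_suppLt (n : Fin (2 * P.m - i)) {Q : L1 𝕜} (hQ : SuppLt (2 * P.m) Q) :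
    P.theta s i n (cheb (Q : ℕ → 𝕜)) = P.thetaQ s i n Q := by
  simp [theta_eq, thetaQ, P.bc_cheb_of_suppLt _ hQ, RCLike.real_smul_eq_coe_mul, sum_apply]

lemma bcQ_of_suppLt_low (k : Fin (2 * P.m)) {Q : L1 𝕜} (hQ : SuppLt i Q) :
    P.bcQ k Q = ∑ q : Fin (i : ℕ), ((P.bcMat k (P.lowIdx i q) : ℝ) : 𝕜) * Q q := by
  conv_lhs => rw [hQ.eq_ofFin, ofFin, map_sum]
  refine Finset.sum_congr rfl fun q _ => ?_
  rw [map_smul, smul_eq_mul, mul_comm, ← P.bcQ_e k (P.lowIdx i q)]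
  rfl

variable {P s i}

/-- Block elimination: the row operation subtracts `ℬ₂₁ ℬ₁₁⁻¹` times the first rows, which clears
the first `i` columns. -/
lemma thetaQ_of_suppLt_low (hs : IsUnit (P.B11 s i)) (n : Fin (2 * P.m - i)) {Q : L1 𝕜}
    (hQ : SuppLt i Q) : P.thetaQ s i n Q = 0 := by
  have h1 : P.B21 s i * (P.B11 s i)⁻¹ * P.B11 s i = P.B21 s i := by
    rw [Matrix.mul_assoc, Matrix.nonsing_inv_mul _ ((Matrix.isUnit_iff_isUnit_det _).1 hs),
      Matrix.mul_one]
  simp only [thetaQ, sub_apply, sum_apply, smul_apply,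
    P.bcQ_of_suppLt_low i _ hQ, smul_eq_mul, Finset.mul_sum, ← mul_assoc]
  rw [Finset.sum_comm, sub_eq_zero]
  refine Finset.sum_congr rfl fun q _ => ?_
  rw [← Finset.sum_mul]
  congr 1
  have h2 := congrFun (congrFun h1 n) q
  rw [Matrix.mul_apply] at h2
  simp only [← RCLike.ofReal_mul, ← RCLike.ofReal_sum]
  congr 1
  exact h2.symm

variable (P) in
lemma coe_antiderProj_sub (p : ℕ) (U : L1 𝕜) : ∃ Q : L1 𝕜, SuppLt p Q ∧
    antiderProj p (U : ℕ → 𝕜) = ((antiderL ^ p) U - Q : L1 𝕜) :=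
  ⟨_, SuppLt.sum fun n _ => (suppLt_e n.2).smul _, coe_antiderProj p U⟩

/-- The truncation in `antiderProj` removes only a polynomial of degree `< i`, invisible to `theta`;
so `BKmat` may be computed from the full power of the antiderivative. -/
lemma thetaQ_antiderL_e (hs : IsUnit (P.B11 s i)) (n l : Fin (2 * P.m - i)) :
    P.thetaQ s i n ((antiderL ^ (i : ℕ)) (L1.e (l : ℕ)) : L1 𝕜) = ((P.BKmat s i n l : ℝ) : 𝕜) := by
  have hsupp : SuppLt (2 * P.m) ((antiderL ^ (i : ℕ)) (L1.e (l : ℕ)) : L1 ℝ) := by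
    refine ((suppLt_e (Nat.lt_succ_self _)).antiderL_pow i).mono ?_
    have := l.2
    omega
  have h1 : P.BKmat s i n l = P.thetaQ s i n ((antiderL ^ (i : ℕ)) (L1.e (l : ℕ)) : L1 ℝ) := by
    rw [BKmat, Matrix.of_apply, BK, ← L1.coe_e]
    obtain ⟨Q, hQ, h⟩ := coe_antiderProj_sub (i : ℕ) (L1.e (l : ℕ) : L1 ℝ)
    rw [h]
    have h2 : SuppLt (2 * P.m) ((antiderL ^ (i : ℕ)) (L1.e (l : ℕ)) - Q) := fun k hk => by
      rw [L1.sub_apply, hsupp k hk, hQ k (by have := i.2; omega), sub_zero]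
    refine (P.theta_cheb_of_suppLt s i n h2).trans ?_
    rw [map_sub, thetaQ_of_suppLt_low hs n hQ, sub_zero]
  rw [h1, ← L1.ofRealSeq_e, antiderL_pow_ofRealSeq]
  clear h1
  generalize ((antiderL ^ (i : ℕ)) (L1.e (l : ℕ)) : L1 ℝ) = Z at hsupp ⊢
  have hsupp' : SuppLt (2 * P.m) (L1.ofRealSeq Z : L1 𝕜) :=
    fun k hk => by rw [L1.ofRealSeq_apply, hsupp k hk, RCLike.ofReal_zero]
  simp [thetaQ, sum_apply, P.bcQ_eq _ hsupp, P.bcQ_eq _ hsupp']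

lemma thetaQ_antiderL (hs : IsUnit (P.B11 s i)) (n : Fin (2 * P.m - i)) {W : L1 𝕜}
    (hW : SuppLt (2 * P.m - i) W) : P.thetaQ s i n ((antiderL ^ (i : ℕ)) W)
      = ∑ l : Fin (2 * P.m - i), ((P.BKmat s i n l : ℝ) : 𝕜) * W l := by
  conv_lhs => rw [hW.eq_ofFin, ofFin, map_sum, map_sum]
  refine Finset.sum_congr rfl fun l _ => ?_
  rw [map_smul, map_smul, thetaQ_antiderL_e hs, smul_eq_mul, mul_comm]

lemma forall_of_low_high {p : Fin (2 * P.m) → Prop} (h1 : ∀ q, p (s (P.lowIdx i q)))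
    (h2 : ∀ n, p (s (P.highIdx i n))) (k : Fin (2 * P.m)) : p k := by
  obtain ⟨l, rfl⟩ := s.surjective k
  by_cases hl : (l : ℕ) < i
  · exact h1 ⟨l, hl⟩
  · have h3 := h2 ⟨l - i, by have := l.2; omega⟩
    have h4 : P.highIdx i ⟨l - i, by have := l.2; omega⟩ = l := by
      ext
      simp only [highIdx]
      omega
    rwa [h4] at h3

/-- From a kernel vector `w`, take its `i`-fold antiderivative and choose a polynomial `c` of degree
`< i` so that the first `i` boundary conditions hold. The remaining ones hold because `w` is in the
kernel. Well-posedness forces the sum to vanish, and its `i`-th derivative is `w`. -/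
lemma isUnit_BKmat (hwell : IsUnit P.bcMat) (hs : IsUnit (P.B11 s i)) : IsUnit (P.BKmat s i) := by
  rw [Matrix.isUnit_iff_isUnit_det, isUnit_iff_ne_zero]
  intro hdet
  obtain ⟨w, hw0, hw⟩ := Matrix.exists_mulVec_eq_zero_iff.2 hdet
  refine hw0 ?_
  have hWs := suppLt_ofFin w
  set W : L1 ℝ := ofFin w with hWdef
  have hSW : SuppLt (2 * P.m) ((antiderL ^ (i : ℕ)) W) :=
    (hWs.antiderL_pow i).mono (by have := i.2; omega)
  set c := ((P.B11 s i)⁻¹).mulVec fun p => -P.bcQ (s (P.lowIdx i p)) ((antiderL ^ (i : ℕ)) W)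
    with hc
  have hcs := suppLt_ofFin c
  have hBc : (P.B11 s i).mulVec c
      = fun p => -P.bcQ (s (P.lowIdx i p)) ((antiderL ^ (i : ℕ)) W) := by
    rw [hc, Matrix.mulVec_mulVec, Matrix.mul_nonsing_inv _ ((Matrix.isUnit_iff_isUnit_det _).1 hs),
      Matrix.one_mulVec]
  have hcs' : SuppLt (2 * P.m) (ofFin c) := hcs.mono i.2.le
  have hlow : ∀ p, P.bcQ (s (P.lowIdx i p)) ((antiderL ^ (i : ℕ)) W + ofFin c) = 0 := fun p => by
    have h1 := congrFun hBc p
    rw [map_add, P.bcQ_of_suppLt_low i _ hcs]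
    simp only [Matrix.mulVec, dotProduct, B11, Matrix.of_apply] at h1
    simp only [ofFin_apply_fin, RCLike.ofReal_real_eq_id, id]
    rw [h1, add_neg_cancel]
  have hhigh : ∀ n, P.bcQ (s (P.highIdx i n)) ((antiderL ^ (i : ℕ)) W + ofFin c) = 0 := fun n => by
    have h1 : P.thetaQ s i n ((antiderL ^ (i : ℕ)) W + ofFin c) = 0 := by
      rw [map_add, thetaQ_of_suppLt_low hs n hcs, add_zero, thetaQ_antiderL hs n hWs]
      simpa [hWdef, Matrix.mulVec, dotProduct] using congrFun hw n
    have h2 := h1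
    simpa only [thetaQ, sub_apply, sum_apply, smul_apply, hlow, smul_zero, Finset.sum_const_zero,
      sub_zero] using h2
  have hZ : (antiderL ^ (i : ℕ)) W + ofFin c = 0 := by
    have := eq_polyL_of_bcQ hwell (U := 0) (hSW.add hcs')
      (forall_of_low_high (s := s) (i := i) (fun q => by rw [hlow, map_zero])
        fun n => by rw [hhigh, map_zero])
    rw [this, map_zero]
  have hW0 : W = 0 := by
    refine cheb_injective fun x hx => ?_
    have h1 := (dx_cheb_antiderL_pow_sub W (-ofFin c) i (d := i)
      (fun n hn => by rw [L1.neg_apply, hcs n hn, neg_zero])).2 i le_rfl x hx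
    have h4 : (derL i ^ (i : ℕ)) (-ofFin c : L1 ℝ) = 0 := by
      ext n
      exact suppLt_derL_pow (d := i) (fun n hn => by rw [L1.neg_apply, hcs n hn, neg_zero]) i n
        (by omega)
    rw [h4, sub_neg_eq_add, hZ, Nat.sub_self] at h1
    have h5 := dx_cheb_of_suppLt (𝕜 := ℝ) (Q := 0) (d := 0) (fun _ _ => rfl) i hx
    rw [map_zero] at h5
    rw [h5] at h1
    simpa using h1.symm
  funext l
  have := ofFin_apply_fin w l
  rw [← hWdef, hW0] at this
  exact this.symm

/-- `𝒦ᵢ e_k` is the bulk of the antiderivative, up to a polynomial of degree `< 2m - i`. -/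
lemma exists_KiL_e_eq (P : Problem) {k : ℕ} (hk : 2 * P.m < k) : ∃ w : L1 𝕜, SuppLt (2 * P.m) w ∧
    ∀ i ≤ 2 * P.m, P.KiL i (L1.e k)
      = (P.sgn : 𝕜) • (bulk (2 * P.m - i) k + (derL (2 * P.m) ^ i) w) := by
  obtain ⟨Q, hQ, h⟩ := exists_antiderL_pow_bulk (𝕜 := 𝕜) (p := 0) (2 * P.m) (k := k) (by omega)
  refine ⟨Q - P.polyL (L1.e k), fun n hn => by
    rw [L1.sub_apply, hQ n hn, P.suppLt_polyL _ n hn, sub_zero], fun i hi => ?_⟩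
  have h1 : bulk (2 * P.m - i) k
      = (antiderL ^ (2 * P.m - i)) (L1.e k) - (derL (2 * P.m) ^ i) Q := by
    refine cheb_injective fun x hx => ?_
    have h2 := (dx_cheb_antiderL_pow_sub (L1.e k) Q (2 * P.m) hQ).2 i hi x hx
    have h3 := dx_cheb_bulk (𝕜 := 𝕜) (j := i) (p := 2 * P.m - i) (k := k) (by omega) hx
    rw [show 2 * P.m - i + i = 0 + 2 * P.m by omega] at h3
    rw [← h2, ← h3, eq_sub_of_add_eq h.symm]
    rfl
  rw [KiL_apply, h1, map_sub]
  congr 1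
  abel

lemma eta_sub_nonneg_sum (s : Equiv.Perm (Fin (2 * P.m))) (i : Fin (2 * P.m)) (k : ℕ) :
    P.eta s i k - gam (2 * P.m - i) k = (matNorm (P.BKmat s i)⁻¹ : ℝ) *
    ∑ n : Fin (2 * P.m - i), ∑ j : Fin (2 * P.m),
      (|P.thetaL s i j n| + |P.thetaR s i j n|) * gam (2 * P.m - j) k := by
  rw [eta, add_sub_cancel_left]

/-- The boundary values of the polynomial correction `w` must cancel those of the bulk. The reduced
conditions see `w` only through `W = ∂ₓ^i w`, so `W` solves a linear system with matrix `BKmat`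
whose right-hand side consists of endpoint values of bulks, bounded by `endVal_le`. -/
lemma norm_low_le (hwell : IsUnit P.bcMat) (hs : IsUnit (P.B11 s i)) {k : ℕ} (hk : 4 * P.m < k)
    {w : L1 𝕜} (hw : SuppLt (2 * P.m) w)
    (h : ∀ i ≤ 2 * P.m, P.KiL i (L1.e k)
      = (P.sgn : 𝕜) • (bulk (2 * P.m - i) k + (derL (2 * P.m) ^ i) w)) :
    ‖(derL (2 * P.m) ^ (i : ℕ)) w‖ ≤ 5 / 6 * (P.eta s i k - gam (2 * P.m - i) k) := by
  have hm := P.one_le_m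
  set W := (derL (2 * P.m) ^ (i : ℕ)) w with hW
  have hWs : SuppLt (2 * P.m - i) W := suppLt_derL_pow hw i
  obtain ⟨Q, hQ, hQw⟩ := exists_cheb_of_dx
    (by simpa using (dx_cheb_antiderL_pow_sub (0 : L1 𝕜) (-w) (i : ℕ)
      (d := 2 * P.m) (fun n hn => by rw [L1.neg_apply, hw n hn, neg_zero])).1)
    (U := W) (fun x hx => dx_cheb_of_suppLt hw i hx)
  have hw' : w = (antiderL ^ (i : ℕ)) W - Q := cheb_injective hQw
  set b : Fin (2 * P.m - i) → 𝕜 := fun n => -P.theta s i n (cheb (bulk (2 * P.m) k : L1 𝕜)) with hb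
  have h1 : ∀ n, ∑ l : Fin (2 * P.m - i), ((P.BKmat s i n l : ℝ) : 𝕜) * W l = b n := fun n => by
    rw [← thetaQ_antiderL hs n hWs, ← sub_zero (P.thetaQ s i n _), ← thetaQ_of_suppLt_low hs n hQ,
      ← map_sub, ← hw', ← P.theta_cheb_of_suppLt s i n hw]
    have h2 : P.theta s i n (cheb (P.LinvL (L1.e k) : L1 𝕜)) = 0 := by
      rw [theta_eq]
      simp [bc_cheb_LinvL hwell]
    have h3 : P.theta s i n (cheb (P.LinvL (L1.e k) : L1 𝕜))
        = (P.sgn : 𝕜) * (P.theta s i n (cheb (bulk (2 * P.m) k : L1 𝕜))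
          + P.theta s i n (cheb (w : ℕ → 𝕜))) := by
      have h4 : ∀ j : Fin (2 * P.m), ∀ x ∈ seg, dx j (cheb (P.LinvL (L1.e k) : L1 𝕜)) x
          = (P.sgn : 𝕜) * (dx j (cheb (bulk (2 * P.m) k : L1 𝕜)) x + dx j (cheb (w : ℕ → 𝕜)) x) := by
        intro j x hx
        have e2 := dx_cheb_bulk (𝕜 := 𝕜) (j := j) (p := 2 * P.m - j) (k := k) (by omega) hx
        rw [show 2 * P.m - (j : ℕ) + j = 2 * P.m by omega] at e2
        rw [P.dx_cheb_LinvL _ j.2.le hx, h j j.2.le, cheb_smul _ _ hx, cheb_add _ _ hx, e2,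
          dx_cheb_of_suppLt hw j hx]
      simp only [theta, h4 _ _ neg_one_mem_seg, h4 _ _ one_mem_seg, RCLike.real_smul_eq_coe_mul]
      rw [← Finset.sum_add_distrib, Finset.mul_sum]
      refine Finset.sum_congr rfl fun j _ => ?_
      ring
    rw [h3, mul_eq_zero, or_iff_right (norm_ne_zero_iff.1 (by rw [norm_sgn]; norm_num))] at h2
    exact (neg_eq_of_add_eq_zero_right h2).symm
  have hbn : ∀ n, ‖b n‖ ≤ 5 / 12 * ∑ j : Fin (2 * P.m),
      (|P.thetaL s i j n| + |P.thetaR s i j n|) * gam (2 * P.m - j) k := fun n => by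
    rw [hb, norm_neg, theta, Finset.mul_sum]
    refine norm_sum_le_of_le _ fun j _ => ?_
    have hj := j.2
    have e1 : 2 * P.m - (j : ℕ) + j = 2 * P.m := by omega
    have e2 := dx_cheb_bulk (𝕜 := 𝕜) (j := j) (p := 2 * P.m - j) (k := k) (by omega)
      neg_one_mem_seg
    have e3 := dx_cheb_bulk (𝕜 := 𝕜) (j := j) (p := 2 * P.m - j) (k := k) (by omega)
      one_mem_seg
    rw [e1] at e2 e3
    obtain ⟨e4, e5⟩ := norm_cheb_bulk_endpoint_le (𝕜 := 𝕜) (p := 2 * P.m - j) (k := k) (by omega)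
      (by omega) (by omega)
    rw [e2, e3, add_mul, mul_add]
    refine (norm_add_le _ _).trans (add_le_add ?_ ?_)
    · rw [norm_smul, Real.norm_eq_abs, mul_left_comm]
      gcongr
    · rw [norm_smul, Real.norm_eq_abs, mul_left_comm]
      gcongr
  have hinv := Matrix.nonsing_inv_mul _ ((Matrix.isUnit_iff_isUnit_det _).1 (isUnit_BKmat hwell hs))
  have hWl : ∀ l : Fin (2 * P.m - i), W l = ∑ n, (((P.BKmat s i)⁻¹ l n : ℝ) : 𝕜) * b n := fun l => by
    simp only [← h1, Finset.mul_sum, ← mul_assoc]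
    rw [Finset.sum_comm]
    simp only [← Finset.sum_mul, ← RCLike.ofReal_mul, ← RCLike.ofReal_sum, ← Matrix.mul_apply, hinv,
      Matrix.one_apply]
    simp
  calc ‖W‖ = ∑ l : Fin (2 * P.m - i), wt l * ‖W l‖ := by
        conv_lhs => rw [hWs.eq_ofFin, norm_ofFin]
    _ ≤ ∑ l : Fin (2 * P.m - i), ∑ n, wt l * ‖(P.BKmat s i)⁻¹ l n‖ * ‖b n‖ := by
        refine Finset.sum_le_sum fun l _ => ?_
        simp only [mul_assoc, ← Finset.mul_sum]
        refine mul_le_mul_of_nonneg_left ?_ (wt_pos _).le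
        rw [hWl]
        refine norm_sum_le_of_le _ fun n _ => ?_
        rw [norm_mul, RCLike.norm_ofReal, Real.norm_eq_abs]
    _ = ∑ n, (∑ l : Fin (2 * P.m - i), wt l * ‖(P.BKmat s i)⁻¹ l n‖) * ‖b n‖ := by
        rw [Finset.sum_comm]
        simp only [Finset.sum_mul]
    -- A column of index `n` has norm at most `matNorm * wt n`, and `wt n ≤ 2`; together with `5/12`
    -- this gives the factor `5/6`.
    _ ≤ ∑ n : Fin (2 * P.m - i), (matNorm (P.BKmat s i)⁻¹ * 2) * (5 / 12 * ∑ j : Fin (2 * P.m),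
      (|P.thetaL s i j n| + |P.thetaR s i j n|) * gam (2 * P.m - j) k) := by
        refine Finset.sum_le_sum fun n _ => ?_
        refine mul_le_mul ((sum_wt_mul_col_le _ n).trans ?_) (hbn n) (norm_nonneg _) (by positivity)
        gcongr
        exact wt_le_two _
    _ = _ := by
        rw [eta_sub_nonneg_sum, ← Finset.mul_sum, ← Finset.mul_sum]
        ring

end Problem

end GegenbauerStability

end

open scoped ENNReal NNReal

noncomputable section

namespace GegenbauerStability

/-! ### Truncations, and estimates above the index `N`. -/

section Projections

/-- The indicator function of the indices `> N`. -/
def indGt (N n : ℕ) : ℝ := if n ≤ N then 0 else 1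

lemma indGt_nonneg (N n : ℕ) : 0 ≤ indGt N n := by unfold indGt; split_ifs <;> simp

lemma indGt_le_one (N n : ℕ) : indGt N n ≤ 1 := by unfold indGt; split_ifs <;> simp

variable {𝕜 : Type*} [RCLike 𝕜]

/-- The projection `π^{≤ N}` on `ℓ¹₁`. -/
def pL (N : ℕ) : L1 𝕜 →L[𝕜] L1 𝕜 := embL (1 : Matrix (Fin (N + 1)) (Fin (N + 1)) 𝕜)

/-- The projection `π^{> N}` on `ℓ¹₁`. -/
def qL (N : ℕ) : L1 𝕜 →L[𝕜] L1 𝕜 := 1 - pL N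

lemma pL_apply (N : ℕ) (U : L1 𝕜) (n : ℕ) : (pL N U) n = if n ≤ N then U n else 0 := by
  rw [pL, embL_apply, Matrix.one_mulVec, ofFin_apply]
  simp only [Nat.lt_succ_iff, dite_eq_ite]

lemma qL_apply (N : ℕ) (U : L1 𝕜) (n : ℕ) : (qL N U) n = if n ≤ N then 0 else U n := by
  rw [qL, sub_apply, one_apply_eq_self, L1.sub_apply, pL_apply]
  split_ifs <;> simp

lemma coe_qL (N : ℕ) (U : L1 𝕜) : piGt N (U : ℕ → 𝕜) = (qL N U : L1 𝕜) :=
  funext fun n => (qL_apply N U n).symm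

lemma pL_mul_pL (N : ℕ) : (pL N : L1 𝕜 →L[𝕜] L1 𝕜) * pL N = pL N := by
  rw [pL, ← embL_mul, mul_one]

lemma qL_e_of_le {N k : ℕ} (h : k ≤ N) : qL N (L1.e k : L1 𝕜) = 0 := by
  ext n
  rw [qL_apply, L1.e_apply]
  split_ifs <;> first | rfl | omega

lemma qL_e_of_lt {N k : ℕ} (h : N < k) : qL N (L1.e k : L1 𝕜) = L1.e k := by
  ext n
  rw [qL_apply, L1.e_apply]
  split_ifs <;> first | rfl | omega

lemma norm_qL_apply_eq (N : ℕ) (U : L1 𝕜) :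
    ‖qL N U‖ = ∑' n, wt n * (indGt N n * ‖U n‖) := by
  rw [L1.norm_eq]
  refine tsum_congr fun n => ?_
  rw [qL_apply, indGt]
  split_ifs <;> simp

lemma norm_qL_apply_le (N : ℕ) (U : L1 𝕜) : ‖qL N U‖ ≤ ‖U‖ := by
  rw [L1.norm_eq, L1.norm_eq]
  refine Summable.tsum_le_tsum (fun n => ?_) (L1.summable_norm _) U.summable_norm
  refine mul_le_mul_of_nonneg_left ?_ (wt_pos n).le
  rw [qL_apply]
  split_ifs <;> simp

/-- Only the columns above `N` survive, and there the unit sequences have norm `2`; this is the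
origin of the factor `2` in all the column estimates that follow. -/
lemma norm_mul_qL_le {N : ℕ} (M : L1 𝕜 →L[𝕜] L1 𝕜) {C : ℝ} (hC : 0 ≤ C)
    (h : ∀ k, N < k → ‖M (L1.e k)‖ ≤ 2 * C) : ‖M * qL N‖ ≤ C := by
  refine L1.opNorm_le_of_e _ hC fun k => ?_
  rw [mul_apply_eq_comp]
  rcases le_or_gt k N with hk | hk
  · rw [qL_e_of_le hk, map_zero, norm_zero]
    exact mul_nonneg hC (wt_pos k).le
  · rw [qL_e_of_lt hk, wt_of_ne (by omega), mul_comm]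
    exact h k hk

lemma norm_pL_le (N : ℕ) : ‖(pL N : L1 𝕜 →L[𝕜] L1 𝕜)‖ ≤ 1 := by
  refine ContinuousLinearMap.opNorm_le_bound _ zero_le_one fun U => ?_
  rw [one_mul, L1.norm_eq, L1.norm_eq]
  refine Summable.tsum_le_tsum (fun n => ?_) (L1.summable_norm _) U.summable_norm
  refine mul_le_mul_of_nonneg_left ?_ (wt_pos n).le
  rw [pL_apply]
  split_ifs <;> simp

lemma norm_qL_le (N : ℕ) : ‖(qL N : L1 𝕜 →L[𝕜] L1 𝕜)‖ ≤ 1 :=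
  ContinuousLinearMap.opNorm_le_bound _ zero_le_one fun U => by
    rw [one_mul]; exact norm_qL_apply_le N U

lemma convL_e_zero (U : L1 𝕜) : convL (L1.e 0) U = U := by
  refine cheb_injective fun x hx => ?_
  rw [cheb_convL _ _ hx, cheb_e]
  simp [chT]

end Projections

section BulkEstimates

variable {𝕜 : Type*} [RCLike 𝕜]

lemma norm_bulk_le {p k : ℕ} (h : p + 1 < k) : ‖(bulk p k : L1 𝕜)‖ ≤ 2 * (k * gam (p + 1) k) := by
  rw [L1.norm_eq, ← (hasSum_colW h).tsum_eq, ← tsum_mul_left]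
  refine Summable.tsum_le_tsum (fun n => ?_) (L1.summable_norm _) ((hasSum_colW h).summable.mul_left 2)
  exact mul_le_mul (wt_le_two n) (norm_bulk_apply_le (by omega) n) (norm_nonneg _) zero_le_two

lemma mul_gam_succ_le_two {p k : ℕ} (hp : 1 ≤ p) (h : 2 * p < k) :
    (k : ℝ) * gam (p + 1) k ≤ 2 * gam p k := by
  rw [← (hasSum_colW (p := p) (k := k) (by omega)).tsum_eq,
    ← (hasSum_rowW (p := p) (k := k) (by omega)).tsum_eq, ← tsum_mul_left]
  exact Summable.tsum_le_tsum (fun n => colW_le_two_mul h)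
    (hasSum_colW (by omega)).summable ((hasSum_rowW (by omega)).summable.mul_left 2)

/-- The part above `N` of a product of the bulk with a low Chebyshev polynomial. -/
lemma tsum_shift_bulk_le {N p k : ℕ} (hp : 1 ≤ p) (hN : 2 * p ≤ N) (hk : N < k) (i : ℤ)
    (hi : i.natAbs ≤ N) :
    ∑' j : ℤ, indGt N (i + j).natAbs * ‖(bulk p k : L1 𝕜) j.natAbs‖
      ≤ 2 * gam p (N + 1) := by
  obtain ⟨χ, hχ⟩ : ∃ χ : ℤ → ℝ, χ = fun n => indGt N n.natAbs := ⟨_, rfl⟩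
  have h0 : ∀ n, 0 ≤ χ n := fun n => by rw [hχ]; exact indGt_nonneg _ _
  have h1 : ∀ n, χ n ≤ 1 := fun n => by rw [hχ]; exact indGt_le_one _ _
  have hz : ∀ n : ℤ, n.natAbs ≤ N → χ n = 0 := fun n hn => by rw [hχ]; exact if_pos hn
  have hs := summable_int_norm (bulk p k : L1 𝕜)
  have hs1 : Summable fun j : ℤ => χ (i + j) * ‖(bulk p k : L1 𝕜) j.natAbs‖ :=
    hs.of_nonneg_of_le (fun j => mul_nonneg (h0 _) (norm_nonneg _))
      fun j => mul_le_of_le_one_left (norm_nonneg _) (h1 _)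
  suffices ∑' j : ℤ, χ (i + j) * ‖(bulk p k : L1 𝕜) j.natAbs‖ ≤ 2 * gam p (N + 1) by
    rwa [hχ] at this
  -- For `k ≥ N + 2` the whole norm of the bulk is at most `2 γ_{p,k-1} ≤ 2 γ_{p,N+1}`. For `k = N +
  -- 1` this is not available, and the cut-off must be used: the sum is averaged with its image
  -- under `j ↦ -j`.
  rcases (Nat.succ_le_of_lt hk).eq_or_lt with rfl | hk'
  · have hs2 : Summable fun j : ℤ => χ (i - j) * ‖(bulk p (N + 1) : L1 𝕜) j.natAbs‖ :=
      hs.of_nonneg_of_le (fun j => mul_nonneg (h0 _) (norm_nonneg _))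
        fun j => mul_le_of_le_one_left (norm_nonneg _) (h1 _)
    have e1 : ∑' j : ℤ, χ (i - j) * ‖(bulk p (N + 1) : L1 𝕜) j.natAbs‖
        = ∑' j : ℤ, χ (i + j) * ‖(bulk p (N + 1) : L1 𝕜) j.natAbs‖ := by
      rw [← (Equiv.neg ℤ).tsum_eq]
      refine tsum_congr fun j => ?_
      rw [Equiv.neg_apply, Int.natAbs_neg, sub_neg_eq_add]
    have hr := hasSum_rowW (p := p) (k := N + 1) (by omega)
    have e2 : ∑' j : ℤ, rowW p (N + 1) j.natAbs ≤ 2 * gam p (N + 1) := by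
      rw [tsum_int_natAbs hr.summable fun n => rowW_nonneg _ _ _, ← hr.tsum_eq, ← tsum_mul_left]
      refine Summable.tsum_le_tsum (fun n => ?_) ?_ (hr.summable.mul_left 2)
      · exact mul_le_mul_of_nonneg_right (wt_le_two n) (rowW_nonneg _ _ _)
      · exact (summable_wt_mul_iff fun n => rowW_nonneg _ _ _).2 hr.summable
    have e3 : ∑' j : ℤ, (χ (i + j) * ‖(bulk p (N + 1) : L1 𝕜) j.natAbs‖
        + χ (i - j) * ‖(bulk p (N + 1) : L1 𝕜) j.natAbs‖)
        ≤ ∑' j : ℤ, 2 * rowW p (N + 1) j.natAbs := by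
      refine Summable.tsum_le_tsum (fun j => ?_) (hs1.add hs2)
        ((summable_int_natAbs hr.summable fun n => rowW_nonneg _ _ _).mul_left 2)
      rw [← add_mul]
      have hb := norm_bulk_apply_le (𝕜 := 𝕜) (p := p) (k := N + 1) (by omega) j.natAbs
      have hr0 := rowW_nonneg p (N + 1) j.natAbs
      -- Where `|j| > N`, column entries are at most row weights and both cut-offs may equal `1`.
      -- Where `|j| ≤ N`, column entries are at most twice the row weights, but `i + j` and `i - j`
      -- cannot both exceed `N` in absolute value. Either way the bound is twice the row weight.
      rcases lt_or_ge N j.natAbs with hj | hj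
      · have h2 := colW_le (p := p) (k := N + 1) (n := j.natAbs) (by omega) hj
        refine mul_le_mul ?_ (hb.trans h2) (norm_nonneg _) zero_le_two
        linarith [h1 (i + j), h1 (i - j)]
      · have h2 := colW_le_two_mul (p := p) (k := N + 1) (n := j.natAbs) (by omega)
        have h3 : χ (i + j) + χ (i - j) ≤ 1 := by
          by_cases h : (i + j).natAbs ≤ N
          · have : χ (i + j) = 0 := hz _ h
            linarith [h1 (i - j)]
          · have : χ (i - j) = 0 := hz _ (by omega)
            linarith [h1 (i + j)]
        refine (mul_le_of_le_one_left (norm_nonneg _) h3).trans (hb.trans h2)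
    rw [hs1.tsum_add hs2, e1, tsum_mul_left] at e3
    linarith
  · have e1 : ∑' j : ℤ, χ (i + j) * ‖(bulk p k : L1 𝕜) j.natAbs‖ ≤ ‖(bulk p k : L1 𝕜)‖ := by
      rw [← tsum_int_norm]
      exact Summable.tsum_le_tsum (fun j => mul_le_of_le_one_left (norm_nonneg _) (h1 _)) hs1 hs
    refine e1.trans ((norm_bulk_le (by omega)).trans ?_)
    refine mul_le_mul_of_nonneg_left ?_ zero_le_two
    exact (mul_gam_succ_le (by omega)).trans (gam_anti (by omega) (by omega))

lemma tsum_int_mul_indGt_le (a : L1 ℝ) (N p : ℕ) :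
    (Summable fun l : ℤ => ‖a l.natAbs‖ * indGt N (l.natAbs + p)) ∧
    ∑' l : ℤ, ‖a l.natAbs‖ * indGt N (l.natAbs + p)
      ≤ 2 * ∑' l : ℕ, if N < l + p then |a l| else 0 := by
  have h0 : ∀ l : ℕ, 0 ≤ ‖a l‖ * indGt N (l + p) := fun l =>
    mul_nonneg (norm_nonneg _) (indGt_nonneg _ _)
  have hst : Summable fun l : ℕ => ‖a l‖ * indGt N (l + p) := a.summable.of_nonneg_of_le h0
    fun l => mul_le_of_le_one_right (norm_nonneg _) (indGt_le_one _ _)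
  refine ⟨summable_int_natAbs (g := fun l => ‖a l‖ * indGt N (l + p)) hst h0, ?_⟩
  have h3 : ∀ l : ℕ, (if N < l + p then |a l| else 0) = ‖a l‖ * indGt N (l + p) := fun l => by
    rw [indGt, Real.norm_eq_abs]
    split_ifs <;> first | omega | simp
  simp only [h3]
  rw [tsum_int_natAbs (g := fun l => ‖a l‖ * indGt N (l + p)) hst h0, ← tsum_mul_left]
  refine Summable.tsum_le_tsum (fun l => ?_) ?_ (hst.mul_left 2)
  · exact mul_le_mul_of_nonneg_right (wt_le_two l) (h0 l)
  · exact (summable_wt_mul_iff h0).2 hst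

/-- The part above `N` of a convolution, in terms of low and high coefficients. -/
lemma norm_qL_convL_le {N p : ℕ} (a : L1 ℝ) (V : L1 𝕜) {C₁ C₂ : ℝ} (hC : 0 ≤ C₂)
    (hV : ‖V‖ ≤ C₁ + C₂) (h : ∀ i : ℤ, i.natAbs + p ≤ N →
      ∑' j : ℤ, indGt N (i + j).natAbs * ‖V j.natAbs‖ ≤ C₁) :
    ‖qL N (convL a V)‖ ≤ ‖a‖ * C₁ + 2 * (∑' l : ℕ, if N < l + p then |a l| else 0) * C₂ := by
  have hsV := summable_int_norm V
  have hsV' (l : ℤ) : Summable fun j : ℤ => indGt N (l + j).natAbs * ‖V j.natAbs‖ :=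
    hsV.of_nonneg_of_le (fun j => mul_nonneg (indGt_nonneg _ _) (norm_nonneg _))
      fun j => mul_le_of_le_one_left (norm_nonneg _) (indGt_le_one _ _)
  have key (l : ℤ) : ∑' j : ℤ, indGt N (l + j).natAbs * ‖V j.natAbs‖
      ≤ C₁ + indGt N (l.natAbs + p) * C₂ := by
    by_cases hl : l.natAbs + p ≤ N
    · rw [indGt, if_pos hl, zero_mul, add_zero]
      exact h l hl
    · rw [indGt, if_neg hl, one_mul]
      refine le_trans ?_ hV
      rw [← tsum_int_norm V]
      exact Summable.tsum_le_tsum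
        (fun j => mul_le_of_le_one_left (norm_nonneg _) (indGt_le_one _ _)) (hsV' l) hsV
  have hsa := summable_int_norm a
  obtain ⟨hsat, htail⟩ := tsum_int_mul_indGt_le a N p
  have hsr : Summable fun l : ℤ =>
      ‖a l.natAbs‖ * C₁ + ‖a l.natAbs‖ * indGt N (l.natAbs + p) * C₂ :=
    (hsa.mul_right _).add (hsat.mul_right _)
  have h2 : ∀ l : ℤ, ‖a l.natAbs‖ * ∑' j : ℤ, indGt N (l + j).natAbs * ‖V j.natAbs‖
      ≤ ‖a l.natAbs‖ * C₁ + ‖a l.natAbs‖ * indGt N (l.natAbs + p) * C₂ := fun l => by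
    rw [mul_assoc, ← mul_add]
    exact mul_le_mul_of_nonneg_left (key l) (norm_nonneg _)
  have h3 : ∑' l : ℤ, ‖a l.natAbs‖ * ∑' j : ℤ, indGt N (l + j).natAbs * ‖V j.natAbs‖
      ≤ ∑' l : ℤ, (‖a l.natAbs‖ * C₁ + ‖a l.natAbs‖ * indGt N (l.natAbs + p) * C₂) := by
    refine Summable.tsum_le_tsum h2 (hsr.of_nonneg_of_le (fun l => ?_) h2) hsr
    exact mul_nonneg (norm_nonneg _)
      (tsum_nonneg fun j => mul_nonneg (indGt_nonneg _ _) (norm_nonneg _))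
  rw [(hsa.mul_right _).tsum_add (hsat.mul_right _), tsum_mul_right, tsum_mul_right,
    tsum_int_norm] at h3
  have h4 := mul_le_mul_of_nonneg_right htail hC
  have h5 := tsum_wt_conv_le a V (indGt N) (indGt_nonneg N) (indGt_le_one N)
  rw [norm_qL_apply_eq, coe_convL]
  refine le_trans h5 (h3.trans ?_)
  linarith

end BulkEstimates

namespace Problem

variable {P : Problem} {𝕜 : Type*} [RCLike 𝕜] {s : Equiv.Perm (Fin (2 * P.m))} {i : Fin (2 * P.m)}

lemma eta_sub_gam_anti {k l : ℕ} (hk : 2 * P.m < k) (hkl : k ≤ l) :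
    P.eta s i l - gam (2 * P.m - i) l ≤ P.eta s i k - gam (2 * P.m - i) k := by
  rw [eta_sub_nonneg_sum, eta_sub_nonneg_sum]
  gcongr with n _ j _
  exact gam_anti (by omega) hkl

lemma gam_le_eta {k : ℕ} (hk : 2 * P.m < k) : gam (2 * P.m - i) k ≤ P.eta s i k := by
  rw [← sub_nonneg, eta_sub_nonneg_sum]
  refine mul_nonneg (by positivity) (Finset.sum_nonneg fun n _ => Finset.sum_nonneg fun j _ => ?_)
  have := gam_pos (p := 2 * P.m - j) (k := k) (by omega)
  positivity

lemma eta_pos {k : ℕ} (hk : 2 * P.m < k) : 0 < P.eta s i k :=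
  (gam_pos (by omega)).trans_le (gam_le_eta hk)

/-- The columns of `π^{> N} (a ∗ 𝒦ᵢ ·)`. -/
lemma norm_qL_convL_KiL_e_le (hwell : IsUnit P.bcMat) (hs : IsUnit (P.B11 s i)) {N k : ℕ}
    (hN : 4 * P.m ≤ N) (hk : N < k) (a : L1 ℝ) :
    ‖qL N (convL a (P.KiL i (L1.e k)) : L1 𝕜)‖ ≤ 2 * (2 * P.eta s i (N + 1)
      * (∑' l : ℕ, if N + i < l + 2 * P.m then |a l| else 0) + ‖a‖ * gam (2 * P.m - i) (N + 1)) := by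
  have hi := i.2
  have hm := P.one_le_m
  obtain ⟨w, hw, hKi⟩ := exists_KiL_e_eq (𝕜 := 𝕜) P (k := k) (by omega)
  have hlow := norm_low_le hwell hs (k := k) (by omega) hw hKi
  have hws := suppLt_derL_pow hw i
  have hK := hKi i hi.le
  have hη := gam_le_eta (s := s) (i := i) (k := N + 1) (by omega)
  have hη0 := eta_pos (s := s) (i := i) (k := N + 1) (by omega)
  have hanti := eta_sub_gam_anti (s := s) (i := i) (k := N + 1) (l := k) (by omega) hk
  have htail : ∀ l : ℕ, (if N + i < l + 2 * P.m then |a l| else 0)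
      = if N < l + (2 * P.m - i) then |a l| else 0 := fun l => by
    congr 1
    exact propext (by omega)
  simp only [htail]
  rw [hK, map_smul, map_smul, norm_smul, norm_sgn, one_mul]
  have h1 := norm_bulk_le (𝕜 := 𝕜) (p := 2 * P.m - i) (k := k) (by omega)
  have h2 := mul_gam_succ_le_two (p := 2 * P.m - i) (k := k) (by omega) (by omega)
  have h3 := gam_anti (p := 2 * P.m - i) (k := N + 1) (l := k) (by omega) hk
  have h4 := norm_add_le (bulk (2 * P.m - i) k) ((derL (2 * P.m) ^ (i : ℕ)) w)
  -- `C₁` bounds what the low coefficients of `a` can push above `N`. For the total norm, bulk and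
  -- polynomial contribute at most `4γ + (5/6)(η - γ)`, which is at most `C₁ + C₂ = 2γ + 2η` since
  -- `γ ≤ η`.
  refine (norm_qL_convL_le a _ (p := 2 * P.m - i) (C₁ := 2 * gam (2 * P.m - i) (N + 1))
    (C₂ := 2 * P.eta s i (N + 1)) (by linarith) (by linarith) fun l hl => ?_).trans
    (le_of_eq (by ring))
  refine le_trans (le_of_eq ?_) (tsum_shift_bulk_le (𝕜 := 𝕜) (N := N) (p := 2 * P.m - i) (k := k)
    (by omega) (by omega) hk l (by omega))
  refine tsum_congr fun j => ?_
  by_cases hj : (l + j).natAbs ≤ N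
  · simp [indGt, hj]
  -- The polynomial part has degree `< 2m - i`, so a shift by `|l| ≤ N - (2m - i)` cannot bring it
  -- above `N`; only the bulk is seen.
  · rw [L1.add_apply, hws j.natAbs (by omega), add_zero]

/-- The case `i = 0`, `a = e₀` of the previous estimate: convolution with `e₀` is the identity and
the sum of high coefficients is empty. -/
lemma norm_qL_LinvL_e_le (hwell : IsUnit P.bcMat) (hs : IsUnit (P.B11 s ⟨0, P.two_m_pos⟩)) {N k : ℕ}
    (hN : 4 * P.m ≤ N) (hk : N < k) :
    ‖qL N (P.LinvL (L1.e k) : L1 𝕜)‖ ≤ 2 * gam (2 * P.m) (N + 1) := by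
  have h := norm_qL_convL_KiL_e_le (𝕜 := 𝕜) hwell hs hN hk (L1.e 0)
  have h2 : ∀ l : ℕ, (if N + 0 < l + 2 * P.m then |(L1.e 0 : L1 ℝ) l| else 0) = 0 := fun l => by
    split_ifs with hl
    · rw [L1.e_of_ne (by have := P.one_le_m; omega), abs_zero]
    · rfl
  simp only [convL_e_zero, h2, tsum_zero, L1.norm_e] at h
  simpa using h

/-- The first column of the identity `ℬ†ℬ = I`. -/
lemma gam_le_two_mul_eta_sub (hwell : IsUnit P.bcMat) (hs : IsUnit (P.B11 s ⟨0, P.two_m_pos⟩)) {k : ℕ}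
    (hk : 2 * P.m < k) :
    gam (2 * P.m) k ≤ 2 * (P.eta s ⟨0, P.two_m_pos⟩ k - gam (2 * P.m) k) := by
  set i : Fin (2 * P.m) := ⟨0, P.two_m_pos⟩ with hi
  have hinv := Matrix.nonsing_inv_mul _ ((Matrix.isUnit_iff_isUnit_det _).1 (isUnit_BKmat hwell hs))
  obtain ⟨z, hz⟩ : ∃ z : Fin (2 * P.m - i), (z : ℕ) = 0 := ⟨⟨0, P.two_m_pos⟩, rfl⟩
  have hcol : ∀ n, P.BKmat s i n z = P.thetaL s i i n + P.thetaR s i i n := fun n => by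
    have h1 := thetaQ_antiderL_e (𝕜 := ℝ) hs n z
    have h2 := P.theta_cheb_of_suppLt s i n (Q := (L1.e 0 : L1 ℝ)) (suppLt_e P.two_m_pos)
    have h3 : P.thetaQ s i n (L1.e 0 : L1 ℝ) = P.BKmat s i n z := by rw [hz] at h1; exact h1
    have hdx : ∀ j : Fin (2 * P.m), j ≠ i → ∀ x ∈ seg, dx j (cheb (L1.e 0 : L1 ℝ)) x = 0 := by
      intro j hj x hx
      have hj' : 1 ≤ (j : ℕ) := Nat.one_le_iff_ne_zero.2 fun h => hj (Fin.ext h)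
      have h := dx_cheb_of_suppLt (𝕜 := ℝ) (Q := L1.e 0) (d := 1) (suppLt_e one_pos) j hx
      have h0 : (derL 1 ^ (j : ℕ)) (L1.e 0 : L1 ℝ) = 0 := by
        ext n
        exact suppLt_derL_pow (suppLt_e (d := 1) one_pos) j n (by omega)
      rw [h, h0]
      exact cheb_zero hx
    rw [← h3, ← h2, theta, Finset.sum_eq_single i]
    · have e1 : ∀ x, dx i (cheb (L1.e 0 : L1 ℝ)) x = 1 := fun x => by
        have : dx i (cheb (L1.e 0 : L1 ℝ)) x = cheb (L1.e 0 : L1 ℝ) x := by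
          simp [dx, hi]
        rw [this, cheb_e]
        simp [chT]
      rw [e1, e1]
      simp
    · intro j _ hj
      rw [hdx j hj _ neg_one_mem_seg, hdx j hj _ one_mem_seg]
      simp
    · simp
  have h1 : (1 : ℝ) ≤ matNorm (P.BKmat s i)⁻¹ * ∑ n : Fin (2 * P.m - i), wt n * ‖P.BKmat s i n z‖ := by
    -- Since `ℬ†ℬ e₀ = e₀` has norm `1`, the norm of `ℬ†` times the norm of the first column is at
    -- least `1`; that column is `θ^{(-1)}_0 + θ^{(1)}_0`, the boundary data of the constant
    -- function `1`.
    have e1 : embL (P.BKmat s i)⁻¹ (ofFin fun n => P.BKmat s i n z) = L1.e 0 := by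
      rw [← embL_e, ← mul_apply_eq_comp, ← embL_mul, hinv, embL_e, ofFin, Finset.sum_eq_single z]
      · simp [hz]
      · intro n _ hn
        rw [Matrix.one_apply_ne hn, zero_smul]
      · simp
    have e2 := (embL (P.BKmat s i)⁻¹).le_opNorm (ofFin fun n => P.BKmat s i n z)
    rw [e1, L1.norm_e, wt_zero, norm_ofFin, ← coe_matNorm] at e2
    exact e2
  have hg := gam_pos (p := 2 * P.m) (k := k) hk
  have h2 := eta_sub_nonneg_sum s i k
  have h2' : P.eta s i k - gam (2 * P.m) k = _ := h2
  rw [h2']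
  calc gam (2 * P.m) k = 1 * gam (2 * P.m) k := (one_mul _).symm
    _ ≤ (matNorm (P.BKmat s i)⁻¹ * ∑ n : Fin (2 * P.m - i), wt n * ‖P.BKmat s i n z‖) * gam (2 * P.m) k := by gcongr
    _ ≤ (matNorm (P.BKmat s i)⁻¹ * ∑ n : Fin (2 * P.m - i), 2 * ∑ j : Fin (2 * P.m),
      (|P.thetaL s i j n| + |P.thetaR s i j n|) * gam (2 * P.m - j) k) := by
        rw [mul_assoc, Finset.sum_mul]
        refine mul_le_mul_of_nonneg_left (Finset.sum_le_sum fun n _ => ?_) (NNReal.coe_nonneg _)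
        rw [mul_assoc]
        refine mul_le_mul (wt_le_two _) ?_ (mul_nonneg (norm_nonneg _) hg.le) zero_le_two
        rw [hcol, Real.norm_eq_abs]
        refine le_trans ?_ (Finset.single_le_sum (f := fun j : Fin (2 * P.m) =>
          (|P.thetaL s i j n| + |P.thetaR s i j n|) * gam (2 * P.m - j) k) (fun j _ => ?_)
          (Finset.mem_univ i))
        · exact mul_le_mul_of_nonneg_right (abs_add_le _ _) hg.le
        · have := gam_pos (p := 2 * P.m - j) (k := k) (by omega)
          positivity
    _ = _ := by rw [← Finset.mul_sum]; ring

/-- The columns of index `> N` of `ℒ⁻¹`. -/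
lemma norm_LinvL_mul_qL_le (hwell : IsUnit P.bcMat) (hs : IsUnit (P.B11 s ⟨0, P.two_m_pos⟩)) {N : ℕ}
    (hN : 4 * P.m ≤ N) : ‖(P.LinvL : L1 𝕜 →L[𝕜] L1 𝕜) * qL N‖
      ≤ P.eta s ⟨0, P.two_m_pos⟩ (N + 1) - gam (2 * P.m) (N + 1) / 24 := by
  have hm := P.one_le_m
  have h5 := gam_le_two_mul_eta_sub hwell hs (k := N + 1) (by omega)
  have hg := gam_pos (p := 2 * P.m) (k := N + 1) (by omega)
  refine norm_mul_qL_le _ (by linarith) fun k hk => ?_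
  obtain ⟨w, hw, hKi⟩ := exists_KiL_e_eq (𝕜 := 𝕜) P (k := k) (by omega)
  have hlow := norm_low_le hwell hs (k := k) (by omega) hw hKi
  have hanti := eta_sub_gam_anti (s := s) (i := ⟨0, P.two_m_pos⟩) (k := N + 1) (l := k) (by omega) hk
  simp only [Nat.sub_zero, pow_zero, one_apply_eq_self] at hlow hanti
  rw [LinvL, hKi 0 (Nat.zero_le _), norm_smul, norm_sgn, one_mul, pow_zero, one_apply_eq_self, Nat.sub_zero]
  have h1 := norm_bulk_le (𝕜 := 𝕜) (p := 2 * P.m) (k := k) (by omega)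
  -- The factor `5/4` is needed only for the column `N + 1`; beyond it `mul_gam_succ_le` gives the
  -- bound with factor `1`.
  have h2 : (k : ℝ) * gam (2 * P.m + 1) k ≤ 5 / 4 * gam (2 * P.m) (N + 1) := by
    rcases (Nat.succ_le_of_lt hk).eq_or_lt with rfl | hk'
    · exact mul_gam_succ_le_of_le hm (by omega)
    · refine ((mul_gam_succ_le (by omega)).trans (gam_anti (by omega) (by omega : N + 1 ≤ k - 1))).trans ?_
      linarith
  have h3 := norm_add_le (bulk (2 * P.m) k) w
  -- The sum `(5/2)γ + (5/6)(η - γ)` has to be at most `2η - γ/12`. This is equivalent to `γ ≤ 2(η -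
  -- γ)`, which is `h5`; the choice of `1/24` uses it up exactly.
  linarith

end Problem

end GegenbauerStability

end

open scoped ENNReal NNReal

noncomputable section

namespace GegenbauerStability

/-! ### Matrices of power series acting on finitely supported sequences. -/

section Chains

open PowerSeries Finset

variable {V V' V'' : Type*} [AddCommGroup V] [Module ℂ V] [AddCommGroup V'] [Module ℂ V']
  [AddCommGroup V''] [Module ℂ V'']

/-- The action of a formal power series of linear maps on finitely supported sequences, the
variable acting as the shift to the left. -/
def shiftAct (F : ℕ → V →ₗ[ℂ] V') : (ℕ →₀ V) →ₗ[ℂ] (ℕ →₀ V') :=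
  Finsupp.lsum ℂ fun j => ∑ kl ∈ antidiagonal j, (Finsupp.lsingle kl.2).comp (F kl.1)

lemma shiftAct_single (F : ℕ → V →ₗ[ℂ] V') (j : ℕ) (v : V) : shiftAct F (Finsupp.single j v)
    = ∑ kl ∈ antidiagonal j, Finsupp.single kl.2 (F kl.1 v) := by
  simp [shiftAct]

lemma shiftAct_single_apply (F : ℕ → V →ₗ[ℂ] V') (j n : ℕ) (v : V) :
    (shiftAct F (Finsupp.single j v)) n = if n ≤ j then F (j - n) v else 0 := by
  rw [shiftAct_single, Finsupp.finsetSum_apply]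
  split_ifs with h
  · rw [Finset.sum_eq_single (j - n, n)]
    · simp
    · rintro ⟨a, b⟩ hab hne
      rw [HasAntidiagonal.mem_antidiagonal] at hab
      refine Finsupp.single_eq_of_ne fun hb => hne ?_
      subst hb
      rw [← hab]
      simp
    · intro hn
      rw [HasAntidiagonal.mem_antidiagonal] at hn
      omega
  · refine Finset.sum_eq_zero fun ab hab => Finsupp.single_eq_of_ne ?_
    rw [HasAntidiagonal.mem_antidiagonal] at hab
    omega

/-- Composition of actions is the Cauchy product of coefficients; finite support makes all sums
finite, so no convergence is involved. -/
lemma shiftAct_shiftAct (F : ℕ → V' →ₗ[ℂ] V'') (G : ℕ → V →ₗ[ℂ] V') (x : ℕ →₀ V) :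
    shiftAct F (shiftAct G x)
      = shiftAct (fun n => ∑ ab ∈ antidiagonal n, (F ab.1).comp (G ab.2)) x := by
  have hsingle : ∀ (l : ℕ) (s : Finset (ℕ × ℕ)) (f : ℕ × ℕ → V''),
      Finsupp.single l (∑ a ∈ s, f a) = ∑ a ∈ s, Finsupp.single l (f a) :=
    fun l s f => map_sum (Finsupp.singleAddHom l) _ _
  induction x using Finsupp.induction_linear with
  | zero => simp
  | add x y hx hy => simp only [map_add, hx, hy]
  | single j v =>
    simp only [shiftAct_single, map_sum, LinearMap.sum_apply, LinearMap.comp_apply, hsingle]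
    rw [sum_sigma', sum_sigma']
    refine sum_bij' (fun p _ => ⟨(p.2.1 + p.1.1, p.2.2), (p.2.1, p.1.1)⟩)
      (fun p _ => ⟨(p.2.2, p.2.1 + p.1.2), (p.2.1, p.1.2)⟩) ?_ ?_ ?_ ?_ ?_
    · rintro ⟨⟨a, b⟩, c, d⟩ h
      simp only [mem_sigma, HasAntidiagonal.mem_antidiagonal] at h ⊢
      grind
    · rintro ⟨⟨a, b⟩, c, d⟩ h
      simp only [mem_sigma, HasAntidiagonal.mem_antidiagonal] at h ⊢
      grind
    · rintro ⟨⟨a, b⟩, c, d⟩ h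
      simp only [mem_sigma, HasAntidiagonal.mem_antidiagonal] at h
      obtain ⟨rfl, rfl⟩ := h
      rfl
    · rintro ⟨⟨a, b⟩, c, d⟩ h
      simp only [mem_sigma, HasAntidiagonal.mem_antidiagonal] at h
      obtain ⟨rfl, rfl⟩ := h
      rfl
    · rintro ⟨⟨a, b⟩, c, d⟩ h
      rfl

lemma shiftAct_add (F G : ℕ → V →ₗ[ℂ] V') (x : ℕ →₀ V) :
    shiftAct (fun n => F n + G n) x = shiftAct F x + shiftAct G x := by
  induction x using Finsupp.induction_linear with
  | zero => simp
  | add x y hx hy => simp only [map_add, hx, hy]; abel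
  | single j v => simp [shiftAct_single, Finset.sum_add_distrib]

lemma shiftAct_apply_of_two {F : ℕ → V →ₗ[ℂ] V'} (h : ∀ n, 2 ≤ n → F n = 0) (x : ℕ →₀ V) (n : ℕ) :
    (shiftAct F x) n = F 0 (x n) + F 1 (x (n + 1)) := by
  induction x using Finsupp.induction_linear with
  | zero => simp
  | add x y hx hy => simp only [map_add, Finsupp.add_apply, hx, hy]; abel
  | single j v =>
    rw [shiftAct_single_apply]
    rcases lt_trichotomy n j with hn | rfl | hn
    · rw [if_pos hn.le, Finsupp.single_eq_of_ne (by omega : n ≠ j), map_zero, zero_add]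
      rcases Nat.lt_or_ge (n + 1) j with hj | hj
      · rw [h (j - n) (by omega), Finsupp.single_eq_of_ne (by omega : n + 1 ≠ j)]
        simp
      · obtain rfl : j = n + 1 := by omega
        simp
    · simp
    · rw [if_neg (by omega), Finsupp.single_eq_of_ne (by omega : n ≠ j),
        Finsupp.single_eq_of_ne (by omega : n + 1 ≠ j)]
      simp

/-- The action of scalar power series. -/
def seriesAct (f : ℂ⟦X⟧) : (ℕ →₀ ℂ) →ₗ[ℂ] (ℕ →₀ ℂ) :=
  shiftAct fun n => coeff n f • LinearMap.id

lemma seriesAct_mul (f g : ℂ⟦X⟧) (x : ℕ →₀ ℂ) : seriesAct (f * g) x = seriesAct f (seriesAct g x) := by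
  rw [seriesAct, seriesAct, seriesAct, shiftAct_shiftAct]
  congr 2
  funext n
  ext
  simp [coeff_mul]

lemma seriesAct_add (f g : ℂ⟦X⟧) (x : ℕ →₀ ℂ) : seriesAct (f + g) x = seriesAct f x + seriesAct g x := by
  rw [seriesAct, seriesAct, seriesAct, ← shiftAct_add]
  congr 2
  funext n
  rw [map_add, add_smul]

lemma seriesAct_zero (x : ℕ →₀ ℂ) : seriesAct 0 x = 0 := by
  have := seriesAct_add 0 0 x
  simpa using this

lemma seriesAct_C (c : ℂ) (x : ℕ →₀ ℂ) : seriesAct (C c) x = c • x := by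
  ext n
  rw [seriesAct, shiftAct_apply_of_two]
  · simp [coeff_C]
  · intro n hn
    rw [coeff_C, if_neg (by omega), zero_smul]

lemma seriesAct_one (x : ℕ →₀ ℂ) : seriesAct 1 x = x := by
  rw [← map_one (C (R := ℂ)), seriesAct_C, one_smul]

lemma seriesAct_X_apply (x : ℕ →₀ ℂ) (n : ℕ) : (seriesAct X x) n = x (n + 1) := by
  rw [seriesAct, shiftAct_apply_of_two]
  · simp [coeff_X]
  · intro n hn
    rw [coeff_X, if_neg (by omega), zero_smul]

lemma seriesAct_sum {ι : Type*} (s : Finset ι) (f : ι → ℂ⟦X⟧) (x : ℕ →₀ ℂ) :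
    seriesAct (∑ i ∈ s, f i) x = ∑ i ∈ s, seriesAct (f i) x := by
  classical
  induction s using Finset.induction_on with
  | empty => simp [seriesAct_zero]
  | insert i s his ih => rw [sum_insert his, sum_insert his, seriesAct_add, ih]

variable {ι : Type} [Fintype ι]

/-- The action of matrices of scalar power series. -/
def matAct (M : Matrix ι ι ℂ⟦X⟧) : (ι → ℕ →₀ ℂ) →ₗ[ℂ] (ι → ℕ →₀ ℂ) :=
  LinearMap.pi fun a => ∑ b, (seriesAct (M a b)).comp (LinearMap.proj b)

lemma matAct_apply (M : Matrix ι ι ℂ⟦X⟧) (y : ι → ℕ →₀ ℂ) (a : ι) :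
    matAct M y a = ∑ b, seriesAct (M a b) (y b) := by
  simp [matAct, LinearMap.sum_apply]

lemma matAct_mul (M M' : Matrix ι ι ℂ⟦X⟧) : matAct (M * M') = (matAct M).comp (matAct M') := by
  refine LinearMap.ext fun y => funext fun a => ?_
  rw [LinearMap.comp_apply, matAct_apply, matAct_apply]
  simp only [matAct_apply, Matrix.mul_apply, seriesAct_sum, seriesAct_mul, map_sum]
  exact sum_comm

variable [DecidableEq ι]

lemma matAct_one : matAct (1 : Matrix ι ι ℂ⟦X⟧) = LinearMap.id := by
  refine LinearMap.ext fun y => funext fun a => ?_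
  rw [matAct_apply, sum_eq_single a]
  · simp [seriesAct_one]
  · intro b _ hb
    rw [Matrix.one_apply_ne hb.symm, seriesAct_zero]
  · simp

lemma matAct_bijective {M : Matrix ι ι ℂ⟦X⟧} (h : IsUnit M) : Function.Bijective (matAct M) := by
  obtain ⟨u, rfl⟩ := h
  refine ⟨Function.LeftInverse.injective (g := matAct ↑u⁻¹) fun y => ?_,
    Function.RightInverse.surjective (g := matAct ↑u⁻¹) fun y => ?_⟩
  · rw [← LinearMap.comp_apply, ← matAct_mul, Units.inv_mul, matAct_one]; rfl
  · rw [← LinearMap.comp_apply, ← matAct_mul, Units.mul_inv, matAct_one]; rfl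

/-- For a surjective `B`, the kernel of `A ∘ B` is an extension of `ker A` by `ker B`. This
additivity is what makes the kernel dimension behave like the order of a determinant. -/
lemma rank_ker_comp {E : Type} [AddCommGroup E] [Module ℂ E] (A B : E →ₗ[ℂ] E)
    (hB : Function.Surjective B) : Module.rank ℂ (LinearMap.ker (A.comp B))
      = Module.rank ℂ (LinearMap.ker A) + Module.rank ℂ (LinearMap.ker B) := by
  let g : LinearMap.ker (A.comp B) →ₗ[ℂ] LinearMap.ker A := B.restrict fun x hx => hx
  have hg : Function.Surjective g := by
    rintro ⟨y, hy⟩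
    obtain ⟨x, rfl⟩ := hB y
    exact ⟨⟨x, hy⟩, rfl⟩
  rw [← LinearMap.rank_range_add_rank_ker g, LinearMap.range_eq_top.2 hg, rank_top]
  congr 1
  let e : LinearMap.ker g ≃ₗ[ℂ] LinearMap.ker B :=
    { toFun := fun x => ⟨x.1.1, congrArg Subtype.val x.2⟩
      map_add' := fun _ _ => rfl
      map_smul' := fun _ _ => rfl
      invFun := fun x => ⟨⟨x.1, by
        have : B x.1 = 0 := x.2
        simp [this]⟩, Subtype.ext x.2⟩
      left_inv := fun _ => rfl
      right_inv := fun _ => rfl }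
  exact e.rank_eq

/-- The diagonal matrix with one entry `X`. -/
def diagX (j : ι) : Matrix ι ι ℂ⟦X⟧ := Matrix.diagonal fun i => if i = j then X else 1

lemma matAct_diagX_apply (j : ι) (y : ι → ℕ →₀ ℂ) (a : ι) :
    matAct (diagX j) y a = if a = j then seriesAct X (y a) else y a := by
  rw [matAct_apply, sum_eq_single a]
  · simp only [diagX, Matrix.diagonal_apply_eq]
    split_ifs <;> simp [seriesAct_one]
  · intro b _ hb
    rw [diagX, Matrix.diagonal_apply_ne _ hb.symm, seriesAct_zero]
  · simp

lemma seriesAct_X_surjective : Function.Surjective (seriesAct X) := by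
  intro x
  refine ⟨x.mapDomain Nat.succ, Finsupp.ext fun n => ?_⟩
  rw [seriesAct_X_apply]
  exact Finsupp.mapDomain_apply Nat.succ_injective x n

lemma matAct_diagX_surjective (j : ι) : Function.Surjective (matAct (diagX j)) := by
  intro y
  obtain ⟨x, hx⟩ := seriesAct_X_surjective (y j)
  refine ⟨Function.update y j x, funext fun a => ?_⟩
  rw [matAct_diagX_apply]
  split_ifs with h
  · subst h; simpa using hx
  · simp [h]

lemma rank_ker_matAct_diagX (j : ι) : Module.rank ℂ (LinearMap.ker (matAct (diagX j))) = 1 := by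
  have h0 : ∀ y : LinearMap.ker (matAct (diagX j)), ∀ a n, (a ≠ j ∨ n ≠ 0) → y.1 a n = 0 := by
    intro y a n h
    have h1 := congrFun (LinearMap.mem_ker.1 y.2) a
    rw [matAct_diagX_apply] at h1
    split_ifs at h1 with ha
    · obtain ⟨n, rfl⟩ := Nat.exists_eq_succ_of_ne_zero (h.resolve_left (not_not.2 ha))
      have h2 := DFunLike.congr_fun h1 n
      rwa [seriesAct_X_apply] at h2
    · rw [h1]; rfl
  let e : LinearMap.ker (matAct (diagX j)) ≃ₗ[ℂ] ℂ :=
    { toFun := fun y => y.1 j 0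
      map_add' := fun _ _ => rfl
      map_smul' := fun _ _ => rfl
      invFun := fun c => ⟨Pi.single j (Finsupp.single 0 c), by
        rw [LinearMap.mem_ker]
        funext a
        rw [matAct_diagX_apply]
        split_ifs with h
        · subst h
          ext n
          rw [seriesAct_X_apply]
          simp
        · simp [h]⟩
      left_inv := fun y => by
        refine Subtype.ext (funext fun a => Finsupp.ext fun n => ?_)
        by_cases ha : a = j
        · subst ha
          rcases n with _ | n
          · simp
          · simp [h0 y a (n + 1) (Or.inr (by omega))]
        · simp [ha, h0 y a n (Or.inl ha)]
      right_inv := fun c => by simp }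
  rw [e.rank_eq, Module.rank_self]

/-- The dimension of the kernel of a matrix of power series, on finitely supported sequences. -/
lemma rank_ker_matAct {d : ℕ} : ∀ {M : Matrix ι ι ℂ⟦X⟧}, M.det.order = d →
    Module.rank ℂ (LinearMap.ker (matAct M)) = d := by
  induction d with
  | zero =>
    intro M hM
    have hu : IsUnit M := by
      rw [Matrix.isUnit_iff_isUnit_det, isUnit_iff_constantCoeff, isUnit_iff_ne_zero]
      rw [Nat.cast_zero] at hM
      exact fun h => order_ne_zero_iff_constCoeff_eq_zero.2 h hM
    rw [LinearMap.ker_eq_bot.2 (matAct_bijective hu).1]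
    simp
  | succ d ih =>
    intro M hM
    -- A determinant of positive order means that the constant term of `M` is singular; a kernel
    -- vector `v` with `v j ≠ 0` is used to split off one factor `X`.
    have h0 : (M.map (constantCoeff (R := ℂ))).det = 0 := by
      rw [← RingHom.mapMatrix_apply, ← RingHom.map_det]
      refine order_ne_zero_iff_constCoeff_eq_zero.1 ?_
      rw [hM]
      exact Nat.cast_ne_zero.2 (by omega)
    obtain ⟨v, hv0, hv⟩ := Matrix.exists_mulVec_eq_zero_iff.2 h0
    obtain ⟨j, hj⟩ := Function.ne_iff.1 hv0
    -- Column `j` of `M * Cm` is `M v`, whose constant term vanishes, while `Cm` is invertible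
    -- because its determinant is the nonzero constant `v j`. Dividing that column by `X` gives `M *
    -- Cm = H * diagX j` with an `H` of order one less.
    set Cm : Matrix ι ι ℂ⟦X⟧ := (1 : Matrix ι ι ℂ⟦X⟧).updateCol j fun i => C (v i) with hCm
    have hdetC : Cm.det = C (v j) := by
      rw [hCm, ← Matrix.cramer_apply, Matrix.cramer_one]
      rfl
    have hCu : IsUnit Cm := by
      rw [Matrix.isUnit_iff_isUnit_det, hdetC]
      exact (isUnit_iff_ne_zero.2 hj).map _
    have hdvd : ∀ a, X ∣ (M * Cm) a j := fun a => by
      rw [X_dvd_iff]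
      have h1 := congrFun hv a
      simpa [hCm, Matrix.mul_apply, Matrix.mulVec, dotProduct] using h1
    choose w hw using hdvd
    set H : Matrix ι ι ℂ⟦X⟧ := (M * Cm).updateCol j w with hH
    have hHD : H * diagX j = M * Cm := by
      ext1 a b
      rw [diagX, Matrix.mul_diagonal]
      by_cases hb : b = j
      · subst hb; simp [hH, hw, mul_comm]
      · simp [hH, hb]
    have hdetH : H.det.order = d := by
      have h1 := congrArg Matrix.det hHD
      rw [Matrix.det_mul, Matrix.det_mul, hdetC] at h1
      have h2 : (diagX j).det = X := by simp [diagX]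
      have h3 := congrArg order h1
      rw [h2, order_mul, order_mul, hM, order_X,
        order_zero_of_unit ((isUnit_iff_ne_zero.2 hj).map (C (R := ℂ))), add_zero, Nat.cast_succ] at h3
      exact ENat.add_left_injective_of_ne_top ENat.one_ne_top h3
    have h1 : Module.rank ℂ (LinearMap.ker (matAct (M * Cm))) = Module.rank ℂ (LinearMap.ker (matAct M)) := by
      rw [matAct_mul, rank_ker_comp _ _ (matAct_bijective hCu).2,
        LinearMap.ker_eq_bot.2 (matAct_bijective hCu).1, rank_bot, add_zero]
    rw [← h1, ← hHD, matAct_mul, rank_ker_comp _ _ (matAct_diagX_surjective j), ih hdetH,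
      rank_ker_matAct_diagX]
    push_cast
    rfl

end Chains

end GegenbauerStability

end

open scoped ENNReal NNReal

noncomputable section

namespace GegenbauerStability

/-! ### Algebra of the Schur complement. -/

section Schur

variable {S : Type*} [Ring S] {p q A R : S}

/-- The Schur complement of `1 + q A q` in `1 + A`, where `R` stands for the inverse of
`1 + q A q`. -/
def schur (p q A R : S) : S := p + p * A * p - p * A * R * q * A * p

lemma mul_right_of_schur (hp : p * p = p) (hq : q = 1 - p) (h1 : R * (1 + q * A * q) = 1) :
    R * p = p := by
  have hqp : q * p = 0 := by rw [hq, sub_mul, hp, one_mul, sub_self]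
  have := congrArg (· * p) h1
  simpa [mul_add, add_mul, mul_assoc, hqp] using this

lemma mul_left_of_schur (hp : p * p = p) (hq : q = 1 - p) (h2 : (1 + q * A * q) * R = 1) :
    p * R * q = 0 := by
  have hpq : p * q = 0 := by rw [hq, mul_sub, hp, mul_one, sub_self]
  have := congrArg (p * ·) h2
  have h3 : p * R = p := by
    simpa [mul_add, add_mul, ← mul_assoc, hpq] using this
  rw [h3, hpq]

/-- Solves the tail equation: applied to `x` with `(1 + A) x = 0`, it expresses `q x` through `p x`.
-/
lemma schur_left (hp : p * p = p) (hq : q = 1 - p) (h1 : R * (1 + q * A * q) = 1) :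
    R * q * (1 + A) = q + R * q * A * p := by
  have h3 := mul_right_of_schur hp hq h1
  have h4 : R * q * A * q = 1 - R := by
    rw [mul_add, mul_one] at h1
    rw [← h1]; noncomm_ring
  have h5 : R * q * A = R * q * A * p + R * q * A * q := by rw [hq]; noncomm_ring
  have h6 : R * q = R - p := by rw [hq, mul_sub, h3, mul_one]
  rw [mul_add, mul_one]
  generalize R * q * A * p = t at h5 ⊢
  rw [h5, h4, h6, hq]; abel

lemma schur_eq (hp : p * p = p) (hq : q = 1 - p) (h2 : (1 + q * A * q) * R = 1) :
    schur p q A R = p * (1 + A) * (p - R * q * A * p) := by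
  have h3 := mul_left_of_schur hp hq h2
  have : p * (1 + A) * (p - R * q * A * p)
      = p * p + p * A * p - p * R * q * (A * p) - p * A * R * q * A * p := by noncomm_ring
  rw [this, hp, h3, zero_mul, sub_zero, schur]

/-- The operator `p - R q A p` lifts a vector of the finite block to one satisfying the tail
equation; by `schur_eq` the only equation left is that of the Schur complement. -/
lemma schur_right (hp : p * p = p) (hq : q = 1 - p) (h2 : (1 + q * A * q) * R = 1) :
    q * (1 + A) * (p - R * q * A * p) = 0 := by
  have h3 := mul_left_of_schur hp hq h2
  have hqp : q * p = 0 := by rw [hq, sub_mul, hp, one_mul, sub_self]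
  have hqq : q * q = q := by rw [hq, mul_sub, sub_mul, sub_mul, hp]; simp
  have h4 : q * (1 + A) * R * q = q := by
    have h5 : q * A * R * q = q * A * (p * R * q) + q * A * q * R * q := by
      rw [hq]; noncomm_ring
    have h6 : q * (1 + A) * R * q = q * R * q + q * A * R * q := by noncomm_ring
    have h7 := congrArg (fun t => q * t * q) h2
    simp only [mul_one, hqq] at h7
    have h8 : q * ((1 + q * A * q) * R) * q = q * R * q + q * q * A * q * R * q := by noncomm_ring
    rw [h6, h5, h3, mul_zero, zero_add]
    rw [h8, hqq] at h7
    exact h7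
  have h9 : q * (1 + A) * (p - R * q * A * p)
      = q * p + q * A * p - q * (1 + A) * R * q * (A * p) := by noncomm_ring
  rw [h9, h4, hqp]; noncomm_ring

lemma schur_proj (hp : p * p = p) (hq : q = 1 - p) (h2 : (1 + q * A * q) * R = 1) :
    p * (p - R * q * A * p) = p := by
  have h3 := mul_left_of_schur hp hq h2
  have : p * (p - R * q * A * p) = p * p - p * R * q * (A * p) := by noncomm_ring
  rw [this, h3, hp, zero_mul, sub_zero]

end Schur

/-! ### Reduction of operator chains to matrix chains. -/

section OperatorChains

open PowerSeries Finset

variable {X : Type} [NormedAddCommGroup X] [NormedSpace ℂ X]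

lemma shiftAct_mapRange {V V' V'' : Type*} [AddCommGroup V] [Module ℂ V] [AddCommGroup V']
    [Module ℂ V'] [AddCommGroup V''] [Module ℂ V''] (F : ℕ → V' →ₗ[ℂ] V'') (f : V →ₗ[ℂ] V')
    (x : ℕ →₀ V) : shiftAct F (Finsupp.mapRange.linearMap f x)
      = shiftAct (fun n => (F n).comp f) x := by
  induction x using Finsupp.induction_linear with
  | zero => simp
  | add x y hx hy => simp only [map_add, hx, hy]
  | single j v => simp [shiftAct_single]

lemma mapRange_shiftAct {V V' V'' : Type*} [AddCommGroup V] [Module ℂ V] [AddCommGroup V']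
    [Module ℂ V'] [AddCommGroup V''] [Module ℂ V''] (F : ℕ → V →ₗ[ℂ] V') (f : V' →ₗ[ℂ] V'')
    (x : ℕ →₀ V) : Finsupp.mapRange.linearMap f (shiftAct F x)
      = shiftAct (fun n => f.comp (F n)) x := by
  induction x using Finsupp.induction_linear with
  | zero => simp
  | add x y hx hy => simp only [map_add, hx, hy]
  | single j v => simp [shiftAct_single, map_sum]

/-- The action of power series of operators on finitely supported sequences. -/
def opAct : (X →L[ℂ] X)⟦X⟧ →+* Module.End ℂ (ℕ →₀ X) where
  toFun F := shiftAct fun n => (coeff n F : X →L[ℂ] X)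
  map_one' := by
    refine LinearMap.ext fun x => Finsupp.ext fun n => ?_
    rw [shiftAct_apply_of_two]
    · simp [coeff_one]
    · intro n hn
      rw [coeff_one, if_neg (by omega)]; rfl
  map_mul' F G := by
    refine LinearMap.ext fun x => ?_
    rw [Module.End.mul_apply, shiftAct_shiftAct]
    congr 2
    funext n
    ext v
    simp [coeff_mul]
  map_zero' := by
    refine LinearMap.ext fun x => Finsupp.ext fun n => ?_
    rw [shiftAct_apply_of_two]
    · simp
    · intro n hn
      simp
  map_add' F G := by
    refine LinearMap.ext fun x => ?_
    rw [LinearMap.add_apply, ← shiftAct_add]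
    congr 2

lemma opAct_apply (F : (X →L[ℂ] X)⟦X⟧) (x : ℕ →₀ X) :
    opAct F x = shiftAct (fun n => ((coeff n F : X →L[ℂ] X) : X →ₗ[ℂ] X)) x := rfl

lemma opAct_C (f : X →L[ℂ] X) (x : ℕ →₀ X) :
    opAct (C f) x = Finsupp.mapRange.linearMap (f : X →ₗ[ℂ] X) x := by
  ext n
  rw [opAct_apply, shiftAct_apply_of_two]
  · simp [coeff_C]
  · intro n hn
    rw [coeff_C, if_neg (by omega)]; rfl

variable {ι : Type} [Fintype ι] [DecidableEq ι]

/-- The matrix of scalar power series attached to a power series of operators. -/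
def serMat (e : ι → X) (co : ι → X →L[ℂ] ℂ) (F : (X →L[ℂ] X)⟦X⟧) : Matrix ι ι ℂ⟦X⟧ :=
  Matrix.of fun a b => PowerSeries.mk fun n => co a ((coeff n F : X →L[ℂ] X) (e b))

/-- Taking the coordinates of `p x` is an isomorphism between the kernels: an element is recovered
from them as `(p - R q A p) x` by the tail equation, and conversely that formula lifts any kernel
element of the Schur complement. -/
lemma rank_ker_opAct {e : ι → X} {co : ι → X →L[ℂ] ℂ} (hco : ∀ a b, co a (e b) = if a = b then 1 else 0)
    {p q : X →L[ℂ] X} (hp : ∀ x, p x = ∑ a, co a x • e a) (hq : q = 1 - p)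
    {A R : (X →L[ℂ] X)⟦X⟧} (h1 : R * (1 + C q * A * C q) = 1) (h2 : (1 + C q * A * C q) * R = 1) :
    Module.rank ℂ (LinearMap.ker (opAct (1 + A)))
      = Module.rank ℂ (LinearMap.ker (matAct (serMat e co (schur (C p) (C q) A R)))) := by
  have hcop : ∀ a x, co a (p x) = co a x := fun a x => by
    simp [hp, map_sum, hco]
  have hpp : (C p : (X →L[ℂ] X)⟦X⟧) * C p = C p := by
    rw [← map_mul]
    congr 1
    ext x
    change p (p x) = p x
    rw [hp (p x), hp x]
    simp [hco]
  have hqq : (C q : (X →L[ℂ] X)⟦X⟧) = 1 - C p := by rw [hq, map_sub, map_one]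
  set E := schur (C p) (C q) A R with hE
  set Y := C p - R * C q * A * C p with hY
  let inc : (ι → ℕ →₀ ℂ) →ₗ[ℂ] (ℕ →₀ X) := ∑ b, (Finsupp.mapRange.linearMap
    (LinearMap.toSpanSingleton ℂ X (e b))).comp (LinearMap.proj b)
  let pr : (ℕ →₀ X) →ₗ[ℂ] (ι → ℕ →₀ ℂ) := LinearMap.pi fun a =>
    Finsupp.mapRange.linearMap (co a : X →ₗ[ℂ] ℂ)
  have hpr : ∀ x a n, pr x a n = co a (x n) := fun x a n => rfl
  have hinc : ∀ y n, inc y n = ∑ b, y b n • e b := fun y n => by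
    simp [inc, LinearMap.sum_apply, Finsupp.finsetSum_apply]
  have hprinc : ∀ y, pr (inc y) = y := fun y => by
    funext a
    ext n
    rw [hpr, hinc]
    simp [hco]
  have hincpr : ∀ x, inc (pr x) = opAct (C p) x := fun x => by
    rw [opAct_C]
    ext n
    rw [hinc]
    simp [hpr, hp]
  have hprp : ∀ x, pr (opAct (C p) x) = pr x := fun x => by rw [← hincpr, hprinc]
  have hincp : ∀ y, opAct (C p) (inc y) = inc y := fun y => by rw [← hincpr, hprinc]
  have hmat : ∀ y, matAct (serMat e co E) y = pr (opAct E (inc y)) := fun y => by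
    funext a
    rw [matAct_apply]
    simp only [inc, LinearMap.sum_apply, map_sum, LinearMap.comp_apply, LinearMap.proj_apply, pr,
      LinearMap.pi_apply, opAct_apply, shiftAct_mapRange, mapRange_shiftAct]
    refine sum_congr rfl fun b _ => ?_
    rw [seriesAct]
    congr 2
    funext n
    ext
    simp [serMat]
  have hEp : C p * E = E := by
    rw [hE, schur_eq hpp hqq h2, ← mul_assoc, ← mul_assoc, hpp]
  have hzero : ∀ x, opAct E x = 0 ↔ pr (opAct E x) = 0 := fun x => by
    constructor
    · intro h; rw [h, map_zero]
    · intro h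
      have : opAct E x = opAct (C p) (opAct E x) := by rw [← Module.End.mul_apply, ← map_mul, hEp]
      rw [this, ← hincpr, h, map_zero]
  have hTY : (1 + A) * Y = E := by
    have h3 := schur_right hpp hqq h2
    have h4 := schur_eq hpp hqq h2
    rw [← hE] at h4
    rw [hqq, sub_mul, sub_mul, one_mul, sub_eq_zero, ← hqq] at h3
    rw [h4, ← h3]
  have hback : ∀ x, opAct (1 + A) x = 0 → x = opAct Y (inc (pr x)) := fun x hx => by
    have h3 := congrArg (fun t => opAct t x) (schur_left hpp hqq h1)
    simp only [map_mul, Module.End.mul_apply, hx, map_zero] at h3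
    have h4 : opAct Y (inc (pr x)) = x - opAct (C q + R * C q * A * C p) x := by
      rw [hincpr, ← Module.End.mul_apply, ← map_mul, ← sub_eq_zero, ← sub_add, hY, sub_mul,
        mul_assoc _ (C p), hpp, hqq]
      simp only [map_sub, map_add, map_one, LinearMap.sub_apply, LinearMap.add_apply, Module.End.one_apply]
      abel
    rw [h4, ← h3, sub_zero]
  let f : LinearMap.ker (opAct (1 + A)) →ₗ[ℂ] LinearMap.ker (matAct (serMat e co E)) :=
    (pr.comp (Submodule.subtype _)).codRestrict _ fun x => by
      have hx : opAct (1 + A) x.1 = 0 := x.2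
      rw [LinearMap.mem_ker, hmat, LinearMap.comp_apply, Submodule.subtype_apply, ← hTY, map_mul,
        Module.End.mul_apply, ← hback _ hx, hx, map_zero]
  refine (LinearEquiv.ofBijective f ⟨?_, ?_⟩).rank_eq
  · intro x y hxy
    have h3 : pr x.1 = pr y.1 := congrArg Subtype.val hxy
    refine Subtype.ext ?_
    rw [hback _ x.2, hback _ y.2, h3]
  · rintro ⟨y, hy⟩
    rw [LinearMap.mem_ker, hmat, ← hzero] at hy
    refine ⟨⟨opAct Y (inc y), ?_⟩, Subtype.ext ?_⟩
    · rw [LinearMap.mem_ker, ← Module.End.mul_apply, ← map_mul, hTY, hy]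
    · change pr (opAct Y (inc y)) = y
      have h3 := schur_proj hpp hqq h2
      rw [← hprp, ← Module.End.mul_apply, ← map_mul, hY, h3, hincp, hprinc]

end OperatorChains

end GegenbauerStability

end

open scoped ENNReal NNReal

noncomputable section

namespace GegenbauerStability

/-! ### Taylor expansions in Banach algebras, as formal power series. -/

section TaylorSeries

open PowerSeries Finset Filter Topology

variable {B B' : Type*} [NormedRing B] [NormedAlgebra ℂ B] [CompleteSpace B]
  [NormedRing B'] [NormedAlgebra ℂ B'] {c : ℂ}

/-- The function `f` is the sum of the power series `p` near the point `c`. -/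
def HasSer {B : Type*} [NormedRing B] [NormedAlgebra ℂ B] (f : ℂ → B) (p : B⟦X⟧) (c : ℂ) : Prop :=
  ∀ᶠ z in 𝓝 (0 : ℂ), Summable (fun n => ‖z ^ n • coeff n p‖) ∧
    HasSum (fun n => z ^ n • coeff n p) (f (c + z))

omit [CompleteSpace B] in
lemma HasSer.congr {f g : ℂ → B} {p : B⟦X⟧} (hf : HasSer f p c) (h : f =ᶠ[𝓝 c] g) :
    HasSer g p c := by
  rw [← map_add_left_nhds_zero c] at h
  have h' : ∀ᶠ z in 𝓝 (0 : ℂ), f (c + z) = g (c + z) := h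
  filter_upwards [hf, h'] with z hz hz'
  rwa [← hz']

omit [CompleteSpace B] in
lemma hasSer_monomial (k : ℕ) (b : B) :
    HasSer (fun z => (z - c) ^ k • b) (monomial k b) c := by
  refine Eventually.of_forall fun z => ⟨?_, ?_⟩
  · refine summable_of_ne_finset_zero (s := {k}) fun n hn => ?_
    rw [coeff_monomial, if_neg (by simpa using hn), smul_zero, norm_zero]
  · have := hasSum_single (f := fun n => z ^ n • coeff n (monomial k b)) k fun n hn => by
      rw [coeff_monomial, if_neg hn, smul_zero]
    simpa using this

omit [CompleteSpace B] in
lemma hasSer_const (b : B) : HasSer (fun _ => b) (C b) c := by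
  simpa using hasSer_monomial (c := c) 0 b

omit [CompleteSpace B] in
lemma HasSer.add {f g : ℂ → B} {p p' : B⟦X⟧} (hf : HasSer f p c) (hg : HasSer g p' c) :
    HasSer (fun z => f z + g z) (p + p') c := by
  filter_upwards [hf, hg] with z h1 h2
  simp only [map_add, smul_add]
  exact ⟨(h1.1.add h2.1).of_nonneg_of_le (fun _ => norm_nonneg _) fun n => norm_add_le _ _,
    h1.2.add h2.2⟩

/-- Absolute convergence is included in `HasSer` for this Cauchy product. -/
lemma HasSer.mul {f g : ℂ → B} {p p' : B⟦X⟧} (hf : HasSer f p c) (hg : HasSer g p' c) :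
    HasSer (fun z => f z * g z) (p * p') c := by
  filter_upwards [hf, hg] with z h1 h2
  have h3 : ∀ n, z ^ n • coeff n (p * p') = ∑ kl ∈ antidiagonal n,
      (z ^ kl.1 • coeff kl.1 p) * (z ^ kl.2 • coeff kl.2 p') := fun n => by
    rw [coeff_mul, smul_sum]
    refine sum_congr rfl fun kl hkl => ?_
    rw [HasAntidiagonal.mem_antidiagonal] at hkl
    rw [smul_mul_smul_comm, ← pow_add, hkl]
  simp only [h3]
  have h4 := summable_norm_sum_mul_antidiagonal_of_summable_norm h1.1 h2.1
  refine ⟨h4, ?_⟩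
  rw [← h1.2.tsum_eq, ← h2.2.tsum_eq,
    tsum_mul_tsum_eq_tsum_sum_antidiagonal_of_summable_norm h1.1 h2.1]
  exact h4.of_norm.hasSum

omit [CompleteSpace B] in
lemma HasSer.map {f : ℂ → B} {p : B⟦X⟧} (hf : HasSer f p c) (φ : B →L[ℂ] B') :
    HasSer (fun z => φ (f z)) (PowerSeries.mk fun n => φ (coeff n p)) c := by
  filter_upwards [hf] with z h
  simp only [coeff_mk, ← map_smul]
  exact ⟨(h.1.mul_left ‖φ‖).of_nonneg_of_le (fun _ => norm_nonneg _) fun n => φ.le_opNorm _,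
    φ.hasSum h.2⟩

omit [CompleteSpace B] in
lemma HasSer.neg {f : ℂ → B} {p : B⟦X⟧} (hf : HasSer f p c) : HasSer (fun z => -f z) (-p) c := by
  filter_upwards [hf] with z h
  simp only [map_neg, smul_neg, norm_neg]
  exact ⟨h.1, h.2.neg⟩

omit [CompleteSpace B] in
lemma HasSer.sub {f g : ℂ → B} {p p' : B⟦X⟧} (hf : HasSer f p c) (hg : HasSer g p' c) :
    HasSer (fun z => f z - g z) (p - p') c := by
  simpa only [sub_eq_add_neg] using hf.add hg.neg

/-- A formal power series as a formal multilinear series. -/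
def serFMS {B : Type*} [NormedRing B] [NormedAlgebra ℂ B] (p : B⟦X⟧) :
    FormalMultilinearSeries ℂ ℂ B :=
  fun n => ContinuousMultilinearMap.mkPiRing ℂ (Fin n) (coeff n p)

omit [CompleteSpace B] in
lemma coeff_serFMS (p : B⟦X⟧) (n : ℕ) : (serFMS p).coeff n = coeff n p := by
  simp [serFMS, FormalMultilinearSeries.coeff]

omit [CompleteSpace B] in
lemma HasSer.hasFPowerSeriesAt {f : ℂ → B} {p : B⟦X⟧} (hf : HasSer f p c) :
    HasFPowerSeriesAt f (serFMS p) c := by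
  refine hasFPowerSeriesAt_iff.2 ?_
  filter_upwards [hf] with z h
  simpa only [coeff_serFMS] using h.2

omit [CompleteSpace B] in
lemma HasSer.unique {f : ℂ → B} {p p' : B⟦X⟧} (hf : HasSer f p c) (hf' : HasSer f p' c) :
    p = p' := by
  have h := hf.hasFPowerSeriesAt.eq_formalMultilinearSeries hf'.hasFPowerSeriesAt
  ext n
  have h1 := congrArg (fun q : FormalMultilinearSeries ℂ ℂ B => q.coeff n) h
  simpa only [coeff_serFMS] using h1

omit [CompleteSpace B] in
lemma exists_hasSer {f : ℂ → B} (hf : AnalyticAt ℂ f c) : ∃ p : B⟦X⟧, HasSer f p c := by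
  obtain ⟨P, hP⟩ := hf
  obtain ⟨r, hr⟩ := hP
  refine ⟨PowerSeries.mk P.coeff, ?_⟩
  filter_upwards [Metric.eball_mem_nhds (0 : ℂ) hr.r_pos] with z hz
  simp only [coeff_mk, ← FormalMultilinearSeries.apply_eq_pow_smul_coeff]
  exact ⟨P.summable_norm_apply (Metric.eball_subset_eball hr.r_le hz), hr.hasSum hz⟩

/-- The inverse of an invertible germ. -/
lemma HasSer.inverse {f : ℂ → B} {M : B⟦X⟧} (hf : HasSer f M c) (hu : IsUnit (f c)) :
    ∃ R : B⟦X⟧, HasSer (fun z => Ring.inverse (f z)) R c ∧ R * M = 1 ∧ M * R = 1 := by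
  have han : AnalyticAt ℂ f c := ⟨_, hf.hasFPowerSeriesAt⟩
  obtain ⟨u, hu'⟩ := hu
  have h1 : AnalyticAt ℂ (Ring.inverse : B → B) (f c) := by
    rw [← hu']; exact analyticAt_inverse u
  obtain ⟨R, hR⟩ := exists_hasSer (AnalyticAt.fun_comp h1 han)
  have hunit : ∀ᶠ z in 𝓝 c, IsUnit (f z) :=
    han.continuousAt.eventually_mem (Units.isOpen.mem_nhds ⟨u, hu'⟩)
  -- The two inverse identities hold for the functions near `c`, and uniqueness of Taylor
  -- coefficients transfers them to the formal series.
  refine ⟨R, hR, ?_, ?_⟩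
  · refine ((hR.mul hf).congr ?_).unique (by simpa using hasSer_const (1 : B))
    filter_upwards [hunit] with z hz
    exact Ring.inverse_mul_cancel _ hz
  · refine ((hf.mul hR).congr ?_).unique (by simpa using hasSer_const (1 : B))
    filter_upwards [hunit] with z hz
    exact Ring.mul_inverse_cancel _ hz

omit [CompleteSpace B] in
lemma HasSer.sum {ι : Type*} (s : Finset ι) {f : ι → ℂ → B} {p : ι → B⟦X⟧}
    (h : ∀ i ∈ s, HasSer (f i) (p i) c) : HasSer (fun z => ∑ i ∈ s, f i z) (∑ i ∈ s, p i) c := by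
  classical
  induction s using Finset.induction_on with
  | empty => simpa using hasSer_const (0 : B)
  | insert i s his ih =>
    simp only [sum_insert his]
    exact (h i (mem_insert_self i s)).add (ih fun j hj => h j (mem_insert_of_mem hj))

lemma HasSer.prod {ι : Type*} (s : Finset ι) {f : ι → ℂ → ℂ} {p : ι → ℂ⟦X⟧}
    (h : ∀ i ∈ s, HasSer (f i) (p i) c) : HasSer (fun z => ∏ i ∈ s, f i z) (∏ i ∈ s, p i) c := by
  classical
  induction s using Finset.induction_on with
  | empty => simpa using hasSer_const (1 : ℂ)
  | insert i s his ih =>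
    simp only [prod_insert his]
    exact (h i (mem_insert_self i s)).mul (ih fun j hj => h j (mem_insert_of_mem hj))

lemma HasSer.det {ι : Type*} [Fintype ι] [DecidableEq ι] {f : ℂ → Matrix ι ι ℂ}
    {p : Matrix ι ι ℂ⟦X⟧} (h : ∀ i j, HasSer (fun z => f z i j) (p i j) c) :
    HasSer (fun z => (f z).det) p.det c := by
  simp only [Matrix.det_apply']
  refine HasSer.sum _ fun σ _ => HasSer.mul ?_ (HasSer.prod _ fun i _ => h _ _)
  simpa using hasSer_const (c := c) (((Equiv.Perm.sign σ : ℤ) : ℂ))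

/-- The order of vanishing of a function is the order of its Taylor series. -/
lemma HasSer.analyticOrderAt_eq {f : ℂ → ℂ} {p : ℂ⟦X⟧} (h : HasSer f p c) :
    analyticOrderAt f c = p.order := by
  have han : AnalyticAt ℂ f c := ⟨_, h.hasFPowerSeriesAt⟩
  by_cases htop : analyticOrderAt f c = ⊤
  · rw [analyticOrderAt_eq_top] at htop
    have : p = 0 := (h.congr htop).unique (by simpa using hasSer_const (0 : ℂ))
    rw [analyticOrderAt_eq_top.2 htop, this, order_zero]
  · obtain ⟨n, hn⟩ := ENat.ne_top_iff_exists.1 htop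
    rw [eq_comm, han.analyticOrderAt_eq_natCast] at hn
    obtain ⟨g, hg, hg0, hfg⟩ := hn
    obtain ⟨pg, hpg⟩ := exists_hasSer hg
    have h1 : HasSer (fun z => (z - c) ^ n • g z) (X ^ n * pg) c := by
      have := (hasSer_monomial (c := c) n (1 : ℂ)).mul hpg
      simpa [X_pow_eq] using this
    have h2 : p = X ^ n * pg := h.unique (h1.congr (hfg.mono fun z hz => hz.symm))
    have h3 : constantCoeff pg = g c := by
      have h4 := (Eventually.self_of_nhds hpg).2
      have h5 := hasSum_single (f := fun n => (0 : ℂ) ^ n • coeff n pg) 0 fun n hn => by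
        rw [zero_pow hn, zero_smul]
      have h6 := h5.unique h4
      simpa using h6
    have h4 : pg.order = 0 := order_zero_of_unit (by
      rw [isUnit_iff_constantCoeff, h3]; exact isUnit_iff_ne_zero.2 hg0)
    rw [h2, order_mul, order_X_pow, h4, add_zero]
    exact (han.analyticOrderAt_eq_natCast).2 ⟨g, hg, hg0, hfg⟩

end TaylorSeries

/-! ### Kernel dimensions as orders of vanishing. -/

section SchurDet

open PowerSeries Finset Filter Topology

variable {X : Type} [NormedAddCommGroup X] [NormedSpace ℂ X] [CompleteSpace X]
  {ι : Type}

/-- The matrix of the Schur complement of the operator `1 + D - λ L`. -/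
def schurMat (e : ι → X) (co : ι → X →L[ℂ] ℂ) (p q D L : X →L[ℂ] X) (l : ℂ) : Matrix ι ι ℂ :=
  Matrix.of fun a b =>
    co a (schur p q (D - l • L) (Ring.inverse (1 + q * (D - l • L) * q)) (e b))

lemma exists_hasSer_schurMat (e : ι → X) (co : ι → X →L[ℂ] ℂ) (p : X →L[ℂ] X) {q : X →L[ℂ] X}
    (D L : X →L[ℂ] X) {l : ℂ} (hu : IsUnit (1 + q * (D - l • L) * q)) :
    ∃ R, R * (1 + C q * (C (D - l • L) - monomial 1 L) * C q) = 1
      ∧ (1 + C q * (C (D - l • L) - monomial 1 L) * C q) * R = 1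
      ∧ ∀ a b, HasSer (fun z => schurMat e co p q D L z a b)
        (serMat e co (schur (C p) (C q) (C (D - l • L) - monomial 1 L) R) a b) l := by
  set A : (X →L[ℂ] X)⟦X⟧ := C (D - l • L) - monomial 1 L with hA
  have hsA : HasSer (fun z => D - z • L) A l := by
    have h1 := (hasSer_const (c := l) (D - l • L)).sub (hasSer_monomial (c := l) 1 L)
    refine h1.congr (Eventually.of_forall fun z => ?_)
    change D - l • L - (z - l) ^ 1 • L = D - z • L
    rw [pow_one, sub_smul]; abel
  have hsM : HasSer (fun z => 1 + q * (D - z • L) * q) (1 + C q * A * C q) l := by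
    have h1 := (hasSer_const (c := l) (1 : X →L[ℂ] X)).add
      (((hasSer_const (c := l) q).mul hsA).mul (hasSer_const (c := l) q))
    simpa using h1
  obtain ⟨R, hR, hR1, hR2⟩ := hsM.inverse hu
  refine ⟨R, hR1, hR2, fun a b => ?_⟩
  have hs : HasSer (fun z => schur p q (D - z • L) (Ring.inverse (1 + q * (D - z • L) * q)))
      (schur (C p) (C q) A R) l := by
    have hcp := hasSer_const (c := l) p
    have hcq := hasSer_const (c := l) q
    exact (hcp.add ((hcp.mul hsA).mul hcp)).sub (((((hcp.mul hsA).mul hR).mul hcq).mul hsA).mul hcp)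
  exact hs.map ((co a).comp (ContinuousLinearMap.apply ℂ X (e b)))

/-- The formal Schur complement, built from the Taylor series of the inverse tail, is the Taylor
series of the analytic one; so the order of the formal determinant is the analytic order of
vanishing. -/
lemma rank_ker_opAct_eq [Fintype ι] [DecidableEq ι] {e : ι → X} {co : ι → X →L[ℂ] ℂ}
    (hco : ∀ a b, co a (e b) = if a = b then 1 else 0) {p q : X →L[ℂ] X}
    (hp : ∀ x, p x = ∑ a, co a x • e a) (hq : q = 1 - p) (D L : X →L[ℂ] X) {l : ℂ}
    (hu : IsUnit (1 + q * (D - l • L) * q)) {d : ℕ}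
    (hd : analyticOrderAt (fun z => (schurMat e co p q D L z).det) l = d) :
    Module.rank ℂ (LinearMap.ker (opAct (1 + (C (D - l • L) - monomial 1 L)))) = d := by
  obtain ⟨R, hR1, hR2, hs⟩ := exists_hasSer_schurMat e co p D L hu
  rw [rank_ker_opAct hco hp hq hR1 hR2]
  refine rank_ker_matAct ?_
  rw [← hd]
  exact (HasSer.analyticOrderAt_eq (HasSer.det hs)).symm

lemma analyticAt_schurMat (e : ι → X) (co : ι → X →L[ℂ] ℂ) (p : X →L[ℂ] X) {q : X →L[ℂ] X}
    (D L : X →L[ℂ] X) {l : ℂ} (hu : IsUnit (1 + q * (D - l • L) * q)) (a b : ι) :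
    AnalyticAt ℂ (fun z => schurMat e co p q D L z a b) l := by
  obtain ⟨R, -, -, hs⟩ := exists_hasSer_schurMat e co p D L hu
  exact ⟨_, (hs a b).hasFPowerSeriesAt⟩

end SchurDet

end GegenbauerStability

end

/-! ### Eigenfunctions, generalized eigenspaces and chains. -/

open scoped ENNReal NNReal

noncomputable section

namespace GegenbauerStability

lemma contDiffOn_one_dx {E : Type*} [NormedAddCommGroup E] [NormedSpace ℝ E] {v : ℝ → E} {p : ℕ}
    (hv : ContDiffOn ℝ p v seg) {j : ℕ} (hj : j < p) : ContDiffOn ℝ 1 (dx j v) seg := by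
  have h := (dx_of_chain 1 (fun i => dx (j + i) v) (fun i hi x hx => ?_) ?_).1
  · simpa using h
  · exact hasDerivWithinAt_dx hv (by omega) hx
  · exact continuousOn_dx hv (by omega)

namespace Problem

variable {P : Problem}

lemma contDiffOn_DQcoef (hwell : IsUnit P.bcMat) (U : L1 ℝ) (i : Fin (2 * P.m)) :
    ContDiffOn ℝ 1 (P.DQcoef (P.sol (U : ℕ → ℝ)) i) seg := by
  have h (l : Fin (2 * P.m)) : ContDiffOn ℝ 1 (dx l (P.sol (U : ℕ → ℝ))) seg := by
    rw [sol, coe_LinvL hwell]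
    exact contDiffOn_one_dx (P.contDiffOn_cheb_LinvL U) l.2
  exact (contDiffOn_const.mul ((h i).pow _)).mul (contDiffOn_prod fun l _ => (h l).pow _)

/-- The function of `Dom` with `(-1)^{m+1} ∂ₓ^{2m} v = 𝒢₀ U`. -/
def domFun (P : Problem) : L1 ℂ →ₗ[ℂ] (ℝ → ℂ) where
  toFun U := seg.indicator (cheb (P.LinvL U : L1 ℂ))
  map_add' U W := by
    funext x
    by_cases hx : x ∈ seg
    · simp [hx, cheb_add _ _ hx]
    · simp [hx]
  map_smul' c U := by
    funext x
    by_cases hx : x ∈ seg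
    · simp [hx, cheb_smul _ _ hx]
    · simp [hx]

lemma domFun_eqOn (U : L1 ℂ) : Set.EqOn (P.domFun U) (cheb (P.LinvL U : L1 ℂ)) seg :=
  fun _ hx => Set.indicator_of_mem hx _

lemma domFun_apply_of_notMem (U : L1 ℂ) {x : ℝ} (hx : x ∉ seg) : P.domFun U x = 0 :=
  Set.indicator_of_notMem hx _

lemma domFun_mem (hwell : IsUnit P.bcMat) (U : L1 ℂ) : P.domFun U ∈ P.Dom :=
  ⟨fun _ hx => domFun_apply_of_notMem U hx, (P.contDiffOn_cheb_LinvL U).congr (domFun_eqOn U),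
    fun k => by rw [P.bc_congr (domFun_eqOn U), bc_cheb_LinvL hwell]⟩

lemma LinvL_injective : Function.Injective (P.LinvL : L1 ℂ →L[ℂ] L1 ℂ) := by
  rw [injective_iff_map_eq_zero]
  intro U hU
  refine cheb_injective fun x hx => ?_
  have h := P.dx_two_m_cheb_LinvL U hx
  rw [hU] at h
  have h0 : dx (2 * P.m) (cheb ((0 : L1 ℂ) : ℕ → ℂ)) x = 0 := by
    rw [dx_cheb_of_suppLt (d := 0) (fun _ _ => rfl) _ hx, map_zero, cheb_zero hx]
  rw [h0, eq_comm] at h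
  rw [cheb_zero hx]
  have h2 : (P.sgn : ℂ) ≠ 0 := fun h2 => by
    have := P.norm_sgn (𝕜 := ℂ); rw [h2] at this; simp at this
  exact (mul_eq_zero.1 h).resolve_left h2

lemma domFun_injective : Function.Injective P.domFun := by
  rw [injective_iff_map_eq_zero]
  intro U hU
  refine LinvL_injective (P := P) ?_
  rw [map_zero]
  refine cheb_injective fun x hx => ?_
  rw [← domFun_eqOn U hx, hU, cheb_zero hx]
  rfl

lemma lin_domFun (hwell : IsUnit P.bcMat) (Ut : L1 ℝ) (U : L1 ℂ) {x : ℝ} (hx : x ∈ seg) :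
    P.lin (P.sol (Ut : ℕ → ℝ)) (P.domFun U) x = cheb (U + DKL hwell Ut U : L1 ℂ) x := by
  rw [lin, Set.indicator_of_mem hx, cheb_add _ _ hx, DKL_apply, cheb_sum _ _ hx,
    dx_congr (domFun_eqOn U) _ hx, P.dx_two_m_cheb_LinvL U hx]
  congr 1
  · rw [← mul_assoc]
    change P.sgn * P.sgn * _ = _
    rw [sgn_mul_sgn, one_mul]
  · refine Finset.sum_congr rfl fun i _ => ?_
    rw [cheb_convL _ _ hx, cheb_VL hwell Ut i hx, dx_congr (domFun_eqOn U) _ hx,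
      P.dx_cheb_LinvL U i.2.le hx, Complex.real_smul]

/-- In the unknown `U`, with `(-1)^{m+1} ∂ₓ^{2m} v = 𝒢₀ U`, the differential operator becomes `1 +
D𝒦` and the function `v` itself becomes `ℒ⁻¹ U`; the equivalence then follows from injectivity of
Chebyshev series. -/
lemma lin_sub_smul_domFun_eq_iff (hwell : IsUnit P.bcMat) (Ut : L1 ℝ) (l : ℂ) (U W : L1 ℂ) :
    P.lin (P.sol (Ut : ℕ → ℝ)) (P.domFun U) - l • P.domFun U = P.domFun W
      ↔ U + (DKL hwell Ut U - l • P.LinvL U) = P.LinvL W := by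
  have key : ∀ x ∈ seg, (P.lin (P.sol (Ut : ℕ → ℝ)) (P.domFun U) - l • P.domFun U) x
      = cheb (U + (DKL hwell Ut U - l • P.LinvL U) : L1 ℂ) x := fun x hx => by
    rw [← add_sub_assoc, cheb_sub _ _ hx, cheb_smul _ _ hx, ← domFun_eqOn U hx,
      ← lin_domFun hwell Ut U hx]
    rfl
  constructor
  · intro h
    refine cheb_injective fun x hx => ?_
    rw [← key x hx, h, domFun_eqOn W hx]
  · intro h
    funext x
    by_cases hx : x ∈ seg
    · rw [key x hx, h, domFun_eqOn W hx]
    · rw [domFun_apply_of_notMem W hx, Pi.sub_apply, Pi.smul_apply, domFun_apply_of_notMem U hx, lin,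
        Set.indicator_of_notMem hx, smul_zero, sub_zero]

/-- An element of the domain is in the range of `domFun` if its image under `lin - l` is. -/
lemma exists_domFun (hwell : IsUnit P.bcMat) (Ut : L1 ℝ) (l : ℂ) {v : ℝ → ℂ} (hv : v ∈ P.Dom)
    {W : L1 ℂ} (h : P.lin (P.sol (Ut : ℕ → ℝ)) v - l • v = P.domFun W) :
    ∃ U, v = P.domFun U := by
  obtain ⟨h0, hc, hb⟩ := hv
  have hW : ContDiffOn ℝ 1 (cheb (P.LinvL W : L1 ℂ)) seg := by
    refine (P.contDiffOn_cheb_LinvL W).of_le ?_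
    exact_mod_cast P.two_m_pos
  have hc1 : ContDiffOn ℝ 1 v seg := hc.of_le (by exact_mod_cast P.two_m_pos)
  -- A priori the highest derivative is only continuous, which does not give summable coefficients.
  -- The equation expresses it as `u`, made of lower derivatives and of the smoother right-hand
  -- side, and `u` is of class `C¹`.
  set u : ℝ → ℂ := fun x => cheb (P.LinvL W : L1 ℂ) x + l * v x
    - ∑ i : Fin (2 * P.m), P.DQcoef (P.sol (Ut : ℕ → ℝ)) i x • dx i v x with hu
  have huc : ContDiffOn ℝ 1 u seg :=
    (hW.add (contDiffOn_const.mul hc1)).sub (ContDiffOn.sum fun i _ =>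
      (contDiffOn_DQcoef hwell Ut i).smul (contDiffOn_one_dx hc i.2))
  obtain ⟨U, hU⟩ := exists_cheb_of_contDiffOn huc
  refine ⟨U, funext fun x => ?_⟩
  by_cases hx : x ∈ seg
  · rw [domFun_eqOn U hx]
    refine eqOn_cheb_LinvL hwell hc hb (fun y hy => ?_) hx
    have h1 := congrFun h y
    rw [domFun_eqOn W hy, Pi.sub_apply, lin, Set.indicator_of_mem hy, Pi.smul_apply, smul_eq_mul] at h1
    have h2 : u y = P.sgn * dx (2 * P.m) v y := by
      simp only [hu, Complex.real_smul]
      rw [← h1, sgn]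
      ring
    rw [← hU y hy, h2, ← mul_assoc, sgn_mul_sgn, one_mul]
  · rw [h0 x hx, domFun_apply_of_notMem U hx]

open PowerSeries in
/-- The power series at `l` of the family of operators `1 + D𝒦 - λ ℒ⁻¹`. -/
def famSer (hwell : IsUnit P.bcMat) (Ut : L1 ℝ) (l : ℂ) : (L1 ℂ →L[ℂ] L1 ℂ)⟦X⟧ :=
  1 + (C (DKL hwell Ut - l • P.LinvL) - monomial 1 P.LinvL)

lemma opAct_famSer_eq_zero_iff (hwell : IsUnit P.bcMat) (Ut : L1 ℝ) (l : ℂ) (x : ℕ →₀ L1 ℂ) :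
    opAct (famSer hwell Ut l) x = 0
      ↔ ∀ n, x n + (DKL hwell Ut (x n) - l • P.LinvL (x n)) = P.LinvL (x (n + 1)) := by
  rw [Finsupp.ext_iff]
  refine forall_congr' fun n => ?_
  rw [opAct_apply, shiftAct_apply_of_two]
  · simp only [famSer, map_add, map_sub, PowerSeries.coeff_one, PowerSeries.coeff_C,
      PowerSeries.coeff_monomial, if_true, Nat.one_ne_zero, Nat.zero_ne_one, if_false, sub_zero, zero_add, zero_sub]
    rw [← sub_eq_zero (b := P.LinvL (x (n + 1)))]
    simp [sub_eq_add_neg]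
  · intro n hn
    simp only [famSer, map_add, map_sub, PowerSeries.coeff_one, PowerSeries.coeff_C,
      PowerSeries.coeff_monomial]
    simp [show n ≠ 0 by omega, show n ≠ 1 by omega]

/-- A vector killed by the `k`-th power generates the chain `v, (lin - l) v, …` of length at most
`k`. Each member lies in the range of `domFun` by descending regularity, starting from the end of
the chain, which is zero. -/
lemma mem_rootKer_iff (hwell : IsUnit P.bcMat) (Ut : L1 ℝ) (l : ℂ) (k : ℕ) (v : ℝ → ℂ) :
    v ∈ P.rootKer (P.sol (Ut : ℕ → ℝ)) l k ↔ ∃ x : ℕ →₀ L1 ℂ,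
      opAct (famSer hwell Ut l) x = 0 ∧ (∀ n, k ≤ n → x n = 0) ∧ v = P.domFun (x 0) := by
  induction k generalizing v with
  | zero =>
    constructor
    · rintro rfl
      exact ⟨0, by simp, by simp, by simp⟩
    · rintro ⟨x, -, h, rfl⟩
      rw [h 0 le_rfl, map_zero]; rfl
  | succ k ih =>
    constructor
    · rintro ⟨hv, hw⟩
      obtain ⟨x, hx, hk, h⟩ := (ih _).1 hw
      obtain ⟨U, rfl⟩ := exists_domFun hwell Ut l hv h
      rw [lin_sub_smul_domFun_eq_iff hwell] at h
      have hshift : ∀ n, (Finsupp.single 0 U + x.mapDomain Nat.succ : ℕ →₀ L1 ℂ) (n + 1) = x n := fun n => by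
        rw [Finsupp.add_apply, Finsupp.single_eq_of_ne (by omega), zero_add]
        exact Finsupp.mapDomain_apply Nat.succ_injective x n
      have hzero : (Finsupp.single 0 U + x.mapDomain Nat.succ : ℕ →₀ L1 ℂ) 0 = U := by
        rw [Finsupp.add_apply, Finsupp.single_eq_same, Finsupp.mapDomain_of_notMem_range, add_zero]
        simp
      -- Prepend `U` to the chain of `(lin - l) v`.
      refine ⟨Finsupp.single 0 U + x.mapDomain Nat.succ, ?_, ?_, by rw [hzero]⟩
      · rw [opAct_famSer_eq_zero_iff] at hx ⊢
        rintro (_ | n)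
        · rw [hshift, hzero, h]
        · rw [hshift, hshift, hx n]
      · rintro (_ | n) hn
        · omega
        · rw [hshift, hk n (by omega)]
    · rintro ⟨x, hx, hk, rfl⟩
      refine ⟨domFun_mem hwell _, (ih _).2 ⟨x.comapDomain Nat.succ Nat.succ_injective.injOn, ?_, ?_, ?_⟩⟩
      · rw [opAct_famSer_eq_zero_iff] at hx ⊢
        exact fun n => hx (n + 1)
      · exact fun n hn => hk (n + 1) (by omega)
      · rw [lin_sub_smul_domFun_eq_iff hwell]
        exact (opAct_famSer_eq_zero_iff hwell Ut l x).1 hx 0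

/-- The generalized eigenspace is isomorphic to the space of chains. -/
lemma rank_rootSpace (hwell : IsUnit P.bcMat) (Ut : L1 ℝ) (l : ℂ) :
    Module.rank ℂ (P.rootSpace (P.sol (Ut : ℕ → ℝ)) l)
      = Module.rank ℂ (LinearMap.ker (opAct (famSer hwell Ut l))) := by
  let Ψ : LinearMap.ker (opAct (famSer hwell Ut l)) →ₗ[ℂ] (ℝ → ℂ) :=
    (P.domFun.comp (Finsupp.lapply 0)).comp (Submodule.subtype _)
  have hΨ : ∀ x, Ψ x = P.domFun (x.1 0) := fun x => rfl
  -- A chain is determined by its first element, since each element determines `ℒ⁻¹` of the next one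
  -- and `ℒ⁻¹` is injective.
  have hinj : Function.Injective Ψ := by
    rw [injective_iff_map_eq_zero]
    rintro ⟨x, hx⟩ h0
    rw [hΨ] at h0
    have h1 : x 0 = 0 := domFun_injective (P := P) (by rw [h0, map_zero])
    rw [LinearMap.mem_ker, opAct_famSer_eq_zero_iff] at hx
    refine Subtype.ext (Finsupp.ext fun n => ?_)
    induction n with
    | zero => exact h1
    | succ n ih =>
      have h2 := hx n
      have ih' : x n = 0 := ih
      rw [ih', map_zero, map_zero, smul_zero, sub_zero, add_zero, eq_comm] at h2
      exact LinvL_injective (P := P) (h2.trans (map_zero _).symm)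
  have hrange : P.rootSpace (P.sol (Ut : ℕ → ℝ)) l = LinearMap.range Ψ := by
    rw [rootSpace]
    have : (⋃ k, P.rootKer (P.sol (Ut : ℕ → ℝ)) l k) = (LinearMap.range Ψ : Set (ℝ → ℂ)) := by
      ext v
      rw [Set.mem_iUnion]
      constructor
      · rintro ⟨k, hk⟩
        obtain ⟨x, hx, -, rfl⟩ := (mem_rootKer_iff hwell Ut l k v).1 hk
        exact ⟨⟨x, hx⟩, rfl⟩
      · rintro ⟨⟨x, hx⟩, rfl⟩
        refine ⟨x.support.sup id + 1, (mem_rootKer_iff hwell Ut l _ _).2 ⟨x, hx, fun n hn => ?_, rfl⟩⟩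
        by_contra h
        have := Finset.le_sup (f := id) (Finsupp.mem_support_iff.2 h)
        simp only [id] at this
        omega
    rw [this, Submodule.span_eq]
  rw [hrange]
  exact (LinearEquiv.ofInjective Ψ hinj).rank_eq.symm

/-- For a nonzero vector in `rootKer` of minimal exponent, its image under `lin - l` lies one level
lower, hence is zero: the vector is an eigenfunction. -/
lemma rootSpace_ne_bot_iff (w : ℝ → ℝ) (l : ℂ) : P.rootSpace w l ≠ ⊥ ↔ P.IsEigenvalue w l := by
  constructor
  · intro h
    have h1 : ∃ k, ∃ v ∈ P.rootKer w l k, v ≠ 0 := by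
      by_contra! hcon
      refine h (Submodule.span_eq_bot.2 fun v hv => ?_)
      obtain ⟨k, hk⟩ := Set.mem_iUnion.1 hv
      exact hcon k v hk
    classical
    obtain ⟨v, hv, hv0⟩ := Nat.find_spec h1
    have hmin := fun j => Nat.find_min h1 (m := j)
    generalize Nat.find h1 = k at hv hmin
    cases k with
    | zero => exact absurd hv hv0
    | succ k =>
      refine ⟨v, hv.1, hv0, ?_⟩
      by_contra hne
      exact hmin k (Nat.lt_succ_self k) ⟨_, hv.2, sub_ne_zero.2 hne⟩
  · rintro ⟨v, hv, hv0, h⟩ hbot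
    have h1 : v ∈ P.rootSpace w l := Submodule.subset_span (Set.mem_iUnion.2 ⟨1, hv, by
      rw [h, sub_self]; rfl⟩)
    rw [hbot] at h1
    exact hv0 h1

end Problem

end GegenbauerStability

end

open scoped ENNReal NNReal

noncomputable section

namespace GegenbauerStability

/-! ### Norm bounds for the Schur complement. -/

section SchurBound

variable {S : Type*} [NormedRing S]

lemma norm_sub_one_le_of_mul_eq_one {X R : S} (h1 : ‖(1 : S)‖ ≤ 1) {e : ℝ} (hX : ‖X‖ ≤ e) (he : e < 1)
    (h : (1 + X) * R = 1) : ‖R - 1‖ ≤ e / (1 - e) := by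
  have h2 : R - 1 = -(X * R) := by
    rw [add_mul, one_mul] at h
    rw [← h]; abel
  have h3 : ‖R‖ ≤ 1 + ‖R - 1‖ := by
    calc ‖R‖ = ‖1 + (R - 1)‖ := by congr 1; abel
      _ ≤ ‖(1 : S)‖ + ‖R - 1‖ := norm_add_le _ _
      _ ≤ _ := by linarith
  have h4 : ‖R - 1‖ ≤ e * (1 + ‖R - 1‖) := by
    calc ‖R - 1‖ = ‖X * R‖ := by rw [h2, norm_neg]
      _ ≤ ‖X‖ * ‖R‖ := norm_mul_le _ _
      _ ≤ _ := mul_le_mul hX h3 (norm_nonneg _) ((norm_nonneg _).trans hX)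
  rw [le_div_iff₀ (by linarith)]
  linarith

/-- The Schur complement, conjugated by an approximate diagonalization, is close to `p - m`. -/
lemma norm_schur_sub_le {p q a b m D D' L R : S} (hp : p * p = p) (hq : q = 1 - p) (ha : a * p = a)
    (hb : p * b = b) (h2 : (1 + q * (D - L) * q) * R = 1)
    {κ z₁ z₂ ρ₀ b₀ x₁ b₄ x₂ y₀ y₁ y₂ y₃ : ℝ} (hκ : ‖R - 1‖ ≤ κ)
    (n₁ : ‖p - a * (1 + D') * b‖ ≤ z₁) (n₂ : ‖a * (D' - D) * b‖ ≤ z₂) (n₃ : ‖a * L * b - m‖ ≤ ρ₀)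
    (u₁ : ‖q * D * b‖ ≤ b₀) (u₂ : ‖q * L * b‖ ≤ x₁) (v₁ : ‖a * D * q‖ ≤ b₄) (v₂ : ‖a * L * q‖ ≤ x₂)
    (w₀ : ‖a * D * q * D * b‖ ≤ y₀) (w₁ : ‖a * D * q * L * b‖ ≤ y₁) (w₂ : ‖a * L * q * D * b‖ ≤ y₂)
    (w₃ : ‖a * L * q * L * b‖ ≤ y₃) :
    ‖a * schur p q (D - L) R * b - (p - m)‖
      ≤ z₁ + z₂ + ρ₀ + (y₀ + y₁ + y₂ + y₃) + κ * (b₄ + x₂) * (b₀ + x₁) := by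
  have h3 := mul_left_of_schur hp hq h2
  have hqq : q * q = q := by rw [hq, mul_sub, sub_mul, sub_mul, hp]; simp
  have hRq : R * q = q * R * q := by
    have : R * q = (p + q) * R * q := by rw [hq]; noncomm_ring
    rw [this, add_mul, add_mul, h3, zero_add]
  have e1 : a * schur p q (D - L) R * b = a * b + a * (D - L) * b
      - (a * (D - L) * q) * (R * q) * ((D - L) * b) := by
    have : a * schur p q (D - L) R * b = (a * p) * b + (a * p) * (D - L) * (p * b)
        - (a * p) * (D - L) * (R * q) * (D - L) * (p * b) := by rw [schur]; noncomm_ring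
    rw [this, ha, hb, hRq]
    nth_rewrite 1 [← hqq]
    noncomm_ring
  have e2 : (a * (D - L) * q) * (R * q) * ((D - L) * b) = a * (D - L) * q * (D - L) * b
      + (a * (D - L) * q) * (R - 1) * (q * (D - L) * b) := by
    have : a * (D - L) * q * (D - L) * b = a * (D - L) * (q * q) * (D - L) * b := by rw [hqq]
    rw [this]; noncomm_ring
  -- Split `R = 1 + (R - 1)`: the part with `1` gives the four explicit products, controlled
  -- individually, and the remainder carries the factor `κ`, which becomes `ε/(1 - ε)`.
  have e3 : a * schur p q (D - L) R * b - (p - m) = -(p - a * (1 + D') * b) - a * (D' - D) * b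
      - (a * L * b - m) - (a * D * q * D * b - a * D * q * L * b - a * L * q * D * b
      + a * L * q * L * b) - (a * D * q - a * L * q) * (R - 1) * (q * D * b - q * L * b) := by
    rw [e1, e2]; noncomm_ring
  have f1 : ‖(a * D * q - a * L * q) * (R - 1) * (q * D * b - q * L * b)‖
      ≤ κ * (b₄ + x₂) * (b₀ + x₁) := by
    have g1 : ‖a * D * q - a * L * q‖ ≤ b₄ + x₂ := (norm_sub_le _ _).trans (add_le_add v₁ v₂)
    have g2 : ‖q * D * b - q * L * b‖ ≤ b₀ + x₁ := (norm_sub_le _ _).trans (add_le_add u₁ u₂)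
    have hκ0 := (norm_nonneg _).trans hκ
    have hx := (norm_nonneg _).trans g1
    calc _ ≤ ‖a * D * q - a * L * q‖ * ‖R - 1‖ * ‖q * D * b - q * L * b‖ :=
          (norm_mul_le _ _).trans (mul_le_mul_of_nonneg_right (norm_mul_le _ _) (norm_nonneg _))
      _ ≤ (b₄ + x₂) * κ * (b₀ + x₁) := by gcongr
      _ = _ := by ring
  have f2 : ‖a * D * q * D * b - a * D * q * L * b - a * L * q * D * b + a * L * q * L * b‖
      ≤ y₀ + y₁ + y₂ + y₃ :=
    (norm_add_le _ _).trans (add_le_add ((norm_sub_le _ _).trans (add_le_add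
      ((norm_sub_le _ _).trans (add_le_add w₀ w₁)) w₂)) w₃)
  rw [e3]
  refine (norm_sub_le _ _).trans (add_le_add ((norm_sub_le _ _).trans (add_le_add
    ((norm_sub_le _ _).trans (add_le_add ((norm_sub_le _ _).trans (add_le_add ?_ n₂)) n₃)) f2)) f1)
  rwa [norm_neg]

end SchurBound

/-! ### The hypotheses on the constants as operator norms on `ℓ¹₁`. -/

namespace Consts.Valid

variable {c : Consts} {P : Problem} {s : Fin (2 * P.m) → Equiv.Perm (Fin (2 * P.m))} {N : ℕ}
  {A0 : Matrix (Fin (N + 1)) (Fin (N + 1)) ℝ} {P0 : Matrix (Fin (N + 1)) (Fin (N + 1)) ℂ}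
  {Ub Ut : L1 ℝ} {r : ℝ≥0}

open Problem

lemma norm_Z1P (hc : c.Valid P s A0 P0 (Ub : ℕ → ℝ) (Ut : ℕ → ℝ) r) (hwell : IsUnit P.bcMat) :
    ‖embL P0⁻¹ * (embL P0 - embL (cplx A0) * (embL P0 + DKL hwell Ub * embL P0))‖ ≤ c.Z1P := by
  refine L1.norm_le_of_opNorm_le (fun U => ?_) hc.Z1P
  simp only [DF, coe_embL, coe_DKL hwell, ← L1.coe_add, ← L1.coe_sub]
  rfl

lemma norm_Z2P (hc : c.Valid P s A0 P0 (Ub : ℕ → ℝ) (Ut : ℕ → ℝ) r) (hwell : IsUnit P.bcMat) :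
    ‖embL (P0⁻¹ * cplx A0) * (DKL hwell Ub - DKL hwell Ut) * embL P0‖ ≤ c.Z2P * r := by
  refine (L1.norm_le_of_opNorm_le (fun U => ?_) hc.Z2P).trans_eq (by push_cast; rfl)
  simp only [DF, coe_embL, coe_DKL hwell, ← L1.coe_add, ← L1.coe_sub, add_sub_add_left_eq_sub]
  rfl

lemma norm_Z2le (hc : c.Valid P s A0 P0 (Ub : ℕ → ℝ) (Ut : ℕ → ℝ) r) (hwell : IsUnit P.bcMat) :
    ‖embL (cplx A0) * (DKL hwell Ub - DKL hwell Ut)‖ ≤ c.Z2le * r := by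
  refine (L1.norm_le_of_opNorm_le (fun U => ?_) hc.Z2le).trans_eq (by push_cast; rfl)
  simp only [DF, coe_embL, coe_DKL hwell, ← L1.coe_add, ← L1.coe_sub, add_sub_add_left_eq_sub]
  rfl

lemma norm_Z2gt (hc : c.Valid P s A0 P0 (Ub : ℕ → ℝ) (Ut : ℕ → ℝ) r) (hwell : IsUnit P.bcMat) :
    ‖qL N * (DKL hwell Ub - DKL hwell Ut : L1 ℂ →L[ℂ] L1 ℂ)‖ ≤ c.Z2gt * r := by
  refine (L1.norm_le_of_opNorm_le (fun U => ?_) hc.Z2gt).trans_eq (by push_cast; rfl)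
  simp only [coe_DKL hwell, ← L1.coe_sub, coe_qL]
  rfl

lemma norm_b01 (hc : c.Valid P s A0 P0 (Ub : ℕ → ℝ) (Ut : ℕ → ℝ) r) (hwell : IsUnit P.bcMat) :
    ‖qL N * DKL hwell Ub * embL P0‖ + ‖embL P0‖ * (c.Z2gt * r) ≤ c.b01 := by
  have h := ENNReal.toReal_mono ENNReal.coe_ne_top hc.b01
  rw [L1.opNorm_eq (M := qL N * DKL hwell Ub * embL P0) fun U => by
    simp only [coe_embL, coe_DKL hwell, coe_qL]; rfl] at h
  rw [ENNReal.toReal_add (by simp) ENNReal.coe_ne_top, ENNReal.toReal_ofReal (norm_nonneg _)] at h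
  simpa [coe_matNorm] using h

lemma norm_b02 (hc : c.Valid P s A0 P0 (Ub : ℕ → ℝ) (Ut : ℕ → ℝ) r) (hwell : IsUnit P.bcMat) :
    ‖embL (P0⁻¹ * cplx A0) * DKL hwell Ub * qL N * DKL hwell Ub * embL P0‖
      + ‖embL (P0⁻¹ * cplx A0) * DKL hwell Ub * qL N‖ * (‖embL P0‖ * (c.Z2gt * r)) ≤ c.b02 := by
  have h := ENNReal.toReal_mono ENNReal.coe_ne_top hc.b02
  rw [L1.opNorm_eq (M := embL (P0⁻¹ * cplx A0) * DKL hwell Ub * qL N * DKL hwell Ub * embL P0)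
    fun U => by simp only [coe_embL, coe_DKL hwell, coe_qL]; rfl,
    L1.opNorm_eq (M := embL (P0⁻¹ * cplx A0) * DKL hwell Ub * qL N)
    fun U => by simp only [coe_embL, coe_DKL hwell, coe_qL]; rfl] at h
  rw [ENNReal.toReal_add (by simp) (ENNReal.mul_ne_top (by simp) ENNReal.coe_ne_top), ENNReal.toReal_mul,
    ENNReal.toReal_ofReal (norm_nonneg _), ENNReal.toReal_ofReal (norm_nonneg _)] at h
  simpa [coe_matNorm] using h

lemma norm_b11 (hc : c.Valid P s A0 P0 (Ub : ℕ → ℝ) (Ut : ℕ → ℝ) r) (hwell : IsUnit P.bcMat)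
    (hN : 4 * P.m ≤ N) : P.eta (s ⟨0, P.two_m_pos⟩) ⟨0, P.two_m_pos⟩ (N + 1)
      * ‖embL (P0⁻¹ * cplx A0)‖ * (‖qL N * DKL hwell Ub * embL P0‖ + ‖embL P0‖ * (c.Z2gt * r))
      ≤ c.b11 := by
  have hm := P.one_le_m
  have h := ENNReal.toReal_mono ENNReal.coe_ne_top hc.b11
  rw [L1.opNorm_eq (M := qL N * DKL hwell Ub * embL P0) fun U => by
    simp only [coe_embL, coe_DKL hwell, coe_qL]; rfl] at h
  rw [ENNReal.toReal_mul, ENNReal.toReal_mul, ENNReal.toReal_ofReal (eta_pos (by omega)).le,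
    ENNReal.toReal_add (by simp) ENNReal.coe_ne_top, ENNReal.toReal_ofReal (norm_nonneg _)] at h
  simpa [coe_matNorm] using h

lemma norm_b12 (hc : c.Valid P s A0 P0 (Ub : ℕ → ℝ) (Ut : ℕ → ℝ) r) (hwell : IsUnit P.bcMat) :
    ‖qL N * P.LinvL * embL P0‖ ≤ c.b12 := by
  refine L1.norm_le_of_opNorm_le (fun U => ?_) hc.b12
  simp only [coe_embL, coe_LinvL hwell, coe_qL]
  rfl

lemma norm_b13 (hc : c.Valid P s A0 P0 (Ub : ℕ → ℝ) (Ut : ℕ → ℝ) r) (hwell : IsUnit P.bcMat) :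
    ‖embL (P0⁻¹ * cplx A0) * DKL hwell Ub * qL N * P.LinvL * embL P0‖ ≤ c.b13 := by
  refine L1.norm_le_of_opNorm_le (fun U => ?_) hc.b13
  simp only [coe_embL, coe_LinvL hwell, coe_qL, coe_DKL hwell]
  rfl

lemma norm_b14 (hc : c.Valid P s A0 P0 (Ub : ℕ → ℝ) (Ut : ℕ → ℝ) r) (hwell : IsUnit P.bcMat) :
    ‖embL (P0⁻¹ * cplx A0) * DKL hwell Ub * qL N‖ + ‖embL P0⁻¹‖ * (c.Z2le * r) ≤ c.b14 := by
  have h := ENNReal.toReal_mono ENNReal.coe_ne_top hc.b14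
  rw [L1.opNorm_eq (M := embL (P0⁻¹ * cplx A0) * DKL hwell Ub * qL N)
    fun U => by simp only [coe_embL, coe_DKL hwell, coe_qL]; rfl] at h
  rw [ENNReal.toReal_add (by simp) ENNReal.coe_ne_top, ENNReal.toReal_ofReal (norm_nonneg _)] at h
  simpa [coe_matNorm] using h

lemma norm_b21 (hc : c.Valid P s A0 P0 (Ub : ℕ → ℝ) (Ut : ℕ → ℝ) r) (hwell : IsUnit P.bcMat) :
    ‖embL (P0⁻¹ * cplx A0) * P.LinvL * qL N * P.LinvL * embL P0‖ ≤ c.b21 := by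
  refine L1.norm_le_of_opNorm_le (fun U => ?_) hc.b21
  simp only [coe_embL, coe_LinvL hwell, coe_qL]
  rfl

lemma norm_b22 (hc : c.Valid P s A0 P0 (Ub : ℕ → ℝ) (Ut : ℕ → ℝ) r) (hN : 4 * P.m ≤ N) :
    P.eta (s ⟨0, P.two_m_pos⟩) ⟨0, P.two_m_pos⟩ (N + 1) * ‖embL (P0⁻¹ * cplx A0)‖ ≤ c.b22 := by
  have hm := P.one_le_m
  have h := ENNReal.toReal_mono ENNReal.coe_ne_top hc.b22
  rw [ENNReal.toReal_mul, ENNReal.toReal_ofReal (eta_pos (by omega)).le] at h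
  simpa [coe_matNorm] using h

end Consts.Valid

end GegenbauerStability

end

open scoped ENNReal NNReal

noncomputable section

namespace GegenbauerStability

/-! ### The matrix of the Schur complement and the tail block. -/

section MatrixOperators

variable {𝕜 : Type*} [RCLike 𝕜] {d : ℕ}

lemma embL_sub (M M' : Matrix (Fin d) (Fin d) 𝕜) : embL (M - M') = embL M - embL M' := by
  ext U n
  rw [sub_apply, L1.sub_apply, embL_apply, embL_apply, embL_apply, Matrix.sub_mulVec]
  simp only [ofFin_apply, Pi.sub_apply]
  split_ifs <;> simp

lemma embL_smul (c : 𝕜) (M : Matrix (Fin d) (Fin d) 𝕜) : embL (c • M) = c • embL M := by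
  ext U n
  rw [smul_apply, L1.smul_apply, embL_apply, embL_apply, Matrix.smul_mulVec]
  simp only [ofFin_apply, Pi.smul_apply, smul_eq_mul]
  split_ifs <;> simp

lemma pL_e_of_lt {N k : ℕ} (h : N < k) : pL N (L1.e k : L1 𝕜) = 0 := by
  ext n
  rw [pL_apply, L1.e_apply]
  split_ifs <;> first | rfl | omega

lemma pL_e_of_le {N k : ℕ} (h : k ≤ N) : pL N (L1.e k : L1 𝕜) = L1.e k := by
  ext n
  rw [pL_apply, L1.e_apply]
  split_ifs <;> first | rfl | omega

/-- An operator between the ranges of `π^{≤ N}` is a matrix. -/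
lemma embL_of_coord {N : ℕ} {G : L1 𝕜 →L[𝕜] L1 𝕜} (h1 : pL N * G = G) (h2 : G * pL N = G) :
    embL (Matrix.of fun a b : Fin (N + 1) => (G (L1.e (b : ℕ))) a) = G := by
  refine L1.clm_ext fun n => ?_
  rcases lt_or_ge n (N + 1) with hn | hn
  · have h3 := embL_e (Matrix.of fun a b : Fin (N + 1) => (G (L1.e (b : ℕ))) a) ⟨n, hn⟩
    rw [h3]
    have h4 : SuppLt (N + 1) (G (L1.e n)) := fun l hl => by
      rw [← h1, mul_apply_eq_comp, pL_apply, if_neg (by omega)]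
    conv_rhs => rw [h4.eq_ofFin]
    rfl
  · rw [← h2, mul_apply_eq_comp, pL_e_of_lt (by omega), map_zero, embL_apply]
    ext l
    rw [ofFin_apply]
    split_ifs with hl
    · rw [Matrix.mulVec, dotProduct]
      refine Finset.sum_eq_zero fun b _ => ?_
      rw [L1.e_of_ne (by omega), mul_zero]
    · rfl

lemma embL_mul_pL {N : ℕ} (M : Matrix (Fin (N + 1)) (Fin (N + 1)) 𝕜) : embL M * pL N = embL M := by
  rw [pL, ← embL_mul, mul_one]

lemma pL_mul_embL {N : ℕ} (M : Matrix (Fin (N + 1)) (Fin (N + 1)) 𝕜) : pL N * embL M = embL M := by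
  rw [pL, ← embL_mul, one_mul]

end MatrixOperators

namespace Problem

variable {P : Problem} {N : ℕ} {A0 : Matrix (Fin (N + 1)) (Fin (N + 1)) ℝ}
  {P0 : Matrix (Fin (N + 1)) (Fin (N + 1)) ℂ} {Ub Ut : L1 ℝ}

/-- The matrix of the Schur complement of `1 + D𝒦 - λ ℒ⁻¹`. -/
def EMat (hwell : IsUnit P.bcMat) (Ut : L1 ℝ) (N : ℕ) (l : ℂ) : Matrix (Fin (N + 1)) (Fin (N + 1)) ℂ :=
  schurMat (fun a => L1.e (a : ℕ)) (fun a => L1.coord (a : ℕ)) (pL N) (qL N) (DKL hwell Ut) P.LinvL l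

lemma embL_EMat (hwell : IsUnit P.bcMat) (Ut : L1 ℝ) (N : ℕ) (l : ℂ) :
    embL (EMat hwell Ut N l) = schur (pL N) (qL N) (DKL hwell Ut - l • P.LinvL)
      (Ring.inverse (1 + qL N * (DKL hwell Ut - l • P.LinvL) * qL N)) := by
  refine embL_of_coord ?_ ?_
  · simp only [schur, mul_add, mul_sub, ← mul_assoc, pL_mul_pL]
  · simp only [schur, add_mul, sub_mul, mul_assoc, pL_mul_pL]

lemma embL_LinvMat (hwell : IsUnit P.bcMat) (N : ℕ) : embL (P.LinvMat N) = pL N * P.LinvL * pL N := by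
  rw [← embL_of_coord (G := pL N * P.LinvL * pL N) (by rw [← mul_assoc, ← mul_assoc, pL_mul_pL])
    (by rw [mul_assoc, pL_mul_pL])]
  congr 1
  ext1 a b
  rw [LinvMat, Matrix.of_apply, Matrix.of_apply, mul_apply_eq_comp, mul_apply_eq_comp,
    pL_e_of_le (by omega), pL_apply, if_pos (by omega), ← coe_LinvL hwell]
  rfl

lemma embL_M0 (hwell : IsUnit P.bcMat) : embL (P.M0 A0 P0) = embL (P0⁻¹ * cplx A0) * P.LinvL * embL P0 := by
  rw [M0, embL_mul, embL_mul, embL_LinvMat hwell]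
  rw [← mul_assoc, ← mul_assoc, embL_mul_pL, mul_assoc _ (pL N), pL_mul_embL]

/-- The deviation of the Schur complement from the diagonal matrix with entries `1 - λ μ_j`. -/
def errMat (hwell : IsUnit P.bcMat) (A0 : Matrix (Fin (N + 1)) (Fin (N + 1)) ℝ)
    (P0 : Matrix (Fin (N + 1)) (Fin (N + 1)) ℂ) (Ut : L1 ℝ) (l : ℂ) :
    Matrix (Fin (N + 1)) (Fin (N + 1)) ℂ :=
  P0⁻¹ * cplx A0 * EMat hwell Ut N l * P0
    - (1 - l • Matrix.diagonal fun j => P.M0 A0 P0 j j)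

lemma embL_errMat (hwell : IsUnit P.bcMat) (l : ℂ) : embL (errMat hwell A0 P0 Ut l)
    = embL (P0⁻¹ * cplx A0) * schur (pL N) (qL N) (DKL hwell Ut - l • P.LinvL)
      (Ring.inverse (1 + qL N * (DKL hwell Ut - l • P.LinvL) * qL N)) * embL P0
      - (pL N - l • embL (Matrix.diagonal fun j => P.M0 A0 P0 j j)) := by
  rw [errMat, embL_sub, embL_mul, embL_mul, embL_EMat, embL_sub, embL_smul, pL]

/-- `ε` is affine in the radius, hence continuous: the condition `ε < 1` survives a small
enlargement of `λ_max`. -/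
lemma eps_eq (s : Fin (2 * P.m) → Equiv.Perm (Fin (2 * P.m))) (Ubar : ℕ → ℝ) (l : ℝ) (Z2gt r : ℝ≥0) :
    P.eps s N Ubar l Z2gt r = P.eps s N Ubar 0 Z2gt r + l * gam (2 * P.m) (N + 1) := by
  rw [eps, eps]; ring

variable {c : Consts} {s : Fin (2 * P.m) → Equiv.Perm (Fin (2 * P.m))} {r : ℝ≥0}

/-- The tail of the operator `1 + D𝒦 - λ ℒ⁻¹` is a perturbation of the identity. -/
lemma norm_tail_le (hwell : IsUnit P.bcMat) (hN : 4 * P.m ≤ N) (hs : ∀ i, IsUnit (P.B11 (s i) i))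
    (hc : c.Valid P s A0 P0 (Ub : ℕ → ℝ) (Ut : ℕ → ℝ) r) {l : ℂ} {ρ : ℝ} (hl : ‖l‖ ≤ ρ) :
    ‖qL N * (DKL hwell Ut - l • P.LinvL) * (qL N : L1 ℂ →L[ℂ] L1 ℂ)‖ ≤ P.eps s N (Ub : ℕ → ℝ) ρ c.Z2gt r := by
  have hm := P.one_le_m
  have hg := gam_pos (p := 2 * P.m) (k := N + 1) (by omega)
  have hq : ‖(qL N : L1 ℂ →L[ℂ] L1 ℂ)‖ ≤ 1 := norm_qL_le N
  set K₀ : ℝ := ∑ i : Fin (2 * P.m), (2 * P.eta (s i) i (N + 1)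
      * (∑' k : ℕ, if N + i < k + 2 * P.m then |P.V (Ub : ℕ → ℝ) i k| else 0)
      + (ell1Norm (P.V (Ub : ℕ → ℝ) i)).toReal * gam (2 * P.m - i) (N + 1)) with hK
  have hK0 : 0 ≤ K₀ := Finset.sum_nonneg fun i _ => add_nonneg
    (mul_nonneg (mul_nonneg (by norm_num) (eta_pos (by omega)).le)
      (tsum_nonneg fun k => by split_ifs <;> positivity))
    (mul_nonneg ENNReal.toReal_nonneg (gam_pos (by omega)).le)
  have h1 : ‖qL N * DKL hwell Ub * (qL N : L1 ℂ →L[ℂ] L1 ℂ)‖ ≤ K₀ := by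
    refine norm_mul_qL_le _ hK0 fun k hk => ?_
    rw [mul_apply_eq_comp, DKL_apply, map_sum, hK, Finset.mul_sum]
    refine norm_sum_le_of_le _ fun i _ => ?_
    have := norm_qL_convL_KiL_e_le (𝕜 := ℂ) hwell (hs i) hN hk (VL hwell Ub i)
    rwa [coe_VL hwell, L1.ell1Norm_coe, ENNReal.toReal_ofReal (norm_nonneg _)]
  have h2 : ‖qL N * P.LinvL * (qL N : L1 ℂ →L[ℂ] L1 ℂ)‖ ≤ gam (2 * P.m) (N + 1) :=
    norm_mul_qL_le _ hg.le fun k hk => norm_qL_LinvL_e_le hwell (hs _) hN hk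
  have h3 : ‖qL N * (DKL hwell Ub - DKL hwell Ut) * (qL N : L1 ℂ →L[ℂ] L1 ℂ)‖ ≤ c.Z2gt * r := by
    refine (norm_mul_le _ _).trans ?_
    have := hc.norm_Z2gt hwell
    have h0 := norm_nonneg (qL N * (DKL hwell Ub - DKL hwell Ut : L1 ℂ →L[ℂ] L1 ℂ))
    nlinarith
  have e : qL N * (DKL hwell Ut - l • P.LinvL) * (qL N : L1 ℂ →L[ℂ] L1 ℂ) = qL N * DKL hwell Ub * qL N
      - qL N * (DKL hwell Ub - DKL hwell Ut) * qL N - l • (qL N * P.LinvL * qL N) := by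
    rw [mul_sub, sub_mul, mul_smul_comm, smul_mul_assoc]
    congr 1
    noncomm_ring
  rw [e]
  refine (norm_sub_le _ _).trans ?_
  have h4 := norm_sub_le (qL N * DKL hwell Ub * (qL N : L1 ℂ →L[ℂ] L1 ℂ))
    (qL N * (DKL hwell Ub - DKL hwell Ut) * qL N)
  have h5 : ‖l • (qL N * P.LinvL * (qL N : L1 ℂ →L[ℂ] L1 ℂ))‖ ≤ ρ * gam (2 * P.m) (N + 1) := by
    rw [norm_smul]
    exact mul_le_mul hl h2 (norm_nonneg _) ((norm_nonneg _).trans hl)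
  rw [eps]
  linarith

end Problem

end GegenbauerStability

end

/-! ### The deviation from the diagonal matrix, compared with `δ`. -/

open scoped ENNReal NNReal

noncomputable section

namespace GegenbauerStability

/-- The bound of the deviation from the diagonal matrix, for `|λ| ≤ l`; here `R` bounds the
off-diagonal part, `x` replaces `β_{2,2}` and `e` replaces `ε`. -/
def Consts.dev (c : Consts) (nP R x e : ℝ) (r : ℝ≥0) (l : ℝ) : ℝ :=
  c.Z1P + c.Z2P * r + l * R + (c.b02 + nP * (c.Z2le * r) * c.b01
    + l * (c.b13 + nP * (c.Z2le * r) * c.b12) + l * c.b11 + l ^ 2 * c.b21)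
    + e / (1 - e) * (c.b14 + l * x) * (c.b01 + l * c.b12)

/-- Here `D` and `D'` stand for `D𝒦` at the true zero and at the approximate one. The hypotheses
concern `D'`, and every product containing `D` is expanded around it; the corrections are those
measured by `Z2le`, `Z2gt` and `Z2P`. -/
lemma norm_schur_sub_le_dev {S : Type*} [NormedRing S] [NormedAlgebra ℂ S] {c : Consts} {r : ℝ≥0}
    {p q a b bi a0 m R0 D D' L R : S} {l : ℂ} {ρ e η η' : ℝ} (hl : ‖l‖ ≤ ρ) (hρ : 0 ≤ ρ)
    (hp : p * p = p) (hq : q = 1 - p) (hap : a * p = a) (hpb : p * b = b) (hib : bi * b = p)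
    (hab : a = bi * a0) (hR0 : R0 = a * L * b - m) (hqN : ‖q‖ ≤ 1)
    (h2 : (1 + q * (D - l • L) * q) * R = 1) (hκ : ‖R - 1‖ ≤ e / (1 - e))
    (n1 : ‖bi * (b - a0 * (b + D' * b))‖ ≤ c.Z1P) (n2 : ‖a * (D' - D) * b‖ ≤ c.Z2P * r)
    (nle : ‖a0 * (D' - D)‖ ≤ c.Z2le * r) (ngt : ‖q * (D' - D)‖ ≤ c.Z2gt * r)
    (n01 : ‖q * D' * b‖ + ‖b‖ * (c.Z2gt * r) ≤ c.b01)
    (n02 : ‖a * D' * q * D' * b‖ + ‖a * D' * q‖ * (‖b‖ * (c.Z2gt * r)) ≤ c.b02)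
    (n11 : η * ‖a‖ * (‖q * D' * b‖ + ‖b‖ * (c.Z2gt * r)) ≤ c.b11) (n12 : ‖q * L * b‖ ≤ c.b12)
    (n13 : ‖a * D' * q * L * b‖ ≤ c.b13) (n14 : ‖a * D' * q‖ + ‖bi‖ * (c.Z2le * r) ≤ c.b14)
    (n21 : ‖a * L * q * L * b‖ ≤ c.b21) (hη : ‖L * q‖ ≤ η') (hηη : η' ≤ η) :
    ‖a * schur p q (D - l • L) R * b - (p - l • m)‖ ≤ c.dev ‖bi‖ ‖R0‖ (η' * ‖a‖) e r ρ := by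
  have hqq : q * q = q := by rw [hq, mul_sub, sub_mul, sub_mul, hp]; simp
  have hz : (0 : ℝ) ≤ c.Z2gt * r := by positivity
  have hzl : (0 : ℝ) ≤ c.Z2le * r := by positivity
  have u0 : ‖q * D * b‖ ≤ ‖q * D' * b‖ + ‖b‖ * (c.Z2gt * r) := by
    have : q * D * b = q * D' * b - q * (D' - D) * b := by noncomm_ring
    rw [this]
    refine (norm_sub_le _ _).trans (add_le_add le_rfl ((norm_mul_le _ _).trans ?_))
    rw [mul_comm]
    gcongr
  have v0 : ‖a * (D' - D)‖ ≤ ‖bi‖ * (c.Z2le * r) := by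
    rw [hab, mul_assoc]
    exact (norm_mul_le _ _).trans (by gcongr)
  have u1 : ‖q * D * b‖ ≤ c.b01 := u0.trans n01
  have hη0 : 0 ≤ η' := (norm_nonneg _).trans hη
  refine (norm_schur_sub_le (D' := D') (z₁ := c.Z1P) (ρ₀ := ρ * ‖R0‖)
    (x₁ := ρ * c.b12) (b₄ := c.b14) (x₂ := ρ * (η' * ‖a‖))
    (y₀ := c.b02 + ‖bi‖ * (c.Z2le * r) * c.b01)
    (y₁ := ρ * (c.b13 + ‖bi‖ * (c.Z2le * r) * c.b12)) (y₂ := ρ * c.b11) (y₃ := ρ ^ 2 * c.b21)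
    hp hq hap hpb h2 hκ ?_ n2 ?_ u1 ?_ ?_ ?_
    ?_ ?_ ?_ ?_).trans_eq ?_
  · have : p - a * (1 + D') * b = bi * (b - a0 * (b + D' * b)) := by
      rw [hab, mul_sub, hib]; noncomm_ring
    rwa [this]
  · rw [mul_smul_comm, smul_mul_assoc, ← smul_sub, norm_smul, hR0]
    gcongr
  · rw [mul_smul_comm, smul_mul_assoc, norm_smul]
    gcongr
  · have : a * D * q = a * D' * q - a * (D' - D) * q := by noncomm_ring
    rw [this]
    refine (norm_sub_le _ _).trans ((add_le_add le_rfl ((norm_mul_le _ _).trans ?_)).trans n14)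
    calc _ ≤ ‖bi‖ * (c.Z2le * r) * 1 := by gcongr
      _ = _ := mul_one _
  · rw [mul_smul_comm, smul_mul_assoc, norm_smul, mul_assoc a, mul_comm _ ‖a‖]
    gcongr
    exact (norm_mul_le _ _).trans (by gcongr)
  · have : a * D * q * D * b = a * D' * q * D' * b - (a * D' * q) * (q * (D' - D)) * b
        - (a * (D' - D)) * (q * D * b) := by
      have e1 : (a * D' * q) * (q * (D' - D)) * b = a * D' * (q * q) * (D' - D) * b := by noncomm_ring
      rw [e1, hqq]; noncomm_ring
    rw [this]
    refine (norm_sub_le _ _).trans (add_le_add ((norm_sub_le _ _).trans (le_trans ?_ n02))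
      ((norm_mul_le _ _).trans (by gcongr)))
    refine add_le_add le_rfl ((norm_mul_le _ _).trans ?_)
    calc ‖a * D' * q * (q * (D' - D))‖ * ‖b‖ ≤ (‖a * D' * q‖ * (c.Z2gt * r)) * ‖b‖ := by
          gcongr
          exact (norm_mul_le _ _).trans (by gcongr)
      _ = _ := by ring
  · have : a * D * q * (l • L) * b = l • (a * D' * q * L * b - (a * (D' - D)) * (q * L * b)) := by
      rw [mul_smul_comm, smul_mul_assoc]
      congr 1
      noncomm_ring
    rw [this, norm_smul]
    gcongr
    exact (norm_sub_le _ _).trans (add_le_add n13 ((norm_mul_le _ _).trans (by gcongr)))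
  -- Doubling `q` separates `L * q`, bounded through `η`, from `q * D * b`, bounded by the
  -- parenthesis in the definition of `β_{1,1}`.
  · have : a * (l • L) * q * D * b = l • (a * (L * q) * (q * D * b)) := by
      have e1 : a * (L * q) * (q * D * b) = a * L * (q * q) * D * b := by noncomm_ring
      rw [e1, hqq]
      simp only [mul_smul_comm, smul_mul_assoc]
    rw [this, norm_smul]
    gcongr
    refine le_trans ((norm_mul_le _ _).trans ?_) n11
    have e2 : ‖a * (L * q)‖ ≤ η * ‖a‖ := by
      rw [mul_comm]
      refine (norm_mul_le _ _).trans ?_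
      gcongr
      linarith
    have e3 := (norm_nonneg _).trans e2
    gcongr
  · have : a * (l • L) * q * (l • L) * b = (l * l) • (a * L * q * L * b) := by
      simp only [mul_smul_comm, smul_mul_assoc, smul_smul]
    rw [this, norm_smul, norm_mul, pow_two]
    gcongr
  · rw [Consts.dev]

namespace Problem

variable {P : Problem} {N : ℕ} {A0 : Matrix (Fin (N + 1)) (Fin (N + 1)) ℝ}
  {P0 : Matrix (Fin (N + 1)) (Fin (N + 1)) ℂ} {Ub Ut : L1 ℝ}
  {c : Consts} {s : Fin (2 * P.m) → Equiv.Perm (Fin (2 * P.m))} {r : ℝ≥0}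

lemma isUnit_tail (hwell : IsUnit P.bcMat) (hN : 4 * P.m ≤ N) (hs : ∀ i, IsUnit (P.B11 (s i) i))
    (hc : c.Valid P s A0 P0 (Ub : ℕ → ℝ) (Ut : ℕ → ℝ) r) {l : ℂ} {ρ : ℝ} (hl : ‖l‖ ≤ ρ)
    (he : P.eps s N (Ub : ℕ → ℝ) ρ c.Z2gt r < 1) :
    IsUnit (1 + qL N * (DKL hwell Ut - l • P.LinvL) * (qL N : L1 ℂ →L[ℂ] L1 ℂ)) := by
  rw [← sub_neg_eq_add]
  refine isUnit_one_sub_of_norm_lt_one ?_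
  rw [norm_neg]
  exact (norm_tail_le hwell hN hs hc hl).trans_lt he

lemma norm_errMat_le (hwell : IsUnit P.bcMat) (hN : 4 * P.m ≤ N) (hs : ∀ i, IsUnit (P.B11 (s i) i))
    (hP0 : IsUnit P0) (hc : c.Valid P s A0 P0 (Ub : ℕ → ℝ) (Ut : ℕ → ℝ) r) {l : ℂ} {ρ : ℝ} (hl : ‖l‖ ≤ ρ)
    (he : P.eps s N (Ub : ℕ → ℝ) ρ c.Z2gt r < 1) :
    ‖embL (errMat hwell A0 P0 Ut l)‖ ≤ c.dev (matNorm P0⁻¹) (matNorm (P.R0 A0 P0))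
      ((P.eta (s ⟨0, P.two_m_pos⟩) ⟨0, P.two_m_pos⟩ (N + 1) - gam (2 * P.m) (N + 1) / 24)
        * matNorm (P0⁻¹ * cplx A0)) (P.eps s N (Ub : ℕ → ℝ) ρ c.Z2gt r) r ρ := by
  have hm := P.one_le_m
  have hρ : 0 ≤ ρ := (norm_nonneg _).trans hl
  have hg := gam_pos (p := 2 * P.m) (k := N + 1) (by omega)
  have hη := norm_LinvL_mul_qL_le (𝕜 := ℂ) hwell (hs ⟨0, P.two_m_pos⟩) hN
  have hdet := (Matrix.isUnit_iff_isUnit_det _).1 hP0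
  set η := P.eta (s ⟨0, P.two_m_pos⟩) ⟨0, P.two_m_pos⟩ (N + 1) with hηdef
  set e := P.eps s N (Ub : ℕ → ℝ) ρ c.Z2gt r with hedef
  have hκ : ‖Ring.inverse (1 + qL N * (DKL hwell Ut - l • P.LinvL) * (qL N : L1 ℂ →L[ℂ] L1 ℂ)) - 1‖
      ≤ e / (1 - e) := norm_sub_one_le_of_mul_eq_one ContinuousLinearMap.norm_id_le
    (norm_tail_le hwell hN hs hc hl) he
    (Ring.mul_inverse_cancel _ (isUnit_tail hwell hN hs hc hl he))
  rw [embL_errMat, coe_matNorm, coe_matNorm, coe_matNorm]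
  have hR0 : embL (P.R0 A0 P0) = embL (P0⁻¹ * cplx A0) * P.LinvL * embL P0
      - embL (Matrix.diagonal fun j => P.M0 A0 P0 j j) := by
    rw [R0, embL_sub, embL_M0 hwell]
  have hab : embL (P0⁻¹ * cplx A0) = embL P0⁻¹ * embL (cplx A0) := embL_mul _ _
  have hib : embL P0⁻¹ * embL P0 = pL N := by
    rw [← embL_mul, Matrix.nonsing_inv_mul _ hdet, pL]
  have n1 := hc.norm_Z1P hwell
  have n2 := hc.norm_Z2P hwell
  have nle := hc.norm_Z2le hwell
  have ngt := hc.norm_Z2gt hwell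
  have n01 := hc.norm_b01 hwell
  have n02 := hc.norm_b02 hwell
  have n11 := hc.norm_b11 hwell hN
  have n12 := hc.norm_b12 hwell
  have n13 := hc.norm_b13 hwell
  have n14 := hc.norm_b14 hwell
  have n21 := hc.norm_b21 hwell
  have hp2 := pL_mul_pL (𝕜 := ℂ) N
  have hqN := norm_qL_le (𝕜 := ℂ) N
  rw [← hηdef] at n11
  exact norm_schur_sub_le_dev hl hρ hp2 rfl (embL_mul_pL _) (pL_mul_embL _) hib hab hR0 hqN
    (Ring.mul_inverse_cancel _ (isUnit_tail hwell hN hs hc hl he)) hκ n1 n2 nle ngt n01 n02 n11 n12 n13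
    n14 n21 hη (by linarith)

/-- Otherwise `ℒ⁻¹ e_N` would be a polynomial of degree at most `N`, and its `2m`-th derivative, of
smaller degree, could not be `± e_N`. This yields `β_{1,2} > 0`. -/
lemma qL_LinvL_embL_ne_zero (hN : 2 * P.m ≤ N + 1) (hP0 : IsUnit P0) :
    qL N * P.LinvL * (embL P0 : L1 ℂ →L[ℂ] L1 ℂ) ≠ 0 := by
  intro h
  have hm := P.one_le_m
  have h1 : qL N * P.LinvL * (pL N : L1 ℂ →L[ℂ] L1 ℂ) = 0 := by
    have : (pL N : L1 ℂ →L[ℂ] L1 ℂ) = embL P0 * embL P0⁻¹ := by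
      rw [← embL_mul, Matrix.mul_nonsing_inv _ ((Matrix.isUnit_iff_isUnit_det _).1 hP0), pL]
    rw [this, ← mul_assoc, h, zero_mul]
  have h2 : SuppLt (N + 1) (P.LinvL (L1.e N : L1 ℂ)) := fun n hn => by
    have h3 := congrArg (fun M : L1 ℂ →L[ℂ] L1 ℂ => (M (L1.e N)) n) h1
    simp only [mul_apply_eq_comp, pL_e_of_le le_rfl, qL_apply] at h3
    rw [if_neg (by omega)] at h3
    exact h3
  have h3 : (derL (N + 1) ^ (2 * P.m)) (P.LinvL (L1.e N : L1 ℂ)) = (P.sgn : ℂ) • L1.e N :=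
    cheb_injective fun x hx => by
      rw [← dx_cheb_of_suppLt h2 _ hx, P.dx_two_m_cheb_LinvL _ hx, cheb_smul _ _ hx]
  have h4 := suppLt_derL_pow h2 (2 * P.m) N (by omega)
  rw [h3, L1.smul_apply, L1.e_self, mul_one] at h4
  have h5 := P.norm_sgn (𝕜 := ℂ)
  rw [h4] at h5
  simp at h5

end Problem

/-- Up to the quadratic form of the last term, `δ` is the same expression as the deviation with `x`
replaced by `β_{2,2}`; only the factor multiplying `ε/(1 - ε)` differs. -/
lemma Consts.delta_sub_dev {d : ℕ} (c : Consts) (P0 : Matrix (Fin d) (Fin d) ℂ) (R0 : Matrix (Fin d) (Fin d) ℂ)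
    (x e : ℝ) (r : ℝ≥0) (l : ℝ) : c.delta P0 e r R0 l - c.dev (matNorm P0⁻¹) (matNorm R0) x e r l
      = e / (1 - e) * l * (c.b22 - x) * (c.b01 + l * c.b12) := by
  rw [Consts.delta, Consts.dev, Consts.b2, Consts.b1, Consts.b0]
  ring

namespace Problem

variable {P : Problem} {N : ℕ} {A0 : Matrix (Fin (N + 1)) (Fin (N + 1)) ℝ}
  {P0 : Matrix (Fin (N + 1)) (Fin (N + 1)) ℂ} {Ub Ut : L1 ℝ}
  {c : Consts} {s : Fin (2 * P.m) → Equiv.Perm (Fin (2 * P.m))} {r : ℝ≥0}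

lemma dev_le_delta (hN : 4 * P.m ≤ N) (hc : c.Valid P s A0 P0 (Ub : ℕ → ℝ) (Ut : ℕ → ℝ) r) {l e : ℝ}
    (hl : 0 ≤ l) (he0 : 0 ≤ e) (he : e < 1) :
    c.dev (matNorm P0⁻¹) (matNorm (P.R0 A0 P0))
      ((P.eta (s ⟨0, P.two_m_pos⟩) ⟨0, P.two_m_pos⟩ (N + 1) - gam (2 * P.m) (N + 1) / 24)
        * matNorm (P0⁻¹ * cplx A0)) e r l ≤ c.delta P0 e r (P.R0 A0 P0) l := by
  have hm := P.one_le_m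
  have hg := gam_pos (p := 2 * P.m) (k := N + 1) (by omega)
  have h22 := hc.norm_b22 hN
  rw [← coe_matNorm] at h22
  rw [← sub_nonneg, c.delta_sub_dev]
  have ha : (0 : ℝ) ≤ matNorm (P0⁻¹ * cplx A0) := NNReal.coe_nonneg _
  have h1 : (0 : ℝ) ≤ e / (1 - e) := div_nonneg he0 (by linarith)
  refine mul_nonneg (mul_nonneg (mul_nonneg h1 hl) ?_) (by positivity)
  have := mul_nonneg hg.le ha
  linarith

/-- The bound is strictly smaller than `δ`. -/
lemma dev_lt_delta (hwell : IsUnit P.bcMat) (hN : 4 * P.m ≤ N) (hP0 : IsUnit P0)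
    (hc : c.Valid P s A0 P0 (Ub : ℕ → ℝ) (Ut : ℕ → ℝ) r) {l e : ℝ}
    (hl : 0 < l) (he0 : 0 < e) (he : e < 1) (ha : 0 < matNorm (P0⁻¹ * cplx A0)) :
    c.dev (matNorm P0⁻¹) (matNorm (P.R0 A0 P0))
      ((P.eta (s ⟨0, P.two_m_pos⟩) ⟨0, P.two_m_pos⟩ (N + 1) - gam (2 * P.m) (N + 1) / 24)
        * matNorm (P0⁻¹ * cplx A0)) e r l < c.delta P0 e r (P.R0 A0 P0) l := by
  have hm := P.one_le_m
  have hg := gam_pos (p := 2 * P.m) (k := N + 1) (by omega)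
  have h12 : (0 : ℝ) < c.b12 :=
    (norm_pos_iff.2 (qL_LinvL_embL_ne_zero (P := P) (by omega) hP0)).trans_le (hc.norm_b12 hwell)
  have h22 := hc.norm_b22 hN
  rw [← coe_matNorm] at h22
  have ha' : (0 : ℝ) < matNorm (P0⁻¹ * cplx A0) := ha
  rw [← sub_pos, c.delta_sub_dev]
  have h1 : (0 : ℝ) < e / (1 - e) := div_pos he0 (by linarith)
  have h2 : (0 : ℝ) ≤ c.b01 := c.b01.2
  refine mul_pos (mul_pos (mul_pos h1 hl) ?_) (by positivity)
  have := mul_pos hg ha'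
  linarith

end Problem

end GegenbauerStability

end

open scoped ENNReal NNReal

noncomputable section

namespace GegenbauerStability

/-! ### Counting zeros in a disk by Jensen's formula. -/

section ZeroCount

open Filter Topology Metric MeromorphicOn

/-- The number of zeros of `f` in `s`, with multiplicities. -/
def zeroCount (f : ℂ → ℂ) (s : Set ℂ) : ℕ := ∑ᶠ z ∈ s, analyticOrderNatAt f z

/-- Jensen's formula on two concentric circles with no zeros of `f` between them: the divisors
agree, so the leading coefficient and the terms `log ‖c - u‖` cancel in the difference. -/
lemma circleAverage_sub_eq_zeroCount {f : ℂ → ℂ} {c : ℂ} {R₁ R₂ : ℝ} (h₁ : 0 < R₁) (h₁₂ : R₁ < R₂)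
    (hf : AnalyticOnNhd ℂ f (closedBall c R₂)) (h0 : ∀ z ∈ closedBall c R₂, z ∉ ball c R₁ → f z ≠ 0) :
    Real.circleAverage (fun z => Real.log ‖f z‖) c R₂ - Real.circleAverage (fun z => Real.log ‖f z‖) c R₁
      = zeroCount f (ball c R₁) * (Real.log R₂ - Real.log R₁) := by
  have h₂ : 0 < R₂ := h₁.trans h₁₂
  have hf₁ : AnalyticOnNhd ℂ f (closedBall c R₁) := hf.mono (closedBall_subset_closedBall h₁₂.le)
  have key : ∀ R, R₁ ≤ R → R ≤ R₂ → (fun u => divisor f (closedBall c |R|) u)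
      = fun u => (((ball c R₁).indicator (analyticOrderNatAt f) u : ℕ) : ℤ) := by
    intro R hR hR'
    rw [abs_of_pos (h₁.trans_le hR)]
    have hfR : AnalyticOnNhd ℂ f (closedBall c R) := hf.mono (closedBall_subset_closedBall hR')
    funext u
    by_cases hu : u ∈ ball c R₁
    · rw [hfR.divisor_apply (ball_subset_closedBall (ball_subset_ball hR hu)),
        Set.indicator_of_mem hu, analyticOrderNatAt]
      cases analyticOrderAt f u <;> rfl
    · rw [Set.indicator_of_notMem hu]
      by_cases hu' : u ∈ closedBall c R
      · rw [hfR.divisor_apply hu', (hfR u hu').analyticOrderAt_eq_zero.2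
          (h0 u (closedBall_subset_closedBall hR' hu') hu)]
        rfl
      · rw [Function.locallyFinsuppWithin.apply_eq_zero_of_notMem _ hu']
        rfl
  set D : ℂ → ℤ := fun u => (((ball c R₁).indicator (analyticOrderNatAt f) u : ℕ) : ℤ) with hD
  have hDf : D.HasFiniteSupport := by
    rw [← key R₁ le_rfl h₁₂.le]
    exact (divisor f (closedBall c |R₁|)).finiteSupport (isCompact_closedBall c |R₁|)
  have hav : ∀ R, R₁ ≤ R → R ≤ R₂ → Real.circleAverage (fun z => Real.log ‖f z‖) c R
      = ∑ᶠ u, (D u : ℝ) * (Real.log R - Real.log ‖c - u‖) + Real.log ‖meromorphicTrailingCoeffAt f c‖ := by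
    intro R hR hR'
    have hR0 : R ≠ 0 := (h₁.trans_le hR).ne'
    have := MeromorphicOn.circleAverage_log_norm hR0 (c := c) (f := f) (by
      rw [abs_of_pos (h₁.trans_le hR)]
      exact (hf.mono (closedBall_subset_closedBall hR')).meromorphicOn)
    rw [this, countingFunction_finsum_eq_finsum_add hR0 hDf]
    have hk : ∀ u, divisor f (closedBall c |R|) u = D u := fun u => congrFun (key R hR hR') u
    simp only [hk]
  rw [hav R₂ h₁₂.le le_rfl, hav R₁ le_rfl h₁₂.le, add_sub_add_right_eq_sub, ← finsum_sub_distrib]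
  · have : ∀ u, (D u : ℝ) * (Real.log R₂ - Real.log ‖c - u‖) - D u * (Real.log R₁ - Real.log ‖c - u‖)
        = (((ball c R₁).indicator (analyticOrderNatAt f) u : ℕ) : ℝ) * (Real.log R₂ - Real.log R₁) := by
      intro u
      simp only [hD, Int.cast_natCast]
      ring
    simp only [this]
    rw [← finsum_mul, zeroCount, finsum_mem_def]
    · congr 1
      exact (map_finsum (Nat.castAddMonoidHom ℝ) (hDf.subset fun u hu => by
        simpa [hD] using hu)).symm
  · exact hDf.subset fun u hu => by
      contrapose! hu
      simp only [Function.mem_support, ne_eq, not_not] at hu ⊢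
      rw [hu]; simp
  · exact hDf.subset fun u hu => by
      contrapose! hu
      simp only [Function.mem_support, ne_eq, not_not] at hu ⊢
      rw [hu]; simp

lemma abs_circleAverage_sub_le {g h : ℂ → ℝ} {c : ℂ} {R η : ℝ} (hR : 0 < R) (hg : ContinuousOn g (sphere c R))
    (hh : ContinuousOn h (sphere c R)) (H : ∀ z ∈ sphere c R, |g z - h z| ≤ η) :
    |Real.circleAverage g c R - Real.circleAverage h c R| ≤ η := by
  have hg' : CircleIntegrable g c R := hg.circleIntegrable hR.le
  have hh' : CircleIntegrable h c R := hh.circleIntegrable hR.le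
  rw [← Real.circleAverage_fun_sub hg' hh', abs_le]
  have hi : CircleIntegrable (fun z => g z - h z) c R := hg'.sub hh'
  constructor
  · have := Real.circleAverage_mono_on_of_le_circle (f := fun z => -(g z - h z)) (a := η) (c := c) (R := R)
      hi.neg fun z hz => by
        rw [abs_of_pos hR] at hz
        linarith [(abs_le.1 (H z hz)).1]
    have e : Real.circleAverage (fun z => -(g z - h z)) c R = -Real.circleAverage (fun z => g z - h z) c R := by
      have := Real.circleAverage_fun_smul (𝕜 := ℝ) (a := (-1 : ℝ)) (f := fun z => g z - h z) (c := c) (R := R)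
      simpa using this
    linarith
  · exact Real.circleAverage_mono_on_of_le_circle hi fun z hz => by
      rw [abs_of_pos hR] at hz
      exact (abs_le.1 (H z hz)).2

/-- The number of zeros in a disk is locally constant, as long as no zero approaches the boundary. -/
lemma eventually_zeroCount_eq {T : Type*} [TopologicalSpace T] {F : T → ℂ → ℂ} {t₀ : T} {c : ℂ} {R₁ R₂ : ℝ}
    (h₁ : 0 < R₁) (h₁₂ : R₁ < R₂) (hF : ∀ z ∈ closedBall c R₂, ContinuousAt (fun x : T × ℂ => F x.1 x.2) (t₀, z))
    (hA : ∀ t, AnalyticOnNhd ℂ (F t) (closedBall c R₂))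
    (h0 : ∀ᶠ t in 𝓝 t₀, ∀ z ∈ closedBall c R₂, z ∉ ball c R₁ → F t z ≠ 0) :
    ∀ᶠ t in 𝓝 t₀, zeroCount (F t) (ball c R₁) = zeroCount (F t₀) (ball c R₁) := by
  have h₂ : 0 < R₂ := h₁.trans h₁₂
  have hL : 0 < Real.log R₂ - Real.log R₁ := sub_pos.2 (Real.log_lt_log h₁ h₁₂)
  -- Two circle averages vary by at most `η` each, so the two counts differ by at most `2/3`; being
  -- integers they agree.
  set η := (Real.log R₂ - Real.log R₁) / 3 with hη
  have hsub : ∀ R, R₁ ≤ R → R ≤ R₂ → ∀ z ∈ sphere c R, z ∈ closedBall c R₂ ∧ z ∉ ball c R₁ := by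
    intro R hR hR' z hz
    rw [mem_sphere] at hz
    rw [mem_closedBall, mem_ball, hz]
    exact ⟨hR', not_lt.2 hR⟩
  have key : ∀ R, R₁ ≤ R → R ≤ R₂ → ∀ᶠ t in 𝓝 t₀,
      |Real.circleAverage (fun z => Real.log ‖F t z‖) c R
        - Real.circleAverage (fun z => Real.log ‖F t₀ z‖) c R| ≤ η := by
    intro R hR hR'
    have hc : ∀ᶠ t in 𝓝 t₀, ∀ z ∈ sphere c R,
        |Real.log ‖F t z‖ - Real.log ‖F t₀ z‖| ≤ η := by
      refine (isCompact_sphere c R).eventually_forall_of_forall_eventually fun z hz => ?_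
      obtain ⟨hz1, hz2⟩ := hsub R hR hR' z hz
      have hne : F t₀ z ≠ 0 := h0.self_of_nhds z hz1 hz2
      have c1 : ContinuousAt (fun x : T × ℂ => Real.log ‖F x.1 x.2‖) (t₀, z) :=
        (hF z hz1).norm.log (norm_ne_zero_iff.2 hne)
      have c2 : ContinuousAt (fun x : T × ℂ => Real.log ‖F t₀ x.2‖) (t₀, z) := by
        have : ContinuousAt (fun w : ℂ => Real.log ‖F t₀ w‖) z :=
          (hA t₀ z hz1).continuousAt.norm.log (norm_ne_zero_iff.2 hne)
        exact ContinuousAt.comp (x := ((t₀, z) : T × ℂ)) (f := Prod.snd) this continuousAt_snd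
      have c3 := (c1.sub c2).abs
      have c4 := c3.eventually_lt (continuousAt_const (y := η)) (by
        change |Real.log ‖F t₀ z‖ - Real.log ‖F t₀ z‖| < η
        rw [sub_self, abs_zero]; positivity)
      exact c4.mono fun x hx => hx.le
    have hcont : ∀ t, (∀ z ∈ closedBall c R₂, z ∉ ball c R₁ → F t z ≠ 0) →
        ContinuousOn (fun z => Real.log ‖F t z‖) (sphere c R) := fun t ht =>
      ContinuousOn.log (((hA t).continuousOn.mono fun z hz => (hsub R hR hR' z hz).1).norm) fun z hz =>
        norm_ne_zero_iff.2 (ht z (hsub R hR hR' z hz).1 (hsub R hR hR' z hz).2)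
    filter_upwards [hc, h0] with t ht ht0
    exact abs_circleAverage_sub_le (h₁.trans_le hR) (hcont t ht0) (hcont t₀ h0.self_of_nhds) ht
  filter_upwards [key R₁ le_rfl h₁₂.le, key R₂ h₁₂.le le_rfl, h0] with t k1 k2 ht0
  have e1 := circleAverage_sub_eq_zeroCount h₁ h₁₂ (hA t) ht0
  have e2 := circleAverage_sub_eq_zeroCount h₁ h₁₂ (hA t₀) h0.self_of_nhds
  have e3 : |((zeroCount (F t) (ball c R₁) : ℝ) - zeroCount (F t₀) (ball c R₁))
      * (Real.log R₂ - Real.log R₁)| < Real.log R₂ - Real.log R₁ := by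
    rw [sub_mul, ← e1, ← e2]
    rw [abs_le] at k1 k2
    rw [abs_lt]
    constructor <;> linarith [k1.1, k1.2, k2.1, k2.2]
  rw [abs_mul, abs_of_pos hL] at e3
  have e4 : |((zeroCount (F t) (ball c R₁) : ℝ) - zeroCount (F t₀) (ball c R₁))| < 1 := by
    by_contra h
    nlinarith [not_lt.1 h]
  have e5 : |((zeroCount (F t) (ball c R₁) : ℤ) - zeroCount (F t₀) (ball c R₁))| < 1 := by
    exact_mod_cast e4
  rw [Int.abs_lt_one_iff] at e5
  omega

end ZeroCount

end GegenbauerStability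

end

open scoped ENNReal NNReal

noncomputable section

namespace GegenbauerStability

/-! ### Homotopy invariance of the number of zeros. -/

section Homotopy

open Filter Topology Metric

variable {f : ℂ → ℂ} {Ω K : Set ℂ}

lemma analyticOrderAt_ne_top_of_ne_zero (hΩ : IsPreconnected Ω) (hf : AnalyticOnNhd ℂ f Ω) {w : ℂ}
    (hw : w ∈ Ω) (h : f w ≠ 0) {z : ℂ} (hz : z ∈ Ω) : analyticOrderAt f z ≠ ⊤ :=
  hf.analyticOrderAt_ne_top_of_isPreconnected hΩ hw hz (by
    rw [(hf w hw).analyticOrderAt_eq_zero.2 h]; exact ENat.zero_ne_top)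

/-- The function is nonzero somewhere on a connected set, so its zeros are isolated; being confined
to a compact subset of the domain of analyticity, they are finitely many. -/
lemma finite_zeros (hΩ : IsPreconnected Ω) (hK : IsCompact K) (hKΩ : K ⊆ Ω) (hne : (Ω \ K).Nonempty)
    (hf : AnalyticOnNhd ℂ f Ω) (h0 : ∀ z ∈ Ω \ K, f z ≠ 0) : {z | z ∈ Ω ∧ f z = 0}.Finite := by
  obtain ⟨w, hw⟩ := hne
  have key : ({z | z ∈ Ω ∧ f z = 0} ∩ K).Finite := by
    refine hK.induction_on (p := fun s => ({z | z ∈ Ω ∧ f z = 0} ∩ s).Finite) (by simp)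
      (fun s t hst ht => ht.subset (Set.inter_subset_inter_right _ hst))
      (fun s t hs ht => by rw [Set.inter_union_distrib_left]; exact hs.union ht) fun z hz => ?_
    have h1 : ∀ᶠ x in 𝓝[≠] z, f x ≠ 0 := by
      rcases (hf z (hKΩ hz)).eventually_eq_zero_or_eventually_ne_zero with h | h
      · exact absurd (analyticOrderAt_eq_top.2 h)
          (analyticOrderAt_ne_top_of_ne_zero hΩ hf hw.1 (h0 w hw) (hKΩ hz))
      · exact h
    refine ⟨{x | x ≠ z → f x ≠ 0}, mem_nhdsWithin_of_mem_nhds (eventually_nhdsWithin_iff.1 h1),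
      (Set.finite_singleton z).subset fun x hx => ?_⟩
    by_contra hxz
    exact hx.2 hxz hx.1.2
  refine key.subset fun z hz => ⟨hz, ?_⟩
  by_contra h
  exact h0 z ⟨hz.1, h⟩ hz.2

lemma zeroCount_eq_sum {Z : Finset ℂ} {R : ℝ} (hfin : {z | z ∈ Ω ∧ f z = 0}.Finite)
    (hsub : ∀ u ∈ Z, ball u R ⊆ Ω) (hdis : (Z : Set ℂ).PairwiseDisjoint fun u => ball u R)
    (hcov : ∀ z ∈ Ω, f z = 0 → ∃ u ∈ Z, z ∈ ball u R) :
    zeroCount f Ω = ∑ u ∈ Z, zeroCount f (ball u R) := by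
  have hz : ∀ z, z ∈ Function.support (analyticOrderNatAt f) → f z = 0 := fun z hz =>
    apply_eq_zero_of_analyticOrderNatAt_ne_zero hz
  have h1 := finsum_mem_biUnion (f := analyticOrderNatAt f) (I := (Z : Set ℂ))
    (t := fun u => ball u R ∩ Function.support (analyticOrderNatAt f))
    (fun u hu v hv huv => (hdis hu hv huv).mono Set.inter_subset_left Set.inter_subset_left)
    Z.finite_toSet fun u hu => hfin.subset fun z hz' => ⟨hsub u hu hz'.1, hz z hz'.2⟩
  simp only [finsum_mem_inter_support] at h1
  rw [zeroCount, ← finsum_mem_inter_support, ← finsum_mem_coe_finset]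
  rw [show Ω ∩ Function.support (analyticOrderNatAt f)
    = ⋃ u ∈ (Z : Set ℂ), ball u R ∩ Function.support (analyticOrderNatAt f) from ?_]
  · exact h1
  · ext z
    simp only [Set.mem_inter_iff, Set.mem_iUnion, exists_prop]
    constructor
    · rintro ⟨h2, h3⟩
      obtain ⟨u, hu, hzu⟩ := hcov z h2 (hz z h3)
      exact ⟨u, hu, hzu, h3⟩
    · rintro ⟨u, hu, hzu, h3⟩
      exact ⟨hsub u hu hzu, h3⟩

lemma exists_radius {Z : Finset ℂ} (hΩ : IsOpen Ω) (hZ : ∀ u ∈ Z, u ∈ Ω) :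
    ∃ R > 0, (∀ u ∈ Z, closedBall u R ⊆ Ω) ∧ (Z : Set ℂ).PairwiseDisjoint fun u => closedBall u R := by
  have h1 : ∀ᶠ R : ℝ in 𝓝[>] 0, ∀ u ∈ Z, closedBall u R ⊆ Ω := by
    rw [Filter.eventually_all_finset]
    intro u hu
    obtain ⟨e, he, h⟩ := Metric.isOpen_iff.1 hΩ u (hZ u hu)
    filter_upwards [mem_nhdsWithin_of_mem_nhds (Iio_mem_nhds he)] with R hR
    exact (closedBall_subset_ball hR).trans h
  have h2 : ∀ᶠ R : ℝ in 𝓝[>] 0, ∀ u ∈ Z, ∀ v ∈ Z, u ≠ v → R + R < dist u v := by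
    rw [Filter.eventually_all_finset]
    intro u hu
    rw [Filter.eventually_all_finset]
    intro v hv
    rcases eq_or_ne u v with h | h
    · exact Eventually.of_forall fun _ hne => absurd h hne
    · filter_upwards [mem_nhdsWithin_of_mem_nhds (Iio_mem_nhds (half_pos (dist_pos.2 h)))] with R hR _
      linarith [Set.mem_Iio.1 hR]
  obtain ⟨R, hR⟩ := (h1.and (h2.and self_mem_nhdsWithin)).exists
  exact ⟨R, hR.2.2, hR.1, fun u hu v hv huv =>
    closedBall_disjoint_closedBall (hR.2.1 u hu v hv huv)⟩

/-- The number of zeros is invariant under homotopies, if the zeros stay in a compact set. -/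
theorem zeroCount_eq_of_homotopy {T : Type*} [TopologicalSpace T] [PreconnectedSpace T]
    (hΩ : IsOpen Ω) (hΩc : IsPreconnected Ω) (hK : IsCompact K) (hKΩ : K ⊆ Ω) (hne : (Ω \ K).Nonempty)
    {F : T → ℂ → ℂ} (hF : ∀ t, ∀ z ∈ Ω, ContinuousAt (fun x : T × ℂ => F x.1 x.2) (t, z))
    (hA : ∀ t, AnalyticOnNhd ℂ (F t) Ω) (h0 : ∀ t, ∀ z ∈ Ω \ K, F t z ≠ 0) (t t' : T) :
    zeroCount (F t) Ω = zeroCount (F t') Ω := by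
  refine IsLocallyConstant.apply_eq_of_preconnectedSpace (f := fun t => zeroCount (F t) Ω)
    ((IsLocallyConstant.iff_eventually_eq _).2 fun t₀ => ?_) t t'
  have hfin := fun t => finite_zeros hΩc hK hKΩ hne (hA t) (h0 t)
  set Z := (hfin t₀).toFinset with hZ
  have hZm : ∀ u, u ∈ Z ↔ u ∈ Ω ∧ F t₀ u = 0 := fun u => by rw [hZ, Set.Finite.mem_toFinset]; rfl
  obtain ⟨R, hR, hRΩ, hdis⟩ := exists_radius hΩ fun u hu => ((hZm u).1 hu).1
  have hR2 : 0 < R / 2 := half_pos hR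
  have hlt : R / 2 < R := half_lt_self hR
  -- On this compact set `F t₀` has no zero, hence neither has `F t` for `t` near `t₀`. Zeros of `F
  -- t` thus stay near those of `F t₀`, where each local count is constant.
  have hC : IsCompact (K \ ⋃ u ∈ Z, ball u (R / 2)) :=
    hK.diff (isOpen_biUnion fun _ _ => isOpen_ball)
  have hev : ∀ᶠ t in 𝓝 t₀, ∀ z ∈ K \ ⋃ u ∈ Z, ball u (R / 2), F t z ≠ 0 := by
    refine hC.eventually_forall_of_forall_eventually fun z hz => ?_
    refine (hF t₀ z (hKΩ hz.1)).eventually_ne fun h => hz.2 ?_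
    exact Set.mem_biUnion ((hZm z).2 ⟨hKΩ hz.1, h⟩) (mem_ball_self hR2)
  have hcov : ∀ t, (∀ z ∈ K \ ⋃ u ∈ Z, ball u (R / 2), F t z ≠ 0) →
      ∀ z ∈ Ω, F t z = 0 → ∃ u ∈ Z, z ∈ ball u (R / 2) := by
    intro t ht z hz hz0
    by_contra h
    have hzK : z ∈ K := by
      by_contra hzK
      exact h0 t z ⟨hz, hzK⟩ hz0
    refine ht z ⟨hzK, fun hm => h ?_⟩ hz0
    simpa using hm
  have hloc : ∀ᶠ t in 𝓝 t₀, ∀ u ∈ Z,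
      zeroCount (F t) (ball u (R / 2)) = zeroCount (F t₀) (ball u (R / 2)) := by
    rw [Filter.eventually_all_finset]
    intro u hu
    refine eventually_zeroCount_eq hR2 hlt (fun z hz => hF t₀ z (hRΩ u hu hz))
      (fun t => (hA t).mono (hRΩ u hu)) ?_
    filter_upwards [hev] with t ht z hz hz' hz0
    obtain ⟨v, hv, hzv⟩ := hcov t ht z (hRΩ u hu hz) hz0
    rcases eq_or_ne u v with rfl | huv
    · exact hz' hzv
    · exact Set.disjoint_left.1 (hdis hu hv huv) hz
        (ball_subset_closedBall (ball_subset_ball hlt.le hzv))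
  have hsub : ∀ u ∈ Z, ball u (R / 2) ⊆ Ω := fun u hu =>
    (ball_subset_ball hlt.le).trans (ball_subset_closedBall.trans (hRΩ u hu))
  have hdis' : (Z : Set ℂ).PairwiseDisjoint fun u => ball u (R / 2) := fun u hu v hv huv =>
    (hdis hu hv huv).mono ((ball_subset_ball hlt.le).trans ball_subset_closedBall)
      ((ball_subset_ball hlt.le).trans ball_subset_closedBall)
  filter_upwards [hev, hloc] with t ht htl
  rw [zeroCount_eq_sum (hfin t) hsub hdis' (hcov t ht),
    zeroCount_eq_sum (hfin t₀) hsub hdis' (hcov t₀ hev.self_of_nhds)]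
  exact Finset.sum_congr rfl htl

end Homotopy

end GegenbauerStability

end

open scoped ENNReal NNReal

noncomputable section

namespace GegenbauerStability

/-! ### Determinants, disks and the homotopy. -/

section Determinants

variable {ι : Type*} [Fintype ι] [DecidableEq ι]

lemma analyticAt_det {M : ℂ → Matrix ι ι ℂ} {l : ℂ} (h : ∀ a b, AnalyticAt ℂ (fun z => M z a b) l) :
    AnalyticAt ℂ (fun z => (M z).det) l := by
  simp only [Matrix.det_apply']
  exact Finset.analyticAt_fun_sum _ fun σ _ =>
    analyticAt_const.mul (Finset.analyticAt_fun_prod _ fun i _ => h _ _)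

lemma analyticOrderAt_one_sub_mul (μ u : ℂ) :
    analyticOrderAt (fun z => 1 - z * μ) u = if 1 - u * μ = 0 then 1 else 0 := by
  have ha : AnalyticAt ℂ (fun z : ℂ => 1 - z * μ) u := by fun_prop
  split_ifs with h
  · have hd : HasDerivAt (fun z : ℂ => 1 - z * μ) (-μ) u := by
      simpa using ((hasDerivAt_id u).mul_const μ).const_sub 1
    refine ha.analyticOrderAt_eq_one_of_zero_deriv_ne_zero h ?_
    rw [hd.deriv, neg_ne_zero]
    rintro rfl
    simp at h
  · exact ha.analyticOrderAt_eq_zero.2 h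

lemma analyticOrderNatAt_prod_one_sub (μ : ι → ℂ) (u : ℂ) :
    analyticOrderNatAt (fun z => ∏ j, (1 - z * μ j)) u = (Finset.univ.filter fun j => 1 - u * μ j = 0).card := by
  have key : ∀ s : Finset ι, analyticOrderAt (fun z => ∏ j ∈ s, (1 - z * μ j)) u
      = ((s.filter fun j => 1 - u * μ j = 0).card : ℕ) := by
    intro s
    induction s using Finset.induction_on with
    | empty => simpa using (analyticAt_const (v := (1 : ℂ)) (x := u)).analyticOrderAt_eq_zero.2 one_ne_zero
    | insert a s ha ih =>
      have h1 : (fun z => ∏ j ∈ insert a s, (1 - z * μ j))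
          = (fun z => 1 - z * μ a) * fun z => ∏ j ∈ s, (1 - z * μ j) := by
        funext z
        rw [Finset.prod_insert ha]; rfl
      rw [h1, analyticOrderAt_mul (by fun_prop) (Finset.analyticAt_fun_prod _ fun i _ => by fun_prop), ih,
        analyticOrderAt_one_sub_mul, Finset.filter_insert]
      split_ifs with h
      · rw [Finset.card_insert_of_notMem (by simp [ha]), add_comm]; rfl
      · rw [zero_add]
  rw [analyticOrderNatAt, key]; rfl

/-- Indices are grouped by the value of `(μ j)⁻¹`: the order of vanishing at a point is the size of
its fibre, so coinciding points are counted with multiplicity. -/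
lemma zeroCount_prod_one_sub (μ : ι → ℂ) (J : Finset ι) (Ω : Set ℂ)
    (hJ : ∀ j, j ∈ J ↔ μ j ≠ 0 ∧ (μ j)⁻¹ ∈ Ω) :
    zeroCount (fun z => ∏ j, (1 - z * μ j)) Ω = J.card := by
  have h0 : ∀ (j : ι) (u : ℂ), 1 - u * μ j = 0 ↔ μ j ≠ 0 ∧ (μ j)⁻¹ = u := by
    intro j u
    constructor
    · intro h
      have h1 : u * μ j = 1 := (sub_eq_zero.1 h).symm
      exact ⟨right_ne_zero_of_mul_eq_one h1, inv_eq_of_mul_eq_one_left h1⟩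
    · rintro ⟨h, rfl⟩
      rw [inv_mul_cancel₀ h, sub_self]
  rw [zeroCount, finsum_mem_eq_sum_of_subset (t := (J.image fun j => (μ j)⁻¹ : Finset ℂ)),
    Finset.card_eq_sum_card_image (fun j => (μ j)⁻¹) J]
  · refine Finset.sum_congr rfl fun u hu => ?_
    rw [analyticOrderNatAt_prod_one_sub]
    congr 1
    ext j
    simp only [Finset.mem_filter, Finset.mem_univ, true_and, h0]
    obtain ⟨i, hi, rfl⟩ := Finset.mem_image.1 hu
    constructor
    · rintro ⟨h1, h2⟩
      exact ⟨(hJ j).2 ⟨h1, h2 ▸ ((hJ i).1 hi).2⟩, h2⟩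
    · rintro ⟨h1, h2⟩
      exact ⟨((hJ j).1 h1).1, h2⟩
  · rintro u ⟨hu, hs⟩
    rw [Function.mem_support, analyticOrderNatAt_prod_one_sub, ← Nat.pos_iff_ne_zero, Finset.card_pos] at hs
    obtain ⟨j, hj⟩ := hs
    obtain ⟨h1, h2⟩ := (h0 j u).1 (Finset.mem_filter.1 hj).2
    exact Finset.mem_coe.2 (Finset.mem_image.2 ⟨j, (hJ j).2 ⟨h1, h2 ▸ hu⟩, h2⟩)
  · intro u hu
    obtain ⟨j, hj, rfl⟩ := Finset.mem_image.1 (Finset.mem_coe.1 hu)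
    exact ((hJ j).1 hj).2

/-- A matrix close to a diagonal matrix is invertible unless a diagonal entry is small. -/
lemma exists_norm_le_of_det_eq_zero {d : ℕ} {D : Fin d → ℂ} {E : Matrix (Fin d) (Fin d) ℂ} {κ : ℝ}
    (hE : ‖embL E‖ ≤ κ) (h : (Matrix.diagonal D + E).det = 0) : ∃ a, ‖D a‖ ≤ κ := by
  obtain ⟨x, hx, h1⟩ := Matrix.exists_mulVec_eq_zero_iff.2 h
  by_contra! hcon
  have h2 : ∀ a, (E.mulVec x) a = -(D a * x a) := by
    intro a
    have := congrFun h1 a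
    rw [Matrix.add_mulVec, Pi.add_apply, Matrix.mulVec_diagonal, Pi.zero_apply] at this
    linear_combination this
  have h3 : embL E (ofFin x) = ofFin (E.mulVec x) := by
    rw [embL_apply]
    simp only [ofFin_apply_fin]
  have h4 := ((embL E).le_opNorm (ofFin x)).trans (mul_le_mul_of_nonneg_right hE (norm_nonneg _))
  rw [h3, norm_ofFin, norm_ofFin, Finset.mul_sum] at h4
  -- For a kernel vector `x`, `E x = -D x`. If every diagonal entry exceeded `κ`, the weighted norm
  -- of `D x` would be strictly larger than `κ‖x‖ ≥ ‖E x‖`.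
  refine absurd h4 (not_le.2 (Finset.sum_lt_sum (fun a _ => ?_) ?_))
  · rw [h2, norm_neg, norm_mul]
    have := mul_nonneg (wt_pos a).le (norm_nonneg (x a))
    nlinarith [(hcon a).le]
  · obtain ⟨a, ha⟩ := Function.ne_iff.1 hx
    refine ⟨a, Finset.mem_univ _, ?_⟩
    rw [h2, norm_neg, norm_mul]
    have := mul_pos (wt_pos a) (norm_pos_iff.2 ha)
    nlinarith [hcon a]

end Determinants

/-- Dividing by `μ` gives `|z - μ⁻¹| = |1 - z μ| |μ⁻¹|`; the case `μ = 0` is excluded since then `|1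
- z μ| = 1 > δ`. -/
lemma mem_disk {μ z : ℂ} {κ δ : ℝ} (h : ‖1 - z * μ‖ ≤ κ) (hκ : κ ≤ δ) (hδ : δ < 1) : μ ≠ 0 ∧ z ∈ disk μ δ := by
  have hμ : μ ≠ 0 := by
    rintro rfl
    rw [mul_zero, sub_zero, norm_one] at h
    linarith
  refine ⟨hμ, ?_⟩
  rw [disk, if_neg hμ, mem_closedBall_iff_norm]
  have : z - μ⁻¹ = -(1 - z * μ) * μ⁻¹ := by field_simp; ring
  rw [this, norm_mul, norm_neg]
  exact mul_le_mul_of_nonneg_right (h.trans hκ) (norm_nonneg _)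

lemma inv_mem_disk {μ : ℂ} (hμ : μ ≠ 0) {δ : ℝ} (hδ : 0 ≤ δ) : μ⁻¹ ∈ disk μ δ := by
  rw [disk, if_neg hμ]
  exact Metric.mem_closedBall_self (by positivity)

lemma zero_mem_disk {μ : ℂ} {δ : ℝ} (hδ : 1 ≤ δ) : 0 ∈ disk μ δ := by
  rw [disk]
  split_ifs with h
  · exact hδ
  · rw [mem_closedBall_iff_norm, zero_sub, norm_neg]
    exact le_mul_of_one_le_left (norm_nonneg _) hδ

namespace Problem

variable {P : Problem} {N : ℕ} {A0 : Matrix (Fin (N + 1)) (Fin (N + 1)) ℝ}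
  {P0 : Matrix (Fin (N + 1)) (Fin (N + 1)) ℂ} {Ub Ut : L1 ℝ}
  {c : Consts} {s : Fin (2 * P.m) → Equiv.Perm (Fin (2 * P.m))} {r : ℝ≥0}

lemma analyticAt_EMat (hwell : IsUnit P.bcMat) {l : ℂ}
    (hu : IsUnit (1 + qL N * (DKL hwell Ut - l • P.LinvL) * (qL N : L1 ℂ →L[ℂ] L1 ℂ))) (a b : Fin (N + 1)) :
    AnalyticAt ℂ (fun z => EMat hwell Ut N z a b) l :=
  analyticAt_schurMat _ _ _ _ _ hu a b

/-- The algebraic multiplicity of an eigenvalue is the order of the zero of the determinant. -/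
lemma rank_rootSpace_eq (hwell : IsUnit P.bcMat) {l : ℂ}
    (hu : IsUnit (1 + qL N * (DKL hwell Ut - l • P.LinvL) * (qL N : L1 ℂ →L[ℂ] L1 ℂ))) {d : ℕ}
    (hd : analyticOrderAt (fun z => (EMat hwell Ut N z).det) l = d) :
    Module.rank ℂ (P.rootSpace (P.sol (Ut : ℕ → ℝ)) l) = d := by
  rw [rank_rootSpace hwell]
  refine rank_ker_opAct_eq (e := fun a : Fin (N + 1) => L1.e (a : ℕ)) (co := fun a => L1.coord (a : ℕ))
    (fun a b => ?_) (fun x => ?_) rfl _ _ hu hd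
  · rw [L1.coord_apply, L1.e_apply]
    simp only [Fin.ext_iff]
  · rw [pL, embL_apply, Matrix.one_mulVec]
    rfl

lemma analyticAt_errMat (hwell : IsUnit P.bcMat) {l : ℂ}
    (hu : IsUnit (1 + qL N * (DKL hwell Ut - l • P.LinvL) * (qL N : L1 ℂ →L[ℂ] L1 ℂ))) (a b : Fin (N + 1)) :
    AnalyticAt ℂ (fun z => errMat hwell A0 P0 Ut z a b) l := by
  have h := analyticAt_EMat (Ut := Ut) hwell hu
  simp only [errMat, Matrix.sub_apply, Matrix.mul_apply, Matrix.smul_apply, smul_eq_mul]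
  refine (Finset.analyticAt_fun_sum _ fun i _ => (Finset.analyticAt_fun_sum _ fun k _ =>
    analyticAt_const.mul (h _ _)).mul analyticAt_const).sub ?_
  fun_prop

/-- The homotopy between the determinants of the diagonal matrix and of the Schur complement. -/
def homDet (hwell : IsUnit P.bcMat) (A0 : Matrix (Fin (N + 1)) (Fin (N + 1)) ℝ)
    (P0 : Matrix (Fin (N + 1)) (Fin (N + 1)) ℂ) (Ut : L1 ℝ) (t : unitInterval) (z : ℂ) : ℂ :=
  (Matrix.diagonal (fun j => 1 - z * P.M0 A0 P0 j j) + ((t : ℝ) : ℂ) • errMat hwell A0 P0 Ut z).det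

lemma homDet_zero (hwell : IsUnit P.bcMat) (z : ℂ) :
    homDet hwell A0 P0 Ut 0 z = ∏ j, (1 - z * P.M0 A0 P0 j j) := by
  simp [homDet]

/-- At the end of the homotopy the determinant is that of the Schur complement up to a constant
factor, later shown to be nonzero. -/
lemma homDet_one (hwell : IsUnit P.bcMat) (z : ℂ) :
    homDet hwell A0 P0 Ut 1 z = (P0⁻¹ * cplx A0).det * P0.det * (EMat hwell Ut N z).det := by
  have : Matrix.diagonal (fun j => 1 - z * P.M0 A0 P0 j j)
      = 1 - z • Matrix.diagonal fun j => P.M0 A0 P0 j j := by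
    rw [← Matrix.diagonal_one, ← Matrix.diagonal_smul, Matrix.diagonal_sub]
    rfl
  rw [homDet, this, errMat]
  simp only [Set.Icc.coe_one, Complex.ofReal_one, one_smul, add_sub_cancel]
  rw [Matrix.det_mul, Matrix.det_mul]
  ring

lemma analyticAt_homDet (hwell : IsUnit P.bcMat) {l : ℂ}
    (hu : IsUnit (1 + qL N * (DKL hwell Ut - l • P.LinvL) * (qL N : L1 ℂ →L[ℂ] L1 ℂ))) (t : unitInterval) :
    AnalyticAt ℂ (homDet hwell A0 P0 Ut t) l := by
  refine analyticAt_det fun a b => ?_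
  have h := analyticAt_errMat (A0 := A0) (P0 := P0) (Ut := Ut) hwell hu a b
  simp only [Matrix.add_apply, Matrix.smul_apply, smul_eq_mul, Matrix.diagonal_apply]
  refine AnalyticAt.add ?_ (analyticAt_const.mul h)
  split_ifs <;> fun_prop

lemma continuousAt_homDet (hwell : IsUnit P.bcMat) {l : ℂ}
    (hu : IsUnit (1 + qL N * (DKL hwell Ut - l • P.LinvL) * (qL N : L1 ℂ →L[ℂ] L1 ℂ))) (t : unitInterval) :
    ContinuousAt (fun x : unitInterval × ℂ => homDet hwell A0 P0 Ut x.1 x.2) (t, l) := by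
  have h := fun a b => (analyticAt_errMat (A0 := A0) (P0 := P0) (Ut := Ut) hwell hu a b).continuousAt
  have h1 : ContinuousAt (fun x : unitInterval × ℂ => Matrix.diagonal (fun j => 1 - x.2 * P.M0 A0 P0 j j)
      + ((x.1 : ℝ) : ℂ) • errMat hwell A0 P0 Ut x.2) (t, l) := by
    refine continuousAt_pi.2 fun a => continuousAt_pi.2 fun b => ?_
    simp only [Matrix.add_apply, Matrix.smul_apply, smul_eq_mul, Matrix.diagonal_apply]
    refine ContinuousAt.add ?_ (ContinuousAt.mul (by fun_prop) ?_)
    · split_ifs <;> fun_prop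
    · exact ContinuousAt.comp (x := ((t, l) : unitInterval × ℂ)) (f := Prod.snd) (h a b) continuousAt_snd
  exact ContinuousAt.comp (g := fun M : Matrix (Fin (N + 1)) (Fin (N + 1)) ℂ => M.det)
    (continuous_id.matrix_det).continuousAt h1

end Problem

end GegenbauerStability

end

open scoped ENNReal NNReal

noncomputable section

namespace GegenbauerStability

/-! ### Counting the unstable eigenvalues. -/

namespace Problem

open Filter Topology

variable {P : Problem} {N : ℕ} {A0 : Matrix (Fin (N + 1)) (Fin (N + 1)) ℝ}
  {P0 : Matrix (Fin (N + 1)) (Fin (N + 1)) ℂ} {Ub Ut : L1 ℝ}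
  {c : Consts} {s : Fin (2 * P.m) → Equiv.Perm (Fin (2 * P.m))} {r : ℝ≥0}

/-- Counting the eigenvalues in a domain by the zeros of the determinant. -/
lemma finsum_finrank_rootSpace (hwell : IsUnit P.bcMat) {Ω : Set ℂ} (hΩ : IsPreconnected Ω)
    (hu : ∀ l ∈ Ω, IsUnit (1 + qL N * (DKL hwell Ut - l • P.LinvL) * (qL N : L1 ℂ →L[ℂ] L1 ℂ)))
    (hk : (P0⁻¹ * cplx A0).det * P0.det ≠ 0) (hfin : {z | z ∈ Ω ∧ homDet hwell A0 P0 Ut 1 z = 0}.Finite)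
    {w : ℂ} (hw : w ∈ Ω) (hw0 : homDet hwell A0 P0 Ut 1 w ≠ 0)
    {S : Set ℂ} (hS : ∀ l, l ∈ S ↔ l ∈ Ω ∧ P.IsEigenvalue (P.sol (Ut : ℕ → ℝ)) l) :
    S.Finite ∧ (∀ l ∈ S, FiniteDimensional ℂ (P.rootSpace (P.sol (Ut : ℕ → ℝ)) l)) ∧
      ∑ᶠ l ∈ S, Module.finrank ℂ (P.rootSpace (P.sol (Ut : ℕ → ℝ)) l)
        = zeroCount (homDet hwell A0 P0 Ut 1) Ω := by
  have hA : AnalyticOnNhd ℂ (homDet hwell A0 P0 Ut 1) Ω := fun l hl => analyticAt_homDet hwell (hu l hl) 1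
  have hE : ∀ l ∈ Ω, AnalyticAt ℂ (fun z => (EMat hwell Ut N z).det) l := fun l hl =>
    analyticAt_det fun a b => analyticAt_EMat hwell (hu l hl) a b
  have hord : ∀ l ∈ Ω, analyticOrderAt (homDet hwell A0 P0 Ut 1) l
      = analyticOrderAt (fun z => (EMat hwell Ut N z).det) l := by
    intro l hl
    have h1 : homDet hwell A0 P0 Ut 1 = (fun _ => (P0⁻¹ * cplx A0).det * P0.det)
        * fun z => (EMat hwell Ut N z).det := funext fun z => homDet_one hwell z
    rw [h1, analyticOrderAt_mul analyticAt_const (hE l hl),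
      analyticAt_const.analyticOrderAt_eq_zero.2 hk, zero_add]
  have hrank : ∀ l ∈ Ω, Module.rank ℂ (P.rootSpace (P.sol (Ut : ℕ → ℝ)) l)
      = (analyticOrderNatAt (homDet hwell A0 P0 Ut 1) l : ℕ) := by
    intro l hl
    refine rank_rootSpace_eq hwell (hu l hl) ?_
    rw [← hord l hl]
    exact (Nat.cast_analyticOrderNatAt (analyticOrderAt_ne_top_of_ne_zero hΩ hA hw hw0 hl)).symm
  have hdim : ∀ l ∈ Ω, FiniteDimensional ℂ (P.rootSpace (P.sol (Ut : ℕ → ℝ)) l) := fun l hl =>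
    Module.rank_lt_aleph0_iff.1 (by rw [hrank l hl]; exact Cardinal.natCast_lt_aleph0)
  have hfr : ∀ l ∈ Ω, Module.finrank ℂ (P.rootSpace (P.sol (Ut : ℕ → ℝ)) l)
      = analyticOrderNatAt (homDet hwell A0 P0 Ut 1) l := fun l hl =>
    Module.finrank_eq_of_rank_eq (hrank l hl)
  have hmem : ∀ l ∈ Ω, l ∈ S ↔ analyticOrderNatAt (homDet hwell A0 P0 Ut 1) l ≠ 0 := by
    intro l hl
    have := hdim l hl
    rw [hS, ← rootSpace_ne_bot_iff, ← hfr l hl, ne_eq, ne_eq, Submodule.finrank_eq_zero]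
    exact and_iff_right hl
  have hSΩ : S = Ω ∩ Function.support (analyticOrderNatAt (homDet hwell A0 P0 Ut 1)) := by
    ext l
    exact ⟨fun h => ⟨((hS l).1 h).1, (hmem l ((hS l).1 h).1).1 h⟩, fun h => (hmem l h.1).2 h.2⟩
  refine ⟨hfin.subset fun l hl => ?_, fun l hl => hdim l ((hS l).1 hl).1, ?_⟩
  · rw [hSΩ] at hl
    exact ⟨hl.1, apply_eq_zero_of_analyticOrderNatAt_ne_zero hl.2⟩
  · rw [zeroCount, ← finsum_mem_inter_support (analyticOrderNatAt (homDet hwell A0 P0 Ut 1)) Ω, ← hSΩ]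
    exact finsum_mem_congr rfl fun l hl => hfr l ((hS l).1 hl).1

lemma eps_zero_nonneg (hwell : IsUnit P.bcMat) (hN : 4 * P.m ≤ N) (hs : ∀ i, IsUnit (P.B11 (s i) i))
    (hc : c.Valid P s A0 P0 (Ub : ℕ → ℝ) (Ut : ℕ → ℝ) r) : 0 ≤ P.eps s N (Ub : ℕ → ℝ) 0 c.Z2gt r :=
  (norm_nonneg _).trans (norm_tail_le (l := 0) hwell hN hs hc norm_zero.le)

lemma norm_pL (N : ℕ) : ‖(pL N : L1 ℂ →L[ℂ] L1 ℂ)‖ = 1 := by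
  refine le_antisymm (norm_pL_le N) ?_
  have h := (pL N : L1 ℂ →L[ℂ] L1 ℂ).le_opNorm (L1.e 0)
  rwa [pL_e_of_le (Nat.zero_le N), L1.norm_e, wt_zero, mul_one] at h

/-- The unstable eigenvalues are counted by the disks in the right half-plane. -/
theorem unstable_count (hwell : IsUnit P.bcMat) (hN : 4 * P.m ≤ N) (hs : ∀ i, IsUnit (P.B11 (s i) i))
    (hP0 : IsUnit P0) (hc : c.Valid P s A0 P0 (Ub : ℕ → ℝ) (Ut : ℕ → ℝ) r) {lamMax : ℝ} (hlam : 0 < lamMax)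
    (hbound : ∀ lam : ℂ, P.IsEigenvalue (P.sol (Ut : ℕ → ℝ)) lam → 0 ≤ lam.re → ‖lam‖ ≤ lamMax)
    {e δ : ℝ} (he : e = P.eps s N (Ub : ℕ → ℝ) lamMax c.Z2gt r) (he1 : e < 1)
    (hδ : δ = c.delta P0 e r (P.R0 A0 P0) lamMax) (J : Finset (Fin (N + 1)))
    (hJ : ∀ j ∈ J, P.M0 A0 P0 j j ≠ 0 ∧
      disk (P.M0 A0 P0 j j) δ ⊆ {z : ℂ | 0 < z.re} ∩ Metric.closedBall 0 lamMax)
    (hJc : ∀ j ∉ J, disk (P.M0 A0 P0 j j) δ ⊆ {z : ℂ | z.re < 0}) :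
    (P.unstable (P.sol (Ut : ℕ → ℝ))).Finite ∧
    (∀ lam ∈ P.unstable (P.sol (Ut : ℕ → ℝ)), FiniteDimensional ℂ (P.rootSpace (P.sol (Ut : ℕ → ℝ)) lam)) ∧
    ∑ᶠ lam ∈ P.unstable (P.sol (Ut : ℕ → ℝ)), Module.finrank ℂ (P.rootSpace (P.sol (Ut : ℕ → ℝ)) lam)
      = J.card := by
  have hm := P.one_le_m
  have hg := gam_pos (p := 2 * P.m) (k := N + 1) (by omega)
  have he0 := eps_zero_nonneg hwell hN hs hc
  have heps := fun l : ℝ => eps_eq (N := N) s (Ub : ℕ → ℝ) l c.Z2gt r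
  have hepos : 0 < e := by
    rw [he, heps]
    have := mul_pos hlam hg
    linarith
  -- Every disk lies in one of the two open half-planes, so none contains the origin. This forces `δ
  -- < 1`, because for `δ ≥ 1` all the disks contain `0`.
  have hnot0 : ∀ j, (0 : ℂ) ∉ disk (P.M0 A0 P0 j j) δ := by
    intro j h0
    by_cases hj : j ∈ J
    · have := ((hJ j hj).2 h0).1
      simp at this
    · have := hJc j hj h0
      simp at this
  have hδ1 : δ < 1 := by
    by_contra h
    exact hnot0 0 (zero_mem_disk (not_lt.1 h))
  set x := (P.eta (s ⟨0, P.two_m_pos⟩) ⟨0, P.two_m_pos⟩ (N + 1) - gam (2 * P.m) (N + 1) / 24)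
    * matNorm (P0⁻¹ * cplx A0) with hx
  have hdev : ∀ ρ : ℝ, P.eps s N (Ub : ℕ → ℝ) ρ c.Z2gt r < 1 → ∀ l : ℂ, ‖l‖ ≤ ρ →
      ‖embL (errMat hwell A0 P0 Ut l)‖ ≤ c.dev (matNorm P0⁻¹) (matNorm (P.R0 A0 P0)) x
        (P.eps s N (Ub : ℕ → ℝ) ρ c.Z2gt r) r ρ := fun ρ hρ l hl =>
    norm_errMat_le hwell hN hs hP0 hc hl hρ
  have hle : ‖embL (errMat hwell A0 P0 Ut 0)‖ ≤ δ := by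
    refine (hdev lamMax (he ▸ he1) 0 (by rw [norm_zero]; exact hlam.le)).trans ?_
    rw [hδ, ← he]
    exact dev_le_delta hN hc hlam.le hepos.le he1
  have hδ0 : 0 ≤ δ := (norm_nonneg _).trans hle
  -- If `𝒫₀⁻¹ 𝒜₀` vanished, the error matrix at `0` would be minus the identity, of norm `1 > δ`.
  have ha : 0 < matNorm (P0⁻¹ * cplx A0) := by
    rw [pos_iff_ne_zero]
    intro h
    have h1 : embL (P0⁻¹ * cplx A0) = 0 := by
      rw [← norm_eq_zero, ← coe_matNorm, h]; rfl
    rw [embL_errMat, h1, zero_mul, zero_mul, zero_smul, sub_zero, zero_sub, norm_neg, norm_pL] at hle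
    linarith
  -- a slightly larger disk
  obtain ⟨ρ, hρ, hρe, hρδ⟩ : ∃ ρ, lamMax < ρ ∧ P.eps s N (Ub : ℕ → ℝ) ρ c.Z2gt r < 1 ∧
      c.dev (matNorm P0⁻¹) (matNorm (P.R0 A0 P0)) x (P.eps s N (Ub : ℕ → ℝ) ρ c.Z2gt r) r ρ < δ := by
    have hce : ContinuousAt (fun l => P.eps s N (Ub : ℕ → ℝ) l c.Z2gt r) lamMax := by
      rw [show (fun l => P.eps s N (Ub : ℕ → ℝ) l c.Z2gt r) = _ from funext heps]
      fun_prop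
    have hne : 1 - P.eps s N (Ub : ℕ → ℝ) lamMax c.Z2gt r ≠ 0 := by
      rw [← he]; linarith
    have hcd : ContinuousAt (fun l => c.dev (matNorm P0⁻¹) (matNorm (P.R0 A0 P0)) x
        (P.eps s N (Ub : ℕ → ℝ) l c.Z2gt r) r l) lamMax := by
      simp only [Consts.dev]
      have := hce.div (continuousAt_const.sub hce) hne
      fun_prop
    have h1 := hce.eventually_lt continuousAt_const (he ▸ he1)
    have h2 := hcd.eventually_lt (continuousAt_const (y := δ)) (by
      rw [hδ, ← he]
      exact dev_lt_delta hwell hN hP0 hc hlam hepos he1 ha)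
    obtain ⟨ρ, h3, h4⟩ := (((h1.and h2).filter_mono nhdsWithin_le_nhds).and
      (self_mem_nhdsWithin : Set.Ioi lamMax ∈ 𝓝[>] lamMax)).exists
    exact ⟨ρ, h4, h3.1, h3.2⟩
  set F := homDet hwell A0 P0 Ut with hF
  have hloc : ∀ (t : unitInterval) (z : ℂ), ‖z‖ ≤ ρ → F t z = 0 →
      ∃ j, P.M0 A0 P0 j j ≠ 0 ∧ z ∈ disk (P.M0 A0 P0 j j) δ := by
    intro t z hz h
    have hE := hdev ρ hρe z hz
    have hE' : ‖embL (((t : ℝ) : ℂ) • errMat hwell A0 P0 Ut z)‖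
        ≤ c.dev (matNorm P0⁻¹) (matNorm (P.R0 A0 P0)) x (P.eps s N (Ub : ℕ → ℝ) ρ c.Z2gt r) r ρ := by
      rw [embL_smul, norm_smul, Complex.norm_real, Real.norm_of_nonneg t.2.1]
      exact (mul_le_of_le_one_left (norm_nonneg _) t.2.2).trans hE
    obtain ⟨j, hj⟩ := exists_norm_le_of_det_eq_zero hE' h
    exact ⟨j, mem_disk hj hρδ.le hδ1⟩
  have hu : ∀ l : ℂ, ‖l‖ ≤ ρ →
      IsUnit (1 + qL N * (DKL hwell Ut - l • P.LinvL) * (qL N : L1 ℂ →L[ℂ] L1 ℂ)) := fun l hl =>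
    isUnit_tail hwell hN hs hc hl hρe
  -- If the constant vanished, `0` would be a zero of the final determinant and hence lie in a disk.
  -- So the hypotheses already imply that `𝒜₀` is invertible.
  have hk : (P0⁻¹ * cplx A0).det * P0.det ≠ 0 := by
    intro h
    obtain ⟨j, -, hj⟩ := hloc 1 0 (by rw [norm_zero]; linarith) (by
      rw [hF, homDet_one, h, zero_mul])
    exact hnot0 j hj
  set Ω : Set ℂ := {z : ℂ | 0 < z.re} ∩ Metric.ball 0 ρ with hΩ
  have hΩo : IsOpen Ω := (isOpen_lt continuous_const Complex.continuous_re).inter Metric.isOpen_ball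
  have hΩc : IsPreconnected Ω :=
    ((convex_halfSpace_re_gt 0).inter (convex_ball 0 ρ)).isPreconnected
  have hΩρ : ∀ z ∈ Ω, ‖z‖ ≤ ρ := fun z hz => (mem_ball_zero_iff.1 hz.2).le
  set K : Set ℂ := ⋃ j ∈ J, disk (P.M0 A0 P0 j j) δ with hK
  have hKsub : K ⊆ {z : ℂ | 0 < z.re} ∩ Metric.closedBall 0 lamMax :=
    Set.iUnion₂_subset fun j hj => (hJ j hj).2
  have hKc : IsCompact K := J.isCompact_biUnion fun j hj => by
    rw [disk, if_neg (hJ j hj).1]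
    exact isCompact_closedBall _ _
  have hKΩ : K ⊆ Ω := hKsub.trans (Set.inter_subset_inter_right _ (Metric.closedBall_subset_ball hρ))
  -- A point between the two radii lies in `Ω` but outside all the disks; the determinants do not
  -- vanish there, so none of them is identically zero on `Ω`.
  have hw : (((lamMax + ρ) / 2 : ℝ) : ℂ) ∈ Ω \ K := by
    have h1 : 0 < (lamMax + ρ) / 2 := by linarith
    have h2 : ‖(((lamMax + ρ) / 2 : ℝ) : ℂ)‖ = (lamMax + ρ) / 2 := by
      rw [Complex.norm_real, Real.norm_of_nonneg h1.le]
    refine ⟨⟨?_, ?_⟩, fun h => ?_⟩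
    · rw [Set.mem_ofPred_eq, Complex.ofReal_re]; exact h1
    · rw [mem_ball_zero_iff, h2]; linarith
    · have := mem_closedBall_zero_iff.1 (hKsub h).2
      rw [h2] at this
      linarith
  have h0 : ∀ (t : unitInterval), ∀ z ∈ Ω \ K, F t z ≠ 0 := by
    intro t z hz h
    obtain ⟨j, -, hj⟩ := hloc t z (hΩρ z hz.1) h
    by_cases hjJ : j ∈ J
    · exact hz.2 (Set.mem_biUnion hjJ hj)
    · exact lt_asymm (a := (0 : ℝ)) (b := z.re) hz.1.1 (hJc j hjJ hj)
  have hA : ∀ t, AnalyticOnNhd ℂ (F t) Ω := fun t l hl => analyticAt_homDet hwell (hu l (hΩρ l hl)) t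
  have hcount : zeroCount (F 1) Ω = J.card := by
    rw [zeroCount_eq_of_homotopy hΩo hΩc hKc hKΩ ⟨_, hw⟩
      (fun t l hl => continuousAt_homDet hwell (hu l (hΩρ l hl)) t) hA h0 1 0]
    rw [show homDet hwell A0 P0 Ut 0 = fun z => ∏ j, (1 - z * P.M0 A0 P0 j j) from funext (homDet_zero hwell)]
    refine zeroCount_prod_one_sub _ _ _ fun j => ⟨fun hj => ?_, fun hj => ?_⟩
    · exact ⟨(hJ j hj).1, hKΩ (Set.mem_biUnion hj (inv_mem_disk (hJ j hj).1 hδ0))⟩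
    · by_contra hjJ
      exact lt_asymm (b := (P.M0 A0 P0 j j)⁻¹.re) hj.2.1 (hJc j hjJ (inv_mem_disk hj.1 hδ0))
  rw [← hcount]
  refine finsum_finrank_rootSpace hwell hΩc (fun l hl => hu l (hΩρ l hl)) hk
    (finite_zeros hΩc hKc hKΩ ⟨_, hw⟩ (hA 1) (h0 1)) hw.1 (h0 1 _ hw) fun l => ?_
  constructor
  · rintro ⟨h1, h2⟩
    exact ⟨⟨h2, mem_ball_zero_iff.2 ((hbound l h1 (le_of_lt h2)).trans_lt hρ)⟩, h1⟩
  · rintro ⟨h1, h2⟩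
    exact ⟨h2, h1.1⟩

end Problem

end GegenbauerStability

end

-- The bounds on `Ubar` and on `Util - Ubar` make both sequences elements of `L1`, where
-- `unstable_count` applies.
open GegenbauerStability in
theorem mainTheorem5 (P : Problem) (hwell : IsUnit P.bcMat)
    (N : ℕ) (hN : 4 * P.m ≤ N)
    (A0 : Matrix (Fin (N + 1)) (Fin (N + 1)) ℝ) (Ubar : ℕ → ℝ)
    (Y Z1 : NNReal) (Z2 : NNReal → NNReal) (r : NNReal)
    (hNK : P.NewtonKantorovich A0 Ubar Y Z1 Z2 r)
    (Util : ℕ → ℝ) (hball : ell1Norm (Util - Ubar) ≤ r) (hzero : P.F Util = 0)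
    (s : Fin (2 * P.m) → Equiv.Perm (Fin (2 * P.m))) (hs : ∀ i, IsUnit (P.B11 (s i) i))
    (P0 : Matrix (Fin (N + 1)) (Fin (N + 1)) ℂ) (hP0 : IsUnit P0)
    (c : Consts) (hc : c.Valid P s A0 P0 Ubar Util r)
    (lamMax : ℝ) (hlam : 0 < lamMax)
    (hbound : ∀ lam : ℂ, P.IsEigenvalue (P.sol Util) lam → 0 ≤ lam.re → ‖lam‖ ≤ lamMax)
    (ε : ℝ) (hε : ε = P.eps s N Ubar lamMax c.Z2gt r) (hε1 : ε < 1)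
    (δ : ℝ) (hδ : δ = c.delta P0 ε r (P.R0 A0 P0) lamMax)
    (B : Fin (N + 1) → Set ℂ) (hB : ∀ j, B j = disk (P.M0 A0 P0 j j) δ)
    (J : Finset (Fin (N + 1)))
    (hJ : ∀ j ∈ J, P.M0 A0 P0 j j ≠ 0 ∧ B j ⊆ {z : ℂ | 0 < z.re} ∩ Metric.closedBall 0 lamMax)
    (hJc : ∀ j ∉ J, B j ⊆ {z : ℂ | z.re < 0})
    (nu : ℕ) (hnu : J.card = nu) :
    (P.unstable (P.sol Util)).Finite ∧
    (∀ lam ∈ P.unstable (P.sol Util), FiniteDimensional ℂ (P.rootSpace (P.sol Util) lam)) ∧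
    ∑ᶠ lam ∈ P.unstable (P.sol Util), Module.finrank ℂ (P.rootSpace (P.sol Util) lam) = nu := by
  have hU : Summable fun n => ‖Ubar n‖ := L1.summable_of_ell1Norm hNK.mem
  have hD : Summable fun n => ‖(Util - Ubar) n‖ :=
    L1.summable_of_ell1Norm (hball.trans_lt ENNReal.coe_lt_top)
  have hU' : Summable fun n => ‖Util n‖ := (hD.add hU).of_nonneg_of_le (fun _ => norm_nonneg _) fun n => by
    simpa using norm_add_le ((Util - Ubar) n) (Ubar n)
  rw [← hnu]
  refine Problem.unstable_count (Ub := L1.mk Ubar hU) (Ut := L1.mk Util hU') hwell hN hs hP0 hc hlam hbound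
    hε hε1 hδ J (fun j hj => ?_) fun j hj => ?_
  · rw [← hB]; exact hJ j hj
  · rw [← hB]; exact hJc j hj
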